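/- **Set-up.** For real $g,h$ let $U(x;g,h)=\frac{g(g-1)}{\sin^2x}+\frac{h(h-1)}{\cos^2x}-(g+h)^2$ on $(0,\pi/2)$, $\eta=\eta(x)=\cos 2x$, $P^{(\alpha,\beta)}_n(\eta)=\frac{1}{n!}\sum_{k=0}^n(\alpha+1+k)_{n-k}\frac{(-n)_k(n+\alpha+\beta+1)_k}{k!}\big(\frac{1-\eta}{2}\big)^k$ (Jacobi polynomials), $\phi_n=(\sin x)^g(\cos x)^hP_n^{(g-1/2,h-1/2)}(\eta)$, $\mathcal E_n=4n(n+g+h)$ for $n\in\mathbb Z$, $h_n=\frac{\Gamma(n+g+\frac12)\Gamma(n+h+\frac12)}{2\,n!\,(2n+g+h)\Gamma(n+g+h)}$. The virtual state solutions, with their energies, are $$\tilde\phi^{\rm I}_v=(\sin x)^g(\cos x)^{1-h}P_v^{(g-1/2,1/2-h)}(\eta),\quad \tilde{\mathcal E}^{\rm I}_v=-4(g+v+\tfrac12)(h-v-\tfrac12),$$ $$\tilde\phi^{\rm II}_v=(\sin x)^{1-g}(\cos x)^{h}P_v^{(1/2-g,h-1/2)}(\eta),\quad \tilde{\mathcal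 E}^{\rm II}_v=-4(g-v-\tfrac12)(h+v+\tfrac12),$$ $$\tilde\phi^{\rm III}_v=(\sin x)^{1-g}(\cos x)^{1-h}P_v^{(1/2-g,1/2-h)}(\eta),\quad \tilde{\mathcal E}^{\rm III}_v=-4(v+1)(g+h-1-v).$$ For a list of seeds with $M,N,L$ members of type I, II, III put $\bar g=g+M-N-L$, $\bar h=h-M+N-L$, $J=M-N-L$, $K=-M+N-L$; let $W=\mathrm W[\text{seeds}](x)$ be the Wronskian in $x$, $U^{(\mathcal N)}=U-2(\log|W|)''$ and $\phi_n^{(\mathcal N)}=\mathrm W[\text{seeds},\phi_n]/W$. The eight cases (seeds; curve $g=g(h)$) are * Ia: $[\tilde\phi_2^{\rm I},\tilde\phi_1^{\rm III}]$, $g=\frac{3(h-3)}{4h-9}$; Ib: $[\tilde\phi_1^{\rm II},\tilde\phi_2^{\rm II},\tilde\phi_1^{\rm III}]$, $g=\frac{3(5h+3)}{4h+3}$; * IIa: $[\tilde\phi_1^{\rm I},\tilde\phi_2^{\rm III}]$, $g=\frac{h}{4h-9}$; IIb: $[\tilde\phi_1^{\rm II},\tilde\phi_2^{\rm III}]$,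 $g=\frac{9h}{4h-1}$; * IIIa: $[\tilde\phi_2^{\rm II},\tilde\phi_1^{\rm III}]$, $g=\frac{9(h-1)}{4h-3}$; IIIb: $[\tilde\phi_1^{\rm I},\tilde\phi_2^{\rm I},\tilde\phi_1^{\rm III}]$, $g=-\frac{3(h-3)}{4h-15}$; * IVa: $[\tilde\phi_1^{\rm II},\tilde\phi_1^{\rm III},\tilde\phi_2^{\rm III}]$, $g=\frac{3(5h-8)}{4h-7}$; IVb: $[\tilde\phi_1^{\rm I},\tilde\phi_1^{\rm III},\tilde\phi_2^{\rm III}]$, $g=\frac{7h-24}{4h-15}$. Let $\ell(\eta)=2\bar h\eta-2\eta-2\bar h-1$ in groups I, II and $\ell(\eta)=2\bar h\eta-2\bar h+3$ in groups III, IV; $\eta_0$ its zero, $w=\ell^2$. Call $h$ *admissible* if $\bar h\notin\{\frac14,1\}$ (I, II), resp. $\bar h\notin\{\frac34,0\}$ (III, IV). The *degenerate* values of $\bar h$ are: $-\frac12,\frac12,\frac7{10},\frac52$ in Ia and IIa; $-\frac12,\frac12,\frac32,\frac52$ in Ib and IIb; $-\frac32,-\frac12,\frac12,\frac32$ in IIIa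 and IVa; $-\frac32,\frac3{10},\frac12,\frac32$ in IIIb and IVb. The index set of modes is $\mathcal M=\{0,1,2,\dots\}\cup\{-(v+1):\tilde\phi^{\rm III}_v\text{ is a seed}\}$; so the additional modes are $-2$ (I, III), $-3$ (II), $-3,-2$ (IV). The *stated ranges* are: Ia $h>\frac{27}{10}$, $h\ne3$; Ib $h>-\frac3{10}$, $h\neq0$; IIa $h>\frac94$, $h\ne3$; IIb $h>\frac14$, $h\ne1$; IIIa $-\frac12<h<\frac34$, $h\neq0$; IIIb $\frac52<h<\frac{15}4$, $h\neq3$; IVa $\frac12<h<\frac{13}{10}$, $h\ne1$; IVb $\frac52<h<\frac{33}{10}$, $h\neq3$. **Explicit polynomials.** In the cases (a), with $g=g(h)$, $J_n=P_n^{(g-1/2,h-1/2)}(\eta)$ and $n\ge0$, put $\mathcal P_n(\eta;h)=A\,J_n+B\,J_n'$, where * Ia: $A=1053- 612h+ 96h^2- 248h^3+ 176h^4- 32h^5- 162n+ 108hn+ 144h^2n- 144h^3n+ 32h^4n- 162n^2+ 288hn^2- 168h^2n^2+ 32h^3n^2+ (1944- 1026h- 1740h^2+ 1976h^3- 736h^4+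 96h^5+ 486n- 108hn- 432h^2n+ 240h^3n- 32h^4n+ 486n^2- 648hn^2+ 264h^2n^2- 32h^3n^2)\eta + (1458- 4914h+ 6132h^2- 3520h^3+ 944h^4- 96h^5- 216hn- 72h^2n+ 144h^3n- 32h^4n- 216hn^2+ 168h^2n^2- 32h^3n^2)\eta ^2+ (- 1620+ 4248h- 4020h^2+ 1792h^3- 384h^4+ 32h^5- 648n+ 504h^2n- 240h^3n+ 32h^4n- 648n^2+ 720hn^2- 264h^2n^2+ 32h^3n^2)\eta ^3$, and $B=(- 9+ 4h)(- 1+ \eta ^2)(3- 2h- 6\eta + 2h\eta )(27- 4h^2+ 54\eta - 30h\eta + 4h^2\eta )$; * IIa: $A=1458- 918h- 144h^3+ 160h^4- 32h^5- 144hn+ 264h^2n- 160h^3n+ 32h^4n- 162n^2+ 288hn^2- 168h^2n^2+ 32h^3n^2+ (2187- 2106h- 936h^2+ 1776h^3- 720h^4+ 96h^5+ 432hn- 600h^2n+ 256h^3n- 32h^4n+ 486n^2- 648hn^2+ 264h^2n^2- 32h^3n^2)\eta + (- 3888h+ 6120h^2- 3624h^3+ 960h^4- 96h^5- 192h^2n+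 160h^3n- 32h^4n- 216hn^2+ 168h^2n^2- 32h^3n^2)\eta ^2+ (- 2916+ 6048h- 4932h^2+ 1992h^3- 400h^4+ 32h^5- 576hn+ 672h^2n- 256h^3n+ 32h^4n- 648n^2+ 720hn^2- 264h^2n^2+ 32h^3n^2)\eta ^3$, and $B=(- 9+ 4h)(- 1+ \eta ^2)(3- 2h- 6\eta + 2h\eta )(27- 4h^2+ 54\eta - 30h\eta + 4h^2\eta )$; * IIIa: $A=405- 648h+ 72h^2+ 72h^3+ 80h^4+ 32h^5- 486n+ 1620hn- 1728h^2n+ 432h^3n+ 288h^4n- 128h^5n- 162n^2+ 648hn^2- 936h^2n^2+ 576h^3n^2- 128h^4n^2+ (810- 1566h+ 612h^2+ 408h^3- 192h^4- 96h^5+ 486n- 2268hn+ 3456h^2n- 1584h^3n- 480h^4n+ 384h^5n+ 162n^2- 864hn^2+ 1656h^2n^2- 1344h^3n^2+ 384h^4n^2)\eta + (270h+ 36h^2- 528h^3+ 144h^4+ 96h^5+ 648hn- 1944h^2n+ 1584h^3n+ 96h^4n- 384h^5n+ 216hn^2- 792h^2n^2+ 960h^3n^2- 384h^4n^2)\eta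 ^2+ (36h^2+ 48h^3- 32h^4- 32h^5+ 216h^2n- 432h^3n+ 96h^4n+ 128h^5n+ 72h^2n^2- 192h^3n^2+ 128h^4n^2)\eta ^3$, and $B=- 9(- 3+ 4h)(- 1+ \eta ^2)(3- 2h+ 2h\eta )(3- 4h^2- 2h\eta + 4h^2\eta )$; * IVa: $A=133407- 291870h+ 189396h^2+ 30456h^3- 98352h^4+ 51552h^5- 12096h^6+ 185640n- 460616hn+ 440564h^2n- 191368h^3n+ 24144h^4n+ 10336h^5n- 4352h^6n+ 54145n^2- 147238hn^2+ 165212h^2n^2- 98712h^3n^2+ 33568h^4n^2- 6272h^5n^2+ 512h^6n^2+ 128h^7(9+ 4n)+ (- 194400+ 574560h- 581760h^2+ 141696h^3+ 160128h^4- 137088h^5+ 41472h^6- 164976n+ 604208hn- 830840h^2n+ 526768h^3n- 129120h^4n- 16384h^5n+ 14336h^6n- 48118n^2+ 187684hn^2- 288488h^2n^2+ 227232h^3n^2- 97792h^4n^2+ 22016h^5n^2- 2048h^6n^2- 512h^7(9+ 4n))\eta + (- 97686+ 4860h+ 300672h^2- 256608h^3- 38016h^4+ 124416h^5- 51840h^6-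 67032n- 77448hn+ 449940h^2n- 490632h^3n+ 194688h^4n- 2496h^5n- 16896h^6n- 19551n^2- 17934hn^2+ 134904h^2n^2- 176112h^3n^2+ 102336h^4n^2- 28416h^5n^2+ 3072h^6n^2+ 768h^7(9+ 4n))\eta ^2+ (32400- 23760h- 102240h^2+ 147744h^3- 33408h^4- 43776h^5+ 27648h^6+ 49728n- 71872hn- 67232h^2n+ 179392h^3n- 108960h^4n+ 12800h^5n+ 8192h^6n+ 14504n^2- 24416hn^2- 13352h^2n^2+ 55008h^3n^2- 45568h^4n^2+ 15872h^5n^2- 2048h^6n^2- 512h^7(9+ 4n))\eta ^3+ (- 3240+ 4320h+ 9576h^2- 21168h^3+ 9648h^4+ 4896h^5- 5184h^6- 3360n+ 5728hn+ 7568h^2n- 24160h^3n+ 19248h^4n- 4256h^5n- 1280h^6n- 980n^2+ 1904hn^2+ 1724h^2n^2- 7416h^3n^2+ 7456h^4n^2- 3200h^5n^2+ 512h^6n^2+ 128h^7(9+ 4n))\eta ^4$, and $B=(- 7+ 4h)(- 1+ \eta ^2)(336n(5- 2\eta )^2(\eta - 1)+ 98n^2(5- 2\eta )^2(\eta - 1)+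 16h^4(120+ n(38- 14\eta )+ 8n^2(\eta - 1)- 69\eta )(\eta - 1)^2+ 32h^5(9+ 4n)(\eta - 1)^3+ 3(- 2048+ 4769\eta - 2056\eta ^2+ 388\eta ^3)- 8h^3(\eta - 1)(- 438+ 468\eta - 93\eta ^2+ 36n(2- 7\eta + 4\eta ^2)+ 8n^2(17- 28\eta + 11\eta ^2))+ 4h^2(9(- 32+ 178\eta - 152\eta ^2+ 51\eta ^3)+ 6n^2(- 143+ 333\eta - 249\eta ^2+ 59\eta ^3)+ 2n(- 953+ 2373\eta - 1896\eta ^2+ 476\eta ^3))- 2h(28n^2(- 85+ 174\eta - 111\eta ^2+ 22\eta ^3)+ 8n(- 895+ 1863\eta - 1212\eta ^2+ 244\eta ^3)+ 3(- 1447+ 3859\eta - 2144\eta ^2+ 488\eta ^3)))$; and for the additional modes: Ia: $\mathcal P_{-2}=27-4h^2+2(h-3)(2h-9)\eta$; IIa: $\mathcal P_{-3}=1$; IIIa: $\mathcal P_{-2}=3-4h^2+2h(2h-1)\eta$; IVa: $\mathcal P_{-3}=(2h-5)\eta-2h+2$ and $\mathcal P_{-2}=107-88h+24h^2-32h^3+16h^4-8(-25+35h-14h^3+4h^4)\eta+4(h-1)^2(11-12h+4h^2)\eta^2$.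 In a case (b), $R_m$ denotes the polynomial $\mathcal P_m$ of case (a) of the same group at the parameter with the same $\bar h$, that is at $h+3$, $h+2$, $h-3$, $h-2$ for Ib, IIb, IIIb, IVb; in a case (a), $R_m=\mathcal P_m(\cdot;h)$. **Theorem.** In each of the eight cases, for every admissible $h$ and $g=g(h)$: 1. $\bar g=\frac{3(\bar h-1)}{4\bar h-1},\ \frac{\bar h+2}{4\bar h-1},\ \frac{\bar h-3}{4\bar h-3},\ \frac{3\bar h}{4\bar h-3}$ in groups I, II, III, IV (so $\bar g_{\rm I}=1-\bar g_{\rm II}$, $\bar g_{\rm III}=1-\bar g_{\rm IV}$ at equal $\bar h$), and $\bar g+\bar h+2L=g+h$. The factor $\ell$ has no zero in $(-1,1)$ iff $\bar h>\frac14$ (I, II), resp. $\bar h<\frac34$ (III, IV); this together with $\bar g,\bar h>-\frac12$ holds iff $h$ is in the stated range. 2. There is a constant $\kappa$, nonzero iff $\bar h$ is not degenerate, with $W=(1-\eta)^{J(2g+J-1)/4}(1+\eta)^{K(2h+K-1)/4}\,\mathcal D(\eta)$ on $(0,\pi/2)$, $\mathcal D=\kappa\,\ell^3$; moreover $\ell$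 has degree one and $\ell(\pm1)\ne0$. 3. Let $\bar h$ be non-degenerate. Wherever $\ell(\eta)\ne0$, $U^{(\mathcal N)}$ equals $$\mathcal U=\frac{2\bar g(\bar g-1)}{1-\eta}+\frac{2\bar h(\bar h-1)}{1+\eta}-(\bar g+\bar h+2L)^2-8\Big[\frac{3(2\bar h+1)}{\ell}+\frac{9(4\bar h-1)}{\ell^2}\Big]\ \text{(I, II)},$$ with the bracket replaced by $\frac{3(2\bar h-3)}{\ell}-\frac{9(4\bar h-3)}{\ell^2}$ in III, IV. For every $n\ge0$ there is exactly one polynomial $P_n$ with $\phi_n^{(\mathcal N)}=(1-\eta)^{\bar g/2}(1+\eta)^{\bar h/2}P_n(\eta)/w(\eta)$ wherever $\ell(\eta)\neq0$ in $(0,\pi/2)$. It satisfies equations (i) and (ii) below with $m=n$. In the cases (a), $P_n=2^{-(g+h)/2}c\,\mathcal P_n$ with $c=-\frac2{4h-9}$ (Ia, IIa), $\frac2{(4h-3)^2}$ (IIIa), $\frac4{(4h-7)^3}$ (IVa). For $h$ in the stated range, in all cases, $P_n$ is a nonzero multiple of $R_n$ and, the integrand being integrable, $$\int_{-1}^1\frac{(1-\eta)^{\bar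 g-1/2}(1+\eta)^{\bar h-1/2}}{\ell(\eta)^4}P_nP_k\,d\eta=2\,\delta_{nk}\,h_n\prod_{j}(\mathcal E_n-\tilde{\mathcal E}_j),$$ the product running over the seeds. 4. For every $m\in\mathcal M$, $\psi_m=(1-\eta)^{\bar g/2}(1+\eta)^{\bar h/2}R_m/w$ satisfies $-\psi_m''+\mathcal U\psi_m=\mathcal E_m\psi_m$ where $\ell(\eta)\neq0$; $y=R_m/w$ satisfies $$\text{(i)}\quad(1-\eta^2)y''+(\bar h-\bar g-(\bar g+\bar h+1)\eta)y'+\{(m+L)(m+\bar g+\bar h+L)+T\}y=0,$$ $T=\frac{6(2\bar h+1)}{\ell}+\frac{18(4\bar h-1)}{\ell^2}$ (I, II), $T=\frac{6(2\bar h-3)}{\ell}-\frac{18(4\bar h-3)}{\ell^2}$ (III, IV); and $P=R_m$ satisfies (ii): in I, II $$\{1+2m+m^2-2\bar h^2(3+m)(\eta-1)-6\eta+4m\eta+2m^2\eta+\bar h[-1+m(5-2\eta)-2m^2(\eta-1)+12\eta]+\bar g[5+m+6\eta+2m\eta-2\bar h(1+m(\eta-1)+3\eta)]\}P$$ $$+\{-8+2\bar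 h^2(\eta-1)^2-\eta+6\eta^2+\bar g(-1+2\bar h(\eta-1)-2\eta)(\eta+1)-\bar h(\eta-1)(8\eta+9)\}P'+(-1+2\bar h(\eta-1)-2\eta)(\eta^2-1)P''=0,$$ and in III, IV, with $\gamma=2L$, $$-\{3(\gamma+2m)^2+2\bar h[3(\gamma+2m)-16\eta+(\gamma+2m)^2(\eta-1)]+4\bar h^2(4+\gamma+2m)(\eta-1)+2\bar g[3(\gamma+2m)+2\bar h(4(\eta+1)+(\gamma+2m)(\eta-1))]\}P$$ $$+4\{2\bar h^2(\eta-1)^2+3\eta+\bar g[3+2\bar h(\eta-1)](\eta+1)-\bar h(6\eta+5)(\eta-1)\}P'+4[3+2\bar h(\eta-1)](\eta^2-1)P''=0.$$ If moreover $\bar h>\frac14$ (I, II), resp. $\bar h<\frac34$ (III, IV), then (i) and (ii) are Fuchsian, with finite singular points in $\{1,-1,\eta_0\}$, and near $\eta_0$ all complex solutions are meromorphic (the singularity is apparent), with exponents $-2,3$ for (i) and $0,5$ for (ii). 5. $\mathcal E_{-(v+1)}=\tilde{\mathcal E}^{\rm III}_v$ for each type III seed $\tilde\phi^{\rm III}_v$.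 6. For $h$ in the stated range and all $m,k\in\mathcal M$: $R_m(\eta_0)\ne0$; $R_mR_k$ is integrable against the weight $(1-\eta)^{\bar g-1/2}(1+\eta)^{\bar h-1/2}/\ell^4$ on $(-1,1)$; the integral is $0$ for $m\neq k$ and positive for $m=k$. For the cases (a), at every admissible $h$, moreover: 7. $y=\mathcal P_m$, $m\in\mathcal M$, satisfies $a_2y''+a_1y'+a_0y=0$, where * Ia: $a_2=(4h-9)(3-2h+2(h-3)\eta)(1-\eta^2)$, $a_1=-[27+60h-58h^2+12h^3-2(-81+102h-48h^2+8h^3)\eta+2(-54+57h-19h^2+2h^3)(2\eta^2-1)]$, $a_0=-8h^3(3+m)-8h^2(-20-3m+m^2)-27(-12+m+m^2)+6h(-63+5m^2)+2(h-3)(3+m)(18-18h+4h^2-9m+4hm)\eta$; * IIa: $a_2$ as in Ia, $a_1=-[(135-198h+96h^2-16h^3)\eta+(h-3)(-9-20h+12h^2+(45-28h+4h^2)(2\eta^2-1))]$, $a_0=(3+m)(27-20h+4h^2-9m+4hm)(3-2h-6\eta+2h\eta)$; * IIIa: $a_2=(4h-3)(3-2h+2h\eta)(1-\eta^2)$, $a_1=9+2h^2-12h^3+2(9-6h-8h^2+8h^3)\eta-2h(3-7h+2h^2)(2\eta^2-1)$,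 $a_0=-8h^3(3+m)-8h^2(-3+m^2)-9(2+3m+m^2)+6h(1+6m+3m^2)+2h(3+m)(4h^2-3m+h(-6+4m))\eta$; * IVa: $a_2=(4h-7)(5-2h+2(h-1)\eta)(1-\eta^2)$, $a_1=(-5+62h-64h^2+16h^3)\eta-(h-1)(19-28h+12h^2+(5-2h)^2(2\eta^2-1))$, $a_0=-(2h-5)[-12-24m-7m^2+4h^2(4+m)+4h(-4+2m+m^2)]+2(h-1)(4+4h^2+4h(m-2)-7m)(4+m)\eta$. 8. The energies of the additional modes are $\tilde{\mathcal E}^{\rm III}_1=-\frac{8(9-14h+4h^2)}{4h-9}$ (Ia), $\tilde{\mathcal E}^{\rm III}_2=-\frac{12(27-20h+4h^2)}{4h-9}$ (IIa), $\tilde{\mathcal E}^{\rm III}_1=-\frac{8(-3-2h+4h^2)}{4h-3}$ (IIIa), $\tilde{\mathcal E}^{\rm III}_2=-\frac{12(2h-3)(2h+1)}{4h-7}$ and $\tilde{\mathcal E}^{\rm III}_1=-\frac{16(2h^2-5)}{4h-7}$ (IVa). 9. For $h$ in the stated range and $n\ge0$, $\int_{-1}^1\frac{(1-\eta)^{\bar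 g-1/2}(1+\eta)^{\bar h-1/2}}{\ell^4}\mathcal P_n^2\,d\eta=C\,h_n\prod_j(\mathcal E_n-\tilde{\mathcal E}_j)$ with $C=2^{g+h-1}(4h-9)^2$ (Ia, IIa), $2^{g+h-1}(4h-3)^4$ (IIIa), $2^{g+h-3}(4h-7)^6$ (IVa). Finally, the shifts $h\to h+3,\ h+2,\ h-3,\ h-2$ carry cases Ia, IIa, IIIa, IVa to Ib, IIb, IIIb, IVb: the value of $\bar h$, the admissible and the stated ranges, and, for admissible $h$, $\bar g$, all $\mathcal E_m$ and the common potential $\mathcal U$ in case (b) at $h$ are those of case (a) at the shifted parameter. -/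

import Mathlib

open Real Set Filter Topology MeasureTheory Polynomial

noncomputable section

namespace JacobiConfluence

/-! ### Pöschl–Teller system, Jacobi polynomials and virtual state solutions -/

/-- The Jacobi polynomial `P_n^{(α,β)}`; the quotient `(α+1)_n / (α+1)_k` of Pochhammer symbols is
written as `(α+1+k)_{n-k}`, so that no division by zero can occur. -/
def jacobi (n : ℕ) (α β : ℝ) : ℝ[X] :=
  ∑ k ∈ Finset.range (n + 1),
    C ((ascPochhammer ℝ (n - k)).eval (α + 1 + k) * (ascPochhammer ℝ k).eval (-(n : ℝ)) *
        (ascPochhammer ℝ k).eval (n + α + β + 1) / (n.factorial * k.factorial)) *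
      (C (1 / 2) * (1 - X)) ^ k

/-- The variable `η = cos 2x`. -/
def eta (x : ℝ) : ℝ := Real.cos (2 * x)

/-- The Pöschl–Teller potential on `(0, π/2)`. -/
def potential (g h x : ℝ) : ℝ :=
  g * (g - 1) / Real.sin x ^ 2 + h * (h - 1) / Real.cos x ^ 2 - (g + h) ^ 2

/-- The eigenfunction `φ_n` of the Pöschl–Teller Hamiltonian. -/
def phi (g h : ℝ) (n : ℕ) (x : ℝ) : ℝ :=
  Real.sin x ^ g * Real.cos x ^ h * (jacobi n (g - 1 / 2) (h - 1 / 2)).eval (eta x)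

/-- The energy `4 n (n + g + h)`, for every integer `n` (additional modes have `n < 0`). -/
def energy (g h : ℝ) (n : ℤ) : ℝ := 4 * n * (n + g + h)

/-- The squared norm of `φ_n`. -/
def baseNorm (g h : ℝ) (n : ℕ) : ℝ :=
  Real.Gamma (n + g + 1 / 2) * Real.Gamma (n + h + 1 / 2) /
    (2 * n.factorial * (2 * n + g + h) * Real.Gamma (n + g + h))

/-- The three types of virtual state solutions. -/
inductive SeedType
  | I | II | III
  deriving DecidableEq

/-- The virtual state solution of a given type and degree. -/
def seedFun (g h : ℝ) : SeedType × ℕ → ℝ → ℝ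
  | (.I, v), x => Real.sin x ^ g * Real.cos x ^ (1 - h) *
      (jacobi v (g - 1 / 2) (1 / 2 - h)).eval (eta x)
  | (.II, v), x => Real.sin x ^ (1 - g) * Real.cos x ^ h *
      (jacobi v (1 / 2 - g) (h - 1 / 2)).eval (eta x)
  | (.III, v), x => Real.sin x ^ (1 - g) * Real.cos x ^ (1 - h) *
      (jacobi v (1 / 2 - g) (1 / 2 - h)).eval (eta x)

/-- The energy of a virtual state solution. -/
def seedEnergy (g h : ℝ) : SeedType × ℕ → ℝ
  | (.I, v) => -4 * (g + v + 1 / 2) * (h - v - 1 / 2)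
  | (.II, v) => -4 * (g - v - 1 / 2) * (h + v + 1 / 2)
  | (.III, v) => -4 * (v + 1) * (g + h - 1 - v)

/-- The Wronskian of a list of functions. -/
def wronskian (fs : List (ℝ → ℝ)) (x : ℝ) : ℝ :=
  Matrix.det (Matrix.of fun j k : Fin fs.length => iteratedDeriv (k : ℕ) (fs.get j) x)

/-! ### The four groups and the eight cases -/

/-- The four groups. -/
inductive Grp
  | I | II | III | IV

/-- The eight cases. -/
inductive Case
  | Ia | Ib | IIa | IIb | IIIa | IIIb | IVa | IVb

/-- The group of a case. -/
def Case.group : Case → Grp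
  | .Ia => .I | .Ib => .I | .IIa => .II | .IIb => .II
  | .IIIa => .III | .IIIb => .III | .IVa => .IV | .IVb => .IV

/-- Member (a) of a group. -/
def Grp.memberA : Grp → Case
  | .I => .Ia | .II => .IIa | .III => .IIIa | .IV => .IVa

/-- Member (b) of a group. -/
def Grp.memberB : Grp → Case
  | .I => .Ib | .II => .IIb | .III => .IIIb | .IV => .IVb

/-- The seed solutions of a case. -/
def seeds : Case → List (SeedType × ℕ)
  | .Ia => [(.I, 2), (.III, 1)]
  | .Ib => [(.II, 1), (.II, 2), (.III, 1)]
  | .IIa => [(.I, 1), (.III, 2)]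
  | .IIb => [(.II, 1), (.III, 2)]
  | .IIIa => [(.II, 2), (.III, 1)]
  | .IIIb => [(.I, 1), (.I, 2), (.III, 1)]
  | .IVa => [(.II, 1), (.III, 1), (.III, 2)]
  | .IVb => [(.I, 1), (.III, 1), (.III, 2)]

/-- The number of seed solutions of type `t`. -/
def numSeeds (t : SeedType) (c : Case) : ℕ := (seeds c).countP (fun s => s.1 = t)

/-- The fine-tuning curve `g = g(h)`. -/
def curve : Case → ℝ → ℝ
  | .Ia, h => 3 * (h - 3) / (4 * h - 9)
  | .Ib, h => 3 * (5 * h + 3) / (4 * h + 3)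
  | .IIa, h => h / (4 * h - 9)
  | .IIb, h => 9 * h / (4 * h - 1)
  | .IIIa, h => 9 * (h - 1) / (4 * h - 3)
  | .IIIb, h => -(3 * (h - 3)) / (4 * h - 15)
  | .IVa, h => 3 * (5 * h - 8) / (4 * h - 7)
  | .IVb, h => (7 * h - 24) / (4 * h - 15)

/-- The shifted parameter `ḡ = g + M - N - L` on the curve. -/
def gBar (c : Case) (h : ℝ) : ℝ :=
  curve c h + numSeeds .I c - numSeeds .II c - numSeeds .III c

/-- The shifted parameter `h̄ = h - M + N - L`. -/
def hBar (c : Case) (h : ℝ) : ℝ :=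
  h - numSeeds .I c + numSeeds .II c - numSeeds .III c

/-- `ḡ` as a function of `h̄`, common to the two members of a group. -/
def gBarOfHBar : Grp → ℝ → ℝ
  | .I, b => 3 * (b - 1) / (4 * b - 1)
  | .II, b => (b + 2) / (4 * b - 1)
  | .III, b => (b - 3) / (4 * b - 3)
  | .IV, b => 3 * b / (4 * b - 3)

/-- The number `L` of type III seeds, as a function of the group (half of the constant `γ`). -/
def Grp.typeIII : Grp → ℝ
  | .I => 1 | .II => 1 | .III => 1 | .IV => 2

/-- The linear factor, as a polynomial in `η` with parameter `h̄`. -/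
def linB : Grp → ℝ → ℝ[X]
  | .I, b => C (2 * b - 2) * X - C (2 * b + 1)
  | .II, b => C (2 * b - 2) * X - C (2 * b + 1)
  | .III, b => C (2 * b) * X - C (2 * b - 3)
  | .IV, b => C (2 * b) * X - C (2 * b - 3)

/-- The linear factor of a case at the parameter `h`. -/
def lin (c : Case) (h : ℝ) : ℝ[X] := linB c.group (hBar c h)

/-- The zero of the linear factor. -/
def etaZero (c : Case) (h : ℝ) : ℝ :=
  match c.group with
  | .I => (2 * hBar c h + 1) / (2 * (hBar c h - 1))
  | .II => (2 * hBar c h + 1) / (2 * (hBar c h - 1))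
  | .III => 1 - 3 / (2 * hBar c h)
  | .IV => 1 - 3 / (2 * hBar c h)

/-- The fine-tuning curve is defined at `h`, and the linear factor is not a constant. -/
def Admissible (c : Case) (h : ℝ) : Prop :=
  match c.group with
  | .I => hBar c h ≠ 1 / 4 ∧ hBar c h ≠ 1
  | .II => hBar c h ≠ 1 / 4 ∧ hBar c h ≠ 1
  | .III => hBar c h ≠ 3 / 4 ∧ hBar c h ≠ 0
  | .IV => hBar c h ≠ 3 / 4 ∧ hBar c h ≠ 0

/-- The linear factor has no zero in the physical domain. -/
def RegularRange (c : Case) (h : ℝ) : Prop :=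
  match c.group with
  | .I => 1 / 4 < hBar c h ∧ hBar c h ≠ 1
  | .II => 1 / 4 < hBar c h ∧ hBar c h ≠ 1
  | .III => hBar c h < 3 / 4 ∧ hBar c h ≠ 0
  | .IV => hBar c h < 3 / 4 ∧ hBar c h ≠ 0

/-- The range of `h` for orthogonality. -/
def StatedRange : Case → ℝ → Prop
  | .Ia, h => 27 / 10 < h ∧ h ≠ 3
  | .Ib, h => -3 / 10 < h ∧ h ≠ 0
  | .IIa, h => 9 / 4 < h ∧ h ≠ 3
  | .IIb, h => 1 / 4 < h ∧ h ≠ 1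
  | .IIIa, h => -1 / 2 < h ∧ h < 3 / 4 ∧ h ≠ 0
  | .IIIb, h => 5 / 2 < h ∧ h < 15 / 4 ∧ h ≠ 3
  | .IVa, h => 1 / 2 < h ∧ h < 13 / 10 ∧ h ≠ 1
  | .IVb, h => 5 / 2 < h ∧ h < 33 / 10 ∧ h ≠ 3

/-- The finitely many values of `h̄` at which the seed solutions on the curve are linearly
dependent (two of them are proportional, or one vanishes), so that their Wronskian is identically
zero and the Darboux–Crum transformation is not defined. -/
def degenerateHBar : Case → Set ℝ
  | .Ia => {-1 / 2, 1 / 2, 7 / 10, 5 / 2}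
  | .Ib => {-1 / 2, 1 / 2, 3 / 2, 5 / 2}
  | .IIa => {-1 / 2, 1 / 2, 7 / 10, 5 / 2}
  | .IIb => {-1 / 2, 1 / 2, 3 / 2, 5 / 2}
  | .IIIa => {-3 / 2, -1 / 2, 1 / 2, 3 / 2}
  | .IIIb => {-3 / 2, 3 / 10, 1 / 2, 3 / 2}
  | .IVa => {-3 / 2, -1 / 2, 1 / 2, 3 / 2}
  | .IVb => {-3 / 2, 3 / 10, 1 / 2, 3 / 2}

/-! ### The deformed system -/

/-- The Wronskian of the seed solutions on the curve. -/
def seedWronskian (c : Case) (h x : ℝ) : ℝ :=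
  wronskian ((seeds c).map (seedFun (curve c h) h)) x

/-- The exponent of `1 - η` in the Wronskian of the seeds, with `J = M - N - L`. -/
def exponentMinus (c : Case) (h : ℝ) : ℝ :=
  let J : ℝ := numSeeds .I c - numSeeds .II c - numSeeds .III c
  J * (2 * curve c h + J - 1) / 4

/-- The exponent of `1 + η` in the Wronskian of the seeds, with `K = - M + N - L`. -/
def exponentPlus (c : Case) (h : ℝ) : ℝ :=
  let K : ℝ := -numSeeds .I c + numSeeds .II c - numSeeds .III c
  K * (2 * h + K - 1) / 4

/-- The Darboux–Crum transform of the eigenfunction `φ_n`. -/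
def deformedState (c : Case) (h : ℝ) (n : ℕ) (x : ℝ) : ℝ :=
  wronskian ((seeds c).map (seedFun (curve c h) h) ++ [phi (curve c h) h n]) x /
    seedWronskian c h x

/-- The Darboux–Crum transform of the potential (`Real.log` is `log |·|`). -/
def deformedPotential (c : Case) (h x : ℝ) : ℝ :=
  potential (curve c h) h x - 2 * iteratedDeriv 2 (fun t => Real.log (seedWronskian c h t)) x

/-- The common forms of the deformed potential. -/
def commonPotential (c : Case) (h x : ℝ) : ℝ :=
  2 * gBar c h * (gBar c h - 1) / (1 - eta x) + 2 * hBar c h * (hBar c h - 1) / (1 + eta x) -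
    (gBar c h + hBar c h + 2 * c.group.typeIII) ^ 2 -
    8 * (match c.group with
      | .I => 3 * (2 * hBar c h + 1) / (lin c h).eval (eta x) +
          9 * (4 * hBar c h - 1) / (lin c h).eval (eta x) ^ 2
      | .II => 3 * (2 * hBar c h + 1) / (lin c h).eval (eta x) +
          9 * (4 * hBar c h - 1) / (lin c h).eval (eta x) ^ 2
      | .III => 3 * (2 * hBar c h - 3) / (lin c h).eval (eta x) -
          9 * (4 * hBar c h - 3) / (lin c h).eval (eta x) ^ 2
      | .IV => 3 * (2 * hBar c h - 3) / (lin c h).eval (eta x) -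
          9 * (4 * hBar c h - 3) / (lin c h).eval (eta x) ^ 2)

/-- The wave function `(1-η)^{ḡ/2} (1+η)^{h̄/2} P(η) / w(η)` with `w` the square of the linear
factor. -/
def waveFun (c : Case) (h : ℝ) (P : ℝ[X]) (x : ℝ) : ℝ :=
  (1 - eta x) ^ (gBar c h / 2) * (1 + eta x) ^ (hBar c h / 2) *
    (P.eval (eta x) / (lin c h).eval (eta x) ^ 2)

/-- `P` is the polynomial part of the `n`-th transformed eigenfunction. -/
def IsPolynomialPart (c : Case) (h : ℝ) (n : ℕ) (P : ℝ[X]) : Prop :=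
  ∀ x ∈ Ioo 0 (π / 2), (lin c h).eval (eta x) ≠ 0 → deformedState c h n x = waveFun c h P x

/-- The indices of all modes: `n = 0, 1, 2, …`, and `n = -(v+1)` for each seed of type III and
degree `v`. -/
def modes (c : Case) : Set ℤ :=
  {m | 0 ≤ m ∨ ∃ v : ℕ, (SeedType.III, v) ∈ seeds c ∧ m = -((v : ℤ) + 1)}

/-! ### Explicit polynomials -/

/-- The polynomial multiplying the Jacobi polynomial in the explicit form of
`P_n` for member (a) of group I. -/
def coeffJacI (h n η : ℝ[X]) : ℝ[X] :=
  1053 - 612 * h + 96 * h^2 - 248 * h^3 + 176 * h^4 - 32 * h^5 - 162 * n + 108 * h * n + 144 *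
  h^2 * n - 144 * h^3 * n + 32 * h^4 * n - 162 * n^2 + 288 * h * n^2 - 168 * h^2 * n^2 + 32 *
  h^3 * n^2 + (1944 - 1026 * h - 1740 * h^2 + 1976 * h^3 - 736 * h^4 + 96 * h^5 + 486 * n -
  108 * h * n - 432 * h^2 * n + 240 * h^3 * n - 32 * h^4 * n + 486 * n^2 - 648 * h * n^2 + 264 *
  h^2 * n^2 - 32 * h^3 * n^2) * η + (1458 - 4914 * h + 6132 * h^2 - 3520 * h^3 + 944 * h^4 -
  96 * h^5 - 216 * h * n - 72 * h^2 * n + 144 * h^3 * n - 32 * h^4 * n - 216 * h * n^2 + 168 *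
  h^2 * n^2 - 32 * h^3 * n^2) * η^2 + (-1620 + 4248 * h - 4020 * h^2 + 1792 * h^3 - 384 * h^4 +
  32 * h^5 - 648 * n + 504 * h^2 * n - 240 * h^3 * n + 32 * h^4 * n - 648 * n^2 + 720 * h *
  n^2 - 264 * h^2 * n^2 + 32 * h^3 * n^2) * η^3

/-- The polynomial multiplying the derivative of the Jacobi polynomial in the explicit form of
`P_n` for member (a) of group I. -/
def coeffDerI (h _n η : ℝ[X]) : ℝ[X] :=
  (-9 + 4 * h) * (-1 + η^2) * (3 - 2 * h - 6 * η + 2 * h * η) * (27 - 4 * h^2 + 54 * η - 30 *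
  h * η + 4 * h^2 * η)

/-- The polynomial multiplying the Jacobi polynomial in the explicit form of
`P_n` for member (a) of group II. -/
def coeffJacII (h n η : ℝ[X]) : ℝ[X] :=
  1458 - 918 * h - 144 * h^3 + 160 * h^4 - 32 * h^5 - 144 * h * n + 264 * h^2 * n - 160 * h^3 *
  n + 32 * h^4 * n - 162 * n^2 + 288 * h * n^2 - 168 * h^2 * n^2 + 32 * h^3 * n^2 + (2187 -
  2106 * h - 936 * h^2 + 1776 * h^3 - 720 * h^4 + 96 * h^5 + 432 * h * n - 600 * h^2 * n + 256 *
  h^3 * n - 32 * h^4 * n + 486 * n^2 - 648 * h * n^2 + 264 * h^2 * n^2 - 32 * h^3 * n^2) * η +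
  (-3888 * h + 6120 * h^2 - 3624 * h^3 + 960 * h^4 - 96 * h^5 - 192 * h^2 * n + 160 * h^3 *
  n - 32 * h^4 * n - 216 * h * n^2 + 168 * h^2 * n^2 - 32 * h^3 * n^2) * η^2 + (-2916 + 6048 *
  h - 4932 * h^2 + 1992 * h^3 - 400 * h^4 + 32 * h^5 - 576 * h * n + 672 * h^2 * n - 256 * h^3 *
  n + 32 * h^4 * n - 648 * n^2 + 720 * h * n^2 - 264 * h^2 * n^2 + 32 * h^3 * n^2) * η^3

/-- The polynomial multiplying the derivative of the Jacobi polynomial in the explicit form of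
`P_n` for member (a) of group II. -/
def coeffDerII (h _n η : ℝ[X]) : ℝ[X] :=
  (-9 + 4 * h) * (-1 + η^2) * (3 - 2 * h - 6 * η + 2 * h * η) * (27 - 4 * h^2 + 54 * η - 30 *
  h * η + 4 * h^2 * η)

/-- The polynomial multiplying the Jacobi polynomial in the explicit form of
`P_n` for member (a) of group III. -/
def coeffJacIII (h n η : ℝ[X]) : ℝ[X] :=
  405 - 648 * h + 72 * h^2 + 72 * h^3 + 80 * h^4 + 32 * h^5 - 486 * n + 1620 * h * n - 1728 *
  h^2 * n + 432 * h^3 * n + 288 * h^4 * n - 128 * h^5 * n - 162 * n^2 + 648 * h * n^2 - 936 *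
  h^2 * n^2 + 576 * h^3 * n^2 - 128 * h^4 * n^2 + (810 - 1566 * h + 612 * h^2 + 408 * h^3 -
  192 * h^4 - 96 * h^5 + 486 * n - 2268 * h * n + 3456 * h^2 * n - 1584 * h^3 * n - 480 * h^4 *
  n + 384 * h^5 * n + 162 * n^2 - 864 * h * n^2 + 1656 * h^2 * n^2 - 1344 * h^3 * n^2 + 384 *
  h^4 * n^2) * η + (270 * h + 36 * h^2 - 528 * h^3 + 144 * h^4 + 96 * h^5 + 648 * h * n -
  1944 * h^2 * n + 1584 * h^3 * n + 96 * h^4 * n - 384 * h^5 * n + 216 * h * n^2 - 792 * h^2 *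
  n^2 + 960 * h^3 * n^2 - 384 * h^4 * n^2) * η^2 + (36 * h^2 + 48 * h^3 - 32 * h^4 - 32 * h^5 +
  216 * h^2 * n - 432 * h^3 * n + 96 * h^4 * n + 128 * h^5 * n + 72 * h^2 * n^2 - 192 * h^3 *
  n^2 + 128 * h^4 * n^2) * η^3

/-- The polynomial multiplying the derivative of the Jacobi polynomial in the explicit form of
`P_n` for member (a) of group III. -/
def coeffDerIII (h _n η : ℝ[X]) : ℝ[X] :=
  -9 * (-3 + 4 * h) * (-1 + η^2) * (3 - 2 * h + 2 * h * η) * (3 - 4 * h^2 - 2 * h * η + 4 *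
  h^2 * η)

/-- The polynomial multiplying the Jacobi polynomial in the explicit form of
`P_n` for member (a) of group IV. -/
def coeffJacIV (h n η : ℝ[X]) : ℝ[X] :=
  133407 - 291870 * h + 189396 * h^2 + 30456 * h^3 - 98352 * h^4 + 51552 * h^5 - 12096 * h^6 +
  185640 * n - 460616 * h * n + 440564 * h^2 * n - 191368 * h^3 * n + 24144 * h^4 * n + 10336 *
  h^5 * n - 4352 * h^6 * n + 54145 * n^2 - 147238 * h * n^2 + 165212 * h^2 * n^2 - 98712 *
  h^3 * n^2 + 33568 * h^4 * n^2 - 6272 * h^5 * n^2 + 512 * h^6 * n^2 + 128 * h^7 * (9 + 4 * n) +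
  (-194400 + 574560 * h - 581760 * h^2 + 141696 * h^3 + 160128 * h^4 - 137088 * h^5 + 41472 *
  h^6 - 164976 * n + 604208 * h * n - 830840 * h^2 * n + 526768 * h^3 * n - 129120 * h^4 * n -
  16384 * h^5 * n + 14336 * h^6 * n - 48118 * n^2 + 187684 * h * n^2 - 288488 * h^2 * n^2 +
  227232 * h^3 * n^2 - 97792 * h^4 * n^2 + 22016 * h^5 * n^2 - 2048 * h^6 * n^2 - 512 * h^7 *
  (9 + 4 * n)) * η + (-97686 + 4860 * h + 300672 * h^2 - 256608 * h^3 - 38016 * h^4 + 124416 *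
  h^5 - 51840 * h^6 - 67032 * n - 77448 * h * n + 449940 * h^2 * n - 490632 * h^3 * n + 194688 *
  h^4 * n - 2496 * h^5 * n - 16896 * h^6 * n - 19551 * n^2 - 17934 * h * n^2 + 134904 * h^2 *
  n^2 - 176112 * h^3 * n^2 + 102336 * h^4 * n^2 - 28416 * h^5 * n^2 + 3072 * h^6 * n^2 + 768 *
  h^7 * (9 + 4 * n)) * η^2 + (32400 - 23760 * h - 102240 * h^2 + 147744 * h^3 - 33408 * h^4 -
  43776 * h^5 + 27648 * h^6 + 49728 * n - 71872 * h * n - 67232 * h^2 * n + 179392 * h^3 * n -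
  108960 * h^4 * n + 12800 * h^5 * n + 8192 * h^6 * n + 14504 * n^2 - 24416 * h * n^2 -
  13352 * h^2 * n^2 + 55008 * h^3 * n^2 - 45568 * h^4 * n^2 + 15872 * h^5 * n^2 - 2048 * h^6 *
  n^2 - 512 * h^7 * (9 + 4 * n)) * η^3 + (-3240 + 4320 * h + 9576 * h^2 - 21168 * h^3 + 9648 *
  h^4 + 4896 * h^5 - 5184 * h^6 - 3360 * n + 5728 * h * n + 7568 * h^2 * n - 24160 * h^3 * n +
  19248 * h^4 * n - 4256 * h^5 * n - 1280 * h^6 * n - 980 * n^2 + 1904 * h * n^2 + 1724 * h^2 *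
  n^2 - 7416 * h^3 * n^2 + 7456 * h^4 * n^2 - 3200 * h^5 * n^2 + 512 * h^6 * n^2 + 128 * h^7 *
  (9 + 4 * n)) * η^4

/-- The polynomial multiplying the derivative of the Jacobi polynomial in the explicit form of
`P_n` for member (a) of group IV. -/
def coeffDerIV (h n η : ℝ[X]) : ℝ[X] :=
  (-7 + 4 * h) * (-1 + η^2) * (336 * n * (5 - 2 * η)^2 * (η - 1) + 98 * n^2 * (5 - 2 * η)^2 *
  (η - 1) + 16 * h^4 * (120 + n * (38 - 14 * η) + 8 * n^2 * (η - 1) - 69 * η) * (η - 1)^2 + 32 *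
  h^5 * (9 + 4 * n) * (η - 1)^3 + 3 * (-2048 + 4769 * η - 2056 * η^2 + 388 * η^3) - 8 * h^3 *
  (η - 1) * (-438 + 468 * η - 93 * η^2 + 36 * n * (2 - 7 * η + 4 * η^2) + 8 * n^2 * (17 - 28 *
  η + 11 * η^2)) + 4 * h^2 * (9 * (-32 + 178 * η - 152 * η^2 + 51 * η^3) + 6 * n^2 * (-143 +
  333 * η - 249 * η^2 + 59 * η^3) + 2 * n * (-953 + 2373 * η - 1896 * η^2 + 476 * η^3)) - 2 *
  h * (28 * n^2 * (-85 + 174 * η - 111 * η^2 + 22 * η^3) + 8 * n * (-895 + 1863 * η - 1212 *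
  η^2 + 244 * η^3) + 3 * (-1447 + 3859 * η - 2144 * η^2 + 488 * η^3)))

/-- The parameter `h` of member (a) of a group in terms of `h̄`. -/
def hOfMemberA : Grp → ℝ → ℝ
  | .I, b => b + 2 | .II, b => b + 2 | .III, b => b | .IV, b => b + 1

/-- The explicit polynomial of member (a) of a group, for `n = 0, 1, 2, …`. -/
def explicitPoly (G : Grp) (h : ℝ) (n : ℕ) : ℝ[X] :=
  let J : ℝ[X] := jacobi n (curve G.memberA h - 1 / 2) (h - 1 / 2)
  match G with
  | .I => coeffJacI (C h) n X * J + coeffDerI (C h) n X * derivative J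
  | .II => coeffJacII (C h) n X * J + coeffDerII (C h) n X * derivative J
  | .III => coeffJacIII (C h) n X * J + coeffDerIII (C h) n X * derivative J
  | .IV => coeffJacIV (C h) n X * J + coeffDerIV (C h) n X * derivative J

/-- The explicit polynomials of the additional modes of member (a), in the parameter `h`, for
`n = -(k+1)`; zero if there is no such mode. -/
def additionalPoly (G : Grp) (h : ℝ) (k : ℕ) : ℝ[X] :=
  match G, k with
  | .I, 1 => C (27 - 4 * h ^ 2) + C (2 * (h - 3) * (2 * h - 9)) * X
  | .II, 2 => 1
  | .III, 1 => C (3 - 4 * h ^ 2) + C (2 * h * (-1 + 2 * h)) * X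
  | .IV, 2 => C (2 * h - 5) * X - C (2 * h - 2)
  | .IV, 1 => C (107 - 88 * h + 24 * h ^ 2 - 32 * h ^ 3 + 16 * h ^ 4) -
      C (8 * (-25 + 35 * h - 14 * h ^ 3 + 4 * h ^ 4)) * X +
      C (4 * (-1 + h) ^ 2 * (11 - 12 * h + 4 * h ^ 2)) * X ^ 2
  | _, _ => 0

/-- The explicit polynomial of every mode, for member (a) at the parameter `h`. -/
def memberAPoly (G : Grp) (h : ℝ) : ℤ → ℝ[X]
  | .ofNat n => explicitPoly G h n
  | .negSucc k => additionalPoly G h k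

/-- The explicit polynomials in any case: those of member (a), at the parameter which has the same
value of `h̄`. -/
def modePoly (c : Case) (h : ℝ) (m : ℤ) : ℝ[X] :=
  memberAPoly c.group (hOfMemberA c.group (hBar c h)) m

/-- The constant relating the polynomial part of the transformed eigenfunction to the explicit
polynomial, for member (a). -/
def normalisation (G : Grp) (h : ℝ) : ℝ :=
  (2 : ℝ) ^ (-(curve G.memberA h + h) / 2) *
    (match G with
      | .I => -2 / (4 * h - 9)
      | .II => -2 / (4 * h - 9)
      | .III => 2 / (4 * h - 3) ^ 2
      | .IV => 4 / (4 * h - 7) ^ 3)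

/-- The energies of the additional modes of member (a), for `n = -(k+1)`. -/
def additionalEnergy (G : Grp) (h : ℝ) (k : ℕ) : ℝ :=
  match G, k with
  | .I, 1 => -8 * (9 - 14 * h + 4 * h ^ 2) / (4 * h - 9)
  | .II, 2 => -12 * (27 - 20 * h + 4 * h ^ 2) / (-9 + 4 * h)
  | .III, 1 => -8 * (-3 - 2 * h + 4 * h ^ 2) / (-3 + 4 * h)
  | .IV, 2 => -12 * (-3 + 2 * h) * (1 + 2 * h) / (4 * h - 7)
  | .IV, 1 => -16 * (-5 + 2 * h ^ 2) / (4 * h - 7)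
  | _, _ => 0

/-- The product of `E_n - Ẽ_j` over the seeds `j`. -/
def energyProduct (c : Case) (h : ℝ) (n : ℕ) : ℝ :=
  ((seeds c).map fun s => energy (curve c h) h n - seedEnergy (curve c h) h s).prod

/-- The squared norms of the explicit polynomials of member (a). -/
def explicitNorm (G : Grp) (h : ℝ) (n : ℕ) : ℝ :=
  (match G with
    | .I => (2 : ℝ) ^ (curve G.memberA h + h - 1) * (4 * h - 9) ^ 2
    | .II => (2 : ℝ) ^ (curve G.memberA h + h - 1) * (4 * h - 9) ^ 2
    | .III => (2 : ℝ) ^ (curve G.memberA h + h - 1) * (4 * h - 3) ^ 4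
    | .IV => (2 : ℝ) ^ (curve G.memberA h + h - 3) * (4 * h - 7) ^ 6) *
    energyProduct G.memberA h n * baseNorm (curve G.memberA h) h n

/-- The weight function `(1-η)^{ḡ-1/2} (1+η)^{h̄-1/2} / (linear factor)^4`. -/
def weight (c : Case) (h t : ℝ) : ℝ :=
  (1 - t) ^ (gBar c h - 1 / 2) * (1 + t) ^ (hBar c h - 1 / 2) / (lin c h).eval t ^ 4

/-! ### Second order equations with polynomial coefficients -/

/-- The equation `p₂ y'' + p₁ y' + p₀ y = 0` with polynomial coefficients. -/
structure PolyEq where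
  p₂ : ℝ[X]
  p₁ : ℝ[X]
  p₀ : ℝ[X]

/-- A polynomial solution. -/
def PolyEq.Solves (e : PolyEq) (y : ℝ[X]) : Prop :=
  e.p₂ * derivative (derivative y) + e.p₁ * derivative y + e.p₀ * y = 0

/-- The equation is Fuchsian: every point of the Riemann sphere is an ordinary point or a regular
singular point. -/
def PolyEq.IsFuchsian (e : PolyEq) : Prop :=
  e.p₂ ≠ 0 ∧
  (∀ z : ℂ,
    (X - C z) ^ ((e.p₂.map (algebraMap ℝ ℂ)).rootMultiplicity z - 1) ∣
      e.p₁.map (algebraMap ℝ ℂ) ∧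
    (X - C z) ^ ((e.p₂.map (algebraMap ℝ ℂ)).rootMultiplicity z - 2) ∣
      e.p₀.map (algebraMap ℝ ℂ)) ∧
  e.p₁.degree + 1 ≤ e.p₂.degree ∧ e.p₀.degree + 2 ≤ e.p₂.degree

/-- `f` solves the equation in a punctured neighbourhood of the point `z₀` of the complex plane. -/
def PolyEq.SolvesNear (e : PolyEq) (f : ℂ → ℂ) (z₀ : ℂ) : Prop :=
  ∀ᶠ z in 𝓝[≠] z₀,
    aeval z e.p₂ * iteratedDeriv 2 f z + aeval z e.p₁ * deriv f z + aeval z e.p₀ * f z = 0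

/-- `z₀` is an apparent singularity (or an ordinary point) with characteristic exponents `r ≠ s`:
the solution space near `z₀` is spanned by two functions that are meromorphic at `z₀`, without
logarithm or branching, of orders `r` and `s`. -/
def PolyEq.IsApparent (e : PolyEq) (z₀ : ℂ) (r s : ℤ) : Prop :=
  ∃ f₁ f₂ : ℂ → ℂ, MeromorphicAt f₁ z₀ ∧ MeromorphicAt f₂ z₀ ∧
    e.SolvesNear f₁ z₀ ∧ e.SolvesNear f₂ z₀ ∧
    meromorphicOrderAt f₁ z₀ = r ∧ meromorphicOrderAt f₂ z₀ = s ∧ r ≠ s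

/-- The terms of the equation for `y_n = P_n / w` which come from the extra singularity. -/
def extraTerm (c : Case) (h t : ℝ) : ℝ :=
  match c.group with
  | .I => 6 * (2 * hBar c h + 1) / (lin c h).eval t +
      18 * (4 * hBar c h - 1) / (lin c h).eval t ^ 2
  | .II => 6 * (2 * hBar c h + 1) / (lin c h).eval t +
      18 * (4 * hBar c h - 1) / (lin c h).eval t ^ 2
  | .III => 6 * (2 * hBar c h - 3) / (lin c h).eval t -
      18 * (4 * hBar c h - 3) / (lin c h).eval t ^ 2
  | .IV => 6 * (2 * hBar c h - 3) / (lin c h).eval t -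
      18 * (4 * hBar c h - 3) / (lin c h).eval t ^ 2

/-- The number `(n + L)(n + ḡ + h̄ + L)`. -/
def spectral (c : Case) (h : ℝ) (m : ℤ) : ℝ :=
  (m + c.group.typeIII) * (m + gBar c h + hBar c h + c.group.typeIII)

/-- The rational function `y = P / w` satisfies the Fuchsian equation of the `m`-th mode. -/
def SolvesRationalEq (c : Case) (h : ℝ) (m : ℤ) (P : ℝ[X]) : Prop :=
  let y : ℝ → ℝ := fun t => P.eval t / (lin c h).eval t ^ 2
  ∀ t : ℝ, (lin c h).eval t ≠ 0 →
    (1 - t ^ 2) * iteratedDeriv 2 y t +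
      (hBar c h - gBar c h - (gBar c h + hBar c h + 1) * t) * deriv y t +
      (spectral c h m + extraTerm c h t) * y t = 0

/-- The same equation, multiplied by the square of the linear factor. -/
def rationalEq (c : Case) (h : ℝ) (m : ℤ) : PolyEq where
  p₂ := (1 - X ^ 2) * lin c h ^ 2
  p₁ := (C (hBar c h - gBar c h) - C (gBar c h + hBar c h + 1) * X) * lin c h ^ 2
  p₀ := C (spectral c h m) * lin c h ^ 2 +
    (match c.group with
      | .I => C (6 * (2 * hBar c h + 1)) * lin c h + C (18 * (4 * hBar c h - 1))
      | .II => C (6 * (2 * hBar c h + 1)) * lin c h + C (18 * (4 * hBar c h - 1))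
      | .III => C (6 * (2 * hBar c h - 3)) * lin c h - C (18 * (4 * hBar c h - 3))
      | .IV => C (6 * (2 * hBar c h - 3)) * lin c h - C (18 * (4 * hBar c h - 3)))

/-- The equation for `P_n` in groups I and II; the arguments are `ḡ`, `h̄`, `n`, `η`. -/
def polyEqOneTwo (g h n η : ℝ[X]) : PolyEq where
  p₂ := (-1 + 2 * h * (η - 1) - 2 * η) * (η ^ 2 - 1)
  p₁ := -8 + 2 * h ^ 2 * (η - 1) ^ 2 - η + 6 * η ^ 2 +
    g * (-1 + 2 * h * (η - 1) - 2 * η) * (η + 1) - h * (η - 1) * (8 * η + 9)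
  p₀ := 1 + 2 * n + n ^ 2 - 2 * h ^ 2 * (3 + n) * (η - 1) - 6 * η + 4 * n * η + 2 * n ^ 2 * η +
    h * (-1 + n * (5 - 2 * η) - 2 * n ^ 2 * (η - 1) + 12 * η) +
    g * (5 + n + 6 * η + 2 * n * η - 2 * h * (1 + n * (η - 1) + 3 * η))

/-- The equation for `P_n` in groups III and IV; the arguments are `γ = 2 L`, `ḡ`, `h̄`, `n`,
`η`. -/
def polyEqThreeFour (γ g h n η : ℝ[X]) : PolyEq where
  p₂ := 4 * (3 + 2 * h * (η - 1)) * (η ^ 2 - 1)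
  p₁ := 4 * (2 * h ^ 2 * (η - 1) ^ 2 + 3 * η + g * (3 + 2 * h * (η - 1)) * (η + 1) -
    h * (6 * η + 5) * (η - 1))
  p₀ := -(3 * (γ + 2 * n) ^ 2 +
    2 * h * (3 * (γ + 2 * n) - 16 * η + (γ + 2 * n) ^ 2 * (η - 1)) +
    4 * h ^ 2 * (4 + γ + 2 * n) * (η - 1) +
    2 * g * (3 * (γ + 2 * n) + 2 * h * (4 * (η + 1) + (γ + 2 * n) * (η - 1))))

/-- The equation for the polynomial of the `m`-th mode. -/
def polynomialEq (c : Case) (h : ℝ) (m : ℤ) : PolyEq :=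
  match c.group with
  | .I => polyEqOneTwo (C (gBar c h)) (C (hBar c h)) m X
  | .II => polyEqOneTwo (C (gBar c h)) (C (hBar c h)) m X
  | .III => polyEqThreeFour 2 (C (gBar c h)) (C (hBar c h)) m X
  | .IV => polyEqThreeFour 4 (C (gBar c h)) (C (hBar c h)) m X

/-- The explicit equations of the four members (a); the arguments are `h`, `n`, `η`. -/
def explicitEqAux (G : Grp) (h n η : ℝ[X]) : PolyEq :=
  match G with
  | .I =>
    { p₂ := (-9 + 4 * h) * (3 - 2 * h + 2 * (-3 + h) * η) * (1 - η ^ 2)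
      p₁ := -(27 + 60 * h - 58 * h ^ 2 + 12 * h ^ 3 -
        2 * (-81 + 102 * h - 48 * h ^ 2 + 8 * h ^ 3) * η +
        2 * (-54 + 57 * h - 19 * h ^ 2 + 2 * h ^ 3) * (2 * η ^ 2 - 1))
      p₀ := -8 * h ^ 3 * (3 + n) - 8 * h ^ 2 * (-20 - 3 * n + n ^ 2) - 27 * (-12 + n + n ^ 2) +
        6 * h * (-63 + 5 * n ^ 2) +
        2 * (-3 + h) * (3 + n) * (18 - 18 * h + 4 * h ^ 2 - 9 * n + 4 * h * n) * η }
  | .II =>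
    { p₂ := (-9 + 4 * h) * (3 - 2 * h + 2 * (-3 + h) * η) * (1 - η ^ 2)
      p₁ := -((135 - 198 * h + 96 * h ^ 2 - 16 * h ^ 3) * η +
        (-3 + h) * (-9 - 20 * h + 12 * h ^ 2 + (45 - 28 * h + 4 * h ^ 2) * (2 * η ^ 2 - 1)))
      p₀ := (3 + n) * (27 - 20 * h + 4 * h ^ 2 - 9 * n + 4 * h * n) *
        (3 - 2 * h - 6 * η + 2 * h * η) }
  | .III =>
    { p₂ := (-3 + 4 * h) * (3 - 2 * h + 2 * h * η) * (1 - η ^ 2)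
      p₁ := 9 + 2 * h ^ 2 - 12 * h ^ 3 + 2 * (9 - 6 * h - 8 * h ^ 2 + 8 * h ^ 3) * η -
        2 * h * (3 - 7 * h + 2 * h ^ 2) * (2 * η ^ 2 - 1)
      p₀ := -8 * h ^ 3 * (3 + n) - 8 * h ^ 2 * (-3 + n ^ 2) - 9 * (2 + 3 * n + n ^ 2) +
        6 * h * (1 + 6 * n + 3 * n ^ 2) +
        2 * h * (3 + n) * (4 * h ^ 2 - 3 * n + h * (-6 + 4 * n)) * η }
  | .IV =>
    { p₂ := (-7 + 4 * h) * (5 - 2 * h + 2 * (-1 + h) * η) * (1 - η ^ 2)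
      p₁ := (-5 + 62 * h - 64 * h ^ 2 + 16 * h ^ 3) * η -
        (-1 + h) * (19 - 28 * h + 12 * h ^ 2 + (5 - 2 * h) ^ 2 * (2 * η ^ 2 - 1))
      p₀ := -((-5 + 2 * h) * (-12 - 24 * n - 7 * n ^ 2 + 4 * h ^ 2 * (4 + n) +
          4 * h * (-4 + 2 * n + n ^ 2))) +
        2 * (-1 + h) * (4 + 4 * h ^ 2 + 4 * h * (-2 + n) - 7 * n) * (4 + n) * η }

/-- The explicit equation of the `m`-th mode of member (a) at the parameter `h`. -/
def explicitEq (G : Grp) (h : ℝ) (m : ℤ) : PolyEq := explicitEqAux G (C h) m X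

/-- The shift of the parameter `h` that maps member (a) of a group to member (b). -/
def memberShift : Grp → ℝ
  | .I => 3 | .II => 2 | .III => -3 | .IV => -2

end JacobiConfluence

end

noncomputable section

namespace JacobiConfluence

/-! ### Jacobi polynomials -/

/-! One second order equation governs all eight cases. Put p = 4h̄ - 1 in groups I, II and p = 4h̄ -
3 in groups III, IV, and let σ = ±3, ε = ±1 be the signs by which the groups differ (`param`,
`Grp.sigma`, `Grp.eps`). Then -2ℓ = p(1 - η) + σ(1 + η). With s the slope of ℓ this says p = s(η₀ +
1), σ = s(η₀ - 1), and on the curve ḡ and h̄ become rational functions of η₀ alone. In these terms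
equation (ii) and the explicit equations of the cases (a) are constant multiples of `normalEq`;
equation (i) is its conjugate by ℓ², and the Schrödinger equation is (i) conjugated by powers of 1 -
η and 1 + η.

Wronskians. The seeds and φ_n solve the same Schrödinger equation at different energies, so all
derivatives of order two and three are combinations of f and f'. The determinants of order at most
four therefore reduce to f, f' and energy differences (`wronskian_two`, `wronskian_three`,
`wronskian_four`). After the powers of sin x, cos x and p are removed, `DetIdentity` states that the
seeds give a constant times powers of 1 ± η times ℓ³ (this is what the fine tuning achieves), while
the seeds with φ_n give ℓ (A J + B J') with the same constant up to a simple factor, where J is the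
Jacobi polynomial of φ_n. The quotient is a polynomial over ℓ² (`deformedState_eq`), and the
logarithm of the first determinant gives the potential (`deformedPotential_eq`).

Equations and norms. Jacobi's equation keeps the span of J and J' stable under differentiation, so
"A J + B J' solves `normalEq`" splits into two polynomial identities (`OdeIdentity`,
`normalEq_transformed`). For the norms, `NormIdentity` exhibits a quadratic form F in J, J' such
that the derivative of a Jacobi-type weight times F/ℓ³ combines the transformed square with ∏(E_n -
Ẽ_j) times the square of J. Its integral is zero, which reduces the norm to the classical one
(`integral_transformed_sq`, `integral_jacobi_sq`).

Remaining assertions. Different modes are orthogonal by Lagrange's identity, because their spectral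
parameters differ (`spectral_ne`). A polynomial solution of `normalEq` is determined by its value at
η = 1 when ḡ > -1/2 (`exists_eq_C_mul`); hence P_n and R_n are proportional. R_m(η₀) is evaluated
explicitly, with Jacobi polynomials having no zero outside [-1, 1] (`jacobi_outside`). At η₀ the
exponents are 0 and 5, and the only obstruction to a power series solution, at the fifth step,
vanishes identically in η₀ and the spectral parameter (`frobenius_coefficients`).

The large identities in p, n, η are decided by Kronecker substitution: a polynomial with integer
coefficients vanishes if it vanishes at one point that is large compared with its coefficients
(`PolyTerm.value_eq_zero`). -/

/-- The coefficient of `((1 - X) / 2) ^ k` in a Jacobi polynomial. -/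
def jacobiCoeff (n : ℕ) (α β : ℝ) (k : ℕ) : ℝ :=
  (ascPochhammer ℝ (n - k)).eval (α + 1 + k) * (ascPochhammer ℝ k).eval (-(n : ℝ)) *
    (ascPochhammer ℝ k).eval (n + α + β + 1) / (n.factorial * k.factorial)

/-- The Jacobi polynomial in the variable `(1 - X) / 2`. -/
def jacobiHyp (n : ℕ) (α β : ℝ) : ℝ[X] :=
  ∑ k ∈ Finset.range (n + 1), C (jacobiCoeff n α β k) * X ^ k

theorem jacobi_eq_comp (n : ℕ) (α β : ℝ) :
    jacobi n α β = (jacobiHyp n α β).comp (C (1 / 2) * (1 - X)) := by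
  change _ = compRingHom (C (1 / 2) * (1 - X)) (jacobiHyp n α β)
  simp [jacobi, jacobiHyp, jacobiCoeff, map_sum]

theorem jacobiCoeff_of_lt {n k : ℕ} (α β : ℝ) (h : n < k) : jacobiCoeff n α β k = 0 := by
  simp [jacobiCoeff, ascPochhammer_eval_neg_coe_nat_of_lt h]

theorem coeff_jacobiHyp (n : ℕ) (α β : ℝ) (k : ℕ) :
    (jacobiHyp n α β).coeff k = jacobiCoeff n α β k := by
  simp only [jacobiHyp, finsetSum_coeff, coeff_C_mul, coeff_X_pow, mul_ite, mul_one, mul_zero]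
  rw [Finset.sum_ite_eq]
  split_ifs with h
  · rfl
  · rw [jacobiCoeff_of_lt]
    simpa using h

theorem ascPochhammer_eval_left (k : ℕ) (a : ℝ) :
    (ascPochhammer ℝ (k + 1)).eval a = a * (ascPochhammer ℝ k).eval (a + 1) := by
  rw [ascPochhammer_succ_left, eval_mul, eval_X, eval_comp]; simp

/-- The ratio of consecutive hypergeometric coefficients, cleared of denominators so that it
survives the vanishing of α + 1 + k. From k = n on both sides are zero. -/
theorem jacobiCoeff_succ (n : ℕ) (α β : ℝ) (k : ℕ) :
    (k + 1) * (α + 1 + k) * jacobiCoeff n α β (k + 1) =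
      (k - n) * (k + n + α + β + 1) * jacobiCoeff n α β k := by
  rcases lt_trichotomy k n with h | h | h
  · obtain ⟨d, rfl⟩ : ∃ d, n = k + 1 + d := ⟨n - (k + 1), by omega⟩
    have e1 : k + 1 + d - (k + 1) = d := by omega
    have e2 : k + 1 + d - k = d + 1 := by omega
    simp only [jacobiCoeff, e1, e2, ascPochhammer_succ_eval (S := ℝ) k,
      ascPochhammer_eval_left d, Nat.factorial_succ k, Nat.cast_mul]
    have h1 : ((k + 1 + d).factorial : ℝ) ≠ 0 := by positivity
    have h2 : (k.factorial : ℝ) ≠ 0 := by positivity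
    have h3 : ((k : ℝ) + 1) ≠ 0 := by positivity
    push_cast
    rw [show α + 1 + ((k : ℝ) + 1) = α + 1 + k + 1 by ring]
    field_simp
    ring
  · subst h; rw [jacobiCoeff_of_lt α β (Nat.lt_succ_self k)]; simp
  · rw [jacobiCoeff_of_lt α β h, jacobiCoeff_of_lt α β (by omega)]; simp

/-- The hypergeometric equation: its k-th coefficient is `jacobiCoeff_succ`. -/
theorem jacobiHyp_ode (n : ℕ) (α β : ℝ) :
    X * (1 - X) * derivative (derivative (jacobiHyp n α β)) +
      (C (α + 1) - C (α + β + 2) * X) * derivative (jacobiHyp n α β) +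
      C (n * (n + α + β + 1)) * jacobiHyp n α β = 0 := by
  obtain ⟨a, ha⟩ : ∃ a, a = α + 1 := ⟨_, rfl⟩
  obtain ⟨b, hb⟩ : ∃ b, b = α + β + 2 := ⟨_, rfl⟩
  obtain ⟨c, hc⟩ : ∃ c, c = n * (n + α + β + 1) := ⟨_, rfl⟩
  rw [← ha, ← hb, ← hc]
  -- Powers of X are written as iterated multiplication by X, so that each factor shifts the
  -- coefficient index by one; low indices are treated apart.
  have key : X * derivative (derivative (jacobiHyp n α β))
      - X * (X * derivative (derivative (jacobiHyp n α β))) +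
      (C a * derivative (jacobiHyp n α β) - C b * (X * derivative (jacobiHyp n α β))) +
      C c * jacobiHyp n α β = 0 := by
    ext k
    have hk := jacobiCoeff_succ n α β k
    rcases k with _ | _ | k <;>
    simp only [coeff_add, coeff_sub, coeff_C_mul, coeff_X_mul, coeff_X_mul_zero,
      coeff_derivative, coeff_jacobiHyp, coeff_zero, ha, hb, hc] <;> push_cast at hk ⊢ <;>
    ring_nf at hk ⊢ <;>
    linear_combination hk
  linear_combination key

/-- The substitution (1 - η)/2 in the hypergeometric equation; each derivative costs a factor -1/2.
-/
theorem jacobi_ode (n : ℕ) (α β : ℝ) :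
    (1 - X ^ 2) * derivative (derivative (jacobi n α β)) +
      (C (β - α) - C (α + β + 2) * X) * derivative (jacobi n α β) +
      C (n * (n + α + β + 1)) * jacobi n α β = 0 := by
  have h := congrArg (fun q => q.comp (C (1 / 2 : ℝ) * (1 - X))) (jacobiHyp_ode n α β)
  have hc : (C (1 / 2 : ℝ)) * 2 = 1 := by
    rw [show (2 : ℝ[X]) = C 2 from rfl, ← C_mul]; norm_num
  simp only [add_comp, mul_comp, sub_comp, X_comp, C_comp, one_comp, zero_comp] at h
  have hq : derivative (C (1 / 2 : ℝ) * (1 - X)) = -C (1 / 2) := by simp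
  have d1 : derivative (jacobi n α β) =
      -C (1 / 2) * (derivative (jacobiHyp n α β)).comp (C (1 / 2) * (1 - X)) := by
    rw [jacobi_eq_comp, derivative_comp, hq]
  have d2 : derivative (derivative (jacobi n α β)) =
      C (1 / 2) * C (1 / 2) *
        (derivative (derivative (jacobiHyp n α β))).comp (C (1 / 2) * (1 - X)) := by
    rw [d1, derivative_mul, derivative_comp, hq, derivative_neg, derivative_C]; ring
  rw [d2, d1, jacobi_eq_comp]
  have hA : (C (β - α) : ℝ[X]) = C (α + β + 2) - 2 * C (α + 1) := by
    rw [show (2 : ℝ[X]) = C 2 from rfl, ← C_mul, ← C_sub]; congr 1; ring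
  rw [hA]
  set u := C (1 / 2 : ℝ)
  set F2 := (derivative (derivative (jacobiHyp n α β))).comp (u * (1 - X))
  set F1 := (derivative (jacobiHyp n α β)).comp (u * (1 - X))
  linear_combination h + ((1 - X) * u * F2 + C (α + 1) * F1) * hc

/-- Coefficient form of the ladder relation: differentiation lowers the degree and raises both
parameters by one. -/
theorem jacobiCoeff_ladder (n : ℕ) (α β : ℝ) (k : ℕ) :
    (k + 1) * jacobiCoeff (n + 1) α β (k + 1) =
      -(n + α + β + 2) * jacobiCoeff n (α + 1) (β + 1) k := by
  have e1 : n + 1 - (k + 1) = n - k := by omega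
  simp only [jacobiCoeff, e1, ascPochhammer_eval_left k, Nat.factorial_succ, Nat.cast_mul]
  push_cast
  rw [show α + 1 + ((k : ℝ) + 1) = α + 1 + 1 + k by ring,
    show -((n : ℝ) + 1) + 1 = -n by ring,
    show (n : ℝ) + 1 + α + β + 1 + 1 = n + (α + 1) + (β + 1) + 1 by ring]
  have h1 : (n.factorial : ℝ) ≠ 0 := by positivity
  have h2 : (k.factorial : ℝ) ≠ 0 := by positivity
  have h3 : ((k : ℝ) + 1) ≠ 0 := by positivity
  have h4 : ((n : ℝ) + 1) ≠ 0 := by positivity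
  field_simp
  ring

theorem derivative_jacobi_succ (n : ℕ) (α β : ℝ) :
    derivative (jacobi (n + 1) α β) =
      C ((n + α + β + 2) / 2) * jacobi n (α + 1) (β + 1) := by
  have h : derivative (jacobiHyp (n + 1) α β) =
      C (-(n + α + β + 2)) * jacobiHyp n (α + 1) (β + 1) := by
    ext k
    rw [coeff_derivative, coeff_C_mul, coeff_jacobiHyp, coeff_jacobiHyp, ← jacobiCoeff_ladder]
    ring
  have hq : derivative (C (1 / 2 : ℝ) * (1 - X)) = C (-1 / 2) := by
    rw [derivative_mul]; simp [neg_div]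
  rw [jacobi_eq_comp, derivative_comp, hq, h, mul_comp, C_comp, ← jacobi_eq_comp, ← mul_assoc,
    ← C_mul]
  congr 2
  ring

theorem derivative_jacobi_zero (α β : ℝ) : derivative (jacobi 0 α β) = 0 := by
  simp [jacobi]

theorem jacobi_zero (α β : ℝ) : jacobi 0 α β = 1 := by
  simp [jacobi]

theorem jacobi_one (α β : ℝ) :
    jacobi 1 α β = C (α + 1) - C ((α + β + 2) / 2) * (1 - X) := by
  refine Polynomial.funext fun t => ?_
  simp only [jacobi, Finset.sum_range_succ, Finset.sum_range_zero]
  simp [ascPochhammer_one]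
  ring

theorem eval_jacobi (n : ℕ) (α β t : ℝ) :
    (jacobi n α β).eval t =
      ∑ k ∈ Finset.range (n + 1), jacobiCoeff n α β k * ((1 - t) / 2) ^ k := by
  rw [jacobi_eq_comp, eval_comp, jacobiHyp, eval_finsetSum]
  simp [div_eq_inv_mul]

theorem jacobi_eval_one (n : ℕ) (α β : ℝ) :
    (jacobi n α β).eval 1 = (ascPochhammer ℝ n).eval (α + 1) / n.factorial := by
  rw [eval_jacobi, Finset.sum_range_succ']
  simp [jacobiCoeff]

theorem jacobi_eval_one_pos (n : ℕ) {α : ℝ} (β : ℝ) (hα : -1 < α) :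
    0 < (jacobi n α β).eval 1 := by
  rw [jacobi_eval_one]
  exact div_pos (ascPochhammer_pos n _ (by linarith)) (by positivity)

theorem jacobi_ne_zero (n : ℕ) {α : ℝ} (β : ℝ) (hα : -1 < α) : jacobi n α β ≠ 0 := by
  intro h
  have := jacobi_eval_one_pos n β hα
  simp [h] at this

theorem ascPochhammer_neg_mul_pow_nonneg {n k : ℕ} (h : k ≤ n) {s : ℝ} (hs : s ≤ 0) :
    0 ≤ (ascPochhammer ℝ k).eval (-(n : ℝ)) * s ^ k := by
  induction k with
  | zero => simp
  | succ k ih =>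
    rw [ascPochhammer_succ_eval, pow_succ]
    have h1 := ih (by omega)
    have h2 : (0 : ℝ) ≤ (-(n : ℝ) + k) * s := by
      have : (k : ℝ) + 1 ≤ n := by exact_mod_cast h
      exact mul_nonneg_of_nonpos_of_nonpos (by linarith) hs
    nlinarith [mul_nonneg h1 h2]

/-- For t > 1 the sign of (-n)_k is compensated by that of ((1 - t)/2)^k, so no term of the
hypergeometric sum is negative, and the term k = 0 is positive. -/
theorem jacobi_pos_of_one_lt (n : ℕ) {α β : ℝ} (hα : -1 < α) (hβ : -1 < β) {t : ℝ} (ht : 1 < t) :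
    0 < (jacobi n α β).eval t := by
  rw [eval_jacobi, Finset.sum_range_succ']
  refine add_pos_of_nonneg_of_pos (Finset.sum_nonneg fun k hk => ?_) ?_
  · have hk' : k + 1 ≤ n := by simpa using hk
    -- A term with positive index forces n ≥ 1; this is what makes n + α + β + 1 positive when only
    -- α, β > -1 is known.
    have hn : (1 : ℝ) ≤ n := by exact_mod_cast (by omega : 1 ≤ n)
    have h1 := ascPochhammer_neg_mul_pow_nonneg hk' (s := (1 - t) / 2) (by linarith)
    have h2 : 0 ≤ (ascPochhammer ℝ (n - (k + 1))).eval (α + 1 + (k + 1 : ℕ)) := by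
      refine (ascPochhammer_pos _ _ ?_).le
      push_cast
      linarith [(Nat.cast_nonneg k : (0 : ℝ) ≤ k)]
    have h3 : 0 ≤ (ascPochhammer ℝ (k + 1)).eval (n + α + β + 1) :=
      (ascPochhammer_pos _ _ (by linarith)).le
    have : jacobiCoeff n α β (k + 1) * ((1 - t) / 2) ^ (k + 1) =
        (ascPochhammer ℝ (n - (k + 1))).eval (α + 1 + (k + 1 : ℕ)) *
          ((ascPochhammer ℝ (k + 1)).eval (-(n : ℝ)) * ((1 - t) / 2) ^ (k + 1)) *
          (ascPochhammer ℝ (k + 1)).eval (n + α + β + 1) /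
            (n.factorial * (k + 1).factorial) := by
      rw [jacobiCoeff]; ring
    rw [this]
    positivity
  · have h2 : 0 < (ascPochhammer ℝ n).eval (α + 1) := ascPochhammer_pos _ _ (by linarith)
    simp only [jacobiCoeff]
    simp
    positivity

theorem derivative_jacobi_nonneg_of_one_lt (n : ℕ) {α β : ℝ} (hα : -1 < α) (hβ : -1 < β) {t : ℝ}
    (ht : 1 < t) : 0 ≤ (derivative (jacobi n α β)).eval t := by
  rcases n with _ | n
  · simp [derivative_jacobi_zero]
  · rw [derivative_jacobi_succ, eval_mul, eval_C]
    have h := jacobi_pos_of_one_lt n (α := α + 1) (β := β + 1) (by linarith) (by linarith) ht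
    have : (0 : ℝ) ≤ n := Nat.cast_nonneg n
    exact mul_nonneg (by linarith) h.le

/-- A polynomial solution of a second order equation with a regular singular point at `1` vanishes
identically if it vanishes at `1` and no positive integer is an exponent there. -/
theorem eq_zero_of_eval_one_eq_zero {a b c D : ℝ[X]}
    (h : (X - C 1) * a * derivative (derivative D) + b * derivative D + c * D = 0)
    (hab : ∀ k : ℕ, a.eval 1 * k + b.eval 1 ≠ 0) (h1 : D.eval 1 = 0) : D = 0 := by
  by_contra hD
  -- If D ≠ 0, write D = (X - 1)^(k+1) E with E(1) ≠ 0; the lowest order term of the equation at 1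
  -- is then the indicial polynomial at k + 1.
  obtain ⟨E, hE, hdvd⟩ := exists_eq_pow_rootMultiplicity_mul_and_not_dvd D hD 1
  have hpos : 0 < D.rootMultiplicity 1 := (rootMultiplicity_pos hD).2 h1
  obtain ⟨k, hk⟩ : ∃ k, D.rootMultiplicity 1 = k + 1 := ⟨_, (Nat.succ_pred_eq_of_pos hpos).symm⟩
  rw [hk] at hE
  set u : ℝ[X] := X - C 1 with hu
  have du : derivative u = 1 := by simp [hu]
  have d1 : derivative D = u ^ k * ((k + 1) * E + u * derivative E) := by
    rw [hE, derivative_mul, derivative_pow_succ, du]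
    simp only [C_add, C_1, C_eq_natCast]; ring
  have d2 : u * derivative (derivative D) =
      u ^ k * (k * ((k + 1) * E + u * derivative E) +
        u * ((k + 1) * derivative E + derivative E + u * derivative (derivative E))) := by
    rw [d1]
    rcases k with _ | k
    · simp [du]; ring_nf; simp
    · rw [derivative_mul, derivative_pow_succ, du]
      simp [du]; ring
  have h2 : u ^ k * (a * (k * ((k + 1) * E + u * derivative E) +
        u * ((k + 1) * derivative E + derivative E + u * derivative (derivative E))) +
        b * ((k + 1) * E + u * derivative E) + c * u * E) = 0 := by
    have h3 : a * (u * derivative (derivative D)) + b * derivative D + c * D = 0 := by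
      linear_combination h
    rw [d2, d1] at h3
    rw [hE] at h3
    linear_combination h3
  have h4 := (mul_eq_zero.1 h2).resolve_left (pow_ne_zero _ (X_sub_C_ne_zero 1))
  have h5 := congrArg (eval 1) h4
  have hu1 : eval 1 u = 0 := by simp [hu]
  simp [hu1] at h5
  -- The indicial polynomial at exponent k + 1 is (k + 1)(a(1) k + b(1)), which the hypothesis makes
  -- nonzero.
  have h6 : (a.eval 1 * k + b.eval 1) * ((k + 1) * E.eval 1) = 0 := by linear_combination h5
  have h7 := (mul_eq_zero.1 h6).resolve_left (hab k)
  have h8 : E.eval 1 = 0 := (mul_eq_zero.1 h7).resolve_left (by positivity)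
  exact hdvd (dvd_iff_isRoot.2 h8)

/-- Reflection exchanges the parameters in Jacobi's equation, so both sides solve it. The exponents
at 1 are 0 and -α < 1, so a combination that vanishes at 1 vanishes identically. -/
theorem jacobi_eval_one_mul_comp_neg (n : ℕ) {α : ℝ} (β : ℝ) (hα : -1 < α) :
    C (((jacobi n β α).comp (-X)).eval 1) * jacobi n α β =
      C ((jacobi n α β).eval 1) * (jacobi n β α).comp (-X) := by
  set J := jacobi n α β with hJ
  set Q := (jacobi n β α).comp (-X) with hQ
  have o1 := jacobi_ode n α β
  have o2 : (1 - X ^ 2) * derivative (derivative Q) +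
      (C (β - α) - C (α + β + 2) * X) * derivative Q + C (n * (n + α + β + 1)) * Q = 0 := by
    have h := congrArg (fun q => q.comp (-X : ℝ[X])) (jacobi_ode n β α)
    have e1 : derivative Q = -(derivative (jacobi n β α)).comp (-X) := by
      rw [hQ, derivative_comp]; simp
    have e2 : derivative (derivative Q) = (derivative (derivative (jacobi n β α))).comp (-X) := by
      rw [e1, derivative_neg, derivative_comp]; simp
    simp only [add_comp, mul_comp, sub_comp, X_comp, C_comp, one_comp, zero_comp, pow_comp] at h
    rw [e2, e1]
    have e3 : (C (α - β) : ℝ[X]) = -C (β - α) := by rw [← C_neg]; congr 1; ring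
    have e4 : (C (β + α + 2) : ℝ[X]) = C (α + β + 2) := by congr 1; ring
    have e5 : (C (n * (n + β + α + 1)) : ℝ[X]) = C (n * (n + α + β + 1)) := by congr 1; ring
    rw [e3, e4, e5] at h
    linear_combination h
  have := eq_zero_of_eval_one_eq_zero (a := -(X + 1)) (b := C (β - α) - C (α + β + 2) * X)
    (c := C (n * (n + α + β + 1))) (D := C (Q.eval 1) * J - C (J.eval 1) * Q) ?_ ?_ ?_
  · linear_combination this
  · simp only [derivative_sub, derivative_C_mul, map_one]
    linear_combination C (Q.eval 1) * o1 - C (J.eval 1) * o2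
  · intro k hk
    simp at hk
    have : (0 : ℝ) ≤ k := Nat.cast_nonneg k
    linarith
  · simp; ring

/-- Only the non-vanishing of the constant is needed, to carry the behaviour on t > 1 to t < -1. -/
theorem jacobi_reflect (n : ℕ) {α β : ℝ} (hα : -1 < α) (hβ : -1 < β) :
    ∃ s : ℝ, s ≠ 0 ∧ jacobi n α β = C s * (jacobi n β α).comp (-X) := by
  have h := jacobi_eval_one_mul_comp_neg n β hα
  have h1 := (jacobi_eval_one_pos n β hα).ne'
  have hQ : (jacobi n β α).comp (-X) ≠ 0 := by
    intro h0
    have := congrArg (fun q => q.comp (-X : ℝ[X])) h0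
    simp [comp_assoc] at this
    exact jacobi_ne_zero n α hβ this
  have h2 : ((jacobi n β α).comp (-X)).eval 1 ≠ 0 := by
    intro h0
    rw [h0] at h
    simp [h1, hQ] at h
  refine ⟨(jacobi n α β).eval 1 / ((jacobi n β α).comp (-X)).eval 1, div_ne_zero h1 h2, ?_⟩
  have h3 : C (((jacobi n β α).comp (-X)).eval 1)⁻¹ * C (((jacobi n β α).comp (-X)).eval 1) =
      (1 : ℝ[X]) := by rw [← C_mul, inv_mul_cancel₀ h2, C_1]
  calc jacobi n α β = C (((jacobi n β α).comp (-X)).eval 1)⁻¹ *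
      (C (((jacobi n β α).comp (-X)).eval 1) * jacobi n α β) := by rw [← mul_assoc, h3, one_mul]
    _ = _ := by rw [h, ← mul_assoc, ← C_mul, div_eq_inv_mul]

/-- Outside `[-1, 1]`, a Jacobi polynomial has no zero, and its logarithmic derivative has the
sign of the argument. -/
theorem jacobi_outside (n : ℕ) {α β : ℝ} (hα : -1 < α) (hβ : -1 < β) :
    (∀ t : ℝ, 1 < t → (jacobi n α β).eval t ≠ 0 ∧
      0 ≤ (jacobi n α β).eval t * (derivative (jacobi n α β)).eval t) ∧
    (∀ t : ℝ, t < -1 → (jacobi n α β).eval t ≠ 0 ∧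
      (jacobi n α β).eval t * (derivative (jacobi n α β)).eval t ≤ 0) := by
  refine ⟨fun t ht => ?_, fun t ht => ?_⟩
  · have h1 := jacobi_pos_of_one_lt n hα hβ ht
    exact ⟨h1.ne', mul_nonneg h1.le (derivative_jacobi_nonneg_of_one_lt n hα hβ ht)⟩
  · obtain ⟨s, hs, hJ⟩ := jacobi_reflect n hα hβ
    have h1 := jacobi_pos_of_one_lt n hβ hα (t := -t) (by linarith)
    have h2 := derivative_jacobi_nonneg_of_one_lt n hβ hα (t := -t) (by linarith)
    rw [hJ]
    simp only [derivative_C_mul, derivative_comp, eval_mul, eval_C, eval_comp, eval_neg, eval_X,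
      derivative_neg, derivative_X, eval_one]
    refine ⟨mul_ne_zero hs h1.ne', ?_⟩
    nlinarith [mul_nonneg (mul_nonneg h1.le h2) (sq_nonneg s)]

/-! ### Integrals against the Jacobi weight -/

/-- The weight function of the Jacobi polynomials. -/
def jacobiWeight (α β t : ℝ) : ℝ := (1 - t) ^ α * (1 + t) ^ β

/-- Splitting at 0 leaves a single singular factor on each half. -/
theorem intervalIntegrable_jacobiWeight {α β : ℝ} (hα : -1 < α) (hβ : -1 < β) :
    IntervalIntegrable (jacobiWeight α β) volume (-1) 1 := by
  have h1 : IntervalIntegrable (jacobiWeight α β) volume (-1) 0 := by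
    have hb : IntervalIntegrable (fun t : ℝ => (1 + t) ^ β) volume (-1) 0 := by
      have := (intervalIntegral.intervalIntegrable_rpow' (a := 0) (b := 1) hβ).comp_add_left (c := 1)
      simpa using this
    refine hb.continuousOn_mul ?_
    refine ContinuousOn.rpow_const (by fun_prop) fun t ht => Or.inl ?_
    rw [uIcc_of_le (by norm_num)] at ht
    linarith [ht.2]
  have h2 : IntervalIntegrable (jacobiWeight α β) volume 0 1 := by
    have hb : IntervalIntegrable (fun t : ℝ => (1 - t) ^ α) volume 0 1 := by
      have := (intervalIntegral.intervalIntegrable_rpow' (a := 0) (b := 1) hα).comp_sub_left (c := 1)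
      simpa using this.symm
    refine hb.mul_continuousOn ?_
    refine ContinuousOn.rpow_const (by fun_prop) fun t ht => Or.inl ?_
    rw [uIcc_of_le (by norm_num)] at ht
    linarith [ht.1]
  exact h1.trans h2

theorem intervalIntegrable_jacobiWeight_mul {α β : ℝ} (hα : -1 < α) (hβ : -1 < β) {s : ℝ → ℝ}
    (hs : ContinuousOn s (Icc (-1) 1)) :
    IntervalIntegrable (fun t => jacobiWeight α β t * s t) volume (-1) 1 :=
  (intervalIntegrable_jacobiWeight hα hβ).mul_continuousOn
    (by rwa [uIcc_of_le (by norm_num)])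

/-- Integration by parts against the Jacobi weight: the boundary terms vanish. -/
theorem integral_jacobiWeight_deriv {α β : ℝ} (hα : -1 < α) (hβ : -1 < β) {r r' : ℝ → ℝ}
    (hr : ∀ t ∈ Icc (-1 : ℝ) 1, HasDerivAt r (r' t) t) (hr' : ContinuousOn r' (Icc (-1) 1)) :
    ∫ t in (-1 : ℝ)..1, jacobiWeight α β t *
      (((β + 1) * (1 - t) - (α + 1) * (1 + t)) * r t + (1 - t ^ 2) * r' t) = 0 := by
  -- The integrand is the derivative of (1 - t)^(α+1) (1 + t)^(β+1) r, whose exponents are positive.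
  have hrc : ContinuousOn r (Icc (-1) 1) := fun t ht => (hr t ht).continuousAt.continuousWithinAt
  have hcont : ContinuousOn (fun t => (1 - t) ^ (α + 1) * (1 + t) ^ (β + 1) * r t)
      (Icc (-1) 1) := by
    refine ContinuousOn.mul (ContinuousOn.mul ?_ ?_) hrc
    · exact ContinuousOn.rpow_const (by fun_prop) fun t _ => Or.inr (by linarith)
    · exact ContinuousOn.rpow_const (by fun_prop) fun t _ => Or.inr (by linarith)
  have hint : IntervalIntegrable (fun t => jacobiWeight α β t *
      (((β + 1) * (1 - t) - (α + 1) * (1 + t)) * r t + (1 - t ^ 2) * r' t)) volume (-1) 1 :=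
    intervalIntegrable_jacobiWeight_mul hα hβ (by fun_prop)
  rw [intervalIntegral.integral_eq_sub_of_hasDerivAt_of_le (by norm_num) hcont _ hint]
  · have e1 : (0 : ℝ) ^ (α + 1) = 0 := Real.zero_rpow (by linarith)
    have e2 : (0 : ℝ) ^ (β + 1) = 0 := Real.zero_rpow (by linarith)
    simp [e1, e2]
  · intro t ht
    have p1 : 0 < 1 - t := by linarith [ht.2]
    have p2 : 0 < 1 + t := by linarith [ht.1]
    have d1 : HasDerivAt (fun t : ℝ => (1 - t) ^ (α + 1)) (-((α + 1) * (1 - t) ^ α)) t := by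
      have := ((hasDerivAt_id t).const_sub 1).rpow_const (p := α + 1) (Or.inl p1.ne')
      convert this using 1 <;> simp
      ring
    have d2 : HasDerivAt (fun t : ℝ => (1 + t) ^ (β + 1)) ((β + 1) * (1 + t) ^ β) t := by
      have := ((hasDerivAt_id t).const_add 1).rpow_const (p := β + 1) (Or.inl p2.ne')
      convert this using 1 <;> simp
    have := (d1.fun_mul d2).fun_mul (hr t (Ioo_subset_Icc_self ht))
    refine HasDerivAt.congr_deriv this ?_
    simp only [jacobiWeight]
    rw [Real.rpow_add_one p1.ne', Real.rpow_add_one p2.ne']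
    ring

theorem integral_jacobiWeight {α β : ℝ} (hα : -1 < α) (hβ : -1 < β) :
    ∫ t in (-1 : ℝ)..1, jacobiWeight α β t =
      2 ^ (α + β + 1) * (Real.Gamma (α + 1) * Real.Gamma (β + 1) / Real.Gamma (α + β + 2)) := by
  have h1 : ∫ t in (-1 : ℝ)..1, jacobiWeight α β t =
      2 * ∫ u in (0 : ℝ)..1, jacobiWeight α β (2 * u - 1) := by
    rw [intervalIntegral.integral_comp_mul_sub _ two_ne_zero]
    norm_num
    ring
  have h2 : ∫ u in (0 : ℝ)..1, jacobiWeight α β (2 * u - 1) =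
      2 ^ (α + β) * ∫ u in (0 : ℝ)..1, u ^ β * (1 - u) ^ α := by
    rw [← intervalIntegral.integral_const_mul]
    refine intervalIntegral.integral_congr fun u hu => ?_
    rw [uIcc_of_le (by norm_num)] at hu
    simp only [jacobiWeight]
    rw [show 1 - (2 * u - 1) = 2 * (1 - u) by ring, show 1 + (2 * u - 1) = 2 * u by ring,
      Real.mul_rpow (by norm_num) (by linarith [hu.2]), Real.mul_rpow (by norm_num) hu.1,
      Real.rpow_add (by norm_num)]
    ring
  -- Euler's integral is known for complex exponents; the real integral is recovered as a real part.
  have h3 : ∫ u in (0 : ℝ)..1, u ^ β * (1 - u) ^ α = ProbabilityTheory.beta (β + 1) (α + 1) := by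
    rw [ProbabilityTheory.beta_eq_betaIntegralReal _ _ (by linarith) (by linarith),
      Complex.betaIntegral]
    rw [← Complex.ofReal_re (∫ u in (0 : ℝ)..1, u ^ β * (1 - u) ^ α),
      ← intervalIntegral.integral_ofReal]
    congr 1
    refine intervalIntegral.integral_congr fun u hu => ?_
    rw [uIcc_of_le (by norm_num)] at hu
    simp only [Complex.ofReal_mul]
    rw [Complex.ofReal_cpow hu.1, Complex.ofReal_cpow (by linarith [hu.2])]
    push_cast
    simp
  rw [h1, h2, h3, ProbabilityTheory.beta, Real.rpow_add_one (by norm_num) (α + β),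
    show β + 1 + (α + 1) = α + β + 2 by ring]
  ring

theorem hasDerivAt_eval (P : ℝ[X]) (t : ℝ) :
    HasDerivAt (fun t => P.eval t) ((derivative P).eval t) t := P.hasDerivAt t

/-- Multiply Jacobi's equation by J and integrate by parts: the eigenvalue times ∫ w J² equals ∫ w
(1 - t²) J'². The ladder relation turns J' into a Jacobi polynomial of lower degree, and 1 - t²
raises both exponents of the weight. -/
theorem integral_jacobi_sq_succ (n : ℕ) {α β : ℝ} (hα : -1 < α) (hβ : -1 < β) :
    (n + 1) * (n + α + β + 2) *
        ∫ t in (-1 : ℝ)..1, jacobiWeight α β t * (jacobi (n + 1) α β).eval t ^ 2 =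
      ((n + α + β + 2) / 2) ^ 2 * ∫ t in (-1 : ℝ)..1,
        jacobiWeight (α + 1) (β + 1) t * (jacobi n (α + 1) (β + 1)).eval t ^ 2 := by
  set J := jacobi (n + 1) α β with hJ
  have h := integral_jacobiWeight_deriv hα hβ (r := fun t => (J * derivative J).eval t)
    (r' := fun t => (derivative (J * derivative J)).eval t)
    (fun t _ => hasDerivAt_eval _ t) (by fun_prop)
  have ode : ∀ t : ℝ, (1 - t ^ 2) * (derivative (derivative J)).eval t +
      ((β - α) - (α + β + 2) * t) * (derivative J).eval t +
      ((n + 1) * (n + α + β + 2)) * J.eval t = 0 := by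
    intro t
    have := congrArg (eval t) (jacobi_ode (n + 1) α β)
    simp only [eval_add, eval_sub, eval_mul, eval_pow, eval_C, eval_X, eval_one, eval_zero] at this
    push_cast at this
    rw [← hJ] at this
    linear_combination this
  have hi : ∀ p : ℝ[X], IntervalIntegrable (fun t => jacobiWeight α β t * p.eval t) volume (-1) 1 :=
    fun p => intervalIntegrable_jacobiWeight_mul hα hβ (by fun_prop)
  have e1 : ∫ t in (-1 : ℝ)..1, jacobiWeight α β t *
      (((β + 1) * (1 - t) - (α + 1) * (1 + t)) * (J * derivative J).eval t +
        (1 - t ^ 2) * (derivative (J * derivative J)).eval t) =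
      ∫ t in (-1 : ℝ)..1, (jacobiWeight α β t * ((1 - X ^ 2) * derivative J ^ 2).eval t -
        ((n + 1) * (n + α + β + 2)) * (jacobiWeight α β t * (J ^ 2).eval t)) := by
    refine intervalIntegral.integral_congr fun t _ => ?_
    simp only [derivative_mul, eval_add, eval_mul, eval_sub, eval_pow, eval_one, eval_X]
    linear_combination jacobiWeight α β t * J.eval t * ode t
  rw [e1, intervalIntegral.integral_sub (hi _) ((hi _).const_mul _),
    intervalIntegral.integral_const_mul] at h
  have e2 : ∫ t in (-1 : ℝ)..1, jacobiWeight α β t * ((1 - X ^ 2) * derivative J ^ 2).eval t =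
      ((n + α + β + 2) / 2) ^ 2 * ∫ t in (-1 : ℝ)..1,
        jacobiWeight (α + 1) (β + 1) t * (jacobi n (α + 1) (β + 1)).eval t ^ 2 := by
    rw [← intervalIntegral.integral_const_mul]
    -- The comparison is restricted to the open interval because shifting a real exponent requires a
    -- nonzero base.
    refine intervalIntegral.integral_congr_uIoo fun t ht => ?_
    rw [uIoo_of_le (by norm_num)] at ht
    have p1 : 0 < 1 - t := by linarith [ht.2]
    have p2 : 0 < 1 + t := by linarith [ht.1]
    rw [hJ, derivative_jacobi_succ]
    simp only [jacobiWeight, eval_mul, eval_sub, eval_pow, eval_one, eval_X, eval_C]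
    rw [Real.rpow_add_one p1.ne', Real.rpow_add_one p2.ne']
    ring
  rw [← e2]
  simp only [eval_pow] at h ⊢
  linarith

/-- Induction on the degree with the parameters generalised, down to the beta integral; α + β + 1 >
0 keeps the Gamma functions in the denominator away from their poles. -/
theorem integral_jacobi_sq (n : ℕ) {α β : ℝ} (hα : -1 < α) (hβ : -1 < β) (hαβ : 0 < α + β + 1) :
    ∫ t in (-1 : ℝ)..1, jacobiWeight α β t * (jacobi n α β).eval t ^ 2 =
      2 ^ (α + β + 1) * (Real.Gamma (n + α + 1) * Real.Gamma (n + β + 1) /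
        (n.factorial * (2 * n + α + β + 1) * Real.Gamma (n + α + β + 1))) := by
  induction n generalizing α β with
  | zero =>
    simp only [jacobi_zero, eval_one, one_pow, mul_one]
    rw [integral_jacobiWeight hα hβ, show α + β + 2 = (α + β + 1) + 1 by ring,
      Real.Gamma_add_one hαβ.ne']
    simp
  | succ n ih =>
    have h := integral_jacobi_sq_succ n hα hβ
    rw [ih (by linarith) (by linarith) (by linarith)] at h
    have hn : (0 : ℝ) ≤ n := Nat.cast_nonneg n
    have h1 : (n : ℝ) + α + β + 2 ≠ 0 := by linarith
    have h2 : (n : ℝ) + 1 ≠ 0 := by linarith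
    have h3 : 2 * ((n : ℝ) + 1) + α + β + 1 ≠ 0 := by linarith
    have h5 : Real.Gamma (n + 1 + α + β + 1) ≠ 0 := (Real.Gamma_pos_of_pos (by linarith)).ne'
    have e : (2 : ℝ) ^ (α + 1 + (β + 1) + 1) = 2 ^ (α + β + 1) * 4 := by
      rw [show α + 1 + (β + 1) + 1 = α + β + 1 + 2 by ring, Real.rpow_add (by norm_num)]
      norm_num
    have g1 : Real.Gamma (n + (α + 1) + (β + 1) + 1) =
        (n + α + β + 2) * Real.Gamma (n + 1 + α + β + 1) := by
      rw [show (n : ℝ) + (α + 1) + (β + 1) + 1 = (n + α + β + 2) + 1 by ring,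
        Real.Gamma_add_one h1]
      congr 2; ring
    rw [e, g1, show (n : ℝ) + (α + 1) + 1 = n + 1 + α + 1 by ring,
      show (n : ℝ) + (β + 1) + 1 = n + 1 + β + 1 by ring] at h
    have h4 : ((n : ℝ) + 1) * (n + α + β + 2) ≠ 0 := mul_ne_zero h2 h1
    refine mul_left_cancel₀ h4 (h.trans ?_)
    have h6 : (2 * n + (α + 1) + (β + 1) + 1) ≠ 0 := by linarith
    have h7 : (n.factorial : ℝ) ≠ 0 := by positivity
    rw [Nat.factorial_succ]
    push_cast
    rw [show 2 * ((n : ℝ) + 1) + α + β + 1 = 2 * n + (α + 1) + (β + 1) + 1 by ring]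
    field_simp
    ring

theorem integral_jacobi_sq_eq_baseNorm (n : ℕ) {g h : ℝ} (hg : -1 / 2 < g) (hh : -1 / 2 < h)
    (hgh : 0 < g + h) :
    ∫ t in (-1 : ℝ)..1, jacobiWeight (g - 1 / 2) (h - 1 / 2) t *
      (jacobi n (g - 1 / 2) (h - 1 / 2)).eval t ^ 2 = 2 ^ (g + h + 1) * baseNorm g h n := by
  rw [integral_jacobi_sq n (by linarith) (by linarith) (by linarith), baseNorm,
    show g - 1 / 2 + (h - 1 / 2) + 1 = g + h by ring, Real.rpow_add_one (by norm_num) (g + h),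
    show (n : ℝ) + (g - 1 / 2) + 1 = n + g + 1 / 2 by ring,
    show (n : ℝ) + (h - 1 / 2) + 1 = n + h + 1 / 2 by ring,
    show (n : ℝ) + (g - 1 / 2) + (h - 1 / 2) + 1 = n + g + h by ring,
    show 2 * (n : ℝ) + (g - 1 / 2) + (h - 1 / 2) + 1 = 2 * n + g + h by ring]
  have hn : (0 : ℝ) ≤ n := Nat.cast_nonneg n
  have h1 : 2 * (n : ℝ) + g + h ≠ 0 := by linarith
  have h2 : Real.Gamma (n + g + h) ≠ 0 := (Real.Gamma_pos_of_pos (by linarith)).ne'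
  field_simp

/-! ### Power series solutions at an apparent singularity -/

/-- The sequence given by six initial values and a three-term recurrence with non-constant
coefficients. -/
def frobeniusPair (c : ℂ) (u v : ℕ → ℂ) (a₄ a₅ : ℂ) : ℕ → ℂ × ℂ
  | 0 => (a₄, a₅)
  | j + 1 =>
    let w := frobeniusPair c u v a₄ a₅ j
    (w.2, -(u (j + 5) * w.2 + v (j + 5) * w.1) / ((j + 6) * (j + 1) * c))

/-- Solutions of the recurrence grow at most geometrically. -/
theorem exists_frobenius_sequence {c : ℂ} (hc : c ≠ 0) {u v : ℕ → ℂ} {M : ℝ}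
    (hu : ∀ k, ‖u k‖ ≤ M * (k + 1) ^ 2) (hv : ∀ k, ‖v k‖ ≤ M * (k + 1) ^ 2)
    {i : ℕ → ℂ} (h0 : 4 * c * i 1 = u 0 * i 0)
    (hi : ∀ k < 4, (k + 2) * (k - 3) * c * i (k + 2) + u (k + 1) * i (k + 1) + v (k + 1) * i k = 0) :
    ∃ a : ℕ → ℂ, (∀ k ≤ 5, a k = i k) ∧ 4 * c * a 1 = u 0 * a 0 ∧
      (∀ k : ℕ, (k + 2) * (k - 3) * c * a (k + 2) + u (k + 1) * a (k + 1) + v (k + 1) * a k = 0) ∧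
      ∃ C R : ℝ, 0 < R ∧ ∀ k, ‖a k‖ ≤ C * R ^ k := by
  -- The relation with k = 3 does not determine the fifth coefficient, since its factor k - 3 is
  -- zero. So i 4 and i 5 are both prescribed and the recursion proper starts at index 6.
  set w := frobeniusPair c u v (i 4) (i 5) with hw
  have hwsucc : ∀ j, (w (j + 1)).1 = (w j).2 := fun j => rfl
  have hw0 : (w 0).1 = i 4 := rfl
  have hw1 : (w 1).1 = i 5 := rfl
  set a : ℕ → ℂ := fun k => if k < 4 then i k else (w (k - 4)).1 with ha
  have ha5 : ∀ k ≤ 5, a k = i k := by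
    intro k hk
    interval_cases k <;> simp [ha, hw0, hw1]
  have ha4 : ∀ j, a (j + 4) = (w j).1 := fun j => by simp [ha]
  have hrec : ∀ j : ℕ, a (j + 6) =
      -(u (j + 5) * a (j + 5) + v (j + 5) * a (j + 4)) / ((j + 6) * (j + 1) * c) := by
    intro j
    rw [ha4 j, show j + 6 = (j + 2) + 4 by ring, ha4, show j + 5 = (j + 1) + 4 by ring, ha4]
    rfl
  have hall : ∀ k : ℕ,
      (k + 2) * (k - 3) * c * a (k + 2) + u (k + 1) * a (k + 1) + v (k + 1) * a k = 0 := by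
    intro k
    rcases lt_or_ge k 4 with hk | hk
    · rw [ha5 k (by omega), ha5 (k + 1) (by omega), ha5 (k + 2) (by omega)]
      exact hi k hk
    · obtain ⟨j, rfl⟩ : ∃ j, k = j + 4 := ⟨k - 4, by omega⟩
      have h6 : ((j : ℂ) + 6) ≠ 0 := by exact_mod_cast (by omega : j + 6 ≠ 0)
      have h1 : ((j : ℂ) + 1) ≠ 0 := by exact_mod_cast (by omega : j + 1 ≠ 0)
      rw [hrec j]
      push_cast
      field_simp
      ring
  refine ⟨a, ha5, by rw [ha5 1 (by omega), ha5 0 (by omega)]; exact h0, hall, ?_⟩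
  have hM : 0 ≤ M := by
    have := (norm_nonneg _).trans (hu 0)
    simpa using this
  have hcn : 0 < ‖c‖ := norm_pos_iff.2 hc
  -- The 6 comes from (j + 6)² ≤ 6 (j + 6)(j + 1): quadratic growth of u and v is absorbed by the
  -- leading factor.
  set K := 6 * M / ‖c‖ with hK
  have hK0 : 0 ≤ K := by positivity
  have hbound : ∀ j : ℕ, ‖a (j + 6)‖ ≤ K * (‖a (j + 5)‖ + ‖a (j + 4)‖) := by
    intro j
    rw [hrec j, norm_div, norm_neg, norm_mul, norm_mul,
      show ((j : ℂ) + 6) = ((j + 6 : ℕ) : ℂ) by push_cast; rfl,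
      show ((j : ℂ) + 1) = ((j + 1 : ℕ) : ℂ) by push_cast; rfl, Complex.norm_natCast,
      Complex.norm_natCast]
    have hj : (0 : ℝ) ≤ j := Nat.cast_nonneg j
    have e1 : ‖u (j + 5) * a (j + 5) + v (j + 5) * a (j + 4)‖ ≤
        M * (j + 6) ^ 2 * (‖a (j + 5)‖ + ‖a (j + 4)‖) := by
      refine (norm_add_le _ _).trans ?_
      rw [norm_mul, norm_mul]
      have h1 := mul_le_mul_of_nonneg_right (hu (j + 5)) (norm_nonneg (a (j + 5)))
      have h2 := mul_le_mul_of_nonneg_right (hv (j + 5)) (norm_nonneg (a (j + 4)))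
      push_cast at h1 h2
      rw [show (j : ℝ) + 5 + 1 = j + 6 by ring] at h1 h2
      linarith
    push_cast
    rw [div_le_iff₀ (by positivity)]
    refine e1.trans ?_
    rw [hK]
    have hx : 0 ≤ ‖a (j + 5)‖ + ‖a (j + 4)‖ := by positivity
    have : 6 * M / ‖c‖ * (‖a (j + 5)‖ + ‖a (j + 4)‖) * (((j : ℝ) + 6) * (j + 1) * ‖c‖) =
        M * (6 * ((j + 6) * (j + 1))) * (‖a (j + 5)‖ + ‖a (j + 4)‖) := by
      field_simp
    rw [this]
    refine mul_le_mul_of_nonneg_right (mul_le_mul_of_nonneg_left ?_ hM) hx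
    nlinarith
  -- R ≥ 1 makes the bounds C R^k increase, and R ≥ 2K then absorbs the two preceding terms.
  set R := 2 * K + 1 with hR
  have hR1 : 1 ≤ R := by linarith
  have hR0 : 0 < R := by linarith
  set C := ∑ k ∈ Finset.range 6, ‖a k‖ with hC
  have hsmall : ∀ k < 6, ‖a k‖ ≤ C * R ^ k := by
    intro k hk
    have h1 : ‖a k‖ ≤ C :=
      Finset.single_le_sum (f := fun k => ‖a k‖) (fun _ _ => norm_nonneg _) (Finset.mem_range.2 hk)
    have h2 : 1 ≤ R ^ k := one_le_pow₀ hR1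
    nlinarith [norm_nonneg (a k)]
  refine ⟨C, R, hR0, fun k => ?_⟩
  induction k using Nat.strong_induction_on with
  | _ k ih =>
    rcases lt_or_ge k 6 with hk | hk
    · exact hsmall k hk
    · obtain ⟨j, rfl⟩ : ∃ j, k = j + 6 := ⟨k - 6, by omega⟩
      have h1 := ih (j + 5) (by omega)
      have h2 := ih (j + 4) (by omega)
      have hC0 : 0 ≤ C := Finset.sum_nonneg fun _ _ => norm_nonneg _
      have hp : 0 ≤ C * R ^ (j + 4) := by positivity
      have h3 : C * R ^ (j + 4) ≤ C * R ^ (j + 5) := by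
        rw [pow_succ R (j + 4)]; nlinarith
      calc ‖a (j + 6)‖ ≤ K * (‖a (j + 5)‖ + ‖a (j + 4)‖) := hbound j
        _ ≤ K * (C * R ^ (j + 5) + C * R ^ (j + 5)) := by gcongr; linarith
        _ = (2 * K) * (C * R ^ (j + 5)) := by ring
        _ ≤ R * (C * R ^ (j + 5)) := by gcongr; linarith
        _ = C * R ^ (j + 6) := by ring

/-- A sequence of at most geometric growth is the sequence of Taylor coefficients of an analytic
function. -/
theorem exists_hasFPowerSeriesAt {a : ℕ → ℂ} {C R : ℝ} (hR : 0 < R) (h : ∀ k, ‖a k‖ ≤ C * R ^ k)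
    (z₀ : ℂ) : ∃ f : ℂ → ℂ, HasFPowerSeriesAt f (FormalMultilinearSeries.ofScalars ℂ a) z₀ := by
  refine ⟨fun z => ∑' k, (z - z₀) ^ k • a k, ?_⟩
  rw [hasFPowerSeriesAt_iff']
  -- Within distance 1/(2R) the series is dominated by a geometric series of ratio 1/2.
  have hball : ∀ᶠ z in 𝓝 z₀, ‖z - z₀‖ < (2 * R)⁻¹ := by
    have := Metric.ball_mem_nhds z₀ (ε := (2 * R)⁻¹) (by positivity)
    filter_upwards [this] with z hz
    simpa [dist_eq_norm] using hz
  filter_upwards [hball] with z hz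
  simp only [FormalMultilinearSeries.coeff_ofScalars]
  refine Summable.hasSum (Summable.of_norm_bounded (g := fun k : ℕ => C * (1 / 2) ^ k)
    (summable_geometric_two.mul_left C) fun k => ?_)
  rw [norm_smul, norm_pow]
  have h1 : ‖z - z₀‖ ^ k ≤ ((2 * R)⁻¹) ^ k := by gcongr
  have hC : 0 ≤ C * R ^ k := (norm_nonneg _).trans (h k)
  calc ‖z - z₀‖ ^ k * ‖a k‖ ≤ ((2 * R)⁻¹) ^ k * (C * R ^ k) := by
        gcongr
        exact h k
    _ = C * (1 / 2) ^ k := by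
        rw [mul_inv, mul_pow, one_div]
        have : (R⁻¹) ^ k * R ^ k = 1 := by rw [← mul_pow, inv_mul_cancel₀ hR.ne', one_pow]
        linear_combination C * (2⁻¹ : ℝ) ^ k * this

theorem iteratedDeriv_of_hasFPowerSeriesAt {a : ℕ → ℂ} {f : ℂ → ℂ} {z₀ : ℂ}
    (hf : HasFPowerSeriesAt f (FormalMultilinearSeries.ofScalars ℂ a) z₀) (k : ℕ) :
    iteratedDeriv k f z₀ = k.factorial * a k := by
  have h := hf.analyticAt.hasFPowerSeriesAt.eq_formalMultilinearSeries hf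
  have h1 := congrArg (fun p => FormalMultilinearSeries.coeff p k) h
  simp only [FormalMultilinearSeries.coeff_ofScalars] at h1
  have : (k.factorial : ℂ) ≠ 0 := by exact_mod_cast k.factorial_ne_zero
  field_simp at h1
  rw [h1]

/-- Taylor coefficients are unique, so those of the derivative can be read off from iterated
derivatives at the centre. -/
theorem hasFPowerSeriesAt_deriv {a : ℕ → ℂ} {f : ℂ → ℂ} {z₀ : ℂ}
    (hf : HasFPowerSeriesAt f (FormalMultilinearSeries.ofScalars ℂ a) z₀) :
    HasFPowerSeriesAt (deriv f)
      (FormalMultilinearSeries.ofScalars ℂ fun k => (k + 1) * a (k + 1)) z₀ := by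
  have h := hf.analyticAt.deriv.hasFPowerSeriesAt
  suffices e : (fun k : ℕ => ((k : ℂ) + 1) * a (k + 1)) =
      fun k : ℕ => iteratedDeriv k (deriv f) z₀ / k.factorial by rwa [e]
  funext k
  rw [← iteratedDeriv_succ', iteratedDeriv_of_hasFPowerSeriesAt hf, Nat.factorial_succ]
  have : (k.factorial : ℂ) ≠ 0 := by exact_mod_cast k.factorial_ne_zero
  push_cast
  field_simp

theorem hasSum_of_eq {f g : ℕ → ℂ} {S : ℂ} (hg : HasSum g S) (h : ∀ k, f k = g k) :
    HasSum f S := by rwa [funext h]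

/-- Multiplication by the local variable shifts the coefficients; iterated, it aligns all terms of
the equation in equal powers. -/
theorem hasSum_mul_shift {b : ℕ → ℂ} {s S : ℂ} (h : HasSum (fun k => s ^ k * b k) S) :
    HasSum (fun k => s ^ k * (if k = 0 then 0 else b (k - 1))) (s * S) := by
  have h1 := h.mul_left s
  rw [← hasSum_nat_add_iff' 1]
  simp only [Finset.range_one, Finset.sum_singleton, if_true, mul_zero, sub_zero]
  refine hasSum_of_eq h1 fun k => ?_
  simp [pow_succ]
  ring

/-- Power series solutions at a regular singular point with exponents `0` and `5`, given initial
values that satisfy the first five relations. -/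
theorem exists_analytic_solution {c₀ c₁ c₂ d₁ d₂ e₀ e₁ : ℂ} (hc : c₀ ≠ 0) (z₀ : ℂ) {i : ℕ → ℂ}
    (h0 : 4 * c₀ * i 1 = e₀ * i 0)
    (hi : ∀ k : ℕ, k < 4 → (k + 2) * (k - 3) * c₀ * i (k + 2) +
      (c₁ * ((k + 1) * k) + d₁ * (k + 1) + e₀) * i (k + 1) +
      (c₂ * (k * (k - 1)) + d₂ * k + e₁) * i k = 0) :
    ∃ f : ℂ → ℂ, AnalyticAt ℂ f z₀ ∧ (∀ k ≤ 5, iteratedDeriv k f z₀ = k.factorial * i k) ∧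
      ∀ᶠ z in 𝓝 z₀, (z - z₀) * (c₀ + c₁ * (z - z₀) + c₂ * (z - z₀) ^ 2) * iteratedDeriv 2 f z +
        (-4 * c₀ + d₁ * (z - z₀) + d₂ * (z - z₀) ^ 2) * deriv f z +
        (e₀ + e₁ * (z - z₀)) * f z = 0 := by
  -- `u k` collects the factors of a_k from the terms that preserve the power, and `v k` those of
  -- a_(k-1) from the terms that raise it by one.
  set u : ℕ → ℂ := fun k => c₁ * (k * (k - 1)) + d₁ * k + e₀ with hu
  set v : ℕ → ℂ := fun k => c₂ * ((k - 1) * (k - 2)) + d₂ * (k - 1) + e₁ with hv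
  set M : ℝ := 4 * (‖c₁‖ + ‖d₁‖ + ‖e₀‖ + ‖c₂‖ + ‖d₂‖ + ‖e₁‖) with hM
  have aux : ∀ (x y z : ℂ) (s t : ℂ) (k : ℕ), ‖s‖ ≤ 4 * ((k : ℝ) + 1) ^ 2 →
      ‖t‖ ≤ 4 * ((k : ℝ) + 1) ^ 2 →
      ‖x * s + y * t + z‖ ≤ 4 * (‖x‖ + ‖y‖ + ‖z‖) * ((k : ℝ) + 1) ^ 2 := by
    intro x y z s t k hs ht
    have hk : (1 : ℝ) ≤ ((k : ℝ) + 1) ^ 2 := by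
      have : (0 : ℝ) ≤ k := Nat.cast_nonneg k
      nlinarith
    calc ‖x * s + y * t + z‖ ≤ ‖x‖ * ‖s‖ + ‖y‖ * ‖t‖ + ‖z‖ := by
          refine (norm_add_le _ _).trans ?_
          gcongr
          refine (norm_add_le _ _).trans ?_
          rw [norm_mul, norm_mul]
      _ ≤ ‖x‖ * (4 * ((k : ℝ) + 1) ^ 2) + ‖y‖ * (4 * ((k : ℝ) + 1) ^ 2) +
          ‖z‖ * (4 * ((k : ℝ) + 1) ^ 2) := by
          gcongr
          nlinarith [norm_nonneg z]
      _ = _ := by ring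
  have n1 : ∀ k : ℕ, ‖(k : ℂ)‖ ≤ (k : ℝ) + 1 := fun k => by
    rw [Complex.norm_natCast]; linarith
  have n2 : ∀ k : ℕ, ‖(k : ℂ) - 1‖ ≤ (k : ℝ) + 1 := fun k => by
    refine (norm_sub_le _ _).trans ?_
    rw [Complex.norm_natCast]; simp
  have n3 : ∀ k : ℕ, ‖(k : ℂ) - 2‖ ≤ 2 * ((k : ℝ) + 1) := fun k => by
    refine (norm_sub_le _ _).trans ?_
    rw [Complex.norm_natCast]
    have : (0 : ℝ) ≤ k := Nat.cast_nonneg k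
    norm_num; linarith
  have hub : ∀ k, ‖u k‖ ≤ M * (k + 1) ^ 2 := by
    intro k
    have hk : (0 : ℝ) ≤ k := Nat.cast_nonneg k
    refine (aux _ _ _ _ _ k ?_ ?_).trans ?_
    · rw [norm_mul]
      nlinarith [n1 k, n2 k, norm_nonneg (k : ℂ), norm_nonneg ((k : ℂ) - 1),
        mul_le_mul (n1 k) (n2 k) (norm_nonneg _) (by linarith)]
    · nlinarith [n1 k]
    · rw [hM]; gcongr ?_ * _
      linarith [norm_nonneg c₂, norm_nonneg d₂, norm_nonneg e₁]
  have hvb : ∀ k, ‖v k‖ ≤ M * (k + 1) ^ 2 := by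
    intro k
    have hk : (0 : ℝ) ≤ k := Nat.cast_nonneg k
    refine (aux _ _ _ _ _ k ?_ ?_).trans ?_
    · rw [norm_mul]
      nlinarith [mul_le_mul (n2 k) (n3 k) (norm_nonneg _) (by linarith)]
    · nlinarith [n2 k]
    · rw [hM]; gcongr ?_ * _
      linarith [norm_nonneg c₁, norm_nonneg d₁, norm_nonneg e₀]
  obtain ⟨a, ha, ha0, hrec, C, R, hR, hbd⟩ := exists_frobenius_sequence hc hub hvb (i := i)
    (by simpa [hu] using h0) (fun k hk => by
      have := hi k hk
      simp only [hu, hv]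
      push_cast
      linear_combination this)
  obtain ⟨f, hf⟩ := exists_hasFPowerSeriesAt hR hbd z₀
  have hf1 := hasFPowerSeriesAt_deriv hf
  have hf2 := hasFPowerSeriesAt_deriv hf1
  refine ⟨f, hf.analyticAt, fun k hk => by rw [iteratedDeriv_of_hasFPowerSeriesAt hf, ha k hk], ?_⟩
  filter_upwards [hasFPowerSeriesAt_iff'.1 hf, hasFPowerSeriesAt_iff'.1 hf1,
    hasFPowerSeriesAt_iff'.1 hf2] with z s0 s1 s2
  simp only [FormalMultilinearSeries.coeff_ofScalars, smul_eq_mul] at s0 s1 s2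
  have t2 : iteratedDeriv 2 f z = deriv (deriv f) z := by
    rw [iteratedDeriv_succ, iteratedDeriv_one]
  rw [t2]
  set s := z - z₀
  have s01 := hasSum_mul_shift s0
  have s11 := hasSum_mul_shift s1
  have s12 := hasSum_mul_shift s11
  have s21 := hasSum_mul_shift s2
  have s22 := hasSum_mul_shift s21
  have s23 := hasSum_mul_shift s22
  have hsum := (((s21.mul_left c₀).add ((s22.mul_left c₁).add (s23.mul_left c₂))).add
    ((s1.mul_left (-4 * c₀)).add ((s11.mul_left d₁).add (s12.mul_left d₂)))).add
    ((s0.mul_left e₀).add (s01.mul_left e₁))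
  -- Every coefficient of the combined series vanishes. The first three are separate because up to
  -- three shifts cut off lower terms; from there on the general recurrence applies.
  have hz := hsum.unique (hasSum_of_eq hasSum_zero fun k => by
    rcases k with _ | _ | _ | k
    · simp
      linear_combination -ha0 + (by simp [hu] : u 0 * a 0 = e₀ * a 0)
    · have := hrec 0
      simp [hu, hv] at this ⊢
      linear_combination s * this
    · have := hrec 1
      simp [hu, hv] at this ⊢
      linear_combination s ^ 2 * this
    · have := hrec (k + 2)
      simp [hu, hv] at this ⊢
      linear_combination s ^ (k + 1 + 1 + 1) * this)
  linear_combination hz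

/-! ### A uniform parametrisation of the four groups -/

/-- The sign (times three) that distinguishes groups I, II from groups III, IV. -/
def Grp.sigma : Grp → ℝ
  | .I => 3 | .II => 3 | .III => -3 | .IV => -3

/-- The sign that distinguishes the two values of `ḡ` belonging to a common potential. -/
def Grp.eps : Grp → ℝ
  | .I => 1 | .II => -1 | .III => -1 | .IV => 1

/-- The parameter in which the denominators of the fine-tuning curves are monomials. -/
def param (G : Grp) (b : ℝ) : ℝ := 4 * b - 2 + G.sigma / 3

theorem Grp.sigma_ne_zero (G : Grp) : G.sigma ≠ 0 := by cases G <;> norm_num [Grp.sigma]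

theorem Grp.sigma_sq (G : Grp) : G.sigma ^ 2 = 9 := by cases G <;> norm_num [Grp.sigma]

/-- p = 0 is the pole of the curve, and p = σ is where the slope of ℓ vanishes. -/
theorem admissible_iff (c : Case) (h : ℝ) :
    Admissible c h ↔ param c.group (hBar c h) ≠ 0 ∧ param c.group (hBar c h) ≠ c.group.sigma := by
  unfold Admissible param
  generalize hBar c h = b
  cases c.group <;> simp only [Grp.sigma] <;>
  refine and_congr (not_congr ⟨fun h => ?_, fun h => ?_⟩) (not_congr ⟨fun h => ?_, fun h => ?_⟩) <;>
  linarith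

/-- One formula for the four groups; in it the denominator of the curve is the monomial p. -/
theorem gBarOfHBar_eq (G : Grp) {b : ℝ} (hp : param G b ≠ 0) :
    gBarOfHBar G b = 1 / 2 + G.eps * (1 - 3 * G.sigma / param G b) / 4 := by
  obtain ⟨p, hb⟩ : ∃ p, param G b = p := ⟨_, rfl⟩
  rw [hb] at hp ⊢
  cases G <;> simp only [gBarOfHBar, param, Grp.sigma, Grp.eps] at hb ⊢
  · rw [show 4 * b - 1 = p by linarith, show b = (p + 1) / 4 by linarith]
    field_simp
    ring
  · rw [show 4 * b - 1 = p by linarith, show b = (p + 1) / 4 by linarith]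
    field_simp
    ring
  · rw [show 4 * b - 3 = p by linarith, show b = (p + 3) / 4 by linarith]
    field_simp
    ring
  · rw [show 4 * b - 3 = p by linarith, show b = (p + 3) / 4 by linarith]
    field_simp
    ring

/-- The shift `ḡ - g`. -/
def Case.shiftG : Case → ℝ
  | .Ia => 0
  | .Ib => -3
  | .IIa => 0
  | .IIb => -2
  | .IIIa => -2
  | .IIIb => 1
  | .IVa => -3
  | .IVb => -1

/-- The shift `h̄ - h`. -/
def Case.shiftH : Case → ℝ
  | .Ia => -2
  | .Ib => 1
  | .IIa => -2
  | .IIb => 0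
  | .IIIa => 0
  | .IIIb => -3
  | .IVa => -1
  | .IVb => -3

theorem gBar_eq_add (c : Case) (h : ℝ) : gBar c h = curve c h + c.shiftG := by
  cases c <;> simp [gBar, numSeeds, seeds, Case.shiftG] <;> ring

theorem hBar_eq_add (c : Case) (h : ℝ) : hBar c h = h + c.shiftH := by
  cases c <;> simp [hBar, numSeeds, seeds, Case.shiftH] <;> ring

theorem gBar_add_hBar (c : Case) (h : ℝ) :
    gBar c h + hBar c h + 2 * c.group.typeIII = curve c h + h := by
  rw [gBar_eq_add, hBar_eq_add]
  cases c <;> simp only [Case.shiftG, Case.shiftH, Case.group, Grp.typeIII] <;> ring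

theorem gBar_eq_gBarOfHBar (c : Case) {h : ℝ} (ha : Admissible c h) :
    gBar c h = gBarOfHBar c.group (hBar c h) := by
  have hp := ((admissible_iff c h).1 ha).1
  rw [gBar_eq_add]
  obtain ⟨p, hb⟩ : ∃ p, param c.group (hBar c h) = p := ⟨_, rfl⟩
  rw [hb] at hp
  rw [hBar_eq_add] at hb ⊢
  cases c <;> simp only [gBarOfHBar, param, Grp.sigma, curve, Case.group, Case.shiftG,
    Case.shiftH] at hb ⊢
  · rw [show 4 * h - 9 = p by linarith, show 4 * (h + -2) - 1 = p by linarith,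
      show h = (p + 9) / 4 by linarith]
    field_simp
    ring
  · rw [show 4 * h + 3 = p by linarith, show 4 * (h + 1) - 1 = p by linarith,
      show h = (p - 3) / 4 by linarith]
    field_simp
    ring
  · rw [show 4 * h - 9 = p by linarith, show 4 * (h + -2) - 1 = p by linarith,
      show h = (p + 9) / 4 by linarith]
    field_simp
    ring
  · rw [show 4 * h - 1 = p by linarith, show 4 * (h + 0) - 1 = p by linarith,
      show h = (p + 1) / 4 by linarith]
    field_simp
    ring
  · rw [show 4 * h - 3 = p by linarith, show 4 * (h + 0) - 3 = p by linarith,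
      show h = (p + 3) / 4 by linarith]
    field_simp
    ring
  · rw [show 4 * h - 15 = p by linarith, show 4 * (h + -3) - 3 = p by linarith,
      show h = (p + 15) / 4 by linarith]
    field_simp
    ring
  · rw [show 4 * h - 7 = p by linarith, show 4 * (h + -1) - 3 = p by linarith,
      show h = (p + 7) / 4 by linarith]
    field_simp
    ring
  · rw [show 4 * h - 15 = p by linarith, show 4 * (h + -3) - 3 = p by linarith,
      show h = (p + 15) / 4 by linarith]
    field_simp
    ring

theorem gBar_eq (c : Case) {h : ℝ} (ha : Admissible c h) :
    gBar c h = 1 / 2 + c.group.eps * (1 - 3 * c.group.sigma / param c.group (hBar c h)) / 4 := by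
  rw [gBar_eq_gBarOfHBar c ha, gBarOfHBar_eq _ ((admissible_iff c h).1 ha).1]

theorem hBar_eq (G : Grp) (b : ℝ) : b = 1 / 2 + (param G b - G.sigma / 3) / 4 := by
  rw [param]; ring

/-- The linear factor in the uniform parametrisation. -/
theorem linB_eq (G : Grp) (b : ℝ) :
    linB G b = -C (1 / 2) * (C (param G b) * (1 - X) + C G.sigma * (1 + X)) := by
  refine Polynomial.funext fun t => ?_
  cases G <;> simp [linB, param, Grp.sigma] <;> ring

theorem eval_lin (c : Case) (h t : ℝ) :
    (lin c h).eval t =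
      -(param c.group (hBar c h) * (1 - t) + c.group.sigma * (1 + t)) / 2 := by
  rw [lin, linB_eq]; simp; ring

theorem derivative_lin (c : Case) (h : ℝ) :
    derivative (lin c h) = C ((param c.group (hBar c h) - c.group.sigma) / 2) := by
  refine Polynomial.funext fun t => ?_
  rw [lin, linB_eq]; simp; ring

theorem etaZero_eq (c : Case) {h : ℝ} (ha : Admissible c h) :
    etaZero c h = (param c.group (hBar c h) + c.group.sigma) /
      (param c.group (hBar c h) - c.group.sigma) := by
  have hp := ((admissible_iff c h).1 ha).2
  have hp' := sub_ne_zero.2 hp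
  unfold etaZero
  revert hp hp'
  generalize hBar c h = b
  cases c.group <;> simp only [param, Grp.sigma] <;> intro hp hp' <;> rw [eq_div_iff hp']
  · have : b - 1 ≠ 0 := fun h => hp (by linarith)
    field_simp; ring
  · have : b - 1 ≠ 0 := fun h => hp (by linarith)
    field_simp; ring
  · have : b ≠ 0 := fun h => hp (by linarith)
    field_simp; ring
  · have : b ≠ 0 := fun h => hp (by linarith)
    field_simp; ring

theorem lin_eq_mul (c : Case) {h : ℝ} (ha : Admissible c h) :
    lin c h = C ((param c.group (hBar c h) - c.group.sigma) / 2) * (X - C (etaZero c h)) := by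
  have hp := sub_ne_zero.2 ((admissible_iff c h).1 ha).2
  refine Polynomial.funext fun t => ?_
  rw [eval_lin, etaZero_eq c ha]
  simp only [eval_mul, eval_C, eval_sub, eval_X]
  field_simp
  ring

/-- The values of ℓ at -1 and 1 are -p and -σ, so absence of zeros between them means that p and σ
have the same sign. -/
theorem regularRange_iff (c : Case) (h : ℝ) :
    RegularRange c h ↔ Admissible c h ∧ 0 < param c.group (hBar c h) * c.group.sigma := by
  rw [admissible_iff]
  unfold RegularRange param
  generalize hBar c h = b
  cases c.group <;> simp only [Grp.sigma] <;>
    refine ⟨fun h => ⟨⟨fun h1 => ?_, fun h1 => h.2 ?_⟩, ?_⟩,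
      fun h => ⟨?_, fun h1 => h.1.2 ?_⟩⟩ <;>
    linarith

/-- Since η₀ = (p + σ)/(p - σ), the inequality η₀² > 1 says that pσ is positive. -/
theorem one_lt_etaZero_sq (c : Case) {h : ℝ} (hr : RegularRange c h) : 1 < etaZero c h ^ 2 := by
  obtain ⟨ha, hpos⟩ := (regularRange_iff c h).1 hr
  have hp := sub_ne_zero.2 ((admissible_iff c h).1 ha).2
  rw [etaZero_eq c ha, div_pow, one_lt_div (by positivity)]
  nlinarith

theorem eval_lin_ne_zero (c : Case) {h : ℝ} (hr : RegularRange c h) {t : ℝ}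
    (ht : t ∈ Icc (-1 : ℝ) 1) : (lin c h).eval t ≠ 0 := by
  obtain ⟨ha, hpos⟩ := (regularRange_iff c h).1 hr
  have hp := sub_ne_zero.2 ((admissible_iff c h).1 ha).2
  have h1 := one_lt_etaZero_sq c hr
  rw [lin_eq_mul c ha]
  simp only [eval_mul, eval_C, eval_sub, eval_X]
  refine mul_ne_zero (div_ne_zero hp two_ne_zero) fun h0 => ?_
  have h2 : t = etaZero c h := by linarith
  rw [← h2] at h1
  nlinarith [ht.1, ht.2]

theorem regularRange_iff_forall (c : Case) {h : ℝ} (ha : Admissible c h) :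
    (∀ t ∈ Ioo (-1 : ℝ) 1, (lin c h).eval t ≠ 0) ↔ RegularRange c h := by
  refine ⟨fun hl => ?_, fun hr t ht => eval_lin_ne_zero c hr (Ioo_subset_Icc_self ht)⟩
  rw [regularRange_iff]
  refine ⟨ha, ?_⟩
  by_contra hneg
  have hp0 := ((admissible_iff c h).1 ha).1
  have hp := sub_ne_zero.2 ((admissible_iff c h).1 ha).2
  have hs := c.group.sigma_ne_zero
  set p := param c.group (hBar c h)
  set s := c.group.sigma
  have hlt : p * s < 0 := lt_of_le_of_ne (not_lt.1 hneg) (mul_ne_zero hp0 hs)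
  have hz : (etaZero c h) ^ 2 < 1 := by
    rw [etaZero_eq c ha, div_pow, div_lt_one (by positivity)]
    nlinarith
  refine hl (etaZero c h) ⟨by nlinarith, by nlinarith⟩ ?_
  rw [lin_eq_mul c ha]; simp

/-! ### The common form of the equations -/

theorem Grp.eps_sq (G : Grp) : G.eps ^ 2 = 1 := by cases G <;> norm_num [Grp.eps]

/-- The leading coefficient of the linear factor. -/
def slope (c : Case) (h : ℝ) : ℝ := (param c.group (hBar c h) - c.group.sigma) / 2

theorem slope_ne_zero (c : Case) {h : ℝ} (ha : Admissible c h) : slope c h ≠ 0 :=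
  div_ne_zero (sub_ne_zero.2 ((admissible_iff c h).1 ha).2) two_ne_zero

theorem lin_eq (c : Case) {h : ℝ} (ha : Admissible c h) :
    lin c h = C (slope c h) * (X - C (etaZero c h)) := lin_eq_mul c ha

/-- Together with its companion for σ this eliminates p and σ: the ratio σ/p depends on η₀ only, and
so do ḡ and h̄ once the signs are fixed. -/
theorem param_eq_slope_mul (c : Case) {h : ℝ} (ha : Admissible c h) :
    param c.group (hBar c h) = slope c h * (etaZero c h + 1) := by
  have hp := sub_ne_zero.2 ((admissible_iff c h).1 ha).2
  rw [slope, etaZero_eq c ha]; field_simp; ring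

theorem sigma_eq_slope_mul (c : Case) {h : ℝ} (ha : Admissible c h) :
    c.group.sigma = slope c h * (etaZero c h - 1) := by
  have hp := sub_ne_zero.2 ((admissible_iff c h).1 ha).2
  rw [slope, etaZero_eq c ha]; field_simp; ring

theorem etaZero_sub_one_ne_zero (c : Case) {h : ℝ} (ha : Admissible c h) :
    etaZero c h - 1 ≠ 0 := fun h0 =>
  c.group.sigma_ne_zero (by rw [sigma_eq_slope_mul c ha, h0, mul_zero])

theorem etaZero_add_one_ne_zero (c : Case) {h : ℝ} (ha : Admissible c h) :
    etaZero c h + 1 ≠ 0 := fun h0 =>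
  ((admissible_iff c h).1 ha).1 (by rw [param_eq_slope_mul c ha, h0, mul_zero])

theorem gBar_eq_etaZero (c : Case) {h : ℝ} (ha : Admissible c h) :
    gBar c h = 1 / 2 + c.group.eps * (2 - etaZero c h) / (2 * (etaZero c h + 1)) := by
  have h1 := slope_ne_zero c ha
  have h2 := etaZero_add_one_ne_zero c ha
  rw [gBar_eq c ha, param_eq_slope_mul c ha, sigma_eq_slope_mul c ha]
  field_simp
  ring

theorem hBar_eq_etaZero (c : Case) {h : ℝ} (ha : Admissible c h) :
    hBar c h =
      1 / 2 + c.group.sigma / 3 * (etaZero c h + 2) / (2 * (etaZero c h - 1)) := by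
  have h2 := etaZero_sub_one_ne_zero c ha
  nth_rewrite 1 [hBar_eq c.group (hBar c h)]
  rw [param_eq_slope_mul c ha, eq_comm, ← sub_eq_zero]
  have h3 := sigma_eq_slope_mul c ha
  generalize c.group.sigma = s at *
  subst h3
  field_simp
  ring

/-- The coefficient of the first derivative in the equation for `P / w`. -/
def tau (c : Case) (h : ℝ) : ℝ[X] := C (hBar c h - gBar c h) - C (gBar c h + hBar c h + 1) * X

/-- The equation for the polynomials of the modes, normalised. -/
def normalEq (c : Case) (h : ℝ) (m : ℤ) : PolyEq where
  p₂ := (X - C (etaZero c h)) * (1 - X ^ 2)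
  p₁ := tau c h * (X - C (etaZero c h)) - 4 * (1 - X ^ 2)
  p₀ := C (spectral c h m) * (X - C (etaZero c h)) - 2 * tau c h - 6 * X

/-- Two equations differ by a constant factor. -/
def PolyEq.Scaled (r : ℝ) (e e' : PolyEq) : Prop :=
  e.p₂ = C r * e'.p₂ ∧ e.p₁ = C r * e'.p₁ ∧ e.p₀ = C r * e'.p₀

theorem PolyEq.Scaled.solves_iff {r : ℝ} {e e' : PolyEq} (h : e.Scaled r e') (hr : r ≠ 0)
    (y : ℝ[X]) : e.Solves y ↔ e'.Solves y := by
  have hC : (C r : ℝ[X]) ≠ 0 := C_ne_zero.2 hr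
  rw [PolyEq.Solves, PolyEq.Solves, h.1, h.2.1, h.2.2]
  constructor
  · intro h0
    exact (mul_eq_zero.1 (by linear_combination h0 : C r * _ = 0)).resolve_left hC
  · intro h0
    linear_combination C r * h0

/-- In all groups the extra term is 3(p + σ)/ℓ + 6pσ/ℓ²; insert p + σ = 2sη₀ and pσ = s²(η₀² - 1)
with s the slope. -/
theorem extraTerm_eq (c : Case) {h : ℝ} (ha : Admissible c h) (t : ℝ)
    (ht : t - etaZero c h ≠ 0) :
    extraTerm c h t = 6 * etaZero c h / (t - etaZero c h) +
      6 * (etaZero c h ^ 2 - 1) / (t - etaZero c h) ^ 2 := by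
  have h1 := slope_ne_zero c ha
  have h2 := param_eq_slope_mul c ha
  have h3 := sigma_eq_slope_mul c ha
  have : extraTerm c h t = 3 * (param c.group (hBar c h) + c.group.sigma) / (lin c h).eval t +
      6 * (c.group.sigma * param c.group (hBar c h)) / (lin c h).eval t ^ 2 := by
    unfold extraTerm param
    generalize hBar c h = b
    cases c.group <;> simp only [Grp.sigma] <;> ring
  rw [this, lin_eq c ha, h2]
  nth_rewrite 1 [h3]
  rw [h3]
  simp only [eval_mul, eval_C, eval_sub, eval_X]
  field_simp
  ring

/-- The factor between the equation of a case and the normalised one. -/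
def Grp.factor : Grp → ℝ
  | .I => -1 | .II => -1 | .III => -4 | .IV => -4

/-- Only the relations valid on the curve make the coefficients proportional to those of `normalEq`;
afterwards it suffices to study that one equation. -/
theorem polynomialEq_scaled (c : Case) {h : ℝ} (ha : Admissible c h) (m : ℤ) :
    (polynomialEq c h m).Scaled (c.group.factor * slope c h) (normalEq c h m) := by
  have h1 := slope_ne_zero c ha
  have h2 := etaZero_sub_one_ne_zero c ha
  have h3 := etaZero_add_one_ne_zero c ha
  have hg := gBar_eq_etaZero c ha
  have hh := hBar_eq_etaZero c ha
  have hk := sigma_eq_slope_mul c ha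
  unfold PolyEq.Scaled polynomialEq normalEq tau spectral
  simp only []
  revert hg hh hk h1 h2 h3
  generalize gBar c h = g
  generalize hBar c h = b
  generalize slope c h = k
  generalize etaZero c h = E
  cases c.group <;> intro h1 h2 h3 hg hh hk <;>
  simp only [Grp.sigma, Grp.eps, Grp.factor, Grp.typeIII] at * <;>
  refine ⟨Polynomial.funext fun t => ?_, Polynomial.funext fun t => ?_,
      Polynomial.funext fun t => ?_⟩ <;>
  simp only [polyEqOneTwo, polyEqThreeFour, eval_mul, eval_C, eval_sub, eval_X, eval_add, eval_pow,
    eval_neg, eval_ofNat, eval_one, eval_intCast] <;>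
  -- The slope is σ/(η₀ - 1), so every remaining quantity is a rational function of η₀.
  rw [← div_eq_iff h2] at hk <;> subst hg hh hk <;> field_simp <;> ring

theorem explicitEq_scaled (G : Grp) {h : ℝ} (ha : Admissible G.memberA h) (m : ℤ) :
    (explicitEq G h m).Scaled
      (param G.memberA.group (hBar G.memberA h) * slope G.memberA h)
      (normalEq G.memberA h m) := by
  have h1 := slope_ne_zero _ ha
  have h2 := etaZero_sub_one_ne_zero _ ha
  have h3 := etaZero_add_one_ne_zero _ ha
  have hg := gBar_eq_etaZero _ ha
  have hh := hBar_eq_etaZero _ ha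
  have hk := sigma_eq_slope_mul _ ha
  rw [param_eq_slope_mul _ ha]
  unfold PolyEq.Scaled explicitEq normalEq tau spectral
  have hb := hBar_eq_add G.memberA h
  revert hg hh hk h1 h2 h3 hb
  generalize gBar G.memberA h = g
  generalize hBar G.memberA h = b
  generalize slope G.memberA h = k
  generalize etaZero G.memberA h = E
  cases G <;> intro h1 h2 h3 hg hh hk hb <;>
  simp only [Grp.sigma, Grp.eps, Grp.typeIII, Grp.memberA, Case.group, Case.shiftH] at * <;>
  refine ⟨Polynomial.funext fun t => ?_, Polynomial.funext fun t => ?_,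
      Polynomial.funext fun t => ?_⟩ <;>
  simp only [explicitEqAux, eval_mul, eval_C, eval_sub, eval_X, eval_add, eval_pow,
    eval_neg, eval_ofNat, eval_one, eval_intCast] <;>
  rw [← div_eq_iff h2] at hk <;> rw [← sub_eq_iff_eq_add] at hb <;>
  subst hb <;> subst hg hh hk <;> field_simp <;> ring

/-- Stated over a general field, since the passage from P to P/w is needed on the real line and also
near η₀ in the complex plane. -/
theorem deriv_of_eventually {𝕜 : Type*} [NontriviallyNormedField 𝕜] {f f' : 𝕜 → 𝕜} {f'' t : 𝕜}
    (h : ∀ᶠ s in 𝓝 t, HasDerivAt f (f' s) s) (h2 : HasDerivAt f' f'' t) :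
    deriv f t = f' t ∧ iteratedDeriv 2 f t = f'' := by
  refine ⟨h.self_of_nhds.deriv, ?_⟩
  rw [iteratedDeriv_succ, iteratedDeriv_one]
  have : deriv f =ᶠ[𝓝 t] f' := h.mono fun s hs => hs.deriv
  rw [this.deriv_eq, h2.deriv]

theorem hasDerivAt_div_sq {𝕜 : Type*} [NontriviallyNormedField 𝕜] {f : 𝕜 → 𝕜} {f' t E : 𝕜}
    (h : HasDerivAt f f' t) (ht : t - E ≠ 0) :
    HasDerivAt (fun s => f s / (s - E) ^ 2) (f' / (t - E) ^ 2 - 2 * (f t / (t - E) ^ 3)) t := by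
  have h1 : HasDerivAt (fun s => (s - E) ^ 2) (2 * (t - E)) t := by
    have := ((hasDerivAt_id t).sub_const E).fun_pow 2
    refine this.congr_deriv ?_
    simp
  refine (h.fun_div h1 (pow_ne_zero 2 ht)).congr_deriv ?_
  field_simp

theorem hasDerivAt_div_cube {𝕜 : Type*} [NontriviallyNormedField 𝕜] {f : 𝕜 → 𝕜} {f' t E : 𝕜}
    (h : HasDerivAt f f' t) (ht : t - E ≠ 0) :
    HasDerivAt (fun s => f s / (s - E) ^ 3) (f' / (t - E) ^ 3 - 3 * (f t / (t - E) ^ 4)) t := by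
  have h1 : HasDerivAt (fun s => (s - E) ^ 3) (3 * (t - E) ^ 2) t := by
    have := ((hasDerivAt_id t).sub_const E).fun_pow 3
    refine this.congr_deriv ?_
    simp
  refine (h.fun_div h1 (pow_ne_zero 3 ht)).congr_deriv ?_
  field_simp

/-- Dividing a solution of the normalised polynomial equation by the square of the linear factor
gives a solution of the rational equation. -/
theorem rational_solution {𝕜 : Type*} [NontriviallyNormedField 𝕜] {f f' : 𝕜 → 𝕜}
    {f'' t E S τ : 𝕜}
    (h : ∀ᶠ s in 𝓝 t, HasDerivAt f (f' s) s) (h2 : HasDerivAt f' f'' t) (ht : t - E ≠ 0)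
    (heq : (t - E) * (1 - t ^ 2) * f'' + (τ * (t - E) - 4 * (1 - t ^ 2)) * f' t +
      (S * (t - E) - 2 * τ - 6 * t) * f t = 0) :
    (1 - t ^ 2) * iteratedDeriv 2 (fun s => f s / (s - E) ^ 2) t +
      τ * deriv (fun s => f s / (s - E) ^ 2) t +
      (S + (6 * E / (t - E) + 6 * (E ^ 2 - 1) / (t - E) ^ 2)) * (f t / (t - E) ^ 2) = 0 := by
  have hne : ∀ᶠ s in 𝓝 t, s - E ≠ 0 :=
    (continuousAt_id.sub continuousAt_const).eventually_ne ht
  have h1 : ∀ᶠ s in 𝓝 t, HasDerivAt (fun s => f s / (s - E) ^ 2)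
      (f' s / (s - E) ^ 2 - 2 * (f s / (s - E) ^ 3)) s := by
    filter_upwards [h, hne] with s hs hs' using hasDerivAt_div_sq hs hs'
  have h3 := (hasDerivAt_div_sq h2 ht).fun_sub
    ((hasDerivAt_div_cube h.self_of_nhds ht).const_mul 2)
  obtain ⟨e1, e2⟩ := deriv_of_eventually h1 h3
  -- The double pole of the extra term meets 6(1 - t²)/(t - E)², which comes from differentiating
  -- the denominator twice. Together with 6E/(t - E) they leave -6t/(t - E), the last term of the
  -- polynomial equation.
  rw [e1, e2]
  field_simp
  linear_combination (t - E) * heq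

theorem eval_lin_eq (c : Case) {h : ℝ} (ha : Admissible c h) (t : ℝ) :
    (lin c h).eval t = slope c h * (t - etaZero c h) := by
  rw [lin_eq c ha]; simp

theorem sub_etaZero_ne_zero (c : Case) {h : ℝ} (ha : Admissible c h) {t : ℝ}
    (ht : (lin c h).eval t ≠ 0) : t - etaZero c h ≠ 0 := by
  rw [eval_lin_eq c ha] at ht
  exact right_ne_zero_of_mul ht

theorem eval_tau (c : Case) (h t : ℝ) :
    (tau c h).eval t = hBar c h - gBar c h - (gBar c h + hBar c h + 1) * t := by
  simp [tau]

theorem normalEq_eval {c : Case} {h : ℝ} {m : ℤ} {P : ℝ[X]} (hP : (normalEq c h m).Solves P)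
    (t : ℝ) :
    (t - etaZero c h) * (1 - t ^ 2) * (derivative (derivative P)).eval t +
      ((tau c h).eval t * (t - etaZero c h) - 4 * (1 - t ^ 2)) * (derivative P).eval t +
      (spectral c h m * (t - etaZero c h) - 2 * (tau c h).eval t - 6 * t) * P.eval t = 0 := by
  have := congrArg (fun q => q.eval t) hP
  simpa [normalEq] using this

theorem PolyEq.Solves.C_mul {e : PolyEq} {y : ℝ[X]} (h : e.Solves y) (s : ℝ) :
    e.Solves (C s * y) := by
  rw [PolyEq.Solves] at h ⊢
  simp only [derivative_mul, derivative_C, zero_mul, zero_add]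
  linear_combination C s * h

theorem div_lin_sq (c : Case) {h : ℝ} (ha : Admissible c h) (P : ℝ[X]) :
    (fun t => P.eval t / (lin c h).eval t ^ 2) =
      fun t => (C (slope c h ^ 2)⁻¹ * P).eval t / (t - etaZero c h) ^ 2 := by
  funext t
  rw [eval_lin_eq c ha, eval_mul, eval_C, mul_pow, div_mul_eq_div_div, inv_mul_eq_div]

theorem solvesRationalEq_of_normalEq {c : Case} {h : ℝ} (ha : Admissible c h) {m : ℤ} {P : ℝ[X]}
    (hP : (normalEq c h m).Solves P) : SolvesRationalEq c h m P := by
  intro t ht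
  have ht' := sub_etaZero_ne_zero c ha ht
  rw [div_lin_sq c ha P, extraTerm_eq c ha t ht', ← eval_tau]
  exact rational_solution (Eventually.of_forall fun s => hasDerivAt_eval _ s)
    (hasDerivAt_eval _ t) ht' (normalEq_eval (hP.C_mul _) t)

/-! ### The Schrödinger equation -/

theorem hasDerivAt_eta (x : ℝ) : HasDerivAt eta (-(2 * Real.sin (2 * x))) x := by
  have h1 : HasDerivAt (fun x : ℝ => 2 * x) 2 x := by
    simpa using (hasDerivAt_id x).const_mul (2 : ℝ)
  exact h1.cos.congr_deriv (by ring)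

theorem eta_mem {x : ℝ} (hx : x ∈ Ioo 0 (π / 2)) : eta x ∈ Ioo (-1 : ℝ) 1 := by
  have h0 := hx.1
  have h1 := hx.2
  have hs : 0 < Real.sin (2 * x) := Real.sin_pos_of_pos_of_lt_pi (by linarith) (by linarith)
  have h2 := Real.sin_sq_add_cos_sq (2 * x)
  rw [eta]
  constructor <;> nlinarith

/-- The power prefactor in the variable `η`. -/
theorem hasDerivAt_jacobiWeight_mul {a b : ℝ} {y : ℝ → ℝ} {y' t : ℝ} (ht : t ∈ Ioo (-1 : ℝ) 1)
    (hy : HasDerivAt y y' t) :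
    HasDerivAt (fun t => jacobiWeight a b t * y t)
      (jacobiWeight a b t * (y' + (-a / (1 - t) + b / (1 + t)) * y t)) t := by
  have h1 : 1 - t ≠ 0 := by linarith [ht.2]
  have h2 : 1 + t ≠ 0 := by linarith [ht.1]
  have e1 : HasDerivAt (fun t : ℝ => (1 - t) ^ a) ((1 - t) ^ a * (-a / (1 - t))) t := by
    refine (((hasDerivAt_id' t).const_sub 1).rpow_const (p := a) (Or.inl h1)).congr_deriv ?_
    rw [Real.rpow_sub_one h1]
    field_simp
  have e2 : HasDerivAt (fun t : ℝ => (1 + t) ^ b) ((1 + t) ^ b * (b / (1 + t))) t := by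
    refine (((hasDerivAt_id' t).const_add 1).rpow_const (p := b) (Or.inl h2)).congr_deriv ?_
    rw [Real.rpow_sub_one h2]
    field_simp
  refine ((e1.fun_mul e2).fun_mul hy).congr_deriv ?_
  rw [jacobiWeight]
  ring

theorem deriv_jacobiWeight_mul {a b : ℝ} {y y' : ℝ → ℝ} {y'' t : ℝ} (ht : t ∈ Ioo (-1 : ℝ) 1)
    (hy : ∀ᶠ s in 𝓝 t, HasDerivAt y (y' s) s) (hy' : HasDerivAt y' y'' t) :
    (∀ᶠ s in 𝓝 t, HasDerivAt (fun t => jacobiWeight a b t * y t)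
      (jacobiWeight a b s * (y' s + (-a / (1 - s) + b / (1 + s)) * y s)) s) ∧
    HasDerivAt (fun s => jacobiWeight a b s * (y' s + (-a / (1 - s) + b / (1 + s)) * y s))
      (jacobiWeight a b t * (y'' + 2 * (-a / (1 - t) + b / (1 + t)) * y' t +
        ((-a / (1 - t) + b / (1 + t)) ^ 2 + (-a / (1 - t) ^ 2 - b / (1 + t) ^ 2)) * y t)) t := by
  have h1 : 1 - t ≠ 0 := by linarith [ht.2]
  have h2 : 1 + t ≠ 0 := by linarith [ht.1]
  refine ⟨?_, ?_⟩
  · filter_upwards [hy, Ioo_mem_nhds ht.1 ht.2] with s hs hs' using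
      hasDerivAt_jacobiWeight_mul hs' hs
  · have e1 : HasDerivAt (fun s : ℝ => -a / (1 - s) + b / (1 + s))
        (-a / (1 - t) ^ 2 - b / (1 + t) ^ 2) t := by
      have d1 := (hasDerivAt_const t (-a)).fun_div ((hasDerivAt_id' t).const_sub 1) h1
      have d2 := (hasDerivAt_const t b).fun_div ((hasDerivAt_id' t).const_add 1) h2
      refine (d1.fun_add d2).congr_deriv ?_
      field_simp
      ring
    refine (hasDerivAt_jacobiWeight_mul ht
      (hy'.fun_add (e1.fun_mul hy.self_of_nhds))).congr_deriv ?_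
    ring

/-- In the variable η the operator d²/dx² is 4((1 - η²)∂² - η∂), as η' = -2 sin 2x. -/
theorem iteratedDeriv_comp_eta {u u' : ℝ → ℝ} {u'' x : ℝ}
    (hu : ∀ᶠ t in 𝓝 (eta x), HasDerivAt u (u' t) t) (hu' : HasDerivAt u' u'' (eta x)) :
    iteratedDeriv 2 (fun x => u (eta x)) x =
      4 * ((1 - eta x ^ 2) * u'' - eta x * u' (eta x)) := by
  have h1 : ∀ᶠ s in 𝓝 x,
      HasDerivAt (fun x => u (eta x)) (u' (eta s) * -(2 * Real.sin (2 * s))) s := by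
    filter_upwards [(hasDerivAt_eta x).continuousAt.eventually hu] with s hs using
      hs.comp s (hasDerivAt_eta s)
  have h2 : HasDerivAt (fun s : ℝ => -(2 * Real.sin (2 * s))) (-(4 * eta x)) x := by
    have h1 : HasDerivAt (fun x : ℝ => 2 * x) 2 x := by
      simpa using (hasDerivAt_id x).const_mul (2 : ℝ)
    exact ((h1.sin.const_mul 2).fun_neg).congr_deriv (by rw [eta]; ring)
  have h3 := (hu'.comp x (hasDerivAt_eta x)).fun_mul h2
  rw [(deriv_of_eventually h1 h3).2]
  have h4 := Real.sin_sq_add_cos_sq (2 * x)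
  simp only [Function.comp, eta] at *
  linear_combination 4 * u'' * h4

/-- Second derivative in `x` of a function in the variable `η` with a power prefactor. -/
theorem iteratedDeriv_jacobiWeight_comp_eta {a b : ℝ} {y y' : ℝ → ℝ} {y'' x : ℝ}
    (hx : x ∈ Ioo 0 (π / 2)) (hy : ∀ᶠ s in 𝓝 (eta x), HasDerivAt y (y' s) s)
    (hy' : HasDerivAt y' y'' (eta x)) :
    iteratedDeriv 2 (fun x => jacobiWeight (a / 2) (b / 2) (eta x) * y (eta x)) x =
      jacobiWeight (a / 2) (b / 2) (eta x) * (4 * ((1 - eta x ^ 2) * y'' +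
        (b - a - (a + b + 1) * eta x) * y' (eta x)) +
        (2 * a * (a - 1) / (1 - eta x) + 2 * b * (b - 1) / (1 + eta x) - (a + b) ^ 2) *
          y (eta x)) := by
  have ht := eta_mem hx
  have h1 : 1 - eta x ≠ 0 := by linarith [ht.2]
  have h2 : 1 + eta x ≠ 0 := by linarith [ht.1]
  obtain ⟨d1, d2⟩ := deriv_jacobiWeight_mul (a := a / 2) (b := b / 2) ht hy hy'
  rw [iteratedDeriv_comp_eta d1 d2]
  field_simp
  ring

/-- Eight times the bracket of the potential is four times the extra term of equation (i), which
makes the two equations correspond. -/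
theorem commonPotential_eq (c : Case) (h x : ℝ) :
    commonPotential c h x =
      2 * gBar c h * (gBar c h - 1) / (1 - eta x) + 2 * hBar c h * (hBar c h - 1) / (1 + eta x) -
    (gBar c h + hBar c h + 2 * c.group.typeIII) ^ 2 - 4 * extraTerm c h (eta x) := by
  unfold commonPotential extraTerm
  cases c.group <;> simp only [] <;> ring

theorem waveFun_eq (c : Case) (h : ℝ) (P : ℝ[X]) :
    waveFun c h P = fun x => jacobiWeight (gBar c h / 2) (hBar c h / 2) (eta x) *
      (fun t => P.eval t / (lin c h).eval t ^ 2) (eta x) := rfl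

/-- The powers of 1 ± η absorb the singular part of the potential, and the rest is -4 times equation
(i). The constants agree because 4(m + L)(m + ḡ + h̄ + L) equals the energy plus (ḡ + h̄ + 2L)² - (ḡ
+ h̄)². -/
theorem schrodinger_waveFun {c : Case} {h : ℝ} (ha : Admissible c h) {m : ℤ} {P : ℝ[X]}
    (hP : SolvesRationalEq c h m P) {x : ℝ} (hx : x ∈ Ioo 0 (π / 2))
    (hl : (lin c h).eval (eta x) ≠ 0) :
    -iteratedDeriv 2 (waveFun c h P) x + commonPotential c h x * waveFun c h P x =
      energy (curve c h) h m * waveFun c h P x := by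
  have ht' := sub_etaZero_ne_zero c ha hl
  have hne : ∀ᶠ s in 𝓝 (eta x), s - etaZero c h ≠ 0 :=
    (continuousAt_id.sub continuousAt_const).eventually_ne ht'
  set y : ℝ → ℝ := fun t => P.eval t / (lin c h).eval t ^ 2 with hy
  have hPy := hP (eta x) hl
  set Q := C (slope c h ^ 2)⁻¹ * P
  have hyQ : y = fun t => Q.eval t / (t - etaZero c h) ^ 2 := div_lin_sq c ha P
  have h1 : ∀ᶠ s in 𝓝 (eta x), HasDerivAt y ((derivative Q).eval s / (s - etaZero c h) ^ 2 -
      2 * (Q.eval s / (s - etaZero c h) ^ 3)) s := by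
    rw [hyQ]
    filter_upwards [hne] with s hs' using hasDerivAt_div_sq (hasDerivAt_eval _ s) hs'
  have h3 := (hasDerivAt_div_sq (hasDerivAt_eval (derivative Q) (eta x)) ht').fun_sub
    ((hasDerivAt_div_cube (hasDerivAt_eval Q (eta x)) ht').const_mul 2)
  obtain ⟨e1, e2⟩ := deriv_of_eventually h1 h3
  rw [← hy, e1, e2] at hPy
  rw [waveFun_eq, ← hy, iteratedDeriv_jacobiWeight_comp_eta hx h1 h3, commonPotential_eq, energy,
    add_assoc (m : ℝ), ← gBar_add_hBar]
  change _ + _ * (jacobiWeight (gBar c h / 2) (hBar c h / 2) (eta x) * y (eta x)) =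
    _ * (jacobiWeight (gBar c h / 2) (hBar c h / 2) (eta x) * y (eta x))
  have hPy' := hPy
  rw [spectral] at hPy'
  change _ + _ * y (eta x) = 0 at hPy'
  linear_combination (-4 * jacobiWeight (gBar c h / 2) (hBar c h / 2) (eta x)) * hPy'

/-! ### Fuchsian equations and apparent singularities -/

/-- Common criterion, with k = 1 for the equation of the polynomials and k = 2 for that of P/w.
Simple roots of the leading coefficient impose nothing, so only η₀ with k = 2 needs divisibility;
the degree bounds settle infinity. -/
theorem isFuchsian_of_eq {e : PolyEq} {a E : ℝ} {k : ℕ} (ha : a ≠ 0) (h1 : E - 1 ≠ 0)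
    (h2 : E + 1 ≠ 0) (hk : k = 1 ∨ k = 2)
    (e2 : e.p₂ = C a * ((X - C 1) * (X - C (-1)) * (X - C E) ^ k))
    (e1 : (X - C E) ^ (k - 1) ∣ e.p₁) (d1 : e.p₁.natDegree ≤ k + 1) (d0 : e.p₀.natDegree ≤ k) :
    e.IsFuchsian := by
  have hm : ((X - C 1) * (X - C (-1)) * (X - C E) ^ k : ℝ[X]).Monic :=
    ((monic_X_sub_C _).mul (monic_X_sub_C _)).mul ((monic_X_sub_C _).pow _)
  have hdeg : e.p₂.degree = (k + 2 : ℕ) := by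
    rw [e2, degree_C_mul ha, degree_mul, degree_mul, degree_pow, degree_X_sub_C, degree_X_sub_C,
      degree_X_sub_C]
    push_cast
    rw [nsmul_one, add_comm, one_add_one_eq_two]
  have hr : ∀ z : ℂ, (e.p₂.map (algebraMap ℝ ℂ)).rootMultiplicity z =
      (if z = 1 then 1 else 0) + (if z = -1 then 1 else 0) + (if z = E then k else 0) := by
    intro z
    have hm' := (hm.map (algebraMap ℝ ℂ)).ne_zero
    rw [e2, Polynomial.map_mul, map_C, ← count_roots, roots_C_mul _ (by simpa using ha)]
    have e3 : ((X - C 1) * (X - C (-1)) * (X - C E) ^ k : ℝ[X]).map (algebraMap ℝ ℂ) =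
        (X - C 1) * (X - C (-1)) * (X - C (E : ℂ)) ^ k := by
      simp [Polynomial.map_mul, Polynomial.map_pow]
    rw [e3] at hm' ⊢
    rw [roots_mul hm', roots_mul (left_ne_zero_of_mul hm'), roots_pow, roots_X_sub_C,
      roots_X_sub_C, roots_X_sub_C]
    simp only [Multiset.count_add, Multiset.count_nsmul, Multiset.count_singleton, mul_ite, mul_one, mul_zero]
  refine ⟨fun h0 => by
    rw [h0, degree_zero] at hdeg; exact WithBot.natCast_ne_bot _ hdeg.symm, fun z => ?_, ?_, ?_⟩
  · rw [hr]
    by_cases hz : z = E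
    · have z1 : z ≠ 1 := by
        rw [hz]; intro h; exact h1 (sub_eq_zero.2 (by exact_mod_cast h))
      have z2 : z ≠ -1 := by
        rw [hz]; intro h; exact h2 (by rw [← sub_neg_eq_add]; exact sub_eq_zero.2 (by exact_mod_cast h))
      rw [if_neg z1, if_neg z2, if_pos hz, zero_add, zero_add]
      refine ⟨?_, ?_⟩
      · have := Polynomial.map_dvd (algebraMap ℝ ℂ) e1
        rw [hz]
        simpa [Polynomial.map_pow] using this
      · rw [show k - 2 = 0 by omega, pow_zero]; exact one_dvd _
    · have : (if z = 1 then 1 else 0) + (if z = -1 then 1 else 0) + (if z = E then k else 0) ≤ 1 := by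
        rw [if_neg hz]
        by_cases z1 : z = 1
        · rw [if_pos z1, if_neg (by rw [z1]; norm_num)]
        · rw [if_neg z1]; split_ifs <;> norm_num
      constructor
      · rw [Nat.sub_eq_zero_of_le this, pow_zero]; exact one_dvd _
      · rw [Nat.sub_eq_zero_of_le (this.trans one_le_two), pow_zero]; exact one_dvd _
  · rw [hdeg]
    calc e.p₁.degree + 1 ≤ ((k + 1 : ℕ) : WithBot ℕ) + 1 := by
          gcongr; exact degree_le_of_natDegree_le d1
      _ = _ := by push_cast; rw [add_assoc, one_add_one_eq_two]
  · rw [hdeg]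
    calc e.p₀.degree + 2 ≤ ((k : ℕ) : WithBot ℕ) + 2 := by
          gcongr; exact degree_le_of_natDegree_le d0
      _ = _ := by push_cast; rfl

theorem polynomialEq_isFuchsian (c : Case) {h : ℝ} (ha : Admissible c h) (m : ℤ) :
    (polynomialEq c h m).IsFuchsian := by
  obtain ⟨s2, s1, s0⟩ := polynomialEq_scaled c ha m
  have hf : c.group.factor * slope c h ≠ 0 := mul_ne_zero
    (by cases c.group <;> norm_num [Grp.factor]) (slope_ne_zero c ha)
  refine isFuchsian_of_eq (a := -(c.group.factor * slope c h)) (E := etaZero c h) (k := 1)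
    (neg_ne_zero.2 hf) (etaZero_sub_one_ne_zero c ha) (etaZero_add_one_ne_zero c ha) (Or.inl rfl)
    ?_ (by simp) ?_ ?_
  · rw [s2, normalEq]
    simp only [map_neg, map_one]
    ring
  · simp only [s1, normalEq, tau]
    exact (natDegree_C_mul_le _ _).trans (by compute_degree)
  · simp only [s0, normalEq, tau]
    exact (natDegree_C_mul_le _ _).trans (by compute_degree)

theorem one_sub_sq_mul_lin (c : Case) {h : ℝ} (ha : Admissible c h) :
    (1 - X ^ 2) * lin c h ^ 2 =
      C (-slope c h ^ 2) * ((X - C 1) * (X - C (-1)) * (X - C (etaZero c h)) ^ 2) := by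
  rw [lin_eq c ha]
  simp only [map_neg, map_one, map_pow]
  ring

theorem rationalEq_isFuchsian (c : Case) {h : ℝ} (ha : Admissible c h) (m : ℤ) :
    (rationalEq c h m).IsFuchsian := by
  refine isFuchsian_of_eq (a := -slope c h ^ 2) (E := etaZero c h) (k := 2)
    (neg_ne_zero.2 (pow_ne_zero 2 (slope_ne_zero c ha))) (etaZero_sub_one_ne_zero c ha)
    (etaZero_add_one_ne_zero c ha) (Or.inr rfl) ?_ ?_ ?_ ?_
  · rw [← one_sub_sq_mul_lin c ha, rationalEq]
  · rw [rationalEq]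
    refine Dvd.dvd.mul_left ?_ _
    rw [lin_eq c ha]
    exact ⟨C (slope c h) ^ 2 * (X - C (etaZero c h)), by ring⟩
  · simp only [rationalEq, lin_eq c ha]
    compute_degree
  · simp only [rationalEq, lin_eq c ha]
    cases c.group <;> simp only [] <;> compute_degree

theorem aeval_rationalEq (c : Case) {h : ℝ} (ha : Admissible c h) (m : ℤ) (z : ℂ) :
    aeval z (rationalEq c h m).p₂ = 0 ↔ z = 1 ∨ z = -1 ∨ z = (etaZero c h : ℂ) := by
  have hs : (slope c h : ℂ) ≠ 0 := by exact_mod_cast slope_ne_zero c ha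
  have : (rationalEq c h m).p₂ = (1 - X ^ 2) * lin c h ^ 2 := rfl
  rw [this, one_sub_sq_mul_lin c ha]
  simp [hs, sub_eq_zero, add_eq_zero_iff_eq_neg, or_assoc]

theorem aeval_polynomialEq (c : Case) {h : ℝ} (ha : Admissible c h) (m : ℤ) (z : ℂ) :
    aeval z (polynomialEq c h m).p₂ = 0 ↔ z = 1 ∨ z = -1 ∨ z = (etaZero c h : ℂ) := by
  have hs : (slope c h : ℂ) ≠ 0 := by exact_mod_cast slope_ne_zero c ha
  have hf : (c.group.factor : ℂ) ≠ 0 := by cases c.group <;> norm_num [Grp.factor]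
  rw [(polynomialEq_scaled c ha m).1, normalEq,
    show (X - C (etaZero c h)) * (1 - X ^ 2 : ℝ[X]) =
      (1 - X) * (X + 1) * (X - C (etaZero c h)) by ring]
  simp [hs, hf, sub_eq_zero, add_eq_zero_iff_eq_neg, or_assoc, eq_comm (a := (1 : ℂ))]

/-- The solvability condition at exponent 5: successive elimination of the first four coefficients
turns the relation in which the fifth one drops out into a polynomial identity free of denominators.
-/
theorem recurrence_closes {c e u₀ u₁ u₂ u₃ v₀ v₁ v₂ v₃ i₁ i₂ i₃ i₄ : ℝ} (hc : c ≠ 0)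
    (h1 : i₁ * (4 * c) = e) (h2 : i₂ * (6 * c) = u₀ * i₁ + v₀)
    (h3 : i₃ * (6 * c) = u₁ * i₂ + v₁ * i₁) (h4 : i₄ * (4 * c) = u₂ * i₃ + v₂ * i₂)
    (hpoly : u₃ * (u₂ * (u₁ * (u₀ * e + 4 * c * v₀) + 6 * c * (v₁ * e)) +
        6 * c * (v₂ * (u₀ * e + 4 * c * v₀))) + 4 * c * (v₃ * (u₁ * (u₀ * e + 4 * c * v₀) +
          6 * c * (v₁ * e))) = 0) : u₃ * i₄ + v₃ * i₃ = 0 := by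
  have hscale : (u₃ * i₄ + v₃ * i₃) * (4 * c * (6 * c) * (6 * c) * (4 * c)) = 0 := by
    rw [← hpoly]
    linear_combination (u₃ * (6 * c) * (6 * c) * (4 * c)) * h4 +
      (u₃ * u₂ + v₃ * (4 * c)) * (6 * c) * (4 * c) * h3 +
      ((u₃ * u₂ + v₃ * (4 * c)) * u₁ + u₃ * v₂ * (6 * c)) * (4 * c) * h2 +
      (((u₃ * u₂ + v₃ * (4 * c)) * u₁ + u₃ * v₂ * (6 * c)) * u₀ +
        (u₃ * u₂ + v₃ * (4 * c)) * (6 * c) * v₁) * h1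
  exact (mul_eq_zero.1 hscale).resolve_right (by positivity)

/-- The beginning of a power series solution at the zero of the linear factor: no logarithm is
needed. -/
theorem frobenius_coefficients {E ε δ g b S : ℝ} (h1 : E - 1 ≠ 0) (h2 : E + 1 ≠ 0)
    (hε : ε ^ 2 = 1) (hδ : δ ^ 2 = 1) (hg : g = 1 / 2 + ε * (2 - E) / (2 * (E + 1)))
    (hb : b = 1 / 2 + δ * (E + 2) / (2 * (E - 1))) :
    ∃ i : ℕ → ℝ, i 0 = 1 ∧
      4 * (1 - E ^ 2) * i 1 = (-2 * (b - g - (g + b + 1) * E) - 6 * E) * i 0 ∧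
      ∀ k : ℕ, k < 4 → (k + 2) * (k - 3) * (1 - E ^ 2) * i (k + 2) +
        ((-2 * E) * ((k + 1) * k) + (b - g - (g + b + 1) * E + 8 * E) * (k + 1) +
          (-2 * (b - g - (g + b + 1) * E) - 6 * E)) * i (k + 1) +
        ((-1) * (k * (k - 1)) + (4 - (g + b + 1)) * k + (S + 2 * (g + b + 1) - 6)) * i k = 0 := by
  have hc : 1 - E ^ 2 ≠ 0 := by
    rw [show 1 - E ^ 2 = -((E - 1) * (E + 1)) by ring]
    exact neg_ne_zero.2 (mul_ne_zero h1 h2)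
  set c := 1 - E ^ 2 with hcdef
  set τ := b - g - (g + b + 1) * E with hτ
  set G := g + b + 1 with hG
  set e := -2 * τ - 6 * E with he
  set e' := S + 2 * G - 6 with he'
  set u : ℝ → ℝ := fun k => (-2 * E) * ((k + 1) * k) + (τ + 8 * E) * (k + 1) + e with hu
  set v : ℝ → ℝ := fun k => (-1) * (k * (k - 1)) + (4 - G) * k + e' with hv
  set i1 := e / (4 * c) with hi1
  set i2 := (u 0 * i1 + v 0) / (6 * c) with hi2
  set i3 := (u 1 * i2 + v 1 * i1) / (6 * c) with hi3
  set i4 := (u 2 * i3 + v 2 * i2) / (4 * c) with hi4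
  -- This is the absence of a logarithm. For each of the four sign choices it is an identity in E
  -- and S, so it holds for every spectral parameter and not only for the modes.
  have key : u 3 * i4 + v 3 * i3 = 0 := by
    refine recurrence_closes hc (div_mul_cancel₀ _ (by positivity))
      (div_mul_cancel₀ _ (by positivity)) (div_mul_cancel₀ _ (by positivity))
      (div_mul_cancel₀ _ (by positivity)) ?_
    clear hi1 hi2 hi3 hi4
    simp only [hu, hv, he, he', hG, hτ, hcdef]
    rcases mul_self_eq_one_iff.1 (by rwa [← sq] : ε * ε = 1) with rfl | rfl <;>
    rcases mul_self_eq_one_iff.1 (by rwa [← sq] : δ * δ = 1) with rfl | rfl <;>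
    subst hg hb <;> field_simp <;> ring
  -- The fifth coefficient is free and is set to zero.
  refine ⟨fun k => match k with | 0 => 1 | 1 => i1 | 2 => i2 | 3 => i3 | 4 => i4 | _ => 0,
    rfl, ?_, fun k hk => ?_⟩
  · simp only [hi1]; field_simp
  · interval_cases k
    · simp only [hi2, hu, hv]; push_cast; field_simp; ring
    · simp only [hi3, hu, hv]; push_cast; field_simp; ring
    · simp only [hi4, hu, hv]; push_cast; field_simp; ring
    · simp only [hu, hv] at key ⊢; push_cast; linear_combination key

theorem aeval_normalEq (c : Case) (h : ℝ) (m : ℤ) (z : ℂ) :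
    aeval z (normalEq c h m).p₂ = (z - etaZero c h) * (1 - z ^ 2) ∧
    aeval z (normalEq c h m).p₁ = ((hBar c h - gBar c h - (gBar c h + hBar c h + 1) * z) *
      (z - etaZero c h) - 4 * (1 - z ^ 2)) ∧
    aeval z (normalEq c h m).p₀ = (spectral c h m * (z - etaZero c h) -
      2 * (hBar c h - gBar c h - (gBar c h + hBar c h + 1) * z) - 6 * z) := by
  have n2 : aeval z (2 : ℝ[X]) = 2 := map_ofNat (aeval z) 2
  have n4 : aeval z (4 : ℝ[X]) = 4 := map_ofNat (aeval z) 4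
  have n6 : aeval z (6 : ℝ[X]) = 6 := map_ofNat (aeval z) 6
  simp [normalEq, tau, n2, n4, n6]

/-- The coefficients of `normalEq` expanded at η₀, using 1 - z² = (1 - η₀²) - 2η₀(z - η₀) - (z -
η₀)²; this puts the equation in the form required by `exists_analytic_solution`. -/
theorem exists_solution_of_coefficients (c : Case) {h : ℝ} (ha : Admissible c h) (m : ℤ)
    {i : ℕ → ℝ}
    (h1 : 4 * (1 - etaZero c h ^ 2) * i 1 = (-2 * (hBar c h - gBar c h -
      (gBar c h + hBar c h + 1) * etaZero c h) - 6 * etaZero c h) * i 0)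
    (h2 : ∀ k : ℕ, k < 4 → (k + 2) * (k - 3) * (1 - etaZero c h ^ 2) * i (k + 2) +
        ((-2 * etaZero c h) * ((k + 1) * k) + (hBar c h - gBar c h -
          (gBar c h + hBar c h + 1) * etaZero c h + 8 * etaZero c h) * (k + 1) +
          (-2 * (hBar c h - gBar c h - (gBar c h + hBar c h + 1) * etaZero c h) -
            6 * etaZero c h)) * i (k + 1) +
        ((-1) * (k * (k - 1)) + (4 - (gBar c h + hBar c h + 1)) * k +
          (spectral c h m + 2 * (gBar c h + hBar c h + 1) - 6)) * i k = 0) :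
    ∃ f : ℂ → ℂ, AnalyticAt ℂ f (etaZero c h) ∧
      (∀ k ≤ 5, iteratedDeriv k f (etaZero c h) = k.factorial * i k) ∧
      ∀ᶠ z in 𝓝 (etaZero c h : ℂ),
        (z - etaZero c h) * (1 - z ^ 2) * iteratedDeriv 2 f z +
          ((hBar c h - gBar c h - (gBar c h + hBar c h + 1) * z) *
            (z - etaZero c h) - 4 * (1 - z ^ 2)) * deriv f z +
          (spectral c h m * (z - etaZero c h) -
            2 * (hBar c h - gBar c h - (gBar c h + hBar c h + 1) * z) - 6 * z) * f z = 0 := by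
  have hc : (1 - (etaZero c h : ℂ) ^ 2) ≠ 0 := by
    have : 1 - etaZero c h ^ 2 ≠ 0 := by
      rw [show 1 - etaZero c h ^ 2 = -((etaZero c h - 1) * (etaZero c h + 1)) by ring]
      exact neg_ne_zero.2 (mul_ne_zero (etaZero_sub_one_ne_zero c ha)
        (etaZero_add_one_ne_zero c ha))
    exact_mod_cast this
  obtain ⟨f, hf, hk, hz⟩ := exists_analytic_solution (c₁ := -2 * (etaZero c h : ℂ)) (c₂ := -1)
    (d₁ := hBar c h - gBar c h - (gBar c h + hBar c h + 1) * etaZero c h + 8 * etaZero c h)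
    (d₂ := 4 - (gBar c h + hBar c h + 1))
    (e₀ := -2 * (hBar c h - gBar c h - (gBar c h + hBar c h + 1) * etaZero c h) -
      6 * etaZero c h) (e₁ := spectral c h m + 2 * (gBar c h + hBar c h + 1) - 6)
    (i := fun k => (i k : ℂ)) hc (etaZero c h : ℂ)
    (by exact_mod_cast h1) (fun k hk => by have := h2 k hk; exact_mod_cast this)
  refine ⟨f, hf, hk, ?_⟩
  filter_upwards [hz] with z hz
  linear_combination hz

theorem order_eq_of_coefficients {f : ℂ → ℂ} {z₀ : ℂ} (hf : AnalyticAt ℂ f z₀) {i : ℕ → ℝ}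
    (hi : ∀ k ≤ 5, iteratedDeriv k f z₀ = k.factorial * i k) {n : ℕ} (hn : n ≤ 5)
    (h0 : ∀ k < n, i k = 0) (h1 : i n ≠ 0) : meromorphicOrderAt f z₀ = (n : ℤ) := by
  have : analyticOrderAt f z₀ = n := by
    rw [analyticOrderAt_eq_nat_iff_iteratedDeriv_eq_zero hf]
    refine ⟨fun k hk => ?_, ?_⟩
    · rw [hi k (by omega), h0 k hk]; simp
    · rw [hi n hn]
      exact mul_ne_zero (by exact_mod_cast n.factorial_ne_zero) (by exact_mod_cast h1)
  rw [hf.meromorphicOrderAt_eq, this]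
  rfl

/-- Two analytic solutions of the normalised equation with exponents `0` and `5`. -/
theorem exists_analytic_solutions (c : Case) {h : ℝ} (ha : Admissible c h) (m : ℤ) :
    ∃ f : Fin 2 → ℂ → ℂ, (∀ j, AnalyticAt ℂ (f j) (etaZero c h) ∧
      meromorphicOrderAt (f j) (etaZero c h) = ((![0, 5] j : ℤ) : WithTop ℤ) ∧
      ∀ᶠ z in 𝓝 (etaZero c h : ℂ),
        (z - etaZero c h) * (1 - z ^ 2) * iteratedDeriv 2 (f j) z +
          ((hBar c h - gBar c h - (gBar c h + hBar c h + 1) * z) *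
            (z - etaZero c h) - 4 * (1 - z ^ 2)) * deriv (f j) z +
          (spectral c h m * (z - etaZero c h) -
            2 * (hBar c h - gBar c h - (gBar c h + hBar c h + 1) * z) - 6 * z) * f j z = 0) := by
  obtain ⟨i, i0, i1, i2⟩ := frobenius_coefficients (S := spectral c h m)
    (etaZero_sub_one_ne_zero c ha) (etaZero_add_one_ne_zero c ha) c.group.eps_sq
    (by rw [div_pow, c.group.sigma_sq]; norm_num) (gBar_eq_etaZero c ha) (hBar_eq_etaZero c ha)
  obtain ⟨f, hf, hk, hz⟩ := exists_solution_of_coefficients c ha m i1 i2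
  -- The second solution starts with (z - η₀)⁵: all earlier coefficients are zero, and the relation
  -- with k = 3 leaves the fifth one free.
  obtain ⟨f', hf', hk', hz'⟩ := exists_solution_of_coefficients c ha m
    (i := fun k => if k = 5 then 1 else 0) (by simp) (fun k hk => by interval_cases k <;> norm_num)
  refine ⟨![f, f'], fun j => ?_⟩
  fin_cases j
  · exact ⟨hf, order_eq_of_coefficients hf hk (n := 0) (by norm_num) (by simp) (by simp [i0]), hz⟩
  · exact ⟨hf', order_eq_of_coefficients hf' hk' (n := 5) le_rfl
      (fun k hk => by rw [if_neg (by omega)]) (by simp), hz'⟩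

theorem polynomialEq_isApparent (c : Case) {h : ℝ} (ha : Admissible c h) (m : ℤ) :
    (polynomialEq c h m).IsApparent (etaZero c h : ℂ) 0 5 := by
  obtain ⟨f, hf⟩ := exists_analytic_solutions c ha m
  have hs : ∀ j, (polynomialEq c h m).SolvesNear (f j) (etaZero c h) := by
    intro j
    refine ((hf j).2.2.filter_mono nhdsWithin_le_nhds).mono fun z hz => ?_
    obtain ⟨s2, s1, s0⟩ := polynomialEq_scaled c ha m
    obtain ⟨a2, a1, a0⟩ := aeval_normalEq c h m z
    generalize c.group.factor * slope c h = r at s2 s1 s0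
    rw [s2, s1, s0, map_mul, a2, map_mul, a1, map_mul, a0]
    linear_combination (aeval z (C r)) * hz
  exact ⟨f 0, f 1, (hf 0).1.meromorphicAt, (hf 1).1.meromorphicAt, hs 0, hs 1, (hf 0).2.1,
    (hf 1).2.1, by norm_num⟩

theorem aeval_rationalEq_all (c : Case) {h : ℝ} (ha : Admissible c h) (m : ℤ) (z : ℂ) :
    aeval z (rationalEq c h m).p₂ = slope c h ^ 2 * (z - etaZero c h) ^ 2 * (1 - z ^ 2) ∧
    aeval z (rationalEq c h m).p₁ = slope c h ^ 2 * (z - etaZero c h) ^ 2 *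
      (hBar c h - gBar c h - (gBar c h + hBar c h + 1) * z) ∧
    aeval z (rationalEq c h m).p₀ = slope c h ^ 2 * (spectral c h m * (z - etaZero c h) ^ 2 +
      (6 * etaZero c h * (z - etaZero c h) + 6 * (etaZero c h ^ 2 - 1))) := by
  have h2 := param_eq_slope_mul c ha
  have h3 := sigma_eq_slope_mul c ha
  have e : (rationalEq c h m).p₀ = C (spectral c h m) * lin c h ^ 2 +
      C (3 * (param c.group (hBar c h) + c.group.sigma)) * lin c h +
      C (6 * (c.group.sigma * param c.group (hBar c h))) := by
    unfold rationalEq param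
    refine Polynomial.funext fun t => ?_
    generalize hBar c h = b
    cases c.group <;> simp [Grp.sigma] <;> ring
  refine ⟨?_, ?_, ?_⟩
  · rw [rationalEq, lin_eq c ha]; simp; ring
  · rw [rationalEq, lin_eq c ha]; simp; ring
  · rw [e, lin_eq c ha, h2, h3]; simp; ring

/-- Division by (z - η₀)² maps solutions to solutions and lowers the exponents 0, 5 to -2, 3. -/
theorem rationalEq_isApparent (c : Case) {h : ℝ} (ha : Admissible c h) (m : ℤ) :
    (rationalEq c h m).IsApparent (etaZero c h : ℂ) (-2) 3 := by
  obtain ⟨f, hf⟩ := exists_analytic_solutions c ha m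
  set E : ℂ := ((etaZero c h : ℝ) : ℂ) with hE
  have hmero : ∀ j, MeromorphicAt (fun z => f j z / (z - E) ^ 2) E := fun j =>
    (hf j).1.meromorphicAt.fun_div (by fun_prop)
  have hs : ∀ j, (rationalEq c h m).SolvesNear (fun z => f j z / (z - E) ^ 2) E := by
    intro j
    have h1 : ∀ᶠ z in 𝓝 E, ∀ᶠ s in 𝓝 z, AnalyticAt ℂ (f j) s :=
      (hf j).1.eventually_analyticAt.eventually_nhds
    filter_upwards [(hf j).2.2.filter_mono nhdsWithin_le_nhds, h1.filter_mono nhdsWithin_le_nhds,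
      self_mem_nhdsWithin] with z hz hz1 hz2
    have hz3 : z - E ≠ 0 := sub_ne_zero.2 hz2
    have d1 : ∀ᶠ s in 𝓝 z, HasDerivAt (f j) (deriv (f j) s) s :=
      hz1.mono fun s hs => hs.differentiableAt.hasDerivAt
    have d2 : HasDerivAt (deriv (f j)) (iteratedDeriv 2 (f j) z) z := by
      rw [iteratedDeriv_succ, iteratedDeriv_one]
      exact hz1.self_of_nhds.deriv.differentiableAt.hasDerivAt
    have key := rational_solution d1 d2 hz3 hz
    obtain ⟨a2, a1, a0⟩ := aeval_rationalEq_all c ha m z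
    rw [a2, a1, a0, ← hE]
    have e : (slope c h : ℂ) ^ 2 * (spectral c h m * (z - E) ^ 2 +
        (6 * E * (z - E) + 6 * (E ^ 2 - 1))) = (slope c h : ℂ) ^ 2 * (z - E) ^ 2 *
          (spectral c h m + (6 * E / (z - E) + 6 * (E ^ 2 - 1) / (z - E) ^ 2)) := by
      field_simp
    rw [e]
    linear_combination (slope c h : ℂ) ^ 2 * (z - E) ^ 2 * key
  have ho : ∀ j, meromorphicOrderAt (fun z => f j z / (z - E) ^ 2) E =
      ((![-2, 3] j : ℤ) : WithTop ℤ) := by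
    intro j
    rw [fun_meromorphicOrderAt_div (hf j).1.meromorphicAt (by fun_prop), (hf j).2.1,
      fun_meromorphicOrderAt_pow_id_sub_const]
    fin_cases j <;> rfl
  exact ⟨_, _, hmero 0, hmero 1, hs 0, hs 1, ho 0, ho 1, by norm_num⟩

/-! ### Parameter ranges -/

/-- The range of `h̄` for orthogonality. -/
def Grp.range : Grp → ℝ → Prop
  | .I, b => 7 / 10 < b ∧ b ≠ 1
  | .II, b => 1 / 4 < b ∧ b ≠ 1
  | .III, b => -1 / 2 < b ∧ b < 3 / 4 ∧ b ≠ 0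
  | .IV, b => -1 / 2 < b ∧ b < 3 / 10 ∧ b ≠ 0

/-- In terms of h̄ the two members of a group have the same range. -/
theorem statedRange_iff (c : Case) (h : ℝ) : StatedRange c h ↔ c.group.range (hBar c h) := by
  rw [hBar_eq_add]
  cases c <;> simp only [StatedRange, Case.group, Grp.range, Case.shiftH]
  · exact and_congr ⟨fun h => by linarith, fun h => by linarith⟩
      (not_congr ⟨fun h => by linarith, fun h => by linarith⟩)
  · exact and_congr ⟨fun h => by linarith, fun h => by linarith⟩
      (not_congr ⟨fun h => by linarith, fun h => by linarith⟩)
  · exact and_congr ⟨fun h => by linarith, fun h => by linarith⟩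
      (not_congr ⟨fun h => by linarith, fun h => by linarith⟩)
  · exact and_congr ⟨fun h => by linarith, fun h => by linarith⟩
      (not_congr ⟨fun h => by linarith, fun h => by linarith⟩)
  all_goals exact and_congr ⟨fun h => by linarith, fun h => by linarith⟩ (and_congr
    ⟨fun h => by linarith, fun h => by linarith⟩
      (not_congr ⟨fun h => by linarith, fun h => by linarith⟩))

theorem Grp.range_iff (G : Grp) {b : ℝ} :
    (G.range b ↔ (param G b ≠ G.sigma ∧ 0 < param G b * G.sigma) ∧ -1 / 2 < gBarOfHBar G b ∧
      -1 / 2 < b) := by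
  cases G <;> simp only [Grp.range, Grp.sigma, param, gBarOfHBar]
  · constructor
    · rintro ⟨h1, h2⟩
      refine ⟨⟨fun h => h2 (by linarith), by linarith⟩, ?_, by linarith⟩
      rw [lt_div_iff₀ (by linarith)]; linarith
    · rintro ⟨⟨h1, h2⟩, h3, h4⟩
      rw [lt_div_iff₀ (by linarith)] at h3
      exact ⟨by linarith, fun h => h1 (by linarith)⟩
  · constructor
    · rintro ⟨h1, h2⟩
      refine ⟨⟨fun h => h2 (by linarith), by linarith⟩, ?_, by linarith⟩
      rw [lt_div_iff₀ (by linarith)]; linarith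
    · rintro ⟨⟨h1, h2⟩, h3, h4⟩
      exact ⟨by linarith, fun h => h1 (by linarith)⟩
  · constructor
    · rintro ⟨h1, h2, h5⟩
      refine ⟨⟨fun h => h5 (by linarith), by linarith⟩, ?_, by linarith⟩
      rw [lt_div_iff_of_neg (by linarith)]; linarith
    · rintro ⟨⟨h1, h2⟩, h3, h4⟩
      exact ⟨by linarith, by linarith, fun h => h1 (by linarith)⟩
  · constructor
    · rintro ⟨h1, h2, h5⟩
      refine ⟨⟨fun h => h5 (by linarith), by linarith⟩, ?_, by linarith⟩
      rw [lt_div_iff_of_neg (by linarith)]; linarith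
    · rintro ⟨⟨h1, h2⟩, h3, h4⟩
      rw [lt_div_iff_of_neg (by linarith)] at h3
      exact ⟨by linarith, by linarith, fun h => h1 (by linarith)⟩

theorem regularRange_and_iff (c : Case) {h : ℝ} (ha : Admissible c h) :
    (RegularRange c h ∧ -1 / 2 < gBar c h ∧ -1 / 2 < hBar c h ↔ StatedRange c h) := by
  rw [statedRange_iff, Grp.range_iff, ← gBar_eq_gBarOfHBar c ha, regularRange_iff, admissible_iff]
  constructor
  · rintro ⟨⟨⟨-, h1⟩, h2⟩, h3⟩
    exact ⟨⟨h1, h2⟩, h3⟩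
  · rintro ⟨⟨h1, h2⟩, h3⟩
    exact ⟨⟨⟨left_ne_zero_of_mul h2.ne', h1⟩, h2⟩, h3⟩

theorem StatedRange.admissible {c : Case} {h : ℝ} (hs : StatedRange c h) : Admissible c h := by
  rw [statedRange_iff, Grp.range_iff] at hs
  exact (admissible_iff c h).2 ⟨left_ne_zero_of_mul hs.1.2.ne', hs.1.1⟩

theorem StatedRange.regularRange {c : Case} {h : ℝ} (hs : StatedRange c h) : RegularRange c h :=
  ((regularRange_and_iff c hs.admissible).2 hs).1

theorem StatedRange.gBar_gt {c : Case} {h : ℝ} (hs : StatedRange c h) : -1 / 2 < gBar c h :=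
  ((regularRange_and_iff c hs.admissible).2 hs).2.1

theorem StatedRange.hBar_gt {c : Case} {h : ℝ} (hs : StatedRange c h) : -1 / 2 < hBar c h :=
  ((regularRange_and_iff c hs.admissible).2 hs).2.2

/-- The indices of all modes, as a function of the group. -/
def Grp.IsMode : Grp → ℤ → Prop
  | .I, m => 0 ≤ m ∨ m = -2
  | .II, m => 0 ≤ m ∨ m = -3
  | .III, m => 0 ≤ m ∨ m = -2
  | .IV, m => 0 ≤ m ∨ m = -2 ∨ m = -3

theorem mem_modes_iff (c : Case) (m : ℤ) : m ∈ modes c ↔ c.group.IsMode m := by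
  cases c <;> simp [modes, seeds, Grp.IsMode, Case.group]

/-- The values of `ḡ + h̄` for which the energies of all modes are different. -/
def Grp.SumBound : Grp → ℝ → Prop
  | .I, s => 0 < s
  | .II, s => 1 < s
  | .III, s => 0 < s
  | .IV, s => -1 < s ∧ s ≤ 0

/-- In group IV the sum is 4b²/(4b - 3), which explains its sign; the other bounds are similar
quadratic inequalities. -/
theorem Grp.sumBound_of_range (G : Grp) {b : ℝ} (hb : G.range b) :
    G.SumBound (gBarOfHBar G b + b) := by
  cases G <;> simp only [Grp.range, gBarOfHBar, Grp.SumBound] at hb ⊢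
  · have h1 : 0 < 4 * b - 1 := by linarith
    rw [div_add' _ _ _ h1.ne']
    exact div_pos (by nlinarith) h1
  · have h1 : 0 < 4 * b - 1 := by linarith
    rw [div_add' _ _ _ h1.ne', lt_div_iff₀ h1]
    nlinarith [sq_nonneg (b - 1 / 2)]
  · have h1 : 4 * b - 3 < 0 := by linarith
    rw [div_add' _ _ _ h1.ne]
    exact div_pos_of_neg_of_neg (by nlinarith) h1
  · have h1 : 4 * b - 3 < 0 := by linarith
    rw [div_add' _ _ _ h1.ne]
    constructor
    · rw [lt_div_iff_of_neg h1]; nlinarith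
    · exact div_nonpos_of_nonneg_of_nonpos (by nlinarith [sq_nonneg b]) h1.le

/-- The difference of two spectral parameters is (m - k)(m + k + 2L + ḡ + h̄). The second factor is
positive for all pairs of distinct modes, except for the pair -2, -3 of group IV, where the upper
bound on ḡ + h̄ makes it negative. -/
theorem spectral_ne {c : Case} {h : ℝ} (hs : StatedRange c h) {m k : ℤ} (hm : m ∈ modes c)
    (hk : k ∈ modes c) (hmk : m ≠ k) : spectral c h m ≠ spectral c h k := by
  rw [mem_modes_iff] at hm hk
  have hadd := Grp.sumBound_of_range _ ((statedRange_iff c h).1 hs)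
  rw [← gBar_eq_gBarOfHBar c hs.admissible] at hadd
  have hmk' : (m : ℝ) - k ≠ 0 := sub_ne_zero.2 (by exact_mod_cast hmk)
  intro heq
  rw [spectral, spectral] at heq
  have h0 : (m : ℝ) + k + (2 * c.group.typeIII + (gBar c h + hBar c h)) = 0 := by
    have : ((m : ℝ) - k) * ((m : ℝ) + k + (2 * c.group.typeIII + (gBar c h + hBar c h))) = 0 := by
      linear_combination heq
    exact (mul_eq_zero.1 this).resolve_left hmk'
  revert hm hk hadd h0
  generalize gBar c h = g
  generalize hBar c h = b
  cases c.group <;> simp only [Grp.IsMode, Grp.typeIII, Grp.SumBound] <;> intro hm hk hadd h0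
  · have : (-2 : ℝ) ≤ m + k := by exact_mod_cast (by omega : (-2 : ℤ) ≤ m + k)
    linarith
  · have : (-3 : ℝ) ≤ m + k := by exact_mod_cast (by omega : (-3 : ℤ) ≤ m + k)
    linarith
  · have : (-2 : ℝ) ≤ m + k := by exact_mod_cast (by omega : (-2 : ℤ) ≤ m + k)
    linarith
  · rcases (by omega : m + k = -5 ∨ (-3 : ℤ) ≤ m + k) with h1 | h1
    · have : (m : ℝ) + k = -5 := by exact_mod_cast h1
      linarith
    · have : (-3 : ℝ) ≤ m + k := by exact_mod_cast h1
      linarith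

/-! ### Orthogonality and uniqueness of polynomial solutions -/

theorem weight_eq (c : Case) (h t : ℝ) :
    weight c h t = jacobiWeight (gBar c h - 1 / 2) (hBar c h - 1 / 2) t *
      ((lin c h).eval t ^ 4)⁻¹ := rfl

theorem intervalIntegrable_weight_mul {c : Case} {h : ℝ} (hs : StatedRange c h) (P Q : ℝ[X]) :
    IntervalIntegrable (fun t => weight c h t * P.eval t * Q.eval t) volume (-1) 1 := by
  have hg := hs.gBar_gt
  have hh := hs.hBar_gt
  have : (fun t => weight c h t * P.eval t * Q.eval t) = fun t =>
      jacobiWeight (gBar c h - 1 / 2) (hBar c h - 1 / 2) t *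
        (((lin c h).eval t ^ 4)⁻¹ * P.eval t * Q.eval t) := by
    funext t; rw [weight_eq]; ring
  rw [this]
  refine intervalIntegrable_jacobiWeight_mul (by linarith) (by linarith) ?_
  exact (((((lin c h).continuous.pow 4).continuousOn).inv₀ fun t ht =>
    pow_ne_zero 4 (eval_lin_ne_zero c hs.regularRange ht)).mul P.continuous.continuousOn).mul
      Q.continuous.continuousOn

theorem integrableOn_weight_mul {c : Case} {h : ℝ} (hs : StatedRange c h) (P Q : ℝ[X]) :
    IntegrableOn (fun t => weight c h t * P.eval t * Q.eval t) (Ioo (-1) 1) := by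
  exact (intervalIntegrable_iff_integrableOn_Ioo_of_le (by norm_num)).1
    (intervalIntegrable_weight_mul hs P Q)

/-- Lagrange's identity: in self-adjoint form, the product PQ times the difference of the spectral
parameters is the derivative of the weight times (1 - t²)(PQ' - P'Q), and
`integral_jacobiWeight_deriv` gives no boundary terms. -/
theorem integral_weight_mul_eq_zero {c : Case} {h : ℝ} (hs : StatedRange c h) {m k : ℤ}
    {P Q : ℝ[X]} (hP : (normalEq c h m).Solves P) (hQ : (normalEq c h k).Solves Q)
    (hne : spectral c h m ≠ spectral c h k) :
    ∫ t in (-1 : ℝ)..1, weight c h t * P.eval t * Q.eval t = 0 := by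
  have hg := hs.gBar_gt
  have hh := hs.hBar_gt
  have ha := hs.admissible
  have hne' : ∀ t ∈ Icc (-1 : ℝ) 1, t - etaZero c h ≠ 0 := fun t ht =>
    sub_etaZero_ne_zero c ha (eval_lin_ne_zero c hs.regularRange ht)
  set W := P * derivative Q - derivative P * Q with hW
  have hr : ∀ t ∈ Icc (-1 : ℝ) 1, HasDerivAt (fun t => W.eval t / (t - etaZero c h) ^ 4)
      ((derivative W).eval t / (t - etaZero c h) ^ 4 -
        4 * (W.eval t / (t - etaZero c h) ^ 5)) t := by
    intro t ht
    have h1 : HasDerivAt (fun s => (s - etaZero c h) ^ 4) (4 * (t - etaZero c h) ^ 3) t := by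
      refine (((hasDerivAt_id' t).sub_const (etaZero c h)).fun_pow 4).congr_deriv ?_
      norm_num
    have h2 := hne' t ht
    refine ((hasDerivAt_eval W t).fun_div h1 (pow_ne_zero 4 h2)).congr_deriv ?_
    field_simp
  have hc : ContinuousOn (fun t => (derivative W).eval t / (t - etaZero c h) ^ 4 -
        4 * (W.eval t / (t - etaZero c h) ^ 5)) (Icc (-1) 1) := by
    refine ContinuousOn.sub ?_ (ContinuousOn.mul continuousOn_const ?_) <;>
    refine ContinuousOn.div (Polynomial.continuous _).continuousOn (by fun_prop)
      fun t ht => pow_ne_zero _ (hne' t ht)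
  have key := integral_jacobiWeight_deriv (α := gBar c h - 1 / 2) (β := hBar c h - 1 / 2)
    (by linarith) (by linarith) hr hc
  have hsub : spectral c h m - spectral c h k ≠ 0 := sub_ne_zero.2 hne
  have hsl := slope_ne_zero c ha
  have : ∫ t in (-1 : ℝ)..1, weight c h t * P.eval t * Q.eval t =
      ((slope c h ^ 4 * (spectral c h m - spectral c h k))⁻¹) * 0 := by
    rw [← key, ← intervalIntegral.integral_const_mul]
    refine intervalIntegral.integral_congr fun t ht => ?_
    rw [uIcc_of_le (by norm_num)] at ht
    have h2 := hne' t ht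
    have eP := normalEq_eval hP t
    have eQ := normalEq_eval hQ t
    rw [eval_tau] at eP eQ
    have e : ((hBar c h - 1 / 2 + 1) * (1 - t) - (gBar c h - 1 / 2 + 1) * (1 + t)) *
        (W.eval t / (t - etaZero c h) ^ 4) + (1 - t ^ 2) *
          ((derivative W).eval t / (t - etaZero c h) ^ 4 -
            4 * (W.eval t / (t - etaZero c h) ^ 5)) =
        (spectral c h m - spectral c h k) * (P.eval t * Q.eval t) / (t - etaZero c h) ^ 4 := by
      simp only [hW, derivative_sub, derivative_mul, eval_sub, eval_add, eval_mul]
      field_simp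
      linear_combination 2 * (P.eval t * eQ - Q.eval t * eP)
    simp only [weight_eq, eval_lin_eq c ha]
    rw [e]
    field_simp
  rw [this, mul_zero]

/-- The integrand is nonnegative, and positive on the interval off the finitely many roots of P. -/
theorem integral_weight_mul_self_pos {c : Case} {h : ℝ} (hs : StatedRange c h) {P : ℝ[X]}
    (hP : P ≠ 0) : 0 < ∫ t in (-1 : ℝ)..1, weight c h t * P.eval t * P.eval t := by
  have hw : ∀ t ∈ Ioo (-1 : ℝ) 1, 0 < weight c h t := by
    intro t ht
    have h1 := eval_lin_ne_zero c hs.regularRange (Ioo_subset_Icc_self ht)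
    have h2 : 0 < 1 - t := by linarith [ht.2]
    have h3 : 0 < 1 + t := by linarith [ht.1]
    rw [weight]
    positivity
  have hnn : 0 ≤ᵐ[volume.restrict (uIoc (-1 : ℝ) 1)] fun t => weight c h t * P.eval t * P.eval t := by
    rw [uIoc_of_le (by norm_num)]
    rw [← restrict_Ioo_eq_restrict_Ioc]
    refine (ae_restrict_iff' measurableSet_Ioo).2 (Eventually.of_forall fun t ht => ?_)
    have := hw t ht
    change 0 ≤ weight c h t * P.eval t * P.eval t
    rw [mul_assoc]
    exact mul_nonneg this.le (mul_self_nonneg _)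
  rw [intervalIntegral.integral_pos_iff_support_of_nonneg_ae' hnn
    (intervalIntegrable_weight_mul hs P P)]
  refine ⟨by norm_num, ?_⟩
  have hsub : Ioo (-1 : ℝ) 1 \ (P.roots.toFinset : Set ℝ) ⊆
      Function.support (fun t => weight c h t * P.eval t * P.eval t) ∩ Ioc (-1) 1 := by
    rintro t ⟨ht, hr⟩
    refine ⟨?_, Ioo_subset_Ioc_self ht⟩
    have : P.eval t ≠ 0 := fun h0 => hr (by simpa [hP] using h0)
    exact mul_ne_zero (mul_ne_zero (hw t ht).ne' this) this
  refine lt_of_lt_of_le ?_ (measure_mono hsub)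
  rw [measure_sdiff_null (Finset.measure_zero _ _), Real.volume_Ioo]
  norm_num

/-- The exponents of `normalEq` at 1 are 0 and 1/2 - ḡ, and the second is below 1 when ḡ > -1/2. -/
theorem eq_zero_of_normalEq {c : Case} {h : ℝ} (ha : Admissible c h) (hg : -1 / 2 < gBar c h)
    {m : ℤ} {D : ℝ[X]} (hD : (normalEq c h m).Solves D) (h1 : D.eval 1 = 0) : D = 0 := by
  refine eq_zero_of_eval_one_eq_zero (a := -((X - C (etaZero c h)) * (1 + X)))
    (b := (normalEq c h m).p₁) (c := (normalEq c h m).p₀) ?_ (fun k => ?_) h1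
  · have e : (X - C 1) * -((X - C (etaZero c h)) * (1 + X)) = (normalEq c h m).p₂ := by
      rw [normalEq, C_1]; ring
    rw [e]
    exact hD
  · have e : eval 1 (-((X - C (etaZero c h)) * (1 + X))) * k + eval 1 (normalEq c h m).p₁ =
        (etaZero c h - 1) * (2 * k + 2 * gBar c h + 1) := by
      simp [normalEq, tau]; ring
    rw [e]
    have : (0 : ℝ) ≤ k := Nat.cast_nonneg k
    exact mul_ne_zero (etaZero_sub_one_ne_zero c ha) (by linarith)

/-- The combination of P and Q that vanishes at 1 is itself a solution, hence zero. -/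
theorem exists_eq_C_mul {c : Case} {h : ℝ} (ha : Admissible c h) (hg : -1 / 2 < gBar c h) {m : ℤ}
    {P Q : ℝ[X]} (hP : (normalEq c h m).Solves P) (hQ : (normalEq c h m).Solves Q)
    (hP0 : P ≠ 0) (hQ0 : Q ≠ 0) : ∃ s : ℝ, s ≠ 0 ∧ P = C s * Q := by
  have hP1 : P.eval 1 ≠ 0 := fun h1 => hP0 (eq_zero_of_normalEq ha hg hP h1)
  have hQ1 : Q.eval 1 ≠ 0 := fun h1 => hQ0 (eq_zero_of_normalEq ha hg hQ h1)
  refine ⟨P.eval 1 / Q.eval 1, div_ne_zero hP1 hQ1, sub_eq_zero.1 ?_⟩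
  refine eq_zero_of_normalEq ha hg (m := m) ?_ (by simp [hQ1])
  have h2 := hQ.C_mul (P.eval 1 / Q.eval 1)
  rw [PolyEq.Solves] at hP h2 ⊢
  simp only [derivative_sub]
  linear_combination hP - h2

/-! ### Polynomial identities in three variables, decided by evaluation at one integer point -/

/-- Polynomial expressions in three variables with integer coefficients. -/
inductive PolyTerm
  | num (k : ℕ)
  | fst | snd | trd
  | add (s t : PolyTerm)
  | sub (s t : PolyTerm)
  | mul (s t : PolyTerm)
  | neg (s : PolyTerm)
  | pow (s : PolyTerm) (k : ℕ)

namespace PolyTerm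

/-- The value of an expression in a commutative ring. -/
def value {R : Type*} [CommRing R] (a b c : R) : PolyTerm → R
  | num k => (k : R)
  | fst => a
  | snd => b
  | trd => c
  | add s t => value a b c s + value a b c t
  | sub s t => value a b c s - value a b c t
  | mul s t => value a b c s * value a b c t
  | neg s => -value a b c s
  | pow s k => value a b c s ^ k

/-- The value of an expression after replacing all signs by `+`. -/
def size (a b c : ℕ) : PolyTerm → ℕ
  | num k => k
  | fst => a
  | snd => b
  | trd => c
  | add s t => size a b c s + size a b c t
  | sub s t => size a b c s + size a b c t
  | mul s t => size a b c s * size a b c t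
  | neg s => size a b c s
  | pow s k => size a b c s ^ k

/-- The value at an integer point, arranged for fast reduction. -/
def intValue (a b c : ℤ) : PolyTerm → ℤ
  | num k => Int.ofNat k
  | fst => a
  | snd => b
  | trd => c
  | add s t => Int.add (intValue a b c s) (intValue a b c t)
  | sub s t => Int.sub (intValue a b c s) (intValue a b c t)
  | mul s t => Int.mul (intValue a b c s) (intValue a b c t)
  | neg s => Int.neg (intValue a b c s)
  | pow s k => Int.pow (intValue a b c s) k

/-- The expression vanishes at an integer point so large that it has to vanish identically. -/
def test (s : PolyTerm) : Bool :=
  let A := s.size 1 1 1 + 1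
  let B := s.size A 1 1 + 1
  let D := s.size A B 1 + 1
  Nat.beq (Int.natAbs (s.intValue (Int.ofNat A) (Int.ofNat B) (Int.ofNat D))) 0

theorem intValue_eq (a b c : ℤ) (s : PolyTerm) : s.intValue a b c = s.value a b c := by
  induction s with
  | num k => rfl
  | fst => rfl
  | snd => rfl
  | trd => rfl
  | add s t hs ht => rw [intValue, value, hs, ht]; rfl
  | sub s t hs ht => rw [intValue, value, hs, ht]; rfl
  | mul s t hs ht => rw [intValue, value, hs, ht]; rfl
  | neg s hs => rw [intValue, value, hs]; rfl
  | pow s k hs => rw [intValue, value, hs]; rfl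

theorem map_value {R S : Type*} [CommRing R] [CommRing S] (φ : R →+* S) (a b c : R)
    (s : PolyTerm) : φ (s.value a b c) = s.value (φ a) (φ b) (φ c) := by
  induction s <;> simp_all [value]

end PolyTerm

/-- A size function on a ring: subadditive, submultiplicative, and such that an element divisible by
an integer larger than its size is zero. -/
structure RingSize (R : Type*) [CommRing R] where
  size : R → ℕ
  size_natCast : ∀ k : ℕ, size k ≤ k
  size_add : ∀ a b, size (a + b) ≤ size a + size b
  size_mul : ∀ a b, size (a * b) ≤ size a * size b
  size_neg : ∀ a, size (-a) = size a
  eq_zero_of_dvd : ∀ (B : ℕ) a, (B : R) ∣ a → size a < B → a = 0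

namespace RingSize

variable {R : Type*} [CommRing R] (ν : RingSize R)

/-- The absolute value as a size function on the integers. -/
def int : RingSize ℤ where
  size := Int.natAbs
  size_natCast k := by simp
  size_add := Int.natAbs_add_le
  size_mul a b := (Int.natAbs_mul a b).le
  size_neg := Int.natAbs_neg
  eq_zero_of_dvd B a h h' := Int.eq_zero_of_abs_lt_dvd h (by rw [Int.abs_eq_natAbs]; exact_mod_cast h')

theorem size_zero : ν.size 0 = 0 := by
  have := ν.size_natCast 0
  simpa using this

/-- The sum of the sizes of the coefficients of a polynomial. -/
def polySize (f : R[X]) : ℕ := ∑ i ∈ f.support, ν.size (f.coeff i)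

theorem polySize_eq (f : R[X]) {m : ℕ} (h : f.natDegree < m) :
    ν.polySize f = ∑ i ∈ Finset.range m, ν.size (f.coeff i) := by
  refine Finset.sum_subset (fun i hi => ?_) fun i _ hi => ?_
  · exact Finset.mem_range.2 ((le_natDegree_of_mem_supp i hi).trans_lt h)
  · rw [notMem_support_iff.1 hi, ν.size_zero]

theorem polySize_add (f g : R[X]) : ν.polySize (f + g) ≤ ν.polySize f + ν.polySize g := by
  obtain ⟨m, hm⟩ := exists_gt (max (f + g).natDegree (max f.natDegree g.natDegree))
  rw [max_lt_iff, max_lt_iff] at hm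
  rw [ν.polySize_eq _ hm.1, ν.polySize_eq _ hm.2.1, ν.polySize_eq _ hm.2.2,
    ← Finset.sum_add_distrib]
  exact Finset.sum_le_sum fun i _ => by rw [coeff_add]; exact ν.size_add _ _

theorem polySize_monomial (k : ℕ) (a : R) : ν.polySize (monomial k a) = ν.size a := by
  by_cases ha : a = 0
  · simp [ha, polySize, ν.size_zero]
  · rw [polySize, support_monomial k ha, Finset.sum_singleton, coeff_monomial_same]

theorem polySize_sum {ι : Type*} (s : Finset ι) (f : ι → R[X]) :
    ν.polySize (∑ i ∈ s, f i) ≤ ∑ i ∈ s, ν.polySize (f i) :=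
  Finset.le_sum_of_subadditive ν.polySize (by simp [polySize]) ν.polySize_add s f

theorem polySize_mul (f g : R[X]) : ν.polySize (f * g) ≤ ν.polySize f * ν.polySize g := by
  have h : f * g = ∑ i ∈ f.support, ∑ j ∈ g.support,
      monomial (i + j) (f.coeff i * g.coeff j) := by
    conv_lhs => rw [f.as_sum_support, g.as_sum_support, Finset.sum_mul_sum]
    simp only [monomial_mul_monomial]
  rw [h]
  refine (ν.polySize_sum _ _).trans ?_
  rw [polySize, polySize, Finset.sum_mul_sum]
  refine Finset.sum_le_sum fun i _ => (ν.polySize_sum _ _).trans ?_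
  exact Finset.sum_le_sum fun j _ => by
    rw [polySize_monomial]; exact ν.size_mul _ _

/-- A polynomial that vanishes at an integer larger than its size is zero. -/
theorem eq_zero_of_eval [IsDomain R] [CharZero R] (B : ℕ) (f : R[X]) (hf : f.eval (B : R) = 0) (h : ν.polySize f < B) :
    f = 0 := by
  induction hd : f.natDegree using Nat.strong_induction_on generalizing f with
  | _ d ih =>
    have hX := f.divX_mul_X_add
    -- Modulo B the value at B is the constant coefficient, which is smaller than B and therefore
    -- zero; then X splits off and the degree drops.
    have h0 : f.coeff 0 = 0 := by
      refine ν.eq_zero_of_dvd B _ ⟨-f.divX.eval (B : R), ?_⟩ (lt_of_le_of_lt ?_ h)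
      · have h1 := congrArg (eval (B : R)) hX
        simp only [eval_add, eval_mul, eval_X, eval_C] at h1
        linear_combination h1 + hf
      · rw [ν.polySize_eq f (Nat.lt_succ_self _), Finset.sum_range_succ']
        omega
    rw [h0, C_0, add_zero] at hX
    by_cases hB : f.natDegree = 0
    · rw [eq_C_of_natDegree_eq_zero hB, h0, C_0]
    have hdeg : f.divX.natDegree = f.natDegree - 1 := natDegree_divX_eq_natDegree_tsub_one
    have hsize : ν.polySize f.divX < B := by
      refine lt_of_le_of_lt ?_ h
      rw [ν.polySize_eq f (Nat.lt_succ_self _), Finset.sum_range_succ',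
        ν.polySize_eq f.divX (m := f.natDegree) (by omega)]
      simp only [coeff_divX]
      omega
    have hev : f.divX.eval (B : R) = 0 := by
      have h1 := congrArg (eval (B : R)) hX
      rw [hf, eval_mul, eval_X] at h1
      exact (mul_eq_zero.1 h1).resolve_right (Nat.cast_ne_zero.2 (by omega))
    rw [← hX, ih _ (by omega) f.divX hev hsize rfl, zero_mul]

theorem size_coeff_le (f : R[X]) (i : ℕ) : ν.size (f.coeff i) ≤ ν.polySize f := by
  by_cases hi : i ∈ f.support
  · exact Finset.single_le_sum (f := fun i => ν.size (f.coeff i)) (fun _ _ => Nat.zero_le _) hi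
  · rw [notMem_support_iff.1 hi, ν.size_zero]
    exact Nat.zero_le _

/-- The size function of the polynomial ring. -/
def poly : RingSize R[X] where
  size := ν.polySize
  size_natCast k := by
    rw [← C_eq_natCast, ← monomial_zero_left, polySize_monomial]
    exact ν.size_natCast k
  size_add := ν.polySize_add
  size_mul := ν.polySize_mul
  size_neg f := by simp [polySize, ν.size_neg]
  eq_zero_of_dvd B f h h' := by
    ext i
    rw [← C_eq_natCast, C_dvd_iff_dvd_coeff] at h
    exact ν.eq_zero_of_dvd B _ (h i) ((ν.size_coeff_le f i).trans_lt h')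

theorem polySize_X : ν.polySize X ≤ 1 := by
  rw [← monomial_one_one_eq_X, polySize_monomial]
  simpa using ν.size_natCast 1

theorem size_value (s : PolyTerm) {a b c : R} {i j k : ℕ} (ha : ν.size a ≤ i) (hb : ν.size b ≤ j)
    (hc : ν.size c ≤ k) : ν.size (s.value a b c) ≤ s.size i j k := by
  induction s with
  | num m => exact ν.size_natCast m
  | fst => exact ha
  | snd => exact hb
  | trd => exact hc
  | add s t hs ht => exact (ν.size_add _ _).trans (add_le_add hs ht)
  | sub s t hs ht =>
    rw [PolyTerm.value, sub_eq_add_neg]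
    refine (ν.size_add _ _).trans (add_le_add hs ?_)
    rw [ν.size_neg]
    exact ht
  | mul s t hs ht => exact (ν.size_mul _ _).trans (Nat.mul_le_mul hs ht)
  | neg s hs =>
    rw [PolyTerm.value, ν.size_neg]
    exact hs
  | pow s m hs =>
    rw [PolyTerm.value, PolyTerm.size]
    induction m with
    | zero => simpa using ν.size_natCast 1
    | succ m ih =>
      rw [pow_succ, pow_succ]
      exact (ν.size_mul _ _).trans (Nat.mul_le_mul ih hs)

end RingSize

/-- Kronecker substitution undone one variable at a time. Each integer exceeds the size of the
expression with the later variables of size 1 and the earlier ones at their chosen integers, so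
`RingSize.eq_zero_of_eval` can restore the variables in the order third, second, first. -/
theorem PolyTerm.value_eq_zero (s : PolyTerm) (h : s.test = true) (a b c : ℝ) :
    s.value a b c = 0 := by
  set A := s.size 1 1 1 + 1 with hA
  set B := s.size A 1 1 + 1 with hB
  set D := s.size A B 1 + 1 with hD
  have h0 : s.value (A : ℤ) B D = 0 := by
    rw [← PolyTerm.intValue_eq]
    exact Int.natAbs_eq_zero.1 (Nat.eq_of_beq_eq_true h)
  have h1 : s.value (A : ℤ[X]) B X = 0 := by
    refine RingSize.int.eq_zero_of_eval D _ ?_ (Nat.lt_succ_of_le ?_)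
    · rw [← coe_evalRingHom, PolyTerm.map_value]
      simpa using h0
    · exact RingSize.int.poly.size_value s (RingSize.int.poly.size_natCast A)
        (RingSize.int.poly.size_natCast B) RingSize.int.polySize_X
  have h2 : s.value (A : ℤ[X][X]) X (C X) = 0 := by
    refine RingSize.int.poly.eq_zero_of_eval B _ ?_ (Nat.lt_succ_of_le ?_)
    · rw [← coe_evalRingHom, PolyTerm.map_value]
      simpa using h1
    · refine RingSize.int.poly.poly.size_value s (RingSize.int.poly.poly.size_natCast A)
        RingSize.int.poly.polySize_X ?_
      refine (RingSize.polySize_monomial _ 0 _).le.trans ?_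
      exact RingSize.int.polySize_X
  have h3 : s.value (X : ℤ[X][X][X]) (C X) (C (C X)) = 0 := by
    refine RingSize.int.poly.poly.eq_zero_of_eval A _ ?_ (Nat.lt_succ_of_le ?_)
    · rw [← coe_evalRingHom, PolyTerm.map_value]
      simpa using h2
    · refine RingSize.int.poly.poly.poly.size_value s RingSize.int.poly.poly.polySize_X ?_ ?_
      · refine (RingSize.polySize_monomial _ 0 _).le.trans ?_
        exact RingSize.int.poly.polySize_X
      · refine (RingSize.polySize_monomial _ 0 _).le.trans ?_
        refine (RingSize.polySize_monomial _ 0 _).le.trans ?_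
        exact RingSize.int.polySize_X
  -- The expression vanishes at the three generic variables, so its value at real numbers is the
  -- image of zero under evaluation.
  let φ : ℤ[X][X][X] →+* ℝ :=
    eval₂RingHom (eval₂RingHom (eval₂RingHom (Int.castRingHom ℝ) c) b) a
  have h4 := PolyTerm.map_value (R := ℤ[X][X][X]) φ X (C X) (C (C X)) s
  rw [h3, map_zero] at h4
  simpa [φ] using h4.symm

/-! ### Reification of real polynomial expressions by instance search -/

/-- Equality of real numbers, to be solved by unification. -/
class IsEqual (r : ℝ) (s : outParam ℝ) : Prop where
  eq : r = s

instance IsEqual.instRefl (r : ℝ) : IsEqual r r := ⟨rfl⟩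

/-- The product of the real number `r` and the positive integer `den` is given by a polynomial
expression in `a, b, c`. -/
class IsPolyTerm (a b c : ℝ) (r : ℝ) (term : outParam PolyTerm) (den : outParam ℕ) : Prop where
  den_ne_zero : den ≠ 0
  value_term : term.value a b c = den * r

namespace IsPolyTerm

variable (a b c r r' : ℝ) (s s' : PolyTerm) (d d' : ℕ)

/-- The instances compute a term and a common denominator along the syntax tree. Rational
coefficients are collected in `den`, so the term itself contains natural numerals only. -/
instance instOfNat (k : ℕ) [k.AtLeastTwo] [h : IsEqual r (OfNat.ofNat k)] :
    IsPolyTerm a b c r (.num k) 1 := ⟨one_ne_zero, by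
  have hk : (k : ℝ) = OfNat.ofNat k := Nat.cast_ofNat
  rw [PolyTerm.value, h.eq, hk, Nat.cast_one, one_mul]⟩
instance instFst : IsPolyTerm a b c a .fst 1 := ⟨one_ne_zero, by simp [PolyTerm.value]⟩
instance instSnd : IsPolyTerm a b c b .snd 1 := ⟨one_ne_zero, by simp [PolyTerm.value]⟩
instance instTrd : IsPolyTerm a b c c .trd 1 := ⟨one_ne_zero, by simp [PolyTerm.value]⟩
instance instZero : IsPolyTerm a b c 0 (.num 0) 1 := ⟨one_ne_zero, by simp [PolyTerm.value]⟩
instance instOne : IsPolyTerm a b c 1 (.num 1) 1 := ⟨one_ne_zero, by simp [PolyTerm.value]⟩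
instance instAdd [hr : IsPolyTerm a b c r s d] [hs : IsPolyTerm a b c r' s' d'] :
    IsPolyTerm a b c (r + r') (.add (.mul s (.num d')) (.mul s' (.num d))) (Nat.mul d d') :=
  ⟨mul_ne_zero hr.den_ne_zero hs.den_ne_zero, by
    simp only [PolyTerm.value, hr.value_term, hs.value_term, Nat.mul_eq, Nat.cast_mul]
    ring⟩
instance instSub [hr : IsPolyTerm a b c r s d] [hs : IsPolyTerm a b c r' s' d'] :
    IsPolyTerm a b c (r - r') (.sub (.mul s (.num d')) (.mul s' (.num d))) (Nat.mul d d') :=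
  ⟨mul_ne_zero hr.den_ne_zero hs.den_ne_zero, by
    simp only [PolyTerm.value, hr.value_term, hs.value_term, Nat.mul_eq, Nat.cast_mul]
    ring⟩
instance instMul [hr : IsPolyTerm a b c r s d] [hs : IsPolyTerm a b c r' s' d'] :
    IsPolyTerm a b c (r * r') (.mul s s') (Nat.mul d d') :=
  ⟨mul_ne_zero hr.den_ne_zero hs.den_ne_zero, by
    simp only [PolyTerm.value, hr.value_term, hs.value_term, Nat.mul_eq, Nat.cast_mul]
    ring⟩
instance instNeg [hr : IsPolyTerm a b c r s d] : IsPolyTerm a b c (-r) (.neg s) d :=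
  ⟨hr.den_ne_zero, by rw [PolyTerm.value, hr.value_term, mul_neg]⟩
instance instPow (k : ℕ) [hr : IsPolyTerm a b c r s d] :
    IsPolyTerm a b c (r ^ k) (.pow s k) (Nat.pow d k) :=
  ⟨pow_ne_zero k hr.den_ne_zero, by
    rw [PolyTerm.value, hr.value_term, Nat.pow_eq, Nat.cast_pow, mul_pow]⟩
instance instDiv (k : ℕ) [k.AtLeastTwo] [hr : IsPolyTerm a b c r s d]
    [h : IsEqual r' (OfNat.ofNat k)] : IsPolyTerm a b c (r / r') s (Nat.mul d k) :=
  ⟨mul_ne_zero hr.den_ne_zero (NeZero.ne k), by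
    have hk : (k : ℝ) = OfNat.ofNat k := Nat.cast_ofNat
    have hk0 : (k : ℝ) ≠ 0 := Nat.cast_ne_zero.2 (NeZero.ne k)
    rw [hr.value_term, h.eq, ← hk, Nat.mul_eq, Nat.cast_mul]
    field_simp⟩

end IsPolyTerm

/-- Two polynomial expressions in `a, b, c` are equal if the test succeeds. -/
theorem eq_of_test (a b c : ℝ) {r r' : ℝ} {s s' : PolyTerm} {d d' : ℕ}
    [hr : IsPolyTerm a b c r s d] [hs : IsPolyTerm a b c r' s' d']
    (h : (PolyTerm.sub (.mul s (.num d')) (.mul s' (.num d))).test = true) : r = r' := by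
  have h1 := PolyTerm.value_eq_zero _ h a b c
  have hd : (d : ℝ) ≠ 0 := Nat.cast_ne_zero.2 hr.den_ne_zero
  have hd' : (d' : ℝ) ≠ 0 := Nat.cast_ne_zero.2 hs.den_ne_zero
  simp only [PolyTerm.value, hr.value_term, hs.value_term] at h1
  refine mul_left_cancel₀ (mul_ne_zero hd hd') ?_
  linear_combination h1

/-! ### Explicit form of the transformed eigenfunctions -/

/-- The polynomial with the coefficients `l`, evaluated at `x`. -/
def hor (x : ℝ) : List ℝ → ℝ
  | [] => 0
  | a :: l => a + x * hor x l

theorem hor_nil (x : ℝ) : hor x [] = 0 := rfl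

theorem hor_cons (x a : ℝ) (l : List ℝ) : hor x (a :: l) = a + x * hor x l := rfl

/-- The polynomial with the coefficients `l` in the variable `1 - X`. -/
def taylor : List ℝ → ℝ[X]
  | [] => 0
  | a :: l => C a + (1 - X) * taylor l

theorem eval_taylor (t : ℝ) (l : List ℝ) : (taylor l).eval t = hor (1 - t) l := by
  induction l with
  | nil => simp [taylor, hor]
  | cons a l ih => simp [taylor, hor, ih]

theorem eval_derivative_taylor_nil (t : ℝ) : (derivative (taylor [])).eval t = 0 := by
  simp [taylor]

theorem eval_derivative_taylor_cons (t a : ℝ) (l : List ℝ) :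
    (derivative (taylor (a :: l))).eval t =
      (1 - t) * (derivative (taylor l)).eval t - hor (1 - t) l := by
  simp [taylor, eval_taylor]; ring

theorem eval_derivative2_taylor_nil (t : ℝ) :
    (derivative (derivative (taylor []))).eval t = 0 := by
  simp [taylor]

theorem eval_derivative2_taylor_cons (t a : ℝ) (l : List ℝ) :
    (derivative (derivative (taylor (a :: l)))).eval t =
      (1 - t) * (derivative (derivative (taylor l))).eval t -
        2 * (derivative (taylor l)).eval t := by
  simp [taylor]; ring

/-- Case `Ia` of `numA`. -/
def numAIa (p n : ℝ) : ℝ[X] :=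
  -- Nested Horner lists, here and in the analogous definitions: the outer entries belong to powers
  -- of 1 - η, the lists after `hor n` to powers of n and those after `hor p` to powers of p.
  taylor [hor n [hor p [-648, 1584, -936], hor p [2592, -3456, -288], hor p [0, -1152]], hor n
    [hor p [972, -2268, 1140, 156], hor p [-3888, 6048, -720, -96], hor p [0, 1728, -384]], hor n
    [hor p [-486, 1080, -564, 8, 26], hor p [1944, -3456, 1008, 0, -8], hor p [0, -864, 384,
    -32]], hor n [hor p [81, -171, 114, -22, -3, 1], hor p [-324, 648, -288, 24, 4], hor p [0,
    144, -96, 16]]]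

/-- Case `Ib` of `numA`. -/
def numAIb (p n : ℝ) : ℝ[X] :=
  taylor [hor p [-52488, 157464, -147096, 42120], hor n [hor p [78732, -227448, 194400, -38664,
    -7020], hor p [0, -23328, 54432, -28512, -2592], hor p [0, 0, 10368, -10368]], hor n [hor p
    [-39366, 109350, -94284, 26028, 1746, -1170], hor p [0, 23328, -54432, 33696, -4320, -576],
    hor p [0, 0, -10368, 10368, -2304]], hor n [hor p [6561, -17496, 16929, -6912, 747, 216, -45],
    hor p [0, -5832, 13608, -9072, 2160, -72, -24], hor p [0, 0, 2592, -2592, 864, -96]]]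

/-- Case `IIa` of `numA`. -/
def numAIIa (p n : ℝ) : ℝ[X] :=
  taylor [hor n [hor p [1944, 2160, 504], hor p [2592, 2880, 288], hor p [0, 1152]], hor n [hor
    p [-2916, -1620, 180, -252], hor p [-3888, -3456, 528, 96], hor p [0, -1728, 384]], hor n [hor
    p [1458, 0, -180, 96, -30], hor p [1944, 1296, -672, -16, 8], hor p [0, 864, -384, 32]], hor n
    [hor p [-243, 135, -18, -6, 5, -1], hor p [-324, -144, 168, -16, -4], hor p [0, -144, 96,
    -16]]]

/-- Case `IIb` of `numA`. -/
def numAIIb (p n : ℝ) : ℝ[X] :=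
  taylor [hor p [5832, 6480, 1512], hor n [hor p [-8748, -4860, 540, -756], hor p [0, -1296,
    -1440, -144], hor p [0, 0, -576]], hor n [hor p [4374, 0, -540, 288, -90], hor p [0, 1296,
    1008, -336, -48], hor p [0, 0, 576, -192]], hor n [hor p [-729, 405, -54, -18, 15, -3], hor p
    [0, -324, -144, 168, -16, -4], hor p [0, 0, -144, 96, -16]]]

/-- Case `IIIa` of `numA`. -/
def numAIIIa (p n : ℝ) : ℝ[X] :=
  taylor [hor p [-5832, 6480, -1512], hor n [hor p [8748, -5508, -684, -252], hor p [0, -1296,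
    1728, 144], hor p [0, 0, 576]], hor n [hor p [-4374, 648, 1116, 120, -6], hor p [0, 1296,
    -1296, -720, -48], hor p [0, 0, -576, -192]], hor n [hor p [729, 243, -198, -114, -19, -1],
    hor p [0, -324, 216, 288, 72, 4], hor p [0, 0, 144, 96, 16]]]

/-- Case `IIIb` of `numA`. -/
def numAIIIb (p n : ℝ) : ℝ[X] :=
  taylor [hor n [hor p [29160, -26568, 1080, 1512], hor p [15552, -25920, 5184, 576], hor p [0,
    -6912, 2304]], hor n [hor p [-43740, 18792, 8928, 1944, 252], hor p [-23328, 28512, 6048,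
    288], hor p [0, 10368, 1152]], hor n [hor p [21870, 1134, -6228, -1716, -90, 6], hor p [11664,
    -9072, -8640, -2304, -336, -16], hor p [0, -5184, -2880, -576, -64]], hor n [hor p [-3645,
    -1944, 747, 768, 209, 24, 1], hor p [-1944, 648, 2160, 1008, 168, 8], hor p [0, 864, 864, 288,
    32]]]

/-- Case `IVa` of `numA`. -/
def numAIVa (p n : ℝ) : ℝ[X] :=
  taylor [hor p [104976, 314928, 294192, 84240], hor n [hor p [-209952, -699840, -767232,
    -288576, -11232], hor p [0, -46656, -160704, -119232, -5184], hor p [0, 0, -20736, -20736]],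
    hor n [hor p [157464, 577368, 734832, 370224, 58104, 2808], hor p [0, 69984, 247536, 206352,
    37008, 1296], hor p [0, 0, 31104, 33984, 5184]], hor n [hor p [-52488, -209952, -306504,
    -198720, -55512, -6048, -216], hor p [0, -34992, -127008, -117792, -36096, -3504, -96], hor p
    [0, 0, -15552, -18432, -5568, -384]], hor n [hor p [6561, 28431, 47061, 37611, 15219, 3069,
    279, 9], hor p [0, 5832, 21708, 22212, 9624, 1904, 156, 4], hor p [0, 0, 2592, 3312, 1488,
    272, 16]]]

/-- Case `IVb` of `numA`. -/
def numAIVb (p n : ℝ) : ℝ[X] :=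
  taylor [hor n [hor p [104976, 221616, 107568, 9360], hor p [46656, 139968, 68544, 2880], hor p
    [0, 20736, 11520]], hor n [hor p [-209952, -513216, -331776, -42048, -1248], hor p [-93312,
    -311040, -216576, -17664, -384], hor p [0, -41472, -36864, -1536]], hor n [hor p [157464,
    437400, 361584, 90288, 8952, 312], hor p [69984, 256608, 233712, 51408, 3632, 80], hor p [0,
    31104, 38016, 7488, 320]], hor n [hor p [-52488, -163296, -166536, -66240, -11352, -864, -24],
    hor p [-23328, -93312, -105552, -40896, -6656, -576, -16], hor p [0, -10368, -16128, -6336,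
    -896, -64]], hor n [hor p [6561, 22599, 27621, 15219, 4179, 581, 39, 1], hor p [2916, 12636,
    17136, 9624, 2468, 268, 8], hor p [0, 1296, 2448, 1488, 368, 32]]]

/-- The factor of the Jacobi polynomial in the transformed eigenfunction, in the parameter `p`. -/
def numA : Case → ℝ → ℝ → ℝ[X]
  | .Ia => numAIa
  | .Ib => numAIb
  | .IIa => numAIIa
  | .IIb => numAIIb
  | .IIIa => numAIIIa
  | .IIIb => numAIIIb
  | .IVa => numAIVa
  | .IVb => numAIVb

/-- Case `Ia` of `numB`. -/
def numBIa (p _n : ℝ) : ℝ[X] :=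
  taylor [0, hor p [0, -2592, 1440], hor p [0, 3888, -2448, 288], hor p [0, -1944, 1368, -264,
    8], hor p [0, 324, -252, 60, -4]]

/-- Case `Ib` of `numB`. -/
def numBIb (p n : ℝ) : ℝ[X] :=
  taylor [0, hor p [0, -23328, 36288, -12960], hor n [hor p [0, 34992, -51840, 15408, 1440], hor
    p [0, 0, -5184, 6912, 576], hor p [0, 0, 0, 2304]], hor n [hor p [0, -17496, 24624, -9792,
    -48, 408], hor p [0, 0, 5184, -8640, 1728, 192], hor p [0, 0, 0, -2304, 768]], hor n [hor p
    [0, 2916, -3888, 2664, -624, -76, 32], hor p [0, 0, -1296, 2592, -1152, 96, 16], hor p [0, 0,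
    0, 576, -384, 64]]]

/-- Case `IIa` of `numB`. -/
def numBIIa (p _n : ℝ) : ℝ[X] :=
  taylor [0, hor p [0, 2592, -1440], hor p [0, -3888, 2448, -288], hor p [0, 1944, -1368, 264,
    -8], hor p [0, -324, 252, -60, 4]]

/-- Case `IIb` of `numB`. -/
def numBIIb (p _n : ℝ) : ℝ[X] :=
  taylor [0, hor p [0, -2592, -864], hor p [0, 3888, -1296, 288], hor p [0, -1944, 1944, -648,
    72], hor p [0, 324, -540, 252, -36]]

/-- Case `IIIa` of `numB`. -/
def numBIIIa (p _n : ℝ) : ℝ[X] :=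
  taylor [0, hor p [0, -2592, 864], hor p [0, 3888, 1296, 288], hor p [0, -1944, -1944, -648,
    -72], hor p [0, 324, 540, 252, 36]]

/-- Case `IIIb` of `numB`. -/
def numBIIIb (p n : ℝ) : ℝ[X] :=
  taylor [hor n [hor p [41472, -18432, -4608], hor p [20736, -27648, -2304], hor p [0, -9216]],
    hor n [hor p [-82944, 22176, 14784, 1824], hor p [-41472, 48384, 13824, 768], hor p [0, 18432,
    3072]], hor n [hor p [62208, -5616, -13824, -2288, 32], hor p [31104, -31104, -16704, -1920,
    -64], hor p [0, -13824, -4608, -256]], hor n [hor p [-20736, -1800, 5040, 1280, 80, 8], hor p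
    [-10368, 8640, 7488, 1344, 64], hor p [0, 4608, 2304, 256]], hor n [hor p [2592, 684, -624,
    -296, -48, -4], hor p [1296, -864, -1152, -288, -16], hor p [0, -576, -384, -64]]]

/-- Case `IVa` of `numB`. -/
def numBIVa (p n : ℝ) : ℝ[X] :=
  taylor [0, hor p [0, -46656, -72576, -25920], hor n [hor p [0, 93312, 152928, 70848, 2016],
    hor p [0, 0, 10368, 25344, 1152], hor p [0, 0, 0, 4608]], hor n [hor p [0, -69984, -120528,
    -79920, -14832, -816], hor p [0, 0, -15552, -41472, -10176, -384], hor p [0, 0, 0, -6912,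
    -1536]], hor n [hor p [0, 23328, 42120, 39744, 14256, 1824, 72], hor p [0, 0, 7776, 22464,
    9600, 1088, 32], hor p [0, 0, 0, 3456, 1536, 128]], hor n [hor p [0, -2916, -5508, -7128,
    -3672, -708, -36], hor p [0, 0, -1296, -4032, -2400, -448, -16], hor p [0, 0, 0, -576, -384,
    -64]]]

/-- Case `IVb` of `numB`. -/
def numBIVb (p n : ℝ) : ℝ[X] :=
  taylor [0, hor n [hor p [0, -46656, -72576, -7488], hor p [0, -20736, -50688, -2304], hor p
    [0, 0, -9216]], hor n [hor p [0, 93312, 159840, 38592, 2784], hor p [0, 41472, 108288, 21504,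
    768], hor p [0, 0, 18432, 3072]], hor n [hor p [0, -69984, -130896, -47664, -5232, -48], hor p
    [0, -31104, -86400, -29376, -2560, -64], hor p [0, 0, -13824, -4608, -256]], hor n [hor p [0,
    23328, 47304, 22464, 3504, 160, 8], hor p [0, 10368, 30528, 14400, 1984, 64], hor p [0, 0,
    4608, 2304, 256]], hor n [hor p [0, -2916, -6372, -3672, -792, -68, -4], hor p [0, -1296,
    -4032, -2400, -448, -16], hor p [0, 0, -576, -384, -64]]]

/-- The factor of the derivative of the Jacobi polynomial in the transformed eigenfunction. -/
def numB : Case → ℝ → ℝ → ℝ[X]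
  | .Ia => numBIa
  | .Ib => numBIb
  | .IIa => numBIIa
  | .IIb => numBIIb
  | .IIIa => numBIIIa
  | .IIIb => numBIIIb
  | .IVa => numBIVa
  | .IVb => numBIVb

/-! ### Parameters and equations with the denominator p cleared -/

/-- The parameter `g`, multiplied by `p`. -/
def Case.scaledG (c : Case) (p : ℝ) : ℝ :=
  p * (1 / 2 + c.group.eps / 4 - c.shiftG) - 3 * c.group.eps * c.group.sigma / 4

/-- The parameter `h`, as a function of `p`. -/
def Case.ofParam (c : Case) (p : ℝ) : ℝ := 1 / 2 + (p - c.group.sigma / 3) / 4 - c.shiftH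

theorem Case.ofParam_param (c : Case) (h : ℝ) : c.ofParam (param c.group (hBar c h)) = h := by
  rw [Case.ofParam, param, hBar_eq_add]; ring

/-- On the curve g has denominator p, so pg is polynomial in p; all later identities are polynomial
for this reason. -/
theorem Case.scaledG_param (c : Case) {h : ℝ} (ha : Admissible c h) :
    c.scaledG (param c.group (hBar c h)) = param c.group (hBar c h) * curve c h := by
  have h0 := ((admissible_iff c h).1 ha).1
  have h1 := gBar_eq c ha
  rw [gBar_eq_add] at h1
  rw [Case.scaledG, eq_sub_of_add_eq h1]
  field_simp
  ring

/-- Coefficients of `p (1 - X²) (A J + B J')'` with respect to `J`, `J'`, where `J` is a Jacobi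
polynomial with `p (1 - X²) J'' = G J' - l J`. -/
def thetaA (p l : ℝ) (A B : ℝ[X]) : ℝ[X] := C p * (1 - X ^ 2) * derivative A - C l * B

/-- See `thetaA`; here `G = g₀ + g₁ X`. -/
def thetaB (p g₀ g₁ : ℝ) (A B : ℝ[X]) : ℝ[X] :=
  C p * (1 - X ^ 2) * (A + derivative B) + (C g₀ + C g₁ * X) * B

/-- The operator p(1 - X²)d/dX preserves the span of J and J' over polynomials, so it acts on pairs
(A, B) without reference to the degree of J. -/
theorem theta_eq {p l g₀ g₁ : ℝ} {J : ℝ[X]}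
    (hJ : C p * (1 - X ^ 2) * derivative (derivative J) =
      (C g₀ + C g₁ * X) * derivative J - C l * J) (A B : ℝ[X]) :
    C p * (1 - X ^ 2) * derivative (A * J + B * derivative J) =
      thetaA p l A B * J + thetaB p g₀ g₁ A B * derivative J := by
  simp only [thetaA, thetaB, derivative_add, derivative_mul]
  linear_combination B * hJ

theorem eval_thetaA (p l t : ℝ) (A B : ℝ[X]) : (thetaA p l A B).eval t =
    p * (1 - t ^ 2) * (derivative A).eval t - l * B.eval t := by
  simp [thetaA]

theorem eval_thetaB (p g₀ g₁ t : ℝ) (A B : ℝ[X]) : (thetaB p g₀ g₁ A B).eval t =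
    p * (1 - t ^ 2) * (A.eval t + (derivative B).eval t) + (g₀ + g₁ * t) * B.eval t := by
  simp [thetaB]

theorem eval_derivative_thetaA (p l t : ℝ) (A B : ℝ[X]) : (derivative (thetaA p l A B)).eval t =
    p * (1 - t ^ 2) * (derivative (derivative A)).eval t - 2 * p * t * (derivative A).eval t -
      l * (derivative B).eval t := by
  simp [thetaA]; ring

theorem eval_derivative_thetaB (p g₀ g₁ t : ℝ) (A B : ℝ[X]) :
    (derivative (thetaB p g₀ g₁ A B)).eval t =
      p * (1 - t ^ 2) * ((derivative A).eval t + (derivative (derivative B)).eval t) -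
        2 * p * t * (A.eval t + (derivative B).eval t) +
        (g₀ + g₁ * t) * (derivative B).eval t + g₁ * B.eval t := by
  simp [thetaB]; ring

/-- The coefficient in the Jacobi equation. -/
def Case.g₀ (c : Case) (p : ℝ) : ℝ := c.scaledG p - p * c.ofParam p

/-- The coefficient in the Jacobi equation. -/
def Case.g₁ (c : Case) (p : ℝ) : ℝ := c.scaledG p + p * c.ofParam p + p

/-- The coefficient in the Jacobi equation. -/
def Case.lam (c : Case) (p n : ℝ) : ℝ := n * (p * n + c.scaledG p + p * c.ofParam p)

/-- Twice the linear factor. -/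
def Grp.ell (G : Grp) (p t : ℝ) : ℝ := -(p * (1 - t) + G.sigma * (1 + t))

/-- The scaled coefficient `p τ`. -/
def Case.scaledTau (c : Case) (p t : ℝ) : ℝ :=
  (p * (c.ofParam p + c.shiftH) - (c.scaledG p + p * c.shiftG)) -
    (p * (c.ofParam p + c.shiftH) + (c.scaledG p + p * c.shiftG) + p) * t

/-- The scaled spectral parameter. -/
def Case.scaledSpectral (c : Case) (p n : ℝ) : ℝ :=
  (n + c.group.typeIII) * (p * n + (c.scaledG p + p * c.shiftG) +
    p * (c.ofParam p + c.shiftH) + p * c.group.typeIII)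

/-- The scaled coefficient of the first derivative. -/
def Case.first (c : Case) (p t : ℝ) : ℝ :=
  c.scaledTau p t * c.group.ell p t - 4 * (p - c.group.sigma) * p * (1 - t ^ 2)

/-- The scaled coefficient of the unknown function. -/
def Case.zeroth (c : Case) (p n t : ℝ) : ℝ :=
  p * c.scaledSpectral p n * c.group.ell p t - 2 * (p - c.group.sigma) * p * c.scaledTau p t -
    6 * (p - c.group.sigma) * p ^ 2 * t

/-- The combination of the coefficient functions that has to vanish. -/
def odeForm (c : Case) (p n t A A₁ A₂ : ℝ) : ℝ :=
  -- A₁ and A₂ stand for one and two applications of θ = p(1 - t²)d/dt, and p²(1 - t²)² T'' = θ²T +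
  -- 2tp θT. The whole form is (p - σ)p²(1 - t²) times the left side of `normalEq`.
  c.group.ell p t * (A₂ + 2 * t * p * A₁) + c.first p t * A₁ + (1 - t ^ 2) * c.zeroth p n t * A

/-- The equation for `A J + B J'`, separated with respect to `J` and `J'`. -/
def OdeIdentity (c : Case) (A B : ℝ → ℝ → ℝ[X]) : Prop := ∀ p n t : ℝ,
  odeForm c p n t ((A p n).eval t)
    ((thetaA p (c.lam p n) (A p n) (B p n)).eval t)
    ((thetaA p (c.lam p n) (thetaA p (c.lam p n) (A p n) (B p n))
      (thetaB p (c.g₀ p) (c.g₁ p) (A p n) (B p n))).eval t) = 0 ∧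
  odeForm c p n t ((B p n).eval t)
    ((thetaB p (c.g₀ p) (c.g₁ p) (A p n) (B p n)).eval t)
    ((thetaB p (c.g₀ p) (c.g₁ p) (thetaA p (c.lam p n) (A p n) (B p n))
      (thetaB p (c.g₀ p) (c.g₁ p) (A p n) (B p n))).eval t) = 0

/-- Collected before the coefficient lists are inserted, so that the identity to be tested involves
A, B and their derivatives only once each. -/
theorem odeForm_thetaA (c : Case) (p n t l g₀ g₁ : ℝ) (A B : ℝ[X]) :
    odeForm c p n t (A.eval t) ((thetaA p l A B).eval t)
      ((thetaA p l (thetaA p l A B) (thetaB p g₀ g₁ A B)).eval t) =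
    (1 - t ^ 2) * (c.group.ell p t * p * (p * (1 - t ^ 2) *
        (derivative (derivative A)).eval t - 2 * l * (derivative B).eval t) +
        p * c.first p t * (derivative A).eval t +
        (c.zeroth p n t - l * p * c.group.ell p t) * A.eval t) -
      l * ((g₀ + g₁ * t + 2 * t * p) * c.group.ell p t + c.first p t) * B.eval t := by
  simp only [odeForm, eval_thetaA, eval_thetaB, eval_derivative_thetaA]
  ring

theorem odeForm_thetaB (c : Case) (p n t l g₀ g₁ : ℝ) (A B : ℝ[X]) :
    odeForm c p n t (B.eval t) ((thetaB p g₀ g₁ A B).eval t)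
      ((thetaB p g₀ g₁ (thetaA p l A B) (thetaB p g₀ g₁ A B)).eval t) =
    (1 - t ^ 2) * (c.group.ell p t * p ^ 2 * (1 - t ^ 2) *
        ((derivative (derivative B)).eval t + 2 * (derivative A).eval t) +
        p * ((g₀ + g₁ * t) * c.group.ell p t + c.first p t) * A.eval t +
        p * (2 * (g₀ + g₁ * t) * c.group.ell p t + c.first p t) * (derivative B).eval t +
        (c.group.ell p t * p * (g₁ - l) + c.zeroth p n t) * B.eval t) +
      (g₀ + g₁ * t) * ((g₀ + g₁ * t + 2 * t * p) * c.group.ell p t + c.first p t) *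
        B.eval t := by
  simp only [odeForm, eval_thetaA, eval_thetaB, eval_derivative_thetaB]
  ring

set_option synthInstance.maxSize 100000 in
set_option synthInstance.maxHeartbeats 0 in
theorem odeIdentity_Ia : OdeIdentity .Ia numAIa numBIa := by
  intro p n t
  -- The lists are in powers of 1 - t; with t = 1 - x they become lists in x.
  obtain ⟨x, rfl⟩ : ∃ x, t = 1 - x := ⟨1 - t, by ring⟩
  have h2 : (1 : ℝ) - (1 - x) ^ 2 = x * (2 - x) := by ring
  rw [odeForm_thetaA, odeForm_thetaB]
  simp only [Case.first, Case.zeroth,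
    numAIa, numBIa, eval_taylor, eval_derivative_taylor_nil, eval_derivative_taylor_cons,
    eval_derivative2_taylor_nil, eval_derivative2_taylor_cons, hor_nil, hor_cons, Case.g₀, Case.g₁,
    Case.lam, Grp.ell, Case.scaledTau, Case.scaledSpectral, Case.scaledG, Case.ofParam, Case.group,
    Case.shiftG, Case.shiftH, Grp.sigma, Grp.eps, Grp.typeIII, sub_sub_cancel, h2]
  -- The coefficients of J and of J' are separate polynomial identities in p, n, x, each decided at
  -- one integer point.
  constructor <;> exact eq_of_test p n x (by decide +kernel)

set_option synthInstance.maxSize 100000 in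
set_option synthInstance.maxHeartbeats 0 in
theorem odeIdentity_Ib : OdeIdentity .Ib numAIb numBIb := by
  intro p n t
  obtain ⟨x, rfl⟩ : ∃ x, t = 1 - x := ⟨1 - t, by ring⟩
  have h2 : (1 : ℝ) - (1 - x) ^ 2 = x * (2 - x) := by ring
  rw [odeForm_thetaA, odeForm_thetaB]
  simp only [Case.first, Case.zeroth,
    numAIb, numBIb, eval_taylor, eval_derivative_taylor_nil, eval_derivative_taylor_cons,
    eval_derivative2_taylor_nil, eval_derivative2_taylor_cons, hor_nil, hor_cons, Case.g₀, Case.g₁,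
    Case.lam, Grp.ell, Case.scaledTau, Case.scaledSpectral, Case.scaledG, Case.ofParam, Case.group,
    Case.shiftG, Case.shiftH, Grp.sigma, Grp.eps, Grp.typeIII, sub_sub_cancel, h2]
  constructor <;> exact eq_of_test p n x (by decide +kernel)

set_option synthInstance.maxSize 100000 in
set_option synthInstance.maxHeartbeats 0 in
theorem odeIdentity_IIa : OdeIdentity .IIa numAIIa numBIIa := by
  intro p n t
  obtain ⟨x, rfl⟩ : ∃ x, t = 1 - x := ⟨1 - t, by ring⟩
  have h2 : (1 : ℝ) - (1 - x) ^ 2 = x * (2 - x) := by ring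
  rw [odeForm_thetaA, odeForm_thetaB]
  simp only [Case.first, Case.zeroth,
    numAIIa, numBIIa, eval_taylor, eval_derivative_taylor_nil, eval_derivative_taylor_cons,
    eval_derivative2_taylor_nil, eval_derivative2_taylor_cons, hor_nil, hor_cons, Case.g₀, Case.g₁,
    Case.lam, Grp.ell, Case.scaledTau, Case.scaledSpectral, Case.scaledG, Case.ofParam, Case.group,
    Case.shiftG, Case.shiftH, Grp.sigma, Grp.eps, Grp.typeIII, sub_sub_cancel, h2]
  constructor <;> exact eq_of_test p n x (by decide +kernel)

set_option synthInstance.maxSize 100000 in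
set_option synthInstance.maxHeartbeats 0 in
theorem odeIdentity_IIb : OdeIdentity .IIb numAIIb numBIIb := by
  intro p n t
  obtain ⟨x, rfl⟩ : ∃ x, t = 1 - x := ⟨1 - t, by ring⟩
  have h2 : (1 : ℝ) - (1 - x) ^ 2 = x * (2 - x) := by ring
  rw [odeForm_thetaA, odeForm_thetaB]
  simp only [Case.first, Case.zeroth,
    numAIIb, numBIIb, eval_taylor, eval_derivative_taylor_nil, eval_derivative_taylor_cons,
    eval_derivative2_taylor_nil, eval_derivative2_taylor_cons, hor_nil, hor_cons, Case.g₀, Case.g₁,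
    Case.lam, Grp.ell, Case.scaledTau, Case.scaledSpectral, Case.scaledG, Case.ofParam, Case.group,
    Case.shiftG, Case.shiftH, Grp.sigma, Grp.eps, Grp.typeIII, sub_sub_cancel, h2]
  constructor <;> exact eq_of_test p n x (by decide +kernel)

set_option synthInstance.maxSize 100000 in
set_option synthInstance.maxHeartbeats 0 in
theorem odeIdentity_IIIa : OdeIdentity .IIIa numAIIIa numBIIIa := by
  intro p n t
  obtain ⟨x, rfl⟩ : ∃ x, t = 1 - x := ⟨1 - t, by ring⟩
  have h2 : (1 : ℝ) - (1 - x) ^ 2 = x * (2 - x) := by ring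
  rw [odeForm_thetaA, odeForm_thetaB]
  simp only [Case.first, Case.zeroth,
    numAIIIa, numBIIIa, eval_taylor, eval_derivative_taylor_nil, eval_derivative_taylor_cons,
    eval_derivative2_taylor_nil, eval_derivative2_taylor_cons, hor_nil, hor_cons, Case.g₀, Case.g₁,
    Case.lam, Grp.ell, Case.scaledTau, Case.scaledSpectral, Case.scaledG, Case.ofParam, Case.group,
    Case.shiftG, Case.shiftH, Grp.sigma, Grp.eps, Grp.typeIII, sub_sub_cancel, h2]
  constructor <;> exact eq_of_test p n x (by decide +kernel)

set_option synthInstance.maxSize 100000 in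
set_option synthInstance.maxHeartbeats 0 in
theorem odeIdentity_IIIb : OdeIdentity .IIIb numAIIIb numBIIIb := by
  intro p n t
  obtain ⟨x, rfl⟩ : ∃ x, t = 1 - x := ⟨1 - t, by ring⟩
  have h2 : (1 : ℝ) - (1 - x) ^ 2 = x * (2 - x) := by ring
  rw [odeForm_thetaA, odeForm_thetaB]
  simp only [Case.first, Case.zeroth,
    numAIIIb, numBIIIb, eval_taylor, eval_derivative_taylor_nil, eval_derivative_taylor_cons,
    eval_derivative2_taylor_nil, eval_derivative2_taylor_cons, hor_nil, hor_cons, Case.g₀, Case.g₁,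
    Case.lam, Grp.ell, Case.scaledTau, Case.scaledSpectral, Case.scaledG, Case.ofParam, Case.group,
    Case.shiftG, Case.shiftH, Grp.sigma, Grp.eps, Grp.typeIII, sub_sub_cancel, h2]
  constructor <;> exact eq_of_test p n x (by decide +kernel)

set_option synthInstance.maxSize 100000 in
set_option synthInstance.maxHeartbeats 0 in
theorem odeIdentity_IVa : OdeIdentity .IVa numAIVa numBIVa := by
  intro p n t
  obtain ⟨x, rfl⟩ : ∃ x, t = 1 - x := ⟨1 - t, by ring⟩
  have h2 : (1 : ℝ) - (1 - x) ^ 2 = x * (2 - x) := by ring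
  rw [odeForm_thetaA, odeForm_thetaB]
  simp only [Case.first, Case.zeroth,
    numAIVa, numBIVa, eval_taylor, eval_derivative_taylor_nil, eval_derivative_taylor_cons,
    eval_derivative2_taylor_nil, eval_derivative2_taylor_cons, hor_nil, hor_cons, Case.g₀, Case.g₁,
    Case.lam, Grp.ell, Case.scaledTau, Case.scaledSpectral, Case.scaledG, Case.ofParam, Case.group,
    Case.shiftG, Case.shiftH, Grp.sigma, Grp.eps, Grp.typeIII, sub_sub_cancel, h2]
  constructor <;> exact eq_of_test p n x (by decide +kernel)

set_option synthInstance.maxSize 100000 in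
set_option synthInstance.maxHeartbeats 0 in
theorem odeIdentity_IVb : OdeIdentity .IVb numAIVb numBIVb := by
  intro p n t
  obtain ⟨x, rfl⟩ : ∃ x, t = 1 - x := ⟨1 - t, by ring⟩
  have h2 : (1 : ℝ) - (1 - x) ^ 2 = x * (2 - x) := by ring
  rw [odeForm_thetaA, odeForm_thetaB]
  simp only [Case.first, Case.zeroth,
    numAIVb, numBIVb, eval_taylor, eval_derivative_taylor_nil, eval_derivative_taylor_cons,
    eval_derivative2_taylor_nil, eval_derivative2_taylor_cons, hor_nil, hor_cons, Case.g₀, Case.g₁,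
    Case.lam, Grp.ell, Case.scaledTau, Case.scaledSpectral, Case.scaledG, Case.ofParam, Case.group,
    Case.shiftG, Case.shiftH, Grp.sigma, Grp.eps, Grp.typeIII, sub_sub_cancel, h2]
  constructor <;> exact eq_of_test p n x (by decide +kernel)

theorem odeIdentity (c : Case) : OdeIdentity c (numA c) (numB c) := by
  cases c
  · exact odeIdentity_Ia
  · exact odeIdentity_Ib
  · exact odeIdentity_IIa
  · exact odeIdentity_IIb
  · exact odeIdentity_IIIa
  · exact odeIdentity_IIIb
  · exact odeIdentity_IVa
  · exact odeIdentity_IVb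

/-! ### The norm identity -/

/-- Case `Ia` of `bdry₀`. -/
def bdry₀Ia (p _n : ℝ) : ℝ[X] :=
  taylor [hor p [34992, -89424, 60048, -5616], hor p [-69984, 178848, -130464, 22752, 4992], hor
    p [52488, -134136, 106272, -27072, -1704, 1080], hor p [-17496, 44712, -38448, 12816, -696,
    -440, 64], hor p [2187, -5589, 5211, -2133, 297, 41, -15, 1]]

/-- Case `Ib` of `bdry₀`. -/
def bdry₀Ib (p n : ℝ) : ℝ[X] :=
  taylor [hor p [51018336, -277766496, 590804928, -611520192, 306599904, -59136480], hor n [hor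
    p [-127545840, 649066608, -1275458400, 1205194464, -546532272, 95275440], hor p [0, 22674816,
    -98257536, 151725312, -95364864, 17200512, 2021760], hor p [0, 0, -10077696, 30233088,
    -28242432, 8087040]], hor n [hor p [127545840, -603716976, 1101303216, -960635376, 393586128,
    -54925776, -3409776, 252720], hor p [0, -45349632, 196515072, -303450624, 190729728,
    -34401024, -4043520], hor p [0, 0, 25194240, -78941952, 77760000, -22519296, -1430784,
    -62208], hor p [0, 0, 0, -4478976, 10450944, -5474304, -497664], hor p [0, 0, 0, 0, 995328,
    -995328]], hor n [hor p [-63772920, 279183672, -477273384, 395672040, -153200808, 14749128,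
    5472360, -713448, -116640], hor p [0, 34012224, -147386304, 231367104, -154384704, 34292160,
    4059072, -1404864, -112320], hor p [0, 0, -22674816, 73903104, -80155008, 30979584, -881280,
    -926208, -24192], hor p [0, 0, 0, 6718464, -16422912, 10948608, -1492992, -193536], hor p [0,
    0, 0, 0, -1492992, 1658880, -387072]], hor n [hor p [15943230, -64127214, 104398632,
    -86692680, 35924148, -4198068, -1873368, 551160, 12222, -11790], hor p [0, -11337408,
    49128768, -79641792, 59019840, -18398016, 243648, 934848, -85824, -11520], hor p [0, 0,
    8817984, -29813184, 35816256, -17993664, 2939328, 328896, -92736, -2880], hor p [0, 0, 0,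
    -3359232, 8584704, -6718464, 1907712, -96768, -23040], hor p [0, 0, 0, 0, 746496, -912384,
    359424, -46080]], hor n [hor p [-1594323, 5845851, -9290376, 8293104, -4283118, 1048302,
    58968, -92952, 13401, 1503, -360], hor p [0, 1417176, -6141096, 10427616, -8794656, 3728592,
    -584496, -88992, 37728, -1512, -360], hor p [0, 0, -1259712, 4408992, -5824224, 3538080,
    -961632, 55008, 21600, -2592, -96], hor p [0, 0, 0, 559872, -1492992, 1306368, -497664, 76032,
    0, -768], hor p [0, 0, 0, 0, -124416, 165888, -82944, 18432, -1536]]]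

/-- Case `IIa` of `bdry₀`. -/
def bdry₀IIa (p _n : ℝ) : ℝ[X] :=
  taylor [hor p [-104976, -11664, 47952, -5040], hor p [209952, -34992, -60912, 22896, -7920],
    hor p [-157464, 69984, 15552, -16848, 7128, -1296], hor p [52488, -37908, 6156, 2952, -2256,
    652, -68], hor p [-6561, 6561, -2349, 189, 189, -93, 17, -1]]

/-- Case `IIb` of `bdry₀`. -/
def bdry₀IIb (p _n : ℝ) : ℝ[X] :=
  taylor [hor p [-34992, -66096, -39312, -7056], hor p [69984, 66096, 9072, 1296, 1008], hor p
    [-52488, 0, 10368, -5616, 1800, -144], hor p [17496, -16524, 2484, 2232, -1488, 468, -60], hor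
    p [-2187, 4131, -2511, 567, 63, -87, 27, -3]]

/-- Case `IIIa` of `bdry₀`. -/
def bdry₀IIIa (p _n : ℝ) : ℝ[X] :=
  taylor [hor p [34992, -66096, 39312, -7056], hor p [-69984, 69984, -9504, -2016], hor p
    [52488, -5832, -15552, -3744, -456, -24], hor p [-17496, -13608, 3024, 5040, 1416, 120], hor p
    [2187, 3645, 1107, -891, -711, -193, -23, -1]]

/-- Case `IIIb` of `bdry₀`. -/
def bdry₀IIIb (p n : ℝ) : ℝ[X] :=
  taylor [hor n [hor p [25194240, -34152192, 8335872, 3442176, -684288, -145152], hor p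
    [25194240, -56547072, 28740096, 2612736, -1845504, -145152], hor p [6718464, -31352832,
    26625024, -1907712, -1161216, -27648], hor p [0, -5971968, 9953280, -1990656, -221184], hor p
    [0, 0, 1327104, -442368]], hor n [hor p [-62985600, 62460720, 1714608, -7951392, -1067040,
    -77328, -15120], hor p [-62985600, 118972800, -29051136, -17812224, -1468800, -24192], hor p
    [-16796160, 72783360, -41306112, -10685952, 276480, 110592, 4608], hor p [0, 14929920,
    -19906560, -1990656, 442368, 36864], hor p [0, 0, -3317760, 0, 73728]], hor n [hor p
    [62985600, -39540960, -17970336, 5291136, 3606336, 617760, 25056, -1728], hor p [62985600,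
    -96577920, -7682688, 20663424, 6867072, 1040256, 93312, 3456], hor p [16796160, -67184640,
    17356032, 20024064, 4368384, 539136, 39168, 768], hor p [0, -14929920, 14929920, 7796736,
    1161216, 129024, 6144], hor p [0, 0, 3317760, 1105920, 110592, 12288]], hor n [hor p
    [-31492800, 8310600, 13963752, 66744, -2385288, -855432, -152808, -15480, -696], hor p
    [-31492800, 37091520, 19175616, -7542720, -5790528, -1342656, -139968, -5184], hor p
    [-8398080, 30792960, 2643840, -11715840, -5277312, -1057536, -109440, -5376, -128], hor p [0,
    7464960, -4976640, -6220800, -2045952, -350208, -30720, -1024], hor p [0, 0, -1658880,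
    -1105920, -276480, -36864, -2048]], hor n [hor p [7873200, 787320, -3948264, -1135080, 427896,
    232776, 28424, -1720, -584, -32], hor p [7873200, -6473520, -7869312, 134784, 1867104, 699552,
    119040, 11264, 624, 16], hor p [2099520, -6998400, -3328128, 2636928, 2225664, 643968, 92288,
    6528, 192], hor p [0, -1866240, 622080, 1990656, 1022976, 235008, 26112, 1024], hor p [0, 0,
    414720, 414720, 156672, 27648, 2048]], hor n [hor p [-787320, -365229, 361827, 278856, 19656,
    -38826, -17626, -3792, -472, -33, -1], hor p [-787320, 367416, 1018656, 266976, -194832,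
    -138096, -36192, -4768, -312, -8], hor p [-209952, 629856, 583200, -165024, -320544, -131040,
    -23968, -2016, -64], hor p [0, 186624, 0, -228096, -165888, -48384, -6144, -256], hor p [0, 0,
    -41472, -55296, -27648, -6144, -512]]]

/-- Case `IVa` of `bdry₀`. -/
def bdry₀IVa (p n : ℝ) : ℝ[X] :=
  taylor [hor p [102036672, 555532992, 1181609856, 1223040384, 613199808, 118272960], hor n [hor
    p [-306110016, -1689273792, -3668281344, -3931701120, -2111386176, -491085504, -26282880], hor
    p [0, -45349632, -246903552, -464693760, -362174976, -103078656, -4043520], hor p [0, 0,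
    -20155392, -60466176, -56484864, -16174080]], hor n [hor p [382637520, 2139935760, 4786590672,
    5418266256, 3211071984, 912937392, 93922416, 3083184], hor p [0, 113374080, 655050240,
    1354050432, 1226990592, 458317440, 44914176, 1213056], hor p [0, 0, 60466176, 227308032,
    297354240, 140838912, 10450944, 124416], hor p [0, 0, 0, 8957952, 30855168, 22892544, 995328],
    hor p [0, 0, 0, 0, 1990656, 1990656]], hor n [hor p [-255091680, -1445519520, -3356502624,
    -4088395296, -2758792608, -992380896, -167176224, -11516256, -248832], hor p [0, -113374080,
    -692841600, -1562322816, -1627952256, -785946240, -150933888, -10309248, -224640], hor p [0,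
    0, -70543872, -306529920, -479841408, -298812672, -60362496, -3466368, -51840], hor p [0, 0,
    0, -17915904, -64447488, -56208384, -11418624, -414720], hor p [0, 0, 0, 0, -3981312,
    -4589568, -829440]], hor n [hor p [95659380, 549155700, 1332460368, 1773219600, 1391610456,
    640422936, 163217808, 21492432, 1377108, 34452], hor p [0, 56687040, 365316480, 893275776,
    1057193856, 634811904, 186164352, 25411968, 1544832, 32832], hor p [0, 0, 40310784, 194415552,
    344756736, 261185472, 83593728, 10942272, 543744, 7488], hor p [0, 0, 0, 13436928, 50388480,
    50347008, 17086464, 1981440, 59904], hor p [0, 0, 0, 0, 2985984, 3898368, 1327104, 119808]],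
    hor n [hor p [-19131876, -111248316, -283592664, -416719728, -383218776, -222067656,
    -78606720, -16260912, -1850148, -105948, -2376], hor p [0, -14171760, -96053040, -253342080,
    -336545280, -242753760, -96012000, -20459520, -2229120, -114480, -2160], hor p [0, 0,
    -11337408, -59276448, -115901280, -102511008, -44130528, -9358560, -920352, -38112, -480], hor
    p [0, 0, 0, -4478976, -17480448, -19636992, -9082368, -1857024, -151296, -3840], hor p [0, 0,
    0, 0, -995328, -1451520, -705024, -133632, -7680]], hor n [hor p [1594323, 9388791, 25253289,
    41218389, 44263422, 31415526, 14415570, 4165290, 731295, 73683, 3861, 81], hor p [0, 1417176,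
    10077696, 28535976, 42099264, 35493552, 17692992, 5246352, 904896, 85752, 4032, 72], hor p [0,
    0, 1259712, 7033392, 14922144, 15013728, 8065440, 2420928, 401120, 34208, 1312, 16], hor p [0,
    0, 0, 559872, 2270592, 2827008, 1634688, 490752, 75904, 5376, 128], hor p [0, 0, 0, 0, 124416,
    200448, 124416, 36864, 5120, 256]]]

/-- Case `IVb` of `bdry₀`. -/
def bdry₀IVb (p n : ℝ) : ℝ[X] :=
  taylor [hor n [hor p [-102036672, -374134464, -456015744, -206312832, -30932928, -1460160],
    hor p [-90699264, -413185536, -571069440, -256545792, -30094848, -898560], hor p [-20155392,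
    -150045696, -264757248, -121651200, -9925632, -138240], hor p [0, -17915904, -53747712,
    -26320896, -1105920], hor p [0, 0, -3981312, -2211840]], hor n [hor p [306110016, 1205544384,
    1646023680, 903913344, 182274624, 15171264, 444288], hor p [272097792, 1315139328, 2030655744,
    1138033152, 194586624, 12586752, 269568], hor p [60466176, 466933248, 913337856, 544444416,
    75561984, 3525120, 41472], hor p [0, 53747712, 176173056, 118444032, 12275712, 331776], hor p
    [0, 0, 11943936, 9953280, 663552]], hor n [hor p [-382637520, -1610856720, -2438487504,
    -1594527120, -445801968, -59763888, -3819120, -93360], hor p [-340122240, -1738402560,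
    -2967041664, -2013486336, -514823040, -57537792, -2825088, -49920], hor p [-75582720,
    -604661760, -1297783296, -955245312, -222835968, -19929600, -697344, -6912], hor p [0,
    -67184640, -238878720, -203876352, -42854400, -2764800, -55296], hor p [0, 0, -14929920,
    -16588800, -3096576, -110592]], hor n [hor p [255091680, 1143188640, 1901955168, 1451771424,
    529299360, 100262880, 10177056, 524640, 10752], hor p [226748160, 1221920640, 2285117568,
    1829319552, 642066048, 109593216, 9680256, 426624, 7296], hor p [50388480, 417104640,
    974115072, 854907264, 291233664, 44545536, 3423232, 122240, 1408], hor p [0, 44789760,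
    171694080, 177444864, 59028480, 7842816, 496640, 11264], hor p [0, 0, 9953280, 13824000,
    4534272, 497664, 22528]], hor n [hor p [-95659380, -454677300, -825216336, -722339856,
    -326402136, -80694936, -11284368, -885712, -36180, -596], hor p [-85030560, -481839840,
    -980055936, -905779584, -406793664, -95874624, -12477312, -895872, -32928, -480], hor p
    [-18895680, -161663040, -407960064, -416000448, -187837056, -42071616, -5070336, -333632,
    -10816, -128], hor p [0, -16796160, -69050880, -83731968, -38568960, -8114688, -873984,
    -48640, -1024], hor p [0, 0, -3732480, -6220800, -2985984, -580608, -52224, -2048]], hor n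
    [hor p [19131876, 96131772, 189114264, 186985584, 101167704, 31460040, 5737728, 608816, 35620,
    988, 8], hor p [17006112, 101091888, 222234192, 233000064, 127490112, 38767968, 6784032,
    694016, 40736, 1264, 16], hor p [3779136, 33382368, 90489312, 105113376, 59077728, 17551584,
    2876064, 259936, 11488, 192], hor p [0, 3359232, 14743296, 20507904, 12096000, 3511296,
    529152, 40192, 1024], hor p [0, 0, 746496, 1451520, 926208, 262656, 35328, 2048]], hor n [hor
    p [-1594323, -8444007, -17904969, -19744965, -12495870, -4805190, -1163538, -182154, -18847,
    -1283, -53, -1], hor p [-1417176, -8817984, -20837736, -24432192, -15739056, -5897664,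
    -1314576, -173248, -13048, -512, -8], hor p [-314928, -2869344, -8312544, -10830240, -7262784,
    -2688480, -556064, -61408, -3216, -64], hor p [0, -279936, -1306368, -2049408, -1472256,
    -544896, -104704, -9344, -256], hor p [0, 0, -62208, -138240, -110592, -41472, -7424, -512]]]

/-- The coefficient of `J²` in the boundary term of the norm integral. -/
def bdry₀ : Case → ℝ → ℝ → ℝ[X]
  | .Ia => bdry₀Ia
  | .Ib => bdry₀Ib
  | .IIa => bdry₀IIa
  | .IIb => bdry₀IIb
  | .IIIa => bdry₀IIIa
  | .IIIb => bdry₀IIIb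
  | .IVa => bdry₀IVa
  | .IVb => bdry₀IVb

/-- Case `Ia` of `bdry₁`. -/
def bdry₁Ia (p _n : ℝ) : ℝ[X] :=
  taylor [hor p [-279936, 186624, -17280], hor p [699840, -575424, 60480, 36288], hor p
    [-699840, 684288, -106272, -58176, 11040], hor p [349920, -396576, 90288, 31824, -12816, 848],
    hor p [-87480, 112752, -35424, -6336, 4872, -688, 16], hor p [8748, -12636, 5184, 216, -612,
    132, -8]]

/-- Case `Ib` of `bdry₁`. -/
def bdry₁Ib (p n : ℝ) : ℝ[X] :=
  taylor [0, hor p [0, 45349632, -181398528, 263139840, -163482624, 36391680], hor n [hor p [0,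
    -113374080, 415704960, -546994944, 310355712, -67713408, 2021760], hor p [0, 0, 10077696,
    -29113344, 25380864, -5723136, -622080], hor p [0, 0, 0, -4478976, 6967296, -2488320]], hor n
    [hor p [0, 113374080, -377913600, 450766944, -232253568, 46395072, -1164672, -88992], hor p
    [0, 0, -20155392, 58786560, -52379136, 12856320, 926208, -34560], hor p [0, 0, 0, 10077696,
    -17169408, 7105536, 193536, 13824], hor p [0, 0, 0, 0, -995328, 1327104, 110592], hor p [0, 0,
    0, 0, 0, 221184]], hor n [hor p [0, -56687040, 170061120, -184582800, 87794928, -15051744,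
    -1016928, 342576, 24624], hor p [0, 0, 15116544, -44509824, 42083712, -13125888, -497664,
    459648, 31104], hor p [0, 0, 0, -8398080, 15863040, -9123840, 718848, 269568, 6912], hor p [0,
    0, 0, 0, 1492992, -2488320, 497664, 55296], hor p [0, 0, 0, 0, 0, -331776, 110592]], hor n
    [hor p [0, 14171760, -37791360, 37773864, -17694288, 3083832, 576288, -282024, 9648, 4824],
    hor p [0, 0, -5038848, 14976576, -15489792, 6765120, -601344, -316224, 43776, 4800], hor p [0,
    0, 0, 3079296, -6469632, 5132160, -1299456, -65664, 39936, 1152], hor p [0, 0, 0, 0, -746496,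
    1492992, -663552, 55296, 9216], hor p [0, 0, 0, 0, 0, 165888, -110592, 18432]], hor n [hor p
    [0, -1417176, 3306744, -3123036, 1641708, -483516, 4428, 49644, -11324, -508, 268], hor p [0,
    0, 629856, -1889568, 2185056, -1350432, 368928, 10656, -21984, 1696, 256], hor p [0, 0, 0,
    -419904, 979776, -1017792, 451008, -59328, -9536, 1984, 64], hor p [0, 0, 0, 0, 124416,
    -290304, 193536, -46080, 1536, 512], hor p [0, 0, 0, 0, 0, -27648, 27648, -9216, 1024]]]

/-- Case `IIa` of `bdry₁`. -/
def bdry₁IIa (p _n : ℝ) : ℝ[X] :=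
  taylor [hor p [-279936, 186624, -17280], hor p [699840, -513216, 157248, -48960], hor p
    [-699840, 559872, -247968, 96192, -12384], hor p [349920, -303264, 157680, -68976, 15024,
    -880], hor p [-87480, 81648, -44928, 21312, -6072, 720, -16], hor p [8748, -8748, 4752, -2376,
    828, -140, 8]]

/-- Case `IIb` of `bdry₁`. -/
def bdry₁IIb (p _n : ℝ) : ℝ[X] :=
  taylor [0, hor p [0, 31104, 34560, 8064], hor p [0, -62208, -21600, 5184, -1248], hor p [0,
    46656, -19440, -1296, 2160, -432], hor p [0, -15552, 18360, -6624, 816, -96, 24], hor p [0,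
    1944, -3780, 2484, -792, 176, -36, 4]]

/-- Case `IIIa` of `bdry₁`. -/
def bdry₁IIIa (p _n : ℝ) : ℝ[X] :=
  taylor [0, hor p [0, 31104, -34560, 8064], hor p [0, -62208, 23328, 6336, 672], hor p [0,
    46656, 16848, -5040, -3408, -528], hor p [0, -15552, -17064, -3744, 1392, 608, 56], hor p [0,
    1944, 3564, 1836, 72, -192, -52, -4]]

/-- Case `IIIb` of `bdry₁`. -/
def bdry₁IIIb (p n : ℝ) : ℝ[X] :=
  taylor [hor n [hor p [37511424, -29611008, -594432, 3234816, 407808], hor p [35831808,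
    -63700992, 13271040, 7077888, 442368], hor p [8957952, -39813120, 21012480, 4423680, 110592],
    hor p [0, -7962624, 10616832, 884736], hor p [0, 0, 1769472]], hor n [hor p [-112534272,
    70077312, 16588800, -9407232, -2840832, -203904], hor p [-107495424, 172440576, -7464960,
    -26873856, -5142528, -248832], hor p [-26873856, 114960384, -42799104, -23556096, -2654208,
    -55296], hor p [0, 23887872, -27869184, -7962624, -442368], hor p [0, 0, -5308416, -884736]],
    hor n [hor p [140667840, -64152000, -36583488, 8878464, 5931072, 737856, 9792], hor p
    [134369280, -192222720, -27744768, 35748864, 11142144, 981504, 26112], hor p [33592320,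
    -138101760, 28947456, 38817792, 7566336, 463872, 9216], hor p [0, -29859840, 29859840,
    15925248, 1990656, 73728], hor p [0, 0, 6635520, 2211840, 147456]], hor n [hor p [-93778560,
    27138240, 33181056, -2058912, -4819968, -1038080, -102912, -6688], hor p [-89579520,
    112596480, 40974336, -21904128, -10639872, -1393152, -58880, -256], hor p [-22394880,
    88335360, -3428352, -29846016, -8709120, -868352, -31744, -512], hor p [0, 19906560,
    -16588800, -14155776, -2838528, -196608, -4096], hor p [0, 0, -4423680, -2211840, -294912,
    -8192]], hor n [hor p [35166960, -4315680, -15075072, -1502928, 1670544, 489792, 38496, -2640,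
    -480], hor p [33592320, -36391680, -22954752, 6189696, 5208192, 981504, 75264, 3712, 128], hor
    p [8398080, -31726080, -4478976, 11840256, 4928256, 698880, 40960, 1280], hor p [0, -7464960,
    4976640, 6469632, 1824768, 184320, 6144], hor p [0, 0, 1658880, 1105920, 221184, 12288]], hor
    n [hor p [-7033392, -309096, 3408480, 941112, -209808, -100680, -8256, 136, -96, -16], hor p
    [-6718464, 6111936, 5940864, -565056, -1275264, -349632, -44160, -3520, -128], hor p
    [-1679616, 6065280, 2011392, -2332800, -1370880, -262272, -21760, -896], hor p [0, 1492992,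
    -746496, -1492992, -552960, -73728, -3072], hor p [0, 0, -331776, -276480, -73728, -6144]],
    hor n [hor p [586116, 123444, -305748, -148932, 1476, 17908, 6756, 1428, 168, 8], hor p
    [559872, -412128, -593568, -31968, 122976, 50016, 8992, 864, 32], hor p [139968, -482112,
    -257472, 177984, 150336, 37696, 4032, 192], hor p [0, -124416, 41472, 138240, 64512, 10752,
    512], hor p [0, 0, 27648, 27648, 9216, 1024]]]

/-- Case `IVa` of `bdry₁`. -/
def bdry₁IVa (p n : ℝ) : ℝ[X] :=
  taylor [0, hor p [0, -90699264, -362797056, -526279680, -326965248, -72783360], hor n [hor p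
    [0, 272097792, 1063196928, 1518372864, 955639296, 240496128, 12130560], hor p [0, 0, 20155392,
    80621568, 90077184, 30855168, 1244160], hor p [0, 0, 0, 8957952, 13934592, 4976640]], hor n
    [hor p [0, -340122240, -1297503360, -1836940032, -1191594240, -343896192, -32787072, -926208],
    hor p [0, 0, -50388480, -208272384, -255052800, -113467392, -11294208, -304128], hor p [0, 0,
    0, -24634368, -48771072, -32292864, -2433024, -27648], hor p [0, 0, 0, 0, -1990656, -4866048,
    -221184], hor p [0, 0, 0, 0, 0, -442368]], hor n [hor p [0, 226748160, 844007040, 1193647104,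
    821207808, 287794944, 45740160, 2806272, 41472], hor p [0, 0, 50388480, 214990848, 290884608,
    170864640, 36453888, 2543616, 55296], hor p [0, 0, 0, 26873856, 63825408, 60272640, 14681088,
    884736, 13824], hor p [0, 0, 0, 0, 3981312, 10727424, 2875392, 110592], hor p [0, 0, 0, 0, 0,
    884736, 221184]], hor n [hor p [0, -85030560, -308629440, -439639488, -332439552, -150600384,
    -39213504, -5358528, -355968, -9504], hor p [0, 0, -25194240, -110854656, -166344192,
    -125971200, -43773696, -6736896, -445440, -9984], hor p [0, 0, 0, -14556672, -39999744,
    -48377088, -19865088, -3013632, -162048, -2304], hor p [0, 0, 0, 0, -2985984, -8792064,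
    -4147200, -571392, -18432], hor p [0, 0, 0, 0, 0, -663552, -331776, -36864]], hor n [hor p [0,
    17006112, 60151248, 87060096, 74999520, 45194112, 17623872, 3955968, 468384, 27360, 624], hor
    p [0, 0, 6298560, 28553472, 47558016, 44914176, 21758976, 5218560, 594048, 30720, 576], hor p
    [0, 0, 0, 3919104, 12161664, 17763840, 10081152, 2444544, 248192, 10240, 128], hor p [0, 0, 0,
    0, 995328, 3179520, 2101248, 497664, 40960, 1024], hor p [0, 0, 0, 0, 0, 221184, 165888,
    36864, 2048]], hor n [hor p [0, -1417176, -4881384, -7243344, -7321104, -5806080, -3055968,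
    -931248, -150384, -11304, -312], hor p [0, 0, -629856, -2939328, -5427648, -6194880, -3825792,
    -1224000, -192576, -12864, -288], hor p [0, 0, 0, -419904, -1446336, -2458944, -1757376,
    -577728, -85312, -4544, -64], hor p [0, 0, 0, 0, -124416, -428544, -359424, -119808, -15872,
    -512], hor p [0, 0, 0, 0, 0, -27648, -27648, -9216, -1024]]]

/-- Case `IVb` of `bdry₁`. -/
def bdry₁IVb (p n : ℝ) : ℝ[X] :=
  taylor [0, hor n [hor p [0, 43670016, 138848256, 124001280, 22947840, 1202688], hor p [0,
    40310784, 161243136, 164229120, 22781952, 718848], hor p [0, 8957952, 61710336, 83386368,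
    7741440, 110592], hor p [0, 0, 7962624, 19464192, 884736], hor p [0, 0, 0, 1769472]], hor n
    [hor p [0, -131010048, -435020544, -435456000, -129765888, -15929856, -701184], hor p [0,
    -120932352, -503138304, -570986496, -149409792, -14100480, -387072], hor p [0, -26873856,
    -189609984, -280682496, -64696320, -4313088, -55296], hor p [0, 0, -23887872, -62373888,
    -12386304, -442368], hor p [0, 0, 0, -5308416, -884736]], hor n [hor p [0, 163762560,
    566870400, 625874688, 244083456, 42309504, 3181440, 79872], hor p [0, 151165440, 653184000,
    814593024, 299704320, 43872768, 2528256, 49152], hor p [0, 33592320, 242611200, 389753856,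
    137687040, 16911360, 740352, 9216], hor p [0, 0, 29859840, 82944000, 28311552, 2727936,
    73728], hor p [0, 0, 0, 6635520, 2211840, 147456]], hor n [hor p [0, -109175040, -393310080,
    -473112576, -222511104, -48211200, -4898688, -218624, -3328], hor p [0, -100776960,
    -451630080, -612292608, -283295232, -55655424, -4761600, -159744, -1536], hor p [0, -22394880,
    -165473280, -286267392, -133028352, -23721984, -1710080, -47104, -512], hor p [0, 0,
    -19906560, -58613760, -27869184, -4386816, -237568, -4096], hor p [0, 0, 0, -4423680,
    -2211840, -294912, -8192]], hor n [hor p [0, 40940640, 153264960, 198925632, 108335232,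
    28142784, 3554880, 195136, 1536, -160], hor p [0, 37791360, 175426560, 256317696, 140790528,
    34677504, 3976704, 212224, 6912, 128], hor p [0, 8398080, 63452160, 117448704, 66624768,
    15503616, 1546752, 64000, 1280], hor p [0, 0, 7464960, 23224320, 13989888, 3041280, 245760,
    6144], hor p [0, 0, 0, 1658880, 1105920, 221184, 12288]], hor n [hor p [0, -8188128,
    -31807728, -44198784, -27244512, -8386560, -1336704, -113152, -6560, -416, -16], hor p [0,
    -7558272, -36298368, -56754432, -35752320, -10600704, -1548672, -116992, -5760, -128], hor p
    [0, -1679616, -12970368, -25546752, -16930944, -4840704, -617088, -33280, -896], hor p [0, 0,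
    -1492992, -4893696, -3538944, -976896, -104448, -3072], hor p [0, 0, 0, -331776, -276480,
    -73728, -6144]], hor n [hor p [0, 682344, 2746872, 4060368, 2793744, 1018656, 215040, 30128,
    3312, 248, 8], hor p [0, 629856, 3125952, 5199552, 3672000, 1275264, 229440, 22336, 1344, 32],
    hor p [0, 139968, 1104192, 2303424, 1733184, 585792, 91072, 5952, 192], hor p [0, 0, 124416,
    428544, 359424, 119808, 15872, 512], hor p [0, 0, 0, 27648, 27648, 9216, 1024]]]

/-- The coefficient of `J J'` in the boundary term of the norm integral. -/
def bdry₁ : Case → ℝ → ℝ → ℝ[X]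
  | .Ia => bdry₁Ia
  | .Ib => bdry₁Ib
  | .IIa => bdry₁IIa
  | .IIb => bdry₁IIb
  | .IIIa => bdry₁IIIa
  | .IIIb => bdry₁IIIb
  | .IVa => bdry₁IVa
  | .IVb => bdry₁IVb

/-- Case `Ia` of `bdry₂`. -/
def bdry₂Ia (p _n : ℝ) : ℝ[X] :=
  taylor [0, hor p [0, -124416, 69120], hor p [0, 311040, -207360, 25344], hor p [0, -311040,
    241920, -51840, 2688], hor p [0, 155520, -138240, 39744, -3840, 64], hor p [0, -38880, 38880,
    -13536, 1824, -64], hor p [0, 3888, -4320, 1728, -288, 16]]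

/-- Case `Ib` of `bdry₂`. -/
def bdry₂Ib (p _n : ℝ) : ℝ[X] :=
  taylor [0, 0, hor p [0, 0, 10077696, -25754112, 21275136, -5598720], hor p [0, 0, -25194240,
    56547072, -42114816, 11384064, -622080], hor p [0, 0, 25194240, -48708864, 32161536, -8481024,
    732672, -13824], hor p [0, 0, -12597120, 20435328, -11664000, 2778624, -224640, -8064, 1920],
    hor p [0, 0, 3149280, -4129056, 1951776, -360288, -11232, 16416, -2592, 96], hor p [0, 0,
    -314928, 314928, -112752, 9072, 9072, -4464, 816, -48]]

/-- Case `IIa` of `bdry₂`. -/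
def bdry₂IIa (p _n : ℝ) : ℝ[X] :=
  taylor [0, hor p [0, 124416, -69120], hor p [0, -311040, 207360, -25344], hor p [0, 311040,
    -241920, 51840, -2688], hor p [0, -155520, 138240, -39744, 3840, -64], hor p [0, 38880,
    -38880, 13536, -1824, 64], hor p [0, -3888, 4320, -1728, 288, -16]]

/-- Case `IIb` of `bdry₂`. -/
def bdry₂IIb (p _n : ℝ) : ℝ[X] :=
  taylor [0, 0, hor p [0, 0, -6912, -2304], hor p [0, 0, 13824, -3456, 384], hor p [0, 0,
    -10368, 8640, -2688, 320], hor p [0, 0, 3456, -4896, 2400, -480, 32], hor p [0, 0, -432, 864,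
    -576, 160, -16]]

/-- Case `IIIa` of `bdry₂`. -/
def bdry₂IIIa (p _n : ℝ) : ℝ[X] :=
  taylor [0, 0, hor p [0, 0, 6912, -2304], hor p [0, 0, -13824, -3456, -384], hor p [0, 0,
    10368, 8640, 2688, 320], hor p [0, 0, -3456, -4896, -2400, -480, -32], hor p [0, 0, 432, 864,
    576, 160, 16]]

/-- Case `IIIb` of `bdry₂`. -/
def bdry₂IIIb (p _n : ℝ) : ℝ[X] :=
  taylor [0, hor p [0, 746496, 580608, -193536, -27648], hor p [0, -2239488, -2156544, -110592,
    239616, 39936], hor p [0, 2799360, 3214080, 919296, -154368, -78336, -9216], hor p [0,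
    -1866240, -2488320, -1078272, -117504, 8448, -4352, -1792], hor p [0, 699840, 1062720, 558144,
    134208, 28992, 9408, 1216, -64], hor p [0, -139968, -238464, -138240, -38592, -8640, -1536,
    128, 64], hor p [0, 11664, 22032, 13392, 3024, -336, -464, -144, -16]]

/-- Case `IVa` of `bdry₂`. -/
def bdry₂IVa (p _n : ℝ) : ℝ[X] :=
  taylor [0, 0, hor p [0, 0, 20155392, 51508224, 42550272, 11197440], hor p [0, 0, -60466176,
    -138848256, -105504768, -28366848, -1244160], hor p [0, 0, 75582720, 153964800, 106437888,
    28346112, 2087424, 27648], hor p [0, 0, -50388480, -89579520, -55489536, -14038272, -1181952,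
    2304, 3840], hor p [0, 0, 18895680, 28693440, 15567552, 3499200, 202176, -40896, -7104, -192],
    hor p [0, 0, -3779136, -4758912, -2177280, -378432, 29376, 25344, 4224, 192], hor p [0, 0,
    314928, 314928, 112752, 9072, -9072, -4464, -816, -48]]

/-- Case `IVb` of `bdry₂`. -/
def bdry₂IVb (p _n : ℝ) : ℝ[X] :=
  taylor [0, 0, hor p [0, 0, 746496, 580608, -193536, -27648], hor p [0, 0, -2239488, -2156544,
    -110592, 239616, 39936], hor p [0, 0, 2799360, 3214080, 919296, -154368, -78336, -9216], hor p
    [0, 0, -1866240, -2488320, -1078272, -117504, 8448, -4352, -1792], hor p [0, 0, 699840,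
    1062720, 558144, 134208, 28992, 9408, 1216, -64], hor p [0, 0, -139968, -238464, -138240,
    -38592, -8640, -1536, 128, 64], hor p [0, 0, 11664, 22032, 13392, 3024, -336, -464, -144,
    -16]]

/-- The coefficient of `J'²` in the boundary term of the norm integral. -/
def bdry₂ : Case → ℝ → ℝ → ℝ[X]
  | .Ia => bdry₂Ia
  | .Ib => bdry₂Ib
  | .IIa => bdry₂IIa
  | .IIb => bdry₂IIb
  | .IIIa => bdry₂IIIa
  | .IIIb => bdry₂IIIb
  | .IVa => bdry₂IVa
  | .IVb => bdry₂IVb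

/-- The factor `p (E_n - Ẽ)` for a seed, in the parameter `p`. -/
def Case.seedDiff (c : Case) (p n : ℝ) : SeedType × ℕ → ℝ
  | (.I, v) => 4 * (p * n + c.scaledG p + p * v + p / 2) * (n + c.ofParam p - v - 1 / 2)
  | (.II, v) => 4 * (p * n + c.scaledG p - p * v - p / 2) * (n + c.ofParam p + v + 1 / 2)
  | (.III, v) => 4 * (n + v + 1) * (p * n + c.scaledG p + p * c.ofParam p - p * v - p)

/-- The order by which `g` may be smaller than `ḡ`. -/
def Case.lowG : Case → ℕ
  | .IIIb => 1
  | _ => 0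

/-- The order by which `h` may be smaller than `h̄`. -/
def Case.lowH : Case → ℕ
  | .Ib => 1
  | _ => 0

/-- The difference `g - ḡ`, increased by `lowG`. -/
def Case.powG : Case → ℕ
  | .Ia => 0 | .Ib => 3 | .IIa => 0 | .IIb => 2 | .IIIa => 2 | .IIIb => 0 | .IVa => 3 | .IVb => 1

/-- The difference `h - h̄`, increased by `lowH`. -/
def Case.powH : Case → ℕ
  | .Ia => 2 | .Ib => 0 | .IIa => 2 | .IIb => 0 | .IIIa => 0 | .IIIb => 3 | .IVa => 1 | .IVb => 3

/-- The factor of the transformed square in the norm identity. -/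
def Case.normRho (c : Case) (p : ℝ) : ℝ :=
  match c with
  | .Ia => -1 / 4 | .Ib => -1 / 4 | .IIa => 1 / 4 | .IIb => -1 / 36 | .IIIa => 1 / 36
  | .IIIb => p / 4 | .IVa => -1 / 4 | .IVb => 1 / 4

/-- The factor of the original square in the norm identity. -/
def Case.normTheta (c : Case) (p : ℝ) : ℝ :=
  match c with
  | .Ia => 64 | .Ib => 256 * p ^ 3 | .IIa => -64 | .IIb => 64 / 9 * p ^ 2
  | .IIIa => -64 / 9 * p ^ 2 | .IIIb => -256 | .IVa => 256 * p ^ 3 | .IVb => -256 * p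

/-- The scaled logarithmic derivative of the weight, times `1 - t²`. -/
def Case.weightTau (c : Case) (p t : ℝ) : ℝ :=
  (p * (c.ofParam p + c.shiftH) + p / 2 - p * c.lowH) * (1 - t) -
    (c.scaledG p + p * c.shiftG + p / 2 - p * c.lowG) * (1 + t)

/-- The scaled derivative of the boundary term: `F` and `D` are a coefficient and the
corresponding coefficient of the derivative. -/
def normForm (c : Case) (p t F D : ℝ) : ℝ :=
  -- This is the derivative of (1 - t²) w F/ℓ³, multiplied by 2pℓ⁴/w; the subtracted term comes from
  -- the denominator ℓ³.
  c.group.ell p t * (c.weightTau p t * F + D) -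
    3 * (p - c.group.sigma) * p * (1 - t ^ 2) * F

/-- The difference of the squares of the original and the transformed eigenfunction is a
derivative. -/
def NormIdentity (c : Case) (A B F₀ F₁ F₂ : ℝ → ℝ → ℝ[X]) : Prop := ∀ p n t : ℝ,
  -- The three equations are the coefficients of J², JJ' and J'². The square of J with the energy
  -- product enters the first one only.
  normForm c p t ((F₀ p n).eval t) (p * (1 - t ^ 2) * (derivative (F₀ p n)).eval t -
      c.lam p n * (F₁ p n).eval t) =
    c.normRho p * ((1 - t) ^ c.lowG * (1 + t) ^ c.lowH) * (A p n).eval t ^ 2 +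
    c.normTheta p * ((1 - t) ^ c.powG * (1 + t) ^ c.powH) * (c.group.ell p t / 2) ^ 4 *
      ((seeds c).map (c.seedDiff p n)).prod ∧
  normForm c p t ((F₁ p n).eval t)
      (p * (1 - t ^ 2) * (2 * (F₀ p n).eval t + (derivative (F₁ p n)).eval t) +
        (c.g₀ p + c.g₁ p * t) * (F₁ p n).eval t - 2 * c.lam p n * (F₂ p n).eval t) =
    2 * (c.normRho p * ((1 - t) ^ c.lowG * (1 + t) ^ c.lowH)) * (A p n).eval t *
      (B p n).eval t ∧
  normForm c p t ((F₂ p n).eval t)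
      (p * (1 - t ^ 2) * ((F₁ p n).eval t + (derivative (F₂ p n)).eval t) +
        2 * (c.g₀ p + c.g₁ p * t) * (F₂ p n).eval t) =
    c.normRho p * ((1 - t) ^ c.lowG * (1 + t) ^ c.lowH) * (B p n).eval t ^ 2

set_option synthInstance.maxSize 100000 in
set_option synthInstance.maxHeartbeats 0 in
theorem normIdentity_Ia : NormIdentity .Ia numAIa numBIa bdry₀Ia bdry₁Ia bdry₂Ia := by
  intro p n t
  obtain ⟨x, rfl⟩ : ∃ x, t = 1 - x := ⟨1 - t, by ring⟩
  have h1 : (1 : ℝ) + (1 - x) = 2 - x := by ring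
  have h2 : (1 : ℝ) - (1 - x) ^ 2 = x * (2 - x) := by ring
  simp only [normForm, numAIa, numBIa, bdry₀Ia, bdry₁Ia, bdry₂Ia, eval_taylor,
    eval_derivative_taylor_nil, eval_derivative_taylor_cons, hor_nil, hor_cons, Case.g₀, Case.g₁,
    Case.lam, Grp.ell, Case.weightTau, Case.scaledG, Case.ofParam, Case.group, Case.shiftG,
    Case.shiftH, Grp.sigma, Grp.eps, Case.lowG, Case.lowH, Case.powG, Case.powH, Case.normRho,
    Case.normTheta, seeds, List.map_cons, List.map_nil, List.prod_cons, List.prod_nil,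
    Case.seedDiff, Nat.cast_zero, Nat.cast_one, Nat.cast_ofNat, sub_sub_cancel, h1, h2]
  refine ⟨?_, ?_, ?_⟩ <;> exact eq_of_test p n x (by decide +kernel)

set_option synthInstance.maxSize 100000 in
set_option synthInstance.maxHeartbeats 0 in
theorem normIdentity_Ib : NormIdentity .Ib numAIb numBIb bdry₀Ib bdry₁Ib bdry₂Ib := by
  intro p n t
  obtain ⟨x, rfl⟩ : ∃ x, t = 1 - x := ⟨1 - t, by ring⟩
  have h1 : (1 : ℝ) + (1 - x) = 2 - x := by ring
  have h2 : (1 : ℝ) - (1 - x) ^ 2 = x * (2 - x) := by ring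
  simp only [normForm, numAIb, numBIb, bdry₀Ib, bdry₁Ib, bdry₂Ib, eval_taylor,
    eval_derivative_taylor_nil, eval_derivative_taylor_cons, hor_nil, hor_cons, Case.g₀, Case.g₁,
    Case.lam, Grp.ell, Case.weightTau, Case.scaledG, Case.ofParam, Case.group, Case.shiftG,
    Case.shiftH, Grp.sigma, Grp.eps, Case.lowG, Case.lowH, Case.powG, Case.powH, Case.normRho,
    Case.normTheta, seeds, List.map_cons, List.map_nil, List.prod_cons, List.prod_nil,
    Case.seedDiff, Nat.cast_zero, Nat.cast_one, Nat.cast_ofNat, sub_sub_cancel, h1, h2]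
  refine ⟨?_, ?_, ?_⟩ <;> exact eq_of_test p n x (by decide +kernel)

set_option synthInstance.maxSize 100000 in
set_option synthInstance.maxHeartbeats 0 in
theorem normIdentity_IIa : NormIdentity .IIa numAIIa numBIIa bdry₀IIa bdry₁IIa bdry₂IIa := by
  intro p n t
  obtain ⟨x, rfl⟩ : ∃ x, t = 1 - x := ⟨1 - t, by ring⟩
  have h1 : (1 : ℝ) + (1 - x) = 2 - x := by ring
  have h2 : (1 : ℝ) - (1 - x) ^ 2 = x * (2 - x) := by ring
  simp only [normForm, numAIIa, numBIIa, bdry₀IIa, bdry₁IIa, bdry₂IIa, eval_taylor,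
    eval_derivative_taylor_nil, eval_derivative_taylor_cons, hor_nil, hor_cons, Case.g₀, Case.g₁,
    Case.lam, Grp.ell, Case.weightTau, Case.scaledG, Case.ofParam, Case.group, Case.shiftG,
    Case.shiftH, Grp.sigma, Grp.eps, Case.lowG, Case.lowH, Case.powG, Case.powH, Case.normRho,
    Case.normTheta, seeds, List.map_cons, List.map_nil, List.prod_cons, List.prod_nil,
    Case.seedDiff, Nat.cast_zero, Nat.cast_one, Nat.cast_ofNat, sub_sub_cancel, h1, h2]
  refine ⟨?_, ?_, ?_⟩ <;> exact eq_of_test p n x (by decide +kernel)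

set_option synthInstance.maxSize 100000 in
set_option synthInstance.maxHeartbeats 0 in
theorem normIdentity_IIb : NormIdentity .IIb numAIIb numBIIb bdry₀IIb bdry₁IIb bdry₂IIb := by
  intro p n t
  obtain ⟨x, rfl⟩ : ∃ x, t = 1 - x := ⟨1 - t, by ring⟩
  have h1 : (1 : ℝ) + (1 - x) = 2 - x := by ring
  have h2 : (1 : ℝ) - (1 - x) ^ 2 = x * (2 - x) := by ring
  simp only [normForm, numAIIb, numBIIb, bdry₀IIb, bdry₁IIb, bdry₂IIb, eval_taylor,
    eval_derivative_taylor_nil, eval_derivative_taylor_cons, hor_nil, hor_cons, Case.g₀, Case.g₁,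
    Case.lam, Grp.ell, Case.weightTau, Case.scaledG, Case.ofParam, Case.group, Case.shiftG,
    Case.shiftH, Grp.sigma, Grp.eps, Case.lowG, Case.lowH, Case.powG, Case.powH, Case.normRho,
    Case.normTheta, seeds, List.map_cons, List.map_nil, List.prod_cons, List.prod_nil,
    Case.seedDiff, Nat.cast_zero, Nat.cast_one, Nat.cast_ofNat, sub_sub_cancel, h1, h2]
  refine ⟨?_, ?_, ?_⟩ <;> exact eq_of_test p n x (by decide +kernel)

set_option synthInstance.maxSize 100000 in
set_option synthInstance.maxHeartbeats 0 in
theorem normIdentity_IIIa : NormIdentity .IIIa numAIIIa numBIIIa bdry₀IIIa bdry₁IIIa bdry₂IIIa := by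
  intro p n t
  obtain ⟨x, rfl⟩ : ∃ x, t = 1 - x := ⟨1 - t, by ring⟩
  have h1 : (1 : ℝ) + (1 - x) = 2 - x := by ring
  have h2 : (1 : ℝ) - (1 - x) ^ 2 = x * (2 - x) := by ring
  simp only [normForm, numAIIIa, numBIIIa, bdry₀IIIa, bdry₁IIIa, bdry₂IIIa, eval_taylor,
    eval_derivative_taylor_nil, eval_derivative_taylor_cons, hor_nil, hor_cons, Case.g₀, Case.g₁,
    Case.lam, Grp.ell, Case.weightTau, Case.scaledG, Case.ofParam, Case.group, Case.shiftG,
    Case.shiftH, Grp.sigma, Grp.eps, Case.lowG, Case.lowH, Case.powG, Case.powH, Case.normRho,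
    Case.normTheta, seeds, List.map_cons, List.map_nil, List.prod_cons, List.prod_nil,
    Case.seedDiff, Nat.cast_zero, Nat.cast_one, Nat.cast_ofNat, sub_sub_cancel, h1, h2]
  refine ⟨?_, ?_, ?_⟩ <;> exact eq_of_test p n x (by decide +kernel)

set_option synthInstance.maxSize 100000 in
set_option synthInstance.maxHeartbeats 0 in
theorem normIdentity_IIIb : NormIdentity .IIIb numAIIIb numBIIIb bdry₀IIIb bdry₁IIIb bdry₂IIIb := by
  intro p n t
  obtain ⟨x, rfl⟩ : ∃ x, t = 1 - x := ⟨1 - t, by ring⟩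
  have h1 : (1 : ℝ) + (1 - x) = 2 - x := by ring
  have h2 : (1 : ℝ) - (1 - x) ^ 2 = x * (2 - x) := by ring
  simp only [normForm, numAIIIb, numBIIIb, bdry₀IIIb, bdry₁IIIb, bdry₂IIIb, eval_taylor,
    eval_derivative_taylor_nil, eval_derivative_taylor_cons, hor_nil, hor_cons, Case.g₀, Case.g₁,
    Case.lam, Grp.ell, Case.weightTau, Case.scaledG, Case.ofParam, Case.group, Case.shiftG,
    Case.shiftH, Grp.sigma, Grp.eps, Case.lowG, Case.lowH, Case.powG, Case.powH, Case.normRho,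
    Case.normTheta, seeds, List.map_cons, List.map_nil, List.prod_cons, List.prod_nil,
    Case.seedDiff, Nat.cast_zero, Nat.cast_one, Nat.cast_ofNat, sub_sub_cancel, h1, h2]
  refine ⟨?_, ?_, ?_⟩ <;> exact eq_of_test p n x (by decide +kernel)

set_option synthInstance.maxSize 100000 in
set_option synthInstance.maxHeartbeats 0 in
theorem normIdentity_IVa : NormIdentity .IVa numAIVa numBIVa bdry₀IVa bdry₁IVa bdry₂IVa := by
  intro p n t
  obtain ⟨x, rfl⟩ : ∃ x, t = 1 - x := ⟨1 - t, by ring⟩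
  have h1 : (1 : ℝ) + (1 - x) = 2 - x := by ring
  have h2 : (1 : ℝ) - (1 - x) ^ 2 = x * (2 - x) := by ring
  simp only [normForm, numAIVa, numBIVa, bdry₀IVa, bdry₁IVa, bdry₂IVa, eval_taylor,
    eval_derivative_taylor_nil, eval_derivative_taylor_cons, hor_nil, hor_cons, Case.g₀, Case.g₁,
    Case.lam, Grp.ell, Case.weightTau, Case.scaledG, Case.ofParam, Case.group, Case.shiftG,
    Case.shiftH, Grp.sigma, Grp.eps, Case.lowG, Case.lowH, Case.powG, Case.powH, Case.normRho,
    Case.normTheta, seeds, List.map_cons, List.map_nil, List.prod_cons, List.prod_nil,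
    Case.seedDiff, Nat.cast_zero, Nat.cast_one, Nat.cast_ofNat, sub_sub_cancel, h1, h2]
  refine ⟨?_, ?_, ?_⟩ <;> exact eq_of_test p n x (by decide +kernel)

set_option synthInstance.maxSize 100000 in
set_option synthInstance.maxHeartbeats 0 in
theorem normIdentity_IVb : NormIdentity .IVb numAIVb numBIVb bdry₀IVb bdry₁IVb bdry₂IVb := by
  intro p n t
  obtain ⟨x, rfl⟩ : ∃ x, t = 1 - x := ⟨1 - t, by ring⟩
  have h1 : (1 : ℝ) + (1 - x) = 2 - x := by ring
  have h2 : (1 : ℝ) - (1 - x) ^ 2 = x * (2 - x) := by ring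
  simp only [normForm, numAIVb, numBIVb, bdry₀IVb, bdry₁IVb, bdry₂IVb, eval_taylor,
    eval_derivative_taylor_nil, eval_derivative_taylor_cons, hor_nil, hor_cons, Case.g₀, Case.g₁,
    Case.lam, Grp.ell, Case.weightTau, Case.scaledG, Case.ofParam, Case.group, Case.shiftG,
    Case.shiftH, Grp.sigma, Grp.eps, Case.lowG, Case.lowH, Case.powG, Case.powH, Case.normRho,
    Case.normTheta, seeds, List.map_cons, List.map_nil, List.prod_cons, List.prod_nil,
    Case.seedDiff, Nat.cast_zero, Nat.cast_one, Nat.cast_ofNat, sub_sub_cancel, h1, h2]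
  refine ⟨?_, ?_, ?_⟩ <;> exact eq_of_test p n x (by decide +kernel)

theorem normIdentity (c : Case) :
    NormIdentity c (numA c) (numB c) (bdry₀ c) (bdry₁ c) (bdry₂ c) := by
  cases c
  · exact normIdentity_Ia
  · exact normIdentity_Ib
  · exact normIdentity_IIa
  · exact normIdentity_IIb
  · exact normIdentity_IIIa
  · exact normIdentity_IIIb
  · exact normIdentity_IVa
  · exact normIdentity_IVb

/-! ### The transformed polynomials -/

/-- The Jacobi polynomial of the undeformed eigenfunction. -/
def baseJacobi (c : Case) (h : ℝ) (n : ℕ) : ℝ[X] := jacobi n (curve c h - 1 / 2) (h - 1 / 2)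

/-- The parameter `p` of a case. -/
def Case.par (c : Case) (h : ℝ) : ℝ := param c.group (hBar c h)

/-- The polynomial part of the transformed eigenfunction, up to a constant. -/
def transformed (c : Case) (h : ℝ) (n : ℕ) : ℝ[X] :=
  numA c (c.par h) n * baseJacobi c h n + numB c (c.par h) n * derivative (baseJacobi c h n)

theorem Case.par_ne_zero (c : Case) {h : ℝ} (ha : Admissible c h) : c.par h ≠ 0 :=
  ((admissible_iff c h).1 ha).1

theorem Case.par_sub_sigma_ne_zero (c : Case) {h : ℝ} (ha : Admissible c h) :
    c.par h - c.group.sigma ≠ 0 := sub_ne_zero.2 ((admissible_iff c h).1 ha).2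

theorem baseJacobi_ode (c : Case) {h : ℝ} (ha : Admissible c h) (n : ℕ) :
    C (c.par h) * (1 - X ^ 2) * derivative (derivative (baseJacobi c h n)) =
      (C (c.g₀ (c.par h)) + C (c.g₁ (c.par h)) * X) * derivative (baseJacobi c h n) -
        C (c.lam (c.par h) n) * baseJacobi c h n := by
  have h1 := jacobi_ode n (curve c h - 1 / 2) (h - 1 / 2)
  have hg : c.scaledG (c.par h) = c.par h * curve c h := c.scaledG_param ha
  have hh : c.ofParam (c.par h) = h := c.ofParam_param h
  refine Polynomial.funext fun t => ?_
  have h2 := congrArg (eval t) h1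
  simp only [eval_add, eval_mul, eval_sub, eval_one, eval_pow, eval_X, eval_C, eval_zero] at h2
  simp only [baseJacobi, eval_add, eval_mul, eval_sub, eval_one, eval_pow, eval_X, eval_C,
    Case.g₀, Case.g₁, Case.lam, hg, hh]
  linear_combination c.par h * h2

theorem eval_transformed (c : Case) (h : ℝ) (n : ℕ) (t : ℝ) : (transformed c h n).eval t =
    (numA c (c.par h) n).eval t * (baseJacobi c h n).eval t +
      (numB c (c.par h) n).eval t * (derivative (baseJacobi c h n)).eval t := by
  simp only [transformed, eval_add, eval_mul]

theorem par_mul_tau (c : Case) {h : ℝ} (ha : Admissible c h) (t : ℝ) :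
    c.scaledTau (c.par h) t = c.par h * (tau c h).eval t := by
  have hg : c.scaledG (c.par h) = c.par h * curve c h := c.scaledG_param ha
  have hh : c.ofParam (c.par h) = h := c.ofParam_param h
  rw [Case.scaledTau, eval_tau, gBar_eq_add, hBar_eq_add, hg, hh]
  ring

theorem par_mul_spectral (c : Case) {h : ℝ} (ha : Admissible c h) (n : ℕ) :
    c.scaledSpectral (c.par h) n = c.par h * spectral c h n := by
  have hg : c.scaledG (c.par h) = c.par h * curve c h := c.scaledG_param ha
  have hh : c.ofParam (c.par h) = h := c.ofParam_param h
  rw [Case.scaledSpectral, spectral, gBar_eq_add, hBar_eq_add, hg, hh]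
  push_cast
  ring

theorem ell_eq (c : Case) (h t : ℝ) : c.group.ell (c.par h) t = 2 * (lin c h).eval t := by
  rw [eval_lin, Grp.ell, Case.par]; ring

theorem ell_eq_mul (c : Case) {h : ℝ} (ha : Admissible c h) (t : ℝ) :
    c.group.ell (c.par h) t = (c.par h - c.group.sigma) * (t - etaZero c h) := by
  rw [ell_eq, eval_lin_eq c ha, slope, Case.par]; ring

/-- By `theta_eq` two applications of p(1 - X²)d/dX are explicit in J and J', and `OdeIdentity`
annihilates both coefficients. -/
theorem normalEq_transformed (c : Case) {h : ℝ} (ha : Admissible c h) (n : ℕ) :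
    (normalEq c h n).Solves (transformed c h n) := by
  have hp := c.par_ne_zero ha
  have hps := c.par_sub_sigma_ne_zero ha
  set p := c.par h with hpdef
  set J := baseJacobi c h n with hJdef
  have hJ := baseJacobi_ode c ha n
  rw [← hpdef, ← hJdef] at hJ
  set A := numA c p n with hA
  set B := numB c p n with hB
  have hT : transformed c h n = A * J + B * derivative J := rfl
  rw [hT]
  set T := A * J + B * derivative J with hTdef
  set A₁ := thetaA p (c.lam p n) A B with hA₁
  set B₁ := thetaB p (c.g₀ p) (c.g₁ p) A B with hB₁
  have e1 : C p * (1 - X ^ 2) * derivative T = A₁ * J + B₁ * derivative J := theta_eq hJ A B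
  have e2 : C p * (1 - X ^ 2) * derivative (C p * (1 - X ^ 2) * derivative T) =
      thetaA p (c.lam p n) A₁ B₁ * J + thetaB p (c.g₀ p) (c.g₁ p) A₁ B₁ * derivative J := by
    rw [e1]; exact theta_eq hJ A₁ B₁
  -- The identities concern the equation multiplied by this factor, which is cancelled in the
  -- polynomial ring.
  have hfac : (C ((p - c.group.sigma) * p ^ 2) * (1 - X ^ 2) : ℝ[X]) ≠ 0 := by
    refine mul_ne_zero (C_ne_zero.2 (mul_ne_zero hps (pow_ne_zero 2 hp))) fun h0 => ?_
    have := congrArg (eval 0) h0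
    norm_num at this
  rw [PolyEq.Solves]
  refine mul_left_cancel₀ hfac ?_
  rw [mul_zero]
  refine Polynomial.funext fun t => ?_
  obtain ⟨i1, i2⟩ := odeIdentity c p n t
  rw [← hA, ← hB, ← hA₁, ← hB₁] at i1 i2
  have f1 := congrArg (eval t) e1
  have f2 := congrArg (eval t) e2
  have f0 := congrArg (eval t) hTdef
  simp only [eval_add, eval_mul, eval_sub, eval_one, eval_pow, eval_X, eval_C, derivative_mul,
    derivative_C, derivative_sub, derivative_one, derivative_X_pow, Nat.cast_ofNat, eval_ofNat,
    zero_mul, zero_add, zero_sub, eval_neg, map_ofNat,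
    Nat.add_one_sub_one, pow_one] at f0 f1 f2
  simp only [eval_add, eval_mul, eval_sub, eval_one, eval_pow, eval_X, eval_C, normalEq, eval_zero,
    eval_ofNat]
  rw [odeForm] at i1 i2
  have ht := par_mul_tau c ha t
  have hS := par_mul_spectral c ha n
  have hl := ell_eq_mul c ha t
  rw [← hpdef] at ht hS hl
  rw [Case.first, Case.zeroth, ht, hS, hl] at i1 i2
  generalize eval t (derivative (derivative T)) = T2 at *
  generalize eval t (derivative T) = T1 at *
  generalize eval t T = T0 at *
  generalize eval t J = J0 at *
  generalize eval t (derivative J) = J1 at *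
  generalize eval t (tau c h) = τ at *
  generalize etaZero c h = E at *
  generalize c.group.sigma = σ at *
  generalize spectral c h n = S at *
  linear_combination J0 * i1 + J1 * i2 + (p - σ) * (t - E) * f2 +
    ((p - σ) * (t - E) * 2 * t * p + (p * τ * ((p - σ) * (t - E)) - 4 * (p - σ) * p * (1 - t ^ 2))) * f1 +
    (1 - t ^ 2) * (p * (p * S) * ((p - σ) * (t - E)) - 2 * (p - σ) * p * (p * τ) -
      6 * (p - σ) * p ^ 2 * t) * f0

/-! ### The norm of the transformed polynomials -/

theorem jacobiWeight_mul_pow (α β : ℝ) (i j : ℕ) {t : ℝ} (ht : t ∈ Ioo (-1 : ℝ) 1) :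
    jacobiWeight α β t * ((1 - t) ^ i * (1 + t) ^ j) = jacobiWeight (α + i) (β + j) t := by
  have h1 : 1 - t ≠ 0 := by linarith [ht.2]
  have h2 : 1 + t ≠ 0 := by linarith [ht.1]
  rw [jacobiWeight, jacobiWeight, rpow_add_natCast h1, rpow_add_natCast h2]
  ring

theorem StatedRange.curve_gt {c : Case} {h : ℝ} (hs : StatedRange c h) : -1 / 2 < curve c h := by
  cases c <;> simp only [StatedRange, curve] at hs ⊢
  · rw [lt_div_iff₀ (by linarith)]; linarith
  · rw [lt_div_iff₀ (by linarith)]; linarith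
  · rw [lt_div_iff₀ (by linarith)]; linarith
  · rw [lt_div_iff₀ (by linarith)]; linarith
  all_goals rw [lt_div_iff_of_neg (by linarith)]; linarith

theorem StatedRange.h_gt {c : Case} {h : ℝ} (hs : StatedRange c h) : -1 / 2 < h := by
  cases c <;> simp only [StatedRange] at hs <;> linarith

theorem StatedRange.curve_add_pos {c : Case} {h : ℝ} (hs : StatedRange c h) :
    0 < curve c h + h := by
  have h1 := Grp.sumBound_of_range _ ((statedRange_iff c h).1 hs)
  rw [← gBar_eq_gBarOfHBar c hs.admissible] at h1
  rw [← gBar_add_hBar]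
  revert h1
  cases c.group <;> simp only [Grp.SumBound, Grp.typeIII] <;> intro h1 <;> linarith

theorem seedDiff_eq (c : Case) {h : ℝ} (ha : Admissible c h) (n : ℕ) (s : SeedType × ℕ) :
    c.seedDiff (c.par h) n s =
      c.par h * (energy (curve c h) h n - seedEnergy (curve c h) h s) := by
  have hg : c.scaledG (c.par h) = c.par h * curve c h := c.scaledG_param ha
  have hh : c.ofParam (c.par h) = h := c.ofParam_param h
  obtain ⟨_ | _ | _, v⟩ := s <;>
  · simp only [Case.seedDiff, hg, hh, energy, seedEnergy]
    push_cast
    ring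

theorem prod_seedDiff (c : Case) {h : ℝ} (ha : Admissible c h) (n : ℕ) :
    ((seeds c).map (c.seedDiff (c.par h) n)).prod =
      c.par h ^ (seeds c).length * energyProduct c h n := by
  rw [energyProduct]
  induction seeds c with
  | nil => simp
  | cons s l ih =>
    rw [List.map_cons, List.prod_cons, ih, seedDiff_eq c ha, List.map_cons, List.prod_cons,
      List.length_cons, pow_succ]
    ring

/-- The numerator of the boundary term in the norm integral. -/
def boundary (c : Case) (h : ℝ) (n : ℕ) : ℝ[X] :=
  bdry₀ c (c.par h) n * baseJacobi c h n ^ 2 +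
    bdry₁ c (c.par h) n * (baseJacobi c h n * derivative (baseJacobi c h n)) +
    bdry₂ c (c.par h) n * derivative (baseJacobi c h n) ^ 2

/-- The three parts of `NormIdentity` weighted with J², JJ', J'²; differentiating the boundary form
produces J'', which Jacobi's equation removes. -/
theorem boundary_identity (c : Case) {h : ℝ} (ha : Admissible c h) (n : ℕ) (t : ℝ) :
    normForm c (c.par h) t ((boundary c h n).eval t)
      (c.par h * (1 - t ^ 2) * (derivative (boundary c h n)).eval t) =
    c.normRho (c.par h) * ((1 - t) ^ c.lowG * (1 + t) ^ c.lowH) * (transformed c h n).eval t ^ 2 +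
    c.normTheta (c.par h) * ((1 - t) ^ c.powG * (1 + t) ^ c.powH) * (lin c h).eval t ^ 4 *
      (c.par h ^ (seeds c).length * energyProduct c h n) * (baseJacobi c h n).eval t ^ 2 := by
  have hJ := congrArg (eval t) (baseJacobi_ode c ha n)
  obtain ⟨i0, i1, i2⟩ := normIdentity c (c.par h) n t
  rw [prod_seedDiff c ha, ell_eq, mul_div_cancel_left₀ _ two_ne_zero] at i0
  rw [eval_transformed, boundary]
  simp only [eval_add, eval_mul, eval_sub, eval_one, eval_pow, eval_X, eval_C] at hJ
  simp only [eval_add, eval_mul, eval_pow, derivative_mul, derivative_add, derivative_pow,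
    Nat.add_one_sub_one, pow_one, eval_C, Nat.cast_ofNat]
  simp only [normForm] at i0 i1 i2 ⊢
  generalize c.par h = p at *
  generalize eval t (derivative (derivative (baseJacobi c h n))) = J2 at *
  generalize eval t (derivative (baseJacobi c h n)) = J1 at *
  generalize eval t (baseJacobi c h n) = J0 at *
  linear_combination J0 ^ 2 * i0 + J0 * J1 * i1 + J1 ^ 2 * i2 +
    c.group.ell p t * (eval t (bdry₁ c p n) * J0 + 2 * eval t (bdry₂ c p n) * J1) * hJ

/-- The boundary identity integrates to zero and leaves a linear relation between the transformed
norm and the classical one. -/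
theorem integral_transformed_sq {c : Case} {h : ℝ} (hs : StatedRange c h) (n : ℕ) :
    c.normRho (c.par h) *
      ∫ t in (-1 : ℝ)..1, weight c h t * (transformed c h n).eval t * (transformed c h n).eval t =
    -(c.normTheta (c.par h) * (c.par h ^ (seeds c).length * energyProduct c h n) *
      (2 ^ (curve c h + h + 1) * baseNorm (curve c h) h n)) := by
  have ha := hs.admissible
  have hp := c.par_ne_zero ha
  have hg := hs.gBar_gt
  have hh := hs.hBar_gt
  have hg' := hs.curve_gt
  have hh' := hs.h_gt
  -- The two squares carry weights with exponents built from ḡ, h̄ and from g, h. The common weight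
  -- takes the smaller exponents: `lowG`, `lowH` measure the distance to the first pair and `powG`,
  -- `powH` to the second.
  have hlg : gBar c h - 1 / 2 - c.lowG + c.powG = curve c h - 1 / 2 := by
    rw [gBar_eq_add]; cases c <;> norm_num [Case.shiftG, Case.lowG, Case.powG] <;> ring
  have hlh : hBar c h - 1 / 2 - c.lowH + c.powH = h - 1 / 2 := by
    rw [hBar_eq_add]; cases c <;> norm_num [Case.shiftH, Case.lowH, Case.powH] <;> ring
  have hα : -1 < gBar c h - 1 / 2 - c.lowG := by
    rw [gBar_eq_add] at hg ⊢
    revert hg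
    cases c <;> simp only [Case.shiftG, Case.lowG] <;> intro hg <;> push_cast <;> linarith
  have hβ : -1 < hBar c h - 1 / 2 - c.lowH := by
    rw [hBar_eq_add] at hh ⊢
    revert hh
    cases c <;> simp only [Case.shiftH, Case.lowH] <;> intro hh <;> push_cast <;> linarith
  have hne : ∀ t ∈ Icc (-1 : ℝ) 1, (lin c h).eval t ≠ 0 := fun t ht =>
    eval_lin_ne_zero c hs.regularRange ht
  set N := boundary c h n with hN
  set k := (c.par h - c.group.sigma) / 2 with hk
  have hr : ∀ t ∈ Icc (-1 : ℝ) 1, HasDerivAt (fun t => N.eval t / (lin c h).eval t ^ 3)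
      ((derivative N).eval t / (lin c h).eval t ^ 3 -
        3 * k * (N.eval t / (lin c h).eval t ^ 4)) t := by
    intro t ht
    have h1 : HasDerivAt (fun s => (lin c h).eval s ^ 3) (3 * (lin c h).eval t ^ 2 * k) t := by
      refine ((hasDerivAt_eval (lin c h) t).fun_pow 3).congr_deriv ?_
      rw [derivative_lin]
      simp [hk, Case.par]
    have h2 := hne t ht
    refine ((hasDerivAt_eval N t).fun_div h1 (pow_ne_zero 3 h2)).congr_deriv ?_
    field_simp
  have hc : ContinuousOn (fun t => (derivative N).eval t / (lin c h).eval t ^ 3 -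
        3 * k * (N.eval t / (lin c h).eval t ^ 4)) (Icc (-1) 1) := by
    refine ContinuousOn.sub ?_ (ContinuousOn.mul continuousOn_const ?_) <;>
    exact ContinuousOn.div (Polynomial.continuous _).continuousOn
      ((Polynomial.continuous _).pow _).continuousOn fun t ht => pow_ne_zero _ (hne t ht)
  have key := integral_jacobiWeight_deriv hα hβ hr hc
  have hint1 := (intervalIntegrable_weight_mul hs (transformed c h n)
    (transformed c h n)).const_mul (c.normRho (c.par h))
  have hint2 := (intervalIntegrable_jacobiWeight_mul (α := curve c h - 1 / 2) (β := h - 1 / 2)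
    (by linarith) (by linarith) (s := fun t => (baseJacobi c h n).eval t ^ 2)
    ((Polynomial.continuous _).pow 2).continuousOn).const_mul
      (c.normTheta (c.par h) * (c.par h ^ (seeds c).length * energyProduct c h n))
  have hbase := integral_jacobi_sq_eq_baseNorm n hg' hh' hs.curve_add_pos
  rw [eq_neg_iff_add_eq_zero, ← intervalIntegral.integral_const_mul, ← hbase,
    ← intervalIntegral.integral_const_mul]
  rw [← baseJacobi, ← intervalIntegral.integral_add hint1 hint2, ← mul_zero (2 * c.par h), ← key,
    ← intervalIntegral.integral_const_mul]
  -- Moving integer powers of 1 ± t into the weight is valid only where these bases do not vanish.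
  refine intervalIntegral.integral_congr_Ioo_of_le (by norm_num) fun t ht => ?_
  have ht' := hne t (Ioo_subset_Icc_self ht)
  have hb := boundary_identity c ha n t
  rw [← hN, normForm, ell_eq, Case.weightTau] at hb
  have hG : c.scaledG (c.par h) = c.par h * curve c h := c.scaledG_param ha
  have hH : c.ofParam (c.par h) = h := c.ofParam_param h
  have e1 := jacobiWeight_mul_pow (gBar c h - 1 / 2 - c.lowG) (hBar c h - 1 / 2 - c.lowH)
    c.lowG c.lowH ht
  have e2 := jacobiWeight_mul_pow (gBar c h - 1 / 2 - c.lowG) (hBar c h - 1 / 2 - c.lowH)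
    c.powG c.powH ht
  rw [sub_add_cancel, sub_add_cancel] at e1
  rw [hlg, hlh] at e2
  simp only [weight_eq, ← e1, ← e2]
  rw [hG, hH, show c.par h - c.group.sigma = 2 * k by rw [hk]; ring] at hb
  have hgg := gBar_eq_add c h
  have hhh := hBar_eq_add c h
  generalize jacobiWeight (gBar c h - 1 / 2 - c.lowG) (hBar c h - 1 / 2 - c.lowH) t = w
  rw [hgg, hhh]
  generalize (lin c h).eval t = l at *
  calc _ = w / l ^ 4 * (c.normRho (c.par h) * ((1 - t) ^ c.lowG * (1 + t) ^ c.lowH) *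
        (transformed c h n).eval t ^ 2 + c.normTheta (c.par h) *
        ((1 - t) ^ c.powG * (1 + t) ^ c.powH) * l ^ 4 *
        (c.par h ^ (seeds c).length * energyProduct c h n) * (baseJacobi c h n).eval t ^ 2) := by
        field_simp
    _ = _ := by
        rw [← hb]
        field_simp
        ring

/-! ### Derivatives of the seed solutions and of the eigenfunctions -/

/-- The function `(sin x)^a (cos x)^b P(cos 2x)`. -/
def ptFun (a b : ℝ) (P : ℝ[X]) (x : ℝ) : ℝ :=
  Real.sin x ^ a * Real.cos x ^ b * P.eval (eta x)

/-- The polynomial of the derivative of `ptFun a b P`. -/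
def ptDeriv (a b : ℝ) (P : ℝ[X]) : ℝ[X] :=
  (C (a / 2) * (1 + X) - C (b / 2) * (1 - X)) * P - (1 - X ^ 2) * derivative P

theorem one_sub_eta (x : ℝ) : 1 - eta x = 2 * Real.sin x ^ 2 := by
  rw [eta, Real.cos_two_mul, Real.cos_sq']; ring

theorem one_add_eta (x : ℝ) : 1 + eta x = 2 * Real.cos x ^ 2 := by
  rw [eta, Real.cos_two_mul]; ring

theorem sin_pos_of_mem {x : ℝ} (hx : x ∈ Ioo 0 (π / 2)) : 0 < Real.sin x :=
  Real.sin_pos_of_pos_of_lt_pi hx.1 (by linarith [hx.2, Real.pi_pos])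

theorem cos_pos_of_mem {x : ℝ} (hx : x ∈ Ioo 0 (π / 2)) : 0 < Real.cos x :=
  Real.cos_pos_of_mem_Ioo ⟨by linarith [hx.1, Real.pi_pos], hx.2⟩

theorem ptFun_sub_one (a b : ℝ) (P : ℝ[X]) {x : ℝ} (hx : x ∈ Ioo 0 (π / 2)) :
    ptFun (a - 1) (b - 1) P x =
      Real.sin x ^ a * Real.cos x ^ b * (P.eval (eta x) / (Real.sin x * Real.cos x)) := by
  have hs := (sin_pos_of_mem hx).ne'
  have hc := (cos_pos_of_mem hx).ne'
  rw [ptFun, rpow_sub_one hs, rpow_sub_one hc]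
  field_simp

/-- The class of such functions is closed under differentiation, which lowers both exponents by one
and replaces P by `ptDeriv a b P`. -/
theorem hasDerivAt_ptFun (a b : ℝ) (P : ℝ[X]) {x : ℝ} (hx : x ∈ Ioo 0 (π / 2)) :
    HasDerivAt (ptFun a b P) (ptFun (a - 1) (b - 1) (ptDeriv a b P) x) x := by
  have hs := (sin_pos_of_mem hx).ne'
  have hc := (cos_pos_of_mem hx).ne'
  have h1 := (Real.hasDerivAt_sin x).rpow_const (p := a) (Or.inl hs)
  have h2 := (Real.hasDerivAt_cos x).rpow_const (p := b) (Or.inl hc)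
  have h3 := (hasDerivAt_eval P (eta x)).comp x (hasDerivAt_eta x)
  refine ((h1.fun_mul h2).fun_mul h3).congr_deriv ?_
  rw [ptFun_sub_one _ _ _ hx, rpow_sub_one hs, rpow_sub_one hc]
  have e1 := one_sub_eta x
  have e2 := one_add_eta x
  have e3 : 1 - eta x ^ 2 = 4 * Real.sin x ^ 2 * Real.cos x ^ 2 := by
    linear_combination (1 + eta x) * e1 + 2 * Real.sin x ^ 2 * e2
  simp only [ptDeriv, eval_sub, eval_mul, eval_add, eval_C, eval_one, eval_X, eval_pow, e1, e2,
    e3, Function.comp_apply, Real.sin_two_mul]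
  field_simp
  ring

theorem deriv_ptFun (a b : ℝ) (P : ℝ[X]) {x : ℝ} (hx : x ∈ Ioo 0 (π / 2)) :
    deriv (ptFun a b P) x = ptFun (a - 1) (b - 1) (ptDeriv a b P) x :=
  (hasDerivAt_ptFun a b P hx).deriv

/-- The Jacobi equation with parameters `a - 1/2`, `b - 1/2`. -/
def SolvesJacobi (a b v : ℝ) (P : ℝ[X]) : Prop :=
  (1 - X ^ 2) * derivative (derivative P) + (C (b - a) - C (a + b + 1) * X) * derivative P +
    C (v * (v + a + b)) * P = 0

theorem solvesJacobi_jacobi (v : ℕ) (a b α β : ℝ) (hα : α = a - 1 / 2) (hβ : β = b - 1 / 2) :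
    SolvesJacobi a b v (jacobi v α β) := by
  have h := jacobi_ode v α β
  rw [SolvesJacobi]
  rw [show β - α = b - a by rw [hα, hβ]; ring,
    show α + β + 2 = a + b + 1 by rw [hα, hβ]; ring,
    show (v : ℝ) * (v + α + β + 1) = v * (v + a + b) by rw [hα, hβ]; ring] at h
  exact h

/-- The potential sees g only through g(g - 1), so the hypotheses allow a = g and a = 1 - g, and
likewise for b. The eigenfunctions and all three types of seeds are thus treated at once, with
energy (2v + a + b)² - (g + h)². -/
theorem hasDerivAt_ptFun_deriv {g h a b v : ℝ} {P : ℝ[X]} (hP : SolvesJacobi a b v P)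
    (ha : a * (a - 1) = g * (g - 1)) (hb : b * (b - 1) = h * (h - 1))
    {x : ℝ} (hx : x ∈ Ioo 0 (π / 2)) :
    HasDerivAt (ptFun (a - 1) (b - 1) (ptDeriv a b P))
      ((potential g h x - ((2 * v + a + b) ^ 2 - (g + h) ^ 2)) * ptFun a b P x) x := by
  have hs := (sin_pos_of_mem hx).ne'
  have hc := (cos_pos_of_mem hx).ne'
  refine (hasDerivAt_ptFun _ _ _ hx).congr_deriv ?_
  have e1 := one_sub_eta x
  have e2 := one_add_eta x
  have e3 : 1 - eta x ^ 2 = 4 * Real.sin x ^ 2 * Real.cos x ^ 2 := by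
    linear_combination (1 + eta x) * e1 + 2 * Real.sin x ^ 2 * e2
  have e4 : (ptDeriv (a - 1) (b - 1) (ptDeriv a b P)).eval (eta x) =
      Real.sin x ^ 2 * Real.cos x ^ 2 *
        ((potential g h x - ((2 * v + a + b) ^ 2 - (g + h) ^ 2)) * P.eval (eta x)) := by
    have h1 := congrArg (eval (eta x)) hP
    have e5 : Real.sin x ^ 2 * Real.cos x ^ 2 * potential g h x =
        g * (g - 1) * Real.cos x ^ 2 + h * (h - 1) * Real.sin x ^ 2 -
          (g + h) ^ 2 * (Real.sin x ^ 2 * Real.cos x ^ 2) := by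
      rw [potential]; field_simp
    rw [sub_mul, mul_sub, ← mul_assoc _ (potential g h x), e5,
      show Real.sin x ^ 2 = (1 - eta x) / 2 by rw [e1]; ring,
      show Real.cos x ^ 2 = (1 + eta x) / 2 by rw [e2]; ring, ← ha, ← hb]
    simp only [eval_add, eval_mul, eval_sub, eval_one, eval_pow, eval_X, eval_C, eval_zero] at h1
    simp only [ptDeriv, eval_sub, eval_mul, eval_add, eval_C, eval_one, eval_X, eval_pow,
      derivative_sub, derivative_mul, derivative_C, derivative_add, derivative_one, derivative_X,
      derivative_X_pow, eval_zero]
    generalize eval (eta x) (derivative (derivative P)) = P2 at *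
    generalize eval (eta x) (derivative P) = P1 at *
    generalize eval (eta x) P = P0 at *
    norm_num
    linear_combination (1 - eta x ^ 2) * h1
  rw [ptFun_sub_one _ _ _ hx, e4, rpow_sub_one hs, rpow_sub_one hc, ptFun]
  field_simp

/-- The derivatives of order at most three at `x` of a solution of the Schrödinger equation with
potential `U` and energy `e`. -/
structure IsSolution (U U₁ e f₀ f₁ x : ℝ) (f : ℝ → ℝ) : Prop where
  deriv0 : iteratedDeriv 0 f x = f₀
  deriv1 : iteratedDeriv 1 f x = f₁
  deriv2 : iteratedDeriv 2 f x = (U - e) * f₀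
  deriv3 : iteratedDeriv 3 f x = U₁ * f₀ + (U - e) * f₁

theorem hasDerivAt_potential (g h : ℝ) {x : ℝ} (hx : x ∈ Ioo 0 (π / 2)) :
    HasDerivAt (potential g h) (deriv (potential g h) x) x := by
  have hs := (sin_pos_of_mem hx).ne'
  have hc := (cos_pos_of_mem hx).ne'
  refine DifferentiableAt.hasDerivAt ?_
  unfold potential
  fun_prop (disch := positivity)

theorem isSolution_ptFun {g h a b v : ℝ} {P : ℝ[X]} (hP : SolvesJacobi a b v P)
    (ha : a * (a - 1) = g * (g - 1)) (hb : b * (b - 1) = h * (h - 1))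
    {x : ℝ} (hx : x ∈ Ioo 0 (π / 2)) :
    IsSolution (potential g h x) (deriv (potential g h) x)
      ((2 * v + a + b) ^ 2 - (g + h) ^ 2) (ptFun a b P x)
      (ptFun (a - 1) (b - 1) (ptDeriv a b P) x) x (ptFun a b P) := by
  have hev : ∀ᶠ y in 𝓝 x, y ∈ Ioo 0 (π / 2) := isOpen_Ioo.mem_nhds hx
  have d1 : deriv (ptFun a b P) =ᶠ[𝓝 x] ptFun (a - 1) (b - 1) (ptDeriv a b P) :=
    hev.mono fun y hy => deriv_ptFun a b P hy
  have d2 : deriv (deriv (ptFun a b P)) =ᶠ[𝓝 x] fun y =>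
      (potential g h y - ((2 * v + a + b) ^ 2 - (g + h) ^ 2)) * ptFun a b P y := by
    refine d1.deriv.trans (hev.mono fun y hy => ?_)
    exact (hasDerivAt_ptFun_deriv hP ha hb hy).deriv
  refine ⟨by rw [iteratedDeriv_zero], by rw [iteratedDeriv_one]; exact d1.eq_of_nhds, ?_, ?_⟩
  · rw [iteratedDeriv_succ, iteratedDeriv_one]; exact d2.eq_of_nhds
  · rw [iteratedDeriv_succ, iteratedDeriv_succ, iteratedDeriv_one, d2.deriv_eq]
    exact (((hasDerivAt_potential g h hx).sub_const _).fun_mul (hasDerivAt_ptFun a b P hx)).deriv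

/-! ### Wronskians of solutions -/

variable {U U₁ x : ℝ}

theorem wronskian_two {e₁ e₂ u₁ v₁ u₂ v₂ : ℝ} {f₁ f₂ : ℝ → ℝ}
    (h₁ : IsSolution U U₁ e₁ u₁ v₁ x f₁) (h₂ : IsSolution U U₁ e₂ u₂ v₂ x f₂) :
    wronskian [f₁, f₂] x = u₁ * v₂ - v₁ * u₂ := by
  change Matrix.det (Matrix.of fun j k : Fin 2 => iteratedDeriv (k : ℕ) ([f₁, f₂].get j) x) = _
  rw [Matrix.det_fin_two]
  change iteratedDeriv 0 f₁ x * iteratedDeriv 1 f₂ x - iteratedDeriv 1 f₁ x * iteratedDeriv 0 f₂ x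
    = _
  rw [h₁.deriv0, h₁.deriv1, h₂.deriv0, h₂.deriv1]

/-- The determinant of the vectors `(u, v, d u)`. -/
def det₃ (u₁ v₁ d₁ u₂ v₂ d₂ u₃ v₃ d₃ : ℝ) : ℝ :=
  (u₁ * v₂ - v₁ * u₂) * (d₃ * u₃) - (u₁ * v₃ - v₁ * u₃) * (d₂ * u₂) +
    (u₂ * v₃ - v₂ * u₃) * (d₁ * u₁)

/-- Subtracting U - E times the first column from the third replaces the second derivatives by (E -
eᵢ)uᵢ. The reference energy E is arbitrary; taking it equal to the energy of φ_n makes one entry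
zero. -/
theorem wronskian_three {e₁ e₂ e₃ u₁ v₁ u₂ v₂ u₃ v₃ : ℝ} {f₁ f₂ f₃ : ℝ → ℝ}
    (h₁ : IsSolution U U₁ e₁ u₁ v₁ x f₁) (h₂ : IsSolution U U₁ e₂ u₂ v₂ x f₂)
    (h₃ : IsSolution U U₁ e₃ u₃ v₃ x f₃) (E : ℝ) :
    wronskian [f₁, f₂, f₃] x = det₃ u₁ v₁ (E - e₁) u₂ v₂ (E - e₂) u₃ v₃ (E - e₃) := by
  change Matrix.det (Matrix.of fun j k : Fin 3 => iteratedDeriv (k : ℕ) ([f₁, f₂, f₃].get j) x) = _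
  rw [Matrix.det_fin_three]
  change iteratedDeriv 0 f₁ x * iteratedDeriv 1 f₂ x * iteratedDeriv 2 f₃ x -
    iteratedDeriv 0 f₁ x * iteratedDeriv 2 f₂ x * iteratedDeriv 1 f₃ x -
    iteratedDeriv 1 f₁ x * iteratedDeriv 0 f₂ x * iteratedDeriv 2 f₃ x +
    iteratedDeriv 1 f₁ x * iteratedDeriv 2 f₂ x * iteratedDeriv 0 f₃ x +
    iteratedDeriv 2 f₁ x * iteratedDeriv 0 f₂ x * iteratedDeriv 1 f₃ x -
    iteratedDeriv 2 f₁ x * iteratedDeriv 1 f₂ x * iteratedDeriv 0 f₃ x = _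
  rw [h₁.deriv0, h₁.deriv1, h₁.deriv2, h₂.deriv0, h₂.deriv1, h₂.deriv2, h₃.deriv0, h₃.deriv1,
    h₃.deriv2, det₃]
  ring

/-- The determinant of the vectors `(u, v, d u, d v)` for three values of the index and
`(u, v, 0, 0)` for the fourth one. -/
def det₄ (u₁ v₁ d₁ u₂ v₂ d₂ u₃ v₃ d₃ u₄ v₄ : ℝ) : ℝ :=
  d₁ * d₂ * (u₁ * v₂ - v₁ * u₂) * (u₃ * v₄ - v₃ * u₄) -
    d₁ * d₃ * (u₁ * v₃ - v₁ * u₃) * (u₂ * v₄ - v₂ * u₄) +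
    d₂ * d₃ * (u₂ * v₃ - v₂ * u₃) * (u₁ * v₄ - v₁ * u₄)

/-- The same column operations, with the fourth energy as reference, remove U and U' and turn the
last row into (u, v, 0, 0). -/
theorem wronskian_four {e₁ e₂ e₃ e₄ u₁ v₁ u₂ v₂ u₃ v₃ u₄ v₄ : ℝ} {f₁ f₂ f₃ f₄ : ℝ → ℝ}
    (h₁ : IsSolution U U₁ e₁ u₁ v₁ x f₁) (h₂ : IsSolution U U₁ e₂ u₂ v₂ x f₂)
    (h₃ : IsSolution U U₁ e₃ u₃ v₃ x f₃) (h₄ : IsSolution U U₁ e₄ u₄ v₄ x f₄) :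
    wronskian [f₁, f₂, f₃, f₄] x =
      det₄ u₁ v₁ (e₄ - e₁) u₂ v₂ (e₄ - e₂) u₃ v₃ (e₄ - e₃) u₄ v₄ := by
  change Matrix.det (Matrix.of fun j k : Fin 4 =>
    iteratedDeriv (k : ℕ) ([f₁, f₂, f₃, f₄].get j) x) = _
  have hM : (Matrix.of fun j k : Fin 4 => iteratedDeriv (k : ℕ) ([f₁, f₂, f₃, f₄].get j) x) =
      !![u₁, v₁, (U - e₁) * u₁, U₁ * u₁ + (U - e₁) * v₁;
        u₂, v₂, (U - e₂) * u₂, U₁ * u₂ + (U - e₂) * v₂;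
        u₃, v₃, (U - e₃) * u₃, U₁ * u₃ + (U - e₃) * v₃;
        u₄, v₄, (U - e₄) * u₄, U₁ * u₄ + (U - e₄) * v₄] := by
    ext j k
    fin_cases j <;> fin_cases k
    exacts [h₁.deriv0, h₁.deriv1, h₁.deriv2, h₁.deriv3, h₂.deriv0, h₂.deriv1, h₂.deriv2, h₂.deriv3,
      h₃.deriv0, h₃.deriv1, h₃.deriv2, h₃.deriv3, h₄.deriv0, h₄.deriv1, h₄.deriv2, h₄.deriv3]
  rw [hM, det₄, Matrix.det_succ_row_zero]
  simp [Fin.sum_univ_succ, Matrix.det_fin_three, Matrix.submatrix, Fin.succAbove]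
  ring

/-! ### The determinants of the seed solutions -/

/-- The Jacobi polynomial of degree one or two with parameters `A / p`, `B / p`, multiplied by a
power of `p`. -/
def scaledJacobi (A B p : ℝ) : ℕ → ℝ[X]
  | 1 => taylor [A + p, -((A + B + 2 * p) / 2)]
  | 2 => taylor [(A + p) * (A + 2 * p) / 2, -((A + 2 * p) * (A + B + 3 * p) / 2),
      (A + B + 3 * p) * (A + B + 4 * p) / 8]
  | _ => 0

/-- Degrees one and two suffice, as all seeds have these degrees. -/
theorem scaledJacobi_eq (p α β : ℝ) {v : ℕ} (hv : v = 1 ∨ v = 2) :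
    scaledJacobi (p * α) (p * β) p v = C (p ^ v) * jacobi v α β := by
  refine Polynomial.funext fun t => ?_
  rcases hv with rfl | rfl
  · rw [jacobi_one, scaledJacobi, eval_taylor]
    simp [hor]
    ring
  · rw [scaledJacobi, eval_taylor, jacobi]
    simp [Finset.sum_range_succ, hor, ascPochhammer_succ_left, Nat.factorial]
    ring

/-- The exponent of `sin x` in a seed solution, multiplied by `p`. -/
def Case.expG (c : Case) (p : ℝ) : SeedType → ℝ
  | .I => c.scaledG p
  | .II => p - c.scaledG p
  | .III => p - c.scaledG p

/-- The exponent of `cos x` in a seed solution, multiplied by `p`. -/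
def Case.expH (c : Case) (p : ℝ) : SeedType → ℝ
  | .I => p - p * c.ofParam p
  | .II => p * c.ofParam p
  | .III => p - p * c.ofParam p

/-- The polynomial of a seed solution, scaled. -/
def Case.seedU (c : Case) (p t : ℝ) (s : SeedType × ℕ) : ℝ :=
  (scaledJacobi (c.expG p s.1 - p / 2) (c.expH p s.1 - p / 2) p s.2).eval t

/-- The polynomial of the derivative of a seed solution, scaled. -/
def Case.seedV (c : Case) (p t : ℝ) (s : SeedType × ℕ) : ℝ :=
  (c.expG p s.1 * (1 + t) / 2 - c.expH p s.1 * (1 - t) / 2) * c.seedU p t s -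
    p * (1 - t ^ 2) * (derivative
      (scaledJacobi (c.expG p s.1 - p / 2) (c.expH p s.1 - p / 2) p s.2)).eval t

/-- The determinant of the seed solutions. -/
def rowDet (u v d : SeedType × ℕ → ℝ) : List (SeedType × ℕ) → ℝ
  | [s₁, s₂] => u s₁ * v s₂ - v s₁ * u s₂
  | [s₁, s₂, s₃] => det₃ (u s₁) (v s₁) (d s₁) (u s₂) (v s₂) (d s₂) (u s₃) (v s₃) (d s₃)
  | _ => 0

/-- The determinant of the seed solutions and a function. -/
def rowDetAdd (u v d : SeedType × ℕ → ℝ) (u₀ v₀ : ℝ) : List (SeedType × ℕ) → ℝ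
  | [s₁, s₂] => det₃ (u s₁) (v s₁) (d s₁) (u s₂) (v s₂) (d s₂) u₀ v₀ 0
  | [s₁, s₂, s₃] =>
    det₄ (u s₁) (v s₁) (d s₁) (u s₂) (v s₂) (d s₂) (u s₃) (v s₃) (d s₃) u₀ v₀
  | _ => 0

/-- The exponent of `1 - η` in the determinant of the seeds. -/
def Case.detG : Case → ℕ
  | .Ia => 0 | .Ib => 2 | .IIa => 0 | .IIb => 1 | .IIIa => 1 | .IIIb => 0 | .IVa => 2 | .IVb => 0

/-- The exponent of `1 + η` in the determinant of the seeds. -/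
def Case.detH : Case → ℕ
  | .Ia => 1 | .Ib => 0 | .IIa => 1 | .IIb => 0 | .IIIa => 0 | .IIIb => 2 | .IVa => 0 | .IVb => 2

/-- The exponent of `1 - η` in the determinant of the seeds and the eigenfunction. -/
def Case.detAddG : Case → ℕ
  | .Ib => 1 | .IIIb => 1 | .IVa => 1 | _ => 0

/-- The exponent of `1 + η` in the determinant of the seeds and the eigenfunction. -/
def Case.detAddH : Case → ℕ
  | .Ib => 1 | .IIIb => 1 | .IVb => 1 | _ => 0

/-- The constant in the determinant of the seeds. -/
def Case.kap (c : Case) (p : ℝ) : ℝ :=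
  match c with
  | .Ia => (p + 3) * (p - 1) * (5 * p - 9) * (p - 9) / 4096
  | .Ib => p ^ 2 * (p + 3) * (p - 1) ^ 2 * (p - 5) * (p - 9) * (p ^ 2 - 2 * p + 9) / 32768
  | .IIa => -((p + 3) * (p - 1) * (5 * p - 9) * (p - 9)) / 4096
  | .IIb => p * (p + 3) * (p - 1) * (p - 5) * (p - 9) / 4096
  | .IIIa => -(p * (p + 9) * (p + 5) * (p + 1) * (p - 3)) / 4096
  | .IIIb => -((p + 9) ^ 2 * (5 * p + 9) * (p + 1) * (p - 3) * (p ^ 2 + 2 * p + 9)) / 32768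
  | .IVa => p ^ 2 * (p + 9) * (p + 5) * (p + 1) ^ 2 * (p - 3) * (p ^ 2 + 2 * p + 9) / 32768
  | .IVb => -((p + 9) ^ 2 * (5 * p + 9) * (p + 1) * (p - 3) * (p ^ 2 + 2 * p + 9)) / 32768

/-- The denominator of the quotient of the constants of the two determinants. -/
def Case.quotDen (c : Case) (p : ℝ) : ℝ :=
  match c with
  | .Ia => 4 | .Ib => 16 * p | .IIa => -4 | .IIb => 4 * p
  | .IIIa => -4 * p | .IIIb => -16 | .IVa => 16 * p | .IVb => -16

/-- The numerator of the quotient of the constants of the two determinants. -/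
def Case.quotNum (c : Case) (p : ℝ) : ℝ :=
  match c with
  | .IIIb => p
  | _ => 1

/-- The determinants of the seeds, and of the seeds with the eigenfunction. -/
def DetIdentity (c : Case) : Prop := ∀ p n t : ℝ,
  -- The right side is free of n: for two seeds the differences do not enter, and for three the
  -- reference energy drops out of the determinant.
  rowDet (c.seedU p t) (c.seedV p t) (c.seedDiff p n) (seeds c) =
    c.kap p * ((1 - t) ^ c.detG * (1 + t) ^ c.detH) * c.group.ell p t ^ 3 ∧
  -- The row of φ_n is linear in J and J'. The last two identities take its parts (1, pg(1 + t)/2 -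
  -- ph(1 - t)/2) and (0, -p(1 - t²)).
  c.quotDen p * rowDetAdd (c.seedU p t) (c.seedV p t) (c.seedDiff p n) 1
      (c.scaledG p * (1 + t) / 2 - p * c.ofParam p * (1 - t) / 2) (seeds c) =
    c.quotNum p * c.kap p * ((1 - t) ^ c.detAddG * (1 + t) ^ c.detAddH) * c.group.ell p t *
      (numA c p n).eval t ∧
  c.quotDen p * rowDetAdd (c.seedU p t) (c.seedV p t) (c.seedDiff p n) 0 (-(p * (1 - t ^ 2)))
      (seeds c) =
    c.quotNum p * c.kap p * ((1 - t) ^ c.detAddG * (1 + t) ^ c.detAddH) * c.group.ell p t *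
      (numB c p n).eval t


set_option synthInstance.maxSize 100000 in
set_option synthInstance.maxHeartbeats 0 in
theorem detIdentity_Ia : DetIdentity .Ia := by
  intro p n t
  simp only [seeds, rowDet, rowDetAdd, det₃, Case.seedU, Case.seedV, Case.expG, Case.expH,
    scaledJacobi, Case.seedDiff, numA, numB, numAIa, numBIa, eval_taylor,
    eval_derivative_taylor_nil, eval_derivative_taylor_cons, hor_nil, hor_cons, Grp.ell,
    Case.scaledG, Case.ofParam, Case.group, Case.shiftG, Case.shiftH, Grp.sigma, Grp.eps,
    Case.detG, Case.detH, Case.detAddG, Case.detAddH, Case.kap, Case.quotDen, Case.quotNum,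
    Nat.cast_one, Nat.cast_ofNat]
  refine ⟨?_, ?_, ?_⟩ <;> exact eq_of_test p n t (by decide +kernel)

set_option synthInstance.maxSize 100000 in
set_option synthInstance.maxHeartbeats 0 in
theorem detIdentity_Ib : DetIdentity .Ib := by
  intro p n t
  simp only [seeds, rowDet, rowDetAdd, det₃, det₄, Case.seedU, Case.seedV, Case.expG, Case.expH,
    scaledJacobi, Case.seedDiff, numA, numB, numAIb, numBIb, eval_taylor,
    eval_derivative_taylor_nil, eval_derivative_taylor_cons, hor_nil, hor_cons, Grp.ell,
    Case.scaledG, Case.ofParam, Case.group, Case.shiftG, Case.shiftH, Grp.sigma, Grp.eps,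
    Case.detG, Case.detH, Case.detAddG, Case.detAddH, Case.kap, Case.quotDen, Case.quotNum,
    Nat.cast_one, Nat.cast_ofNat]
  refine ⟨?_, ?_, ?_⟩ <;> exact eq_of_test p n t (by decide +kernel)

set_option synthInstance.maxSize 100000 in
set_option synthInstance.maxHeartbeats 0 in
theorem detIdentity_IIa : DetIdentity .IIa := by
  intro p n t
  simp only [seeds, rowDet, rowDetAdd, det₃, Case.seedU, Case.seedV, Case.expG, Case.expH,
    scaledJacobi, Case.seedDiff, numA, numB, numAIIa, numBIIa, eval_taylor,
    eval_derivative_taylor_nil, eval_derivative_taylor_cons, hor_nil, hor_cons, Grp.ell,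
    Case.scaledG, Case.ofParam, Case.group, Case.shiftG, Case.shiftH, Grp.sigma, Grp.eps,
    Case.detG, Case.detH, Case.detAddG, Case.detAddH, Case.kap, Case.quotDen, Case.quotNum,
    Nat.cast_one, Nat.cast_ofNat]
  refine ⟨?_, ?_, ?_⟩ <;> exact eq_of_test p n t (by decide +kernel)

set_option synthInstance.maxSize 100000 in
set_option synthInstance.maxHeartbeats 0 in
theorem detIdentity_IIb : DetIdentity .IIb := by
  intro p n t
  simp only [seeds, rowDet, rowDetAdd, det₃, Case.seedU, Case.seedV, Case.expG, Case.expH,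
    scaledJacobi, Case.seedDiff, numA, numB, numAIIb, numBIIb, eval_taylor,
    eval_derivative_taylor_nil, eval_derivative_taylor_cons, hor_nil, hor_cons, Grp.ell,
    Case.scaledG, Case.ofParam, Case.group, Case.shiftG, Case.shiftH, Grp.sigma, Grp.eps,
    Case.detG, Case.detH, Case.detAddG, Case.detAddH, Case.kap, Case.quotDen, Case.quotNum,
    Nat.cast_one, Nat.cast_ofNat]
  refine ⟨?_, ?_, ?_⟩ <;> exact eq_of_test p n t (by decide +kernel)

set_option synthInstance.maxSize 100000 in
set_option synthInstance.maxHeartbeats 0 in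
theorem detIdentity_IIIa : DetIdentity .IIIa := by
  intro p n t
  simp only [seeds, rowDet, rowDetAdd, det₃, Case.seedU, Case.seedV, Case.expG, Case.expH,
    scaledJacobi, Case.seedDiff, numA, numB, numAIIIa, numBIIIa, eval_taylor,
    eval_derivative_taylor_nil, eval_derivative_taylor_cons, hor_nil, hor_cons, Grp.ell,
    Case.scaledG, Case.ofParam, Case.group, Case.shiftG, Case.shiftH, Grp.sigma, Grp.eps,
    Case.detG, Case.detH, Case.detAddG, Case.detAddH, Case.kap, Case.quotDen, Case.quotNum,
    Nat.cast_one, Nat.cast_ofNat]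
  refine ⟨?_, ?_, ?_⟩ <;> exact eq_of_test p n t (by decide +kernel)

set_option synthInstance.maxSize 100000 in
set_option synthInstance.maxHeartbeats 0 in
theorem detIdentity_IIIb : DetIdentity .IIIb := by
  intro p n t
  simp only [seeds, rowDet, rowDetAdd, det₃, det₄, Case.seedU, Case.seedV, Case.expG, Case.expH,
    scaledJacobi, Case.seedDiff, numA, numB, numAIIIb, numBIIIb, eval_taylor,
    eval_derivative_taylor_nil, eval_derivative_taylor_cons, hor_nil, hor_cons, Grp.ell,
    Case.scaledG, Case.ofParam, Case.group, Case.shiftG, Case.shiftH, Grp.sigma, Grp.eps,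
    Case.detG, Case.detH, Case.detAddG, Case.detAddH, Case.kap, Case.quotDen, Case.quotNum,
    Nat.cast_one, Nat.cast_ofNat]
  refine ⟨?_, ?_, ?_⟩ <;> exact eq_of_test p n t (by decide +kernel)

set_option synthInstance.maxSize 100000 in
set_option synthInstance.maxHeartbeats 0 in
theorem detIdentity_IVa : DetIdentity .IVa := by
  intro p n t
  simp only [seeds, rowDet, rowDetAdd, det₃, det₄, Case.seedU, Case.seedV, Case.expG, Case.expH,
    scaledJacobi, Case.seedDiff, numA, numB, numAIVa, numBIVa, eval_taylor,
    eval_derivative_taylor_nil, eval_derivative_taylor_cons, hor_nil, hor_cons, Grp.ell,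
    Case.scaledG, Case.ofParam, Case.group, Case.shiftG, Case.shiftH, Grp.sigma, Grp.eps,
    Case.detG, Case.detH, Case.detAddG, Case.detAddH, Case.kap, Case.quotDen, Case.quotNum,
    Nat.cast_one, Nat.cast_ofNat]
  refine ⟨?_, ?_, ?_⟩ <;> exact eq_of_test p n t (by decide +kernel)

set_option synthInstance.maxSize 100000 in
set_option synthInstance.maxHeartbeats 0 in
theorem detIdentity_IVb : DetIdentity .IVb := by
  intro p n t
  simp only [seeds, rowDet, rowDetAdd, det₃, det₄, Case.seedU, Case.seedV, Case.expG, Case.expH,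
    scaledJacobi, Case.seedDiff, numA, numB, numAIVb, numBIVb, eval_taylor,
    eval_derivative_taylor_nil, eval_derivative_taylor_cons, hor_nil, hor_cons, Grp.ell,
    Case.scaledG, Case.ofParam, Case.group, Case.shiftG, Case.shiftH, Grp.sigma, Grp.eps,
    Case.detG, Case.detH, Case.detAddG, Case.detAddH, Case.kap, Case.quotDen, Case.quotNum,
    Nat.cast_one, Nat.cast_ofNat]
  refine ⟨?_, ?_, ?_⟩ <;> exact eq_of_test p n t (by decide +kernel)

theorem detIdentity (c : Case) : DetIdentity c := by
  cases c
  · exact detIdentity_Ia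
  · exact detIdentity_Ib
  · exact detIdentity_IIa
  · exact detIdentity_IIb
  · exact detIdentity_IIIa
  · exact detIdentity_IIIb
  · exact detIdentity_IVa
  · exact detIdentity_IVb

/-! ### The Wronskians on the curve -/

/-- The exponent of `sin x` in a seed solution. -/
def sinExp (g : ℝ) : SeedType → ℝ
  | .I => g | .II => 1 - g | .III => 1 - g

/-- The exponent of `cos x` in a seed solution. -/
def cosExp (h : ℝ) : SeedType → ℝ
  | .I => 1 - h | .II => h | .III => 1 - h

/-- The polynomial of a seed solution. -/
def seedJacobi (g h : ℝ) (s : SeedType × ℕ) : ℝ[X] :=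
  jacobi s.2 (sinExp g s.1 - 1 / 2) (cosExp h s.1 - 1 / 2)

theorem seedFun_eq (g h : ℝ) (s : SeedType × ℕ) :
    seedFun g h s = ptFun (sinExp g s.1) (cosExp h s.1) (seedJacobi g h s) := by
  have e : ∀ r : ℝ, 1 - r - 1 / 2 = 1 / 2 - r := fun r => by ring
  obtain ⟨_ | _ | _, v⟩ := s <;> funext x <;>
    simp only [seedFun, ptFun, seedJacobi, sinExp, cosExp, e]

theorem phi_eq (c : Case) (h : ℝ) (n : ℕ) :
    phi (curve c h) h n = ptFun (curve c h) h (baseJacobi c h n) := rfl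

/-- The squares (2v + a + b)² - (g + h)² factor into the seed energies for all three types. -/
theorem isSolution_seedFun (g h : ℝ) (s : SeedType × ℕ) {x : ℝ} (hx : x ∈ Ioo 0 (π / 2)) :
    IsSolution (potential g h x) (deriv (potential g h) x) (seedEnergy g h s)
      (ptFun (sinExp g s.1) (cosExp h s.1) (seedJacobi g h s) x)
      (ptFun (sinExp g s.1 - 1) (cosExp h s.1 - 1)
        (ptDeriv (sinExp g s.1) (cosExp h s.1) (seedJacobi g h s)) x) x (seedFun g h s) := by
  rw [seedFun_eq]
  have h1 := isSolution_ptFun (g := g) (h := h)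
    (solvesJacobi_jacobi s.2 (sinExp g s.1) (cosExp h s.1) _ _ rfl rfl)
    (by cases s.1 <;> simp only [sinExp] <;> ring) (by cases s.1 <;> simp only [cosExp] <;> ring) hx
  have h2 : (2 * (s.2 : ℝ) + sinExp g s.1 + cosExp h s.1) ^ 2 - (g + h) ^ 2 = seedEnergy g h s := by
    obtain ⟨_ | _ | _, v⟩ := s <;> simp only [sinExp, cosExp, seedEnergy] <;> ring
  rwa [h2] at h1

theorem isSolution_phi (c : Case) (h : ℝ) (n : ℕ) {x : ℝ} (hx : x ∈ Ioo 0 (π / 2)) :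
    IsSolution (potential (curve c h) h x) (deriv (potential (curve c h) h) x)
      (energy (curve c h) h n) (ptFun (curve c h) h (baseJacobi c h n) x)
      (ptFun (curve c h - 1) (h - 1) (ptDeriv (curve c h) h (baseJacobi c h n)) x) x
      (phi (curve c h) h n) := by
  rw [phi_eq]
  have h1 := isSolution_ptFun (g := curve c h) (h := h)
    (solvesJacobi_jacobi n (curve c h) h _ _ rfl rfl) rfl rfl hx
  have h2 : (2 * (n : ℝ) + curve c h + h) ^ 2 - (curve c h + h) ^ 2 =
      energy (curve c h) h n := by
    rw [energy]; push_cast; ring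
  rwa [h2] at h1

/-- The factor `(sin x)^a (cos x)^b` of a seed solution. -/
def seedWeight (g h x : ℝ) (s : SeedType × ℕ) : ℝ :=
  Real.sin x ^ sinExp g s.1 * Real.cos x ^ cosExp h s.1

theorem seedU_eq {c : Case} {h : ℝ} (ha : Admissible c h) {s : SeedType × ℕ} (hs : s.2 = 1 ∨ s.2 = 2) (t : ℝ) :
    c.seedU (c.par h) t s = c.par h ^ s.2 * (seedJacobi (curve c h) h s).eval t ∧
    c.seedV (c.par h) t s = c.par h ^ (s.2 + 1) *
      (ptDeriv (sinExp (curve c h) s.1) (cosExp h s.1) (seedJacobi (curve c h) h s)).eval t := by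
  have hg : c.scaledG (c.par h) = c.par h * curve c h := c.scaledG_param ha
  have hh : c.ofParam (c.par h) = h := c.ofParam_param h
  have e1 : c.expG (c.par h) s.1 = c.par h * sinExp (curve c h) s.1 := by
    cases s.1 <;> simp only [Case.expG, sinExp, hg] <;> ring
  have e2 : c.expH (c.par h) s.1 = c.par h * cosExp h s.1 := by
    cases s.1 <;> simp only [Case.expH, cosExp, hh] <;> ring
  have e3 : scaledJacobi (c.expG (c.par h) s.1 - c.par h / 2) (c.expH (c.par h) s.1 - c.par h / 2)
      (c.par h) s.2 = C (c.par h ^ s.2) * seedJacobi (curve c h) h s := by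
    rw [seedJacobi, ← scaledJacobi_eq _ _ _ hs, e1, e2]
    congr 1 <;> ring
  constructor
  · rw [Case.seedU, e3, eval_mul, eval_C]
  · rw [Case.seedV, Case.seedU, e3, e1, e2]
    simp only [ptDeriv, eval_sub, eval_mul, eval_add, eval_C, eval_one, eval_X, eval_pow,
      derivative_mul, derivative_C, eval_zero]
    ring

/-- Values and derivatives of a seed with the power prefactor separated and the powers of p
restored; the energy is expressed relative to that of an arbitrary φ_n. -/
theorem seed_row {c : Case} {h x : ℝ} (ha : Admissible c h)
    (hx : x ∈ Ioo 0 (π / 2)) {s : SeedType × ℕ} (hs : s.2 = 1 ∨ s.2 = 2) (n : ℕ) :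
    IsSolution (potential (curve c h) h x) (deriv (potential (curve c h) h) x)
      (energy (curve c h) h n - c.seedDiff (c.par h) n s / c.par h)
      (seedWeight (curve c h) h x s * (c.seedU (c.par h) (eta x) s / c.par h ^ s.2))
      (seedWeight (curve c h) h x s * (c.seedV (c.par h) (eta x) s /
        (c.par h ^ (s.2 + 1) * (Real.sin x * Real.cos x)))) x (seedFun (curve c h) h s) := by
  have hp := c.par_ne_zero ha
  have h1 := isSolution_seedFun (curve c h) h s hx
  obtain ⟨e1, e2⟩ := seedU_eq ha hs (eta x)
  rw [seedDiff_eq c ha, mul_div_cancel_left₀ _ hp, sub_sub_cancel, e1, e2,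
    mul_div_cancel_left₀ _ (pow_ne_zero _ hp), mul_div_mul_left _ _ (pow_ne_zero _ hp),
    seedWeight, ← ptFun_sub_one _ _ _ hx]
  exact h1

theorem wronskian_seeds_two {c : Case} {h x : ℝ} (ha : Admissible c h)
    (hx : x ∈ Ioo 0 (π / 2)) {s₁ s₂ : SeedType × ℕ} (h₁ : s₁.2 = 1 ∨ s₁.2 = 2)
    (h₂ : s₂.2 = 1 ∨ s₂.2 = 2) :
    wronskian ([s₁, s₂].map (seedFun (curve c h) h)) x =
      seedWeight (curve c h) h x s₁ * seedWeight (curve c h) h x s₂ /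
        (c.par h ^ (s₁.2 + s₂.2 + 1) * (Real.sin x * Real.cos x)) *
      rowDet (c.seedU (c.par h) (eta x)) (c.seedV (c.par h) (eta x)) (c.seedDiff (c.par h) 0)
        [s₁, s₂] := by
  have hp := c.par_ne_zero ha
  have hs := (sin_pos_of_mem hx).ne'
  have hc := (cos_pos_of_mem hx).ne'
  refine (wronskian_two (seed_row ha hx h₁ 0) (seed_row ha hx h₂ 0)).trans ?_
  rw [rowDet]
  field_simp
  ring

theorem wronskian_seeds_three {c : Case} {h x : ℝ} (ha : Admissible c h)
    (hx : x ∈ Ioo 0 (π / 2)) {s₁ s₂ s₃ : SeedType × ℕ} (h₁ : s₁.2 = 1 ∨ s₁.2 = 2)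
    (h₂ : s₂.2 = 1 ∨ s₂.2 = 2) (h₃ : s₃.2 = 1 ∨ s₃.2 = 2) :
    wronskian ([s₁, s₂, s₃].map (seedFun (curve c h) h)) x =
      seedWeight (curve c h) h x s₁ * seedWeight (curve c h) h x s₂ *
        seedWeight (curve c h) h x s₃ /
        (c.par h ^ (s₁.2 + s₂.2 + s₃.2 + 2) * (Real.sin x * Real.cos x)) *
      rowDet (c.seedU (c.par h) (eta x)) (c.seedV (c.par h) (eta x)) (c.seedDiff (c.par h) 0)
        [s₁, s₂, s₃] := by
  have hp := c.par_ne_zero ha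
  have hs := (sin_pos_of_mem hx).ne'
  have hc := (cos_pos_of_mem hx).ne'
  refine (wronskian_three (seed_row ha hx h₁ 0) (seed_row ha hx h₂ 0) (seed_row ha hx h₃ 0)
    (energy (curve c h) h (0 : ℕ))).trans ?_
  rw [rowDet, det₃, det₃, Nat.cast_zero]
  field_simp
  ring_nf

/-- The entries of the last row, for the eigenfunction. -/
theorem phi_row {c : Case} {h x : ℝ} (ha : Admissible c h)
    (hx : x ∈ Ioo 0 (π / 2)) (n : ℕ) :
    IsSolution (potential (curve c h) h x) (deriv (potential (curve c h) h) x)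
      (energy (curve c h) h n)
      (Real.sin x ^ curve c h * Real.cos x ^ h * (baseJacobi c h n).eval (eta x))
      (Real.sin x ^ curve c h * Real.cos x ^ h *
        (((c.scaledG (c.par h) * (1 + eta x) / 2 -
          c.par h * c.ofParam (c.par h) * (1 - eta x) / 2) * (baseJacobi c h n).eval (eta x) -
          c.par h * (1 - eta x ^ 2) * (derivative (baseJacobi c h n)).eval (eta x)) /
        (c.par h * (Real.sin x * Real.cos x)))) x (phi (curve c h) h n) := by
  have hp := c.par_ne_zero ha
  have hg : c.scaledG (c.par h) = c.par h * curve c h := c.scaledG_param ha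
  have hh : c.ofParam (c.par h) = h := c.ofParam_param h
  have e : (c.scaledG (c.par h) * (1 + eta x) / 2 -
          c.par h * c.ofParam (c.par h) * (1 - eta x) / 2) * (baseJacobi c h n).eval (eta x) -
          c.par h * (1 - eta x ^ 2) * (derivative (baseJacobi c h n)).eval (eta x) =
        c.par h * (ptDeriv (curve c h) h (baseJacobi c h n)).eval (eta x) := by
    rw [hg, hh]
    simp only [ptDeriv, eval_sub, eval_mul, eval_add, eval_C, eval_one, eval_X, eval_pow]
    ring
  have h1 := isSolution_phi c h n hx
  rw [e, mul_div_mul_left _ _ hp, ← ptFun_sub_one _ _ _ hx]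
  exact h1

theorem wronskian_add_two {c : Case} {h x : ℝ} (ha : Admissible c h)
    (hx : x ∈ Ioo 0 (π / 2)) {s₁ s₂ : SeedType × ℕ} (h₁ : s₁.2 = 1 ∨ s₁.2 = 2)
    (h₂ : s₂.2 = 1 ∨ s₂.2 = 2) (n : ℕ) :
    wronskian ([s₁, s₂].map (seedFun (curve c h) h) ++ [phi (curve c h) h n]) x =
      seedWeight (curve c h) h x s₁ * seedWeight (curve c h) h x s₂ *
        (Real.sin x ^ curve c h * Real.cos x ^ h) /
        (c.par h ^ (s₁.2 + s₂.2 + 2) * (Real.sin x * Real.cos x)) *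
      ((baseJacobi c h n).eval (eta x) * rowDetAdd (c.seedU (c.par h) (eta x))
        (c.seedV (c.par h) (eta x)) (c.seedDiff (c.par h) n) 1
        (c.scaledG (c.par h) * (1 + eta x) / 2 -
          c.par h * c.ofParam (c.par h) * (1 - eta x) / 2) [s₁, s₂] +
      (derivative (baseJacobi c h n)).eval (eta x) * rowDetAdd (c.seedU (c.par h) (eta x))
        (c.seedV (c.par h) (eta x)) (c.seedDiff (c.par h) n) 0
        (-(c.par h * (1 - eta x ^ 2))) [s₁, s₂]) := by
  have hp := c.par_ne_zero ha
  have hs := (sin_pos_of_mem hx).ne'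
  have hc := (cos_pos_of_mem hx).ne'
  refine (wronskian_three (seed_row ha hx h₁ n) (seed_row ha hx h₂ n) (phi_row ha hx n)
    (energy (curve c h) h n)).trans ?_
  rw [rowDetAdd, rowDetAdd, det₃, det₃, det₃]
  generalize (c.scaledG (c.par h) * (1 + eta x) / 2 -
          c.par h * c.ofParam (c.par h) * (1 - eta x) / 2) = r
  field_simp
  ring

theorem wronskian_add_three {c : Case} {h x : ℝ} (ha : Admissible c h)
    (hx : x ∈ Ioo 0 (π / 2)) {s₁ s₂ s₃ : SeedType × ℕ} (h₁ : s₁.2 = 1 ∨ s₁.2 = 2)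
    (h₂ : s₂.2 = 1 ∨ s₂.2 = 2) (h₃ : s₃.2 = 1 ∨ s₃.2 = 2) (n : ℕ) :
    wronskian ([s₁, s₂, s₃].map (seedFun (curve c h) h) ++ [phi (curve c h) h n]) x =
      seedWeight (curve c h) h x s₁ * seedWeight (curve c h) h x s₂ *
        seedWeight (curve c h) h x s₃ * (Real.sin x ^ curve c h * Real.cos x ^ h) /
        (c.par h ^ (s₁.2 + s₂.2 + s₃.2 + 4) * (Real.sin x * Real.cos x) ^ 2) *
      ((baseJacobi c h n).eval (eta x) * rowDetAdd (c.seedU (c.par h) (eta x))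
        (c.seedV (c.par h) (eta x)) (c.seedDiff (c.par h) n) 1
        (c.scaledG (c.par h) * (1 + eta x) / 2 -
          c.par h * c.ofParam (c.par h) * (1 - eta x) / 2) [s₁, s₂, s₃] +
      (derivative (baseJacobi c h n)).eval (eta x) * rowDetAdd (c.seedU (c.par h) (eta x))
        (c.seedV (c.par h) (eta x)) (c.seedDiff (c.par h) n) 0
        (-(c.par h * (1 - eta x ^ 2))) [s₁, s₂, s₃]) := by
  have hp := c.par_ne_zero ha
  have hs := (sin_pos_of_mem hx).ne'
  have hc := (cos_pos_of_mem hx).ne'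
  refine (wronskian_four (seed_row ha hx h₁ n) (seed_row ha hx h₂ n) (seed_row ha hx h₃ n)
    (phi_row ha hx n)).trans ?_
  rw [rowDetAdd, rowDetAdd, det₄, det₄, det₄]
  generalize (c.scaledG (c.par h) * (1 + eta x) / 2 -
          c.par h * c.ofParam (c.par h) * (1 - eta x) / 2) = r
  field_simp
  ring

/-! ### Closed forms of the Wronskians -/

/-- The power of `p` in the denominator of the Wronskian of the seeds. -/
def Case.detP : Case → ℕ
  | .Ia => 4 | .Ib => 6 | .IIa => 4 | .IIb => 4 | .IIIa => 4 | .IIIb => 6 | .IVa => 6 | .IVb => 6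

/-- The number of seeds, minus two. -/
def Case.extra : Case → ℕ
  | .Ia => 0 | .Ib => 1 | .IIa => 0 | .IIb => 0 | .IIIa => 0 | .IIIb => 1 | .IVa => 1 | .IVb => 1

theorem seedWronskian_mul {c : Case} {h x : ℝ} (ha : Admissible c h) (hx : x ∈ Ioo 0 (π / 2)) :
    seedWronskian c h x =
      ((seeds c).map (seedWeight (curve c h) h x)).prod /
        (c.par h ^ c.detP * (Real.sin x * Real.cos x)) *
      (c.kap (c.par h) * ((1 - eta x) ^ c.detG * (1 + eta x) ^ c.detH) *
        (2 * (lin c h).eval (eta x)) ^ 3) := by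
  rw [← ell_eq, ← (detIdentity c (c.par h) 0 (eta x)).1, seedWronskian]
  cases c <;> simp only [seeds] <;>
  first
  | rw [wronskian_seeds_two ha hx (by decide) (by decide)]
  | rw [wronskian_seeds_three ha hx (by decide) (by decide) (by decide)]
  all_goals simp only [List.map_cons, List.map_nil, List.prod_cons, List.prod_nil, mul_one,
    Case.detP, mul_assoc]

/-- The determinant is linear in the row of φ_n, so the parts belonging to J and J' add up to
`transformed`. -/
theorem wronskian_add_mul {c : Case} {h x : ℝ} (ha : Admissible c h) (hx : x ∈ Ioo 0 (π / 2))
    (n : ℕ) :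
    c.quotDen (c.par h) *
      wronskian ((seeds c).map (seedFun (curve c h) h) ++ [phi (curve c h) h n]) x =
      ((seeds c).map (seedWeight (curve c h) h x)).prod *
        (Real.sin x ^ curve c h * Real.cos x ^ h) /
        (c.par h ^ (c.detP + c.extra + 1) * (Real.sin x * Real.cos x) ^ (c.extra + 1)) *
      (c.quotNum (c.par h) * c.kap (c.par h) *
        ((1 - eta x) ^ c.detAddG * (1 + eta x) ^ c.detAddH) *
        (2 * (lin c h).eval (eta x)) * (transformed c h n).eval (eta x)) := by
  obtain ⟨-, e1, e2⟩ := detIdentity c (c.par h) n (eta x)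
  rw [← ell_eq, eval_transformed, mul_add, ← mul_assoc (_ * _ * _ * _),
    ← mul_assoc (_ * _ * _ * _), ← e1, ← e2]
  cases c <;> simp only [seeds] <;>
  first
  | rw [wronskian_add_two ha hx (by decide) (by decide)]
  | rw [wronskian_add_three ha hx (by decide) (by decide) (by decide)]
  all_goals
    simp only [List.map_cons, List.map_nil, List.prod_cons, List.prod_nil, mul_one, Case.detP,
      Case.extra]
    ring

/-- The exponents of the individual seeds add up to the prefactor of the Wronskian. -/
theorem prod_seedWeight (c : Case) (h : ℝ) {x : ℝ} (hx : x ∈ Ioo 0 (π / 2)) :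
    ((seeds c).map (seedWeight (curve c h) h x)).prod *
        ((Real.sin x ^ 2) ^ c.detG * (Real.cos x ^ 2) ^ c.detH) =
      Real.sin x ^ (2 * exponentMinus c h) * Real.cos x ^ (2 * exponentPlus c h) *
        (Real.sin x * Real.cos x) := by
  have hs := sin_pos_of_mem hx
  have hc := cos_pos_of_mem hx
  -- Writing sin x and cos x as exponentials makes every power, real or integer, additive in the
  -- exponent, so that linear arithmetic of exponents remains.
  obtain ⟨a, hsa⟩ : ∃ a, Real.sin x = Real.exp a := ⟨_, (Real.exp_log hs).symm⟩
  obtain ⟨b, hcb⟩ : ∃ b, Real.cos x = Real.exp b := ⟨_, (Real.exp_log hc).symm⟩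
  cases c <;>
  · simp [seeds, seedWeight, sinExp, cosExp, exponentMinus, exponentPlus, numSeeds, Case.detG,
      Case.detH, hsa, hcb, ← Real.exp_mul, ← Real.exp_add, ← Real.exp_nat_mul]
    ring

theorem eigen_weight (c : Case) (h : ℝ) {x : ℝ} (hx : x ∈ Ioo 0 (π / 2)) :
    Real.sin x ^ curve c h * Real.cos x ^ h *
        ((Real.sin x ^ 2) ^ c.detAddG * (Real.cos x ^ 2) ^ c.detAddH) =
      Real.sin x ^ gBar c h * Real.cos x ^ hBar c h *
        ((Real.sin x ^ 2) ^ c.detG * (Real.cos x ^ 2) ^ c.detH) *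
        (Real.sin x * Real.cos x) ^ c.extra := by
  have hs := sin_pos_of_mem hx
  have hc := cos_pos_of_mem hx
  obtain ⟨a, hsa⟩ : ∃ a, Real.sin x = Real.exp a := ⟨_, (Real.exp_log hs).symm⟩
  obtain ⟨b, hcb⟩ : ∃ b, Real.cos x = Real.exp b := ⟨_, (Real.exp_log hc).symm⟩
  rw [gBar_eq_add, hBar_eq_add]
  cases c <;>
  · simp [Case.detG, Case.detH, Case.detAddG, Case.detAddH, Case.extra, Case.shiftG, Case.shiftH,
      hsa, hcb, ← Real.exp_mul, ← Real.exp_add, ← Real.exp_nat_mul]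
    try ring

theorem two_mul_sq_rpow {s : ℝ} (hs : 0 < s) (r : ℝ) : (2 * s ^ 2) ^ r = 2 ^ r * s ^ (2 * r) := by
  rw [mul_rpow (by norm_num) (by positivity), ← rpow_natCast s 2, ← rpow_mul hs.le]
  norm_num

/-- The constant in the Wronskian of the seeds. -/
def kappa (c : Case) (h : ℝ) : ℝ :=
  8 * c.kap (c.par h) * 2 ^ (c.detG + c.detH) /
    (c.par h ^ c.detP * 2 ^ (exponentMinus c h + exponentPlus c h))

theorem seedWronskian_eq {c : Case} {h x : ℝ} (ha : Admissible c h) (hx : x ∈ Ioo 0 (π / 2)) :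
    seedWronskian c h x =
      (1 - eta x) ^ exponentMinus c h * (1 + eta x) ^ exponentPlus c h *
        (C (kappa c h) * lin c h ^ 3).eval (eta x) := by
  have hp := c.par_ne_zero ha
  have hs := sin_pos_of_mem hx
  have hc := cos_pos_of_mem hx
  have h2 : (2 : ℝ) ^ (exponentMinus c h + exponentPlus c h) ≠ 0 := (by positivity)
  have key := prod_seedWeight c h hx
  rw [seedWronskian_mul ha hx]
  simp only [eval_mul, eval_C, eval_pow, kappa]
  rw [one_sub_eta, one_add_eta, two_mul_sq_rpow hs, two_mul_sq_rpow hc, mul_pow 2, mul_pow 2]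
  rw [rpow_add (by norm_num)] at h2 ⊢
  rw [pow_add]
  generalize (lin c h).eval (eta x) = l
  have h3 := left_ne_zero_of_mul h2
  have h4 := right_ne_zero_of_mul h2
  field_simp
  linear_combination (8 * l ^ 3 * c.kap (c.par h)) * key

/-- The factor between the polynomial part of the transformed eigenfunction and
`transformed c h n`. -/
def Case.scale (c : Case) (p : ℝ) : ℝ :=
  match c with
  | .Ia => 1 / (16 * p) | .Ib => 1 / (32 * p ^ 3) | .IIa => -1 / (16 * p)
  | .IIb => 1 / (16 * p ^ 2) | .IIIa => -1 / (16 * p ^ 2) | .IIIb => -1 / (32 * p)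
  | .IVa => 1 / (32 * p ^ 3) | .IVb => -1 / (32 * p ^ 2)

/-- The polynomial part of the transformed eigenfunction. -/
def polyPart (c : Case) (h : ℝ) (n : ℕ) : ℝ[X] :=
  C (2 ^ (-(curve c h + h) / 2) * c.scale (c.par h)) * transformed c h n

/-- Bookkeeping of the powers of 2 and p that fixes `Case.scale`. -/
theorem quot_eq (c : Case) {p : ℝ} (hp : p ≠ 0) :
    c.quotNum p * 2 ^ (c.detAddG + c.detAddH) * 2 ^ (2 * c.group.typeIII / 2) =
    c.scale p * c.quotDen p * p ^ (c.extra + 1) * 4 * 2 ^ (c.detG + c.detH) ∧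
      c.quotDen p ≠ 0 := by
  cases c <;> simp [Case.quotNum, Case.detAddG, Case.detAddH, Case.scale, Case.quotDen,
    Case.extra, Case.detG, Case.detH, Grp.typeIII, Case.group, hp] <;> field_simp <;> norm_num

/-- In the quotient of the two determinants the constant `Case.kap` cancels, and ℓ over ℓ³ leaves
the denominator ℓ². -/
theorem deformedState_eq {c : Case} {h x : ℝ} (ha : Admissible c h) (hx : x ∈ Ioo 0 (π / 2))
    (hk : c.kap (c.par h) ≠ 0) (hl : (lin c h).eval (eta x) ≠ 0) (n : ℕ) :
    deformedState c h n x = waveFun c h (polyPart c h n) x := by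
  have hp := c.par_ne_zero ha
  have hs := sin_pos_of_mem hx
  have hc := cos_pos_of_mem hx
  obtain ⟨hq, hq0⟩ := quot_eq c hp
  have key := eigen_weight c h hx
  have hW := seedWronskian_mul ha hx
  have hA := wronskian_add_mul ha hx n
  have hw : ((seeds c).map (seedWeight (curve c h) h x)).prod ≠ 0 := by
    refine List.prod_ne_zero fun h0 => ?_
    obtain ⟨s, -, hs0⟩ := List.mem_map.1 h0
    have : 0 < seedWeight (curve c h) h x s := by rw [seedWeight]; positivity
    exact this.ne' hs0
  have h1 : 0 < 1 - eta x := by rw [one_sub_eta]; positivity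
  have h2 : 0 < 1 + eta x := by rw [one_add_eta]; positivity
  have h0 : seedWronskian c h x ≠ 0 := by
    rw [hW]
    positivity
  rw [deformedState, div_eq_iff h0]
  refine mul_left_cancel₀ hq0 ?_
  rw [hA, hW, waveFun, polyPart, eval_mul, eval_C]
  rw [one_sub_eta, one_add_eta, two_mul_sq_rpow hs, two_mul_sq_rpow hc, mul_pow 2, mul_pow 2,
    mul_pow 2, mul_pow 2, mul_div_cancel₀ _ two_ne_zero, mul_div_cancel₀ _ two_ne_zero]
  -- Passing from sin x and cos x to 1 ± η creates powers of 2, balanced here through ḡ + h̄ + 2L =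
  -- g + h.
  have e2 : (2 : ℝ) ^ (-(curve c h + h) / 2) * (2 ^ (gBar c h / 2) * 2 ^ (hBar c h / 2)) *
      2 ^ (2 * c.group.typeIII / 2) = 1 := by
    rw [← rpow_add (by norm_num), ← rpow_add (by norm_num), ← rpow_add (by norm_num),
      ← gBar_add_hBar]
    ring_nf
    exact rpow_zero _
  have e3 : c.quotNum (c.par h) * (2 ^ c.detAddG * 2 ^ c.detAddH) =
      c.scale (c.par h) * c.quotDen (c.par h) * c.par h ^ (c.extra + 1) * 4 *
        (2 ^ c.detG * 2 ^ c.detH) *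
        (2 ^ (-(curve c h + h) / 2) * (2 ^ (gBar c h / 2) * 2 ^ (hBar c h / 2))) := by
    rw [pow_add, pow_add] at hq
    linear_combination (2 ^ (-(curve c h + h) / 2) * (2 ^ (gBar c h / 2) * 2 ^ (hBar c h / 2))) * hq
      - c.quotNum (c.par h) * (2 ^ c.detAddG * 2 ^ c.detAddH) * e2
  generalize (lin c h).eval (eta x) = l at *
  generalize (transformed c h n).eval (eta x) = T at *
  generalize ((seeds c).map (seedWeight (curve c h) h x)).prod = w at *
  generalize (2 : ℝ) ^ (-(curve c h + h) / 2) = E₀ at *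
  generalize (2 : ℝ) ^ (gBar c h / 2) = E₁ at *
  generalize (2 : ℝ) ^ (hBar c h / 2) = E₂ at *
  generalize Real.sin x ^ curve c h = a₁ at *
  generalize Real.cos x ^ h = a₂ at *
  generalize Real.sin x ^ gBar c h = b₁ at *
  generalize Real.cos x ^ hBar c h = b₂ at *
  generalize (Real.sin x ^ 2) ^ c.detAddG = d₁ at *
  generalize (Real.cos x ^ 2) ^ c.detAddH = d₂ at *
  generalize (Real.sin x ^ 2) ^ c.detG = d₃ at *
  generalize (Real.cos x ^ 2) ^ c.detH = d₄ at *
  generalize (2 : ℝ) ^ c.detAddG = f₁ at *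
  generalize (2 : ℝ) ^ c.detAddH = f₂ at *
  generalize (2 : ℝ) ^ c.detG = f₃ at *
  generalize (2 : ℝ) ^ c.detH = f₄ at *
  generalize c.quotNum (c.par h) = qN at *
  generalize c.quotDen (c.par h) = qD at *
  generalize c.kap (c.par h) = kp at *
  generalize c.scale (c.par h) = sc at *
  generalize c.par h = p at *
  have hsc : Real.sin x * Real.cos x ≠ 0 := (mul_pos hs hc).ne'
  generalize Real.sin x * Real.cos x = sc₀ at *
  rw [pow_succ sc₀, add_assoc, pow_add p]
  have hr := pow_ne_zero c.extra hsc
  have hr1 := pow_ne_zero (c.extra + 1) hp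
  have hr2 := pow_ne_zero c.detP hp
  generalize sc₀ ^ c.extra = r at *
  generalize p ^ (c.extra + 1) = r₁ at *
  generalize p ^ c.detP = r₂ at *
  rw [eq_comm] at e3
  field_simp
  linear_combination (T * qN * f₁ * f₂) * key - T * b₁ * b₂ * d₃ * d₄ * r * e3

/-! ### The deformed system -/

/-- The linear factors in p give the degenerate values. The quadratic ones are (p ± 1)² + 8 and have
no real zero, and a factor p is excluded by admissibility. -/
theorem kap_ne_zero_iff (c : Case) {h : ℝ} (ha : Admissible c h) :
    c.kap (c.par h) ≠ 0 ↔ hBar c h ∉ degenerateHBar c := by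
  have hp := c.par_ne_zero ha
  rw [Case.par] at hp ⊢
  have q1 : (param c.group (hBar c h)) ^ 2 - 2 * param c.group (hBar c h) + 9 ≠ 0 :=
    (by nlinarith [sq_nonneg (param c.group (hBar c h) - 1)] : (0 : ℝ) < _).ne'
  have q2 : (param c.group (hBar c h)) ^ 2 + 2 * param c.group (hBar c h) + 9 ≠ 0 :=
    (by nlinarith [sq_nonneg (param c.group (hBar c h) + 1)] : (0 : ℝ) < _).ne'
  refine not_congr ?_
  obtain ⟨p, hb⟩ : ∃ p, param c.group (hBar c h) = p := ⟨_, rfl⟩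
  rw [hb] at hp q1 q2 ⊢
  revert hb
  generalize hBar c h = b
  cases c <;> intro hb <;>
  simp only [Case.kap, degenerateHBar, mem_insert_iff, mem_singleton_iff, div_eq_zero_iff,
    mul_eq_zero, neg_eq_zero, pow_eq_zero_iff two_ne_zero, hp, q1, q2, false_or, or_false, or_assoc,
    OfNat.ofNat_ne_zero, param, Case.group, Grp.sigma] at hb ⊢ <;>
  subst hb <;>
  constructor <;>
  · rintro (h0 | h0 | h0 | h0) <;>
    first
    | (refine Or.inl ?_; linarith)
    | (refine Or.inr (Or.inl ?_); linarith)
    | (refine Or.inr (Or.inr (Or.inl ?_)); linarith)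
    | (refine Or.inr (Or.inr (Or.inr ?_)); linarith)

theorem kappa_ne_zero_iff (c : Case) {h : ℝ} (ha : Admissible c h) :
    kappa c h ≠ 0 ↔ hBar c h ∉ degenerateHBar c := by
  have hp := c.par_ne_zero ha
  have h2 : (2 : ℝ) ^ (exponentMinus c h + exponentPlus c h) ≠ 0 := (by positivity)
  rw [← kap_ne_zero_iff c ha, kappa, ne_eq, ne_eq, not_iff_not, div_eq_zero_iff]
  simp [hp, h2]

theorem eval_lin_one_ne_zero (c : Case) {h : ℝ} : (lin c h).eval 1 ≠ 0 := by
  rw [eval_lin]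
  have := c.group.sigma_ne_zero
  intro h0
  exact this (by linarith)

theorem eval_lin_neg_one_ne_zero (c : Case) {h : ℝ} (ha : Admissible c h) :
    (lin c h).eval (-1) ≠ 0 := by
  rw [eval_lin]
  have := c.par_ne_zero ha
  rw [Case.par] at this
  intro h0
  exact this (by linarith)

theorem natDegree_lin (c : Case) {h : ℝ} (ha : Admissible c h) : (lin c h).natDegree = 1 := by
  rw [lin_eq c ha, natDegree_C_mul (slope_ne_zero c ha), natDegree_X_sub_C]

theorem eval_lin_etaZero (c : Case) {h : ℝ} (ha : Admissible c h) :
    (lin c h).eval (etaZero c h) = 0 := by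
  simp [lin_eq c ha]

/-- Uniqueness: x ↦ η covers (-1, 1), so two candidates agree at infinitely many points. -/
theorem isPolynomialPart_iff {c : Case} {h : ℝ} (ha : Admissible c h)
    (hd : hBar c h ∉ degenerateHBar c) (n : ℕ) (Q : ℝ[X]) :
    IsPolynomialPart c h n Q ↔ Q = polyPart c h n := by
  have hk := (kap_ne_zero_iff c ha).2 hd
  constructor
  · intro hQ
    refine Polynomial.eq_of_infinite_eval_eq _ _ (Set.Infinite.mono ?_
      ((Ioo_infinite (by norm_num : (-1 : ℝ) < 1)).sdiff (finite_singleton (etaZero c h))))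
    rintro t ⟨ht, ht0⟩
    have hx : Real.arccos t / 2 ∈ Ioo 0 (π / 2) := by
      have h1 := Real.arccos_pos.2 ht.2
      have h2 : Real.arccos t < π := by
        refine lt_of_le_of_ne (Real.arccos_le_pi t) fun h0 => ?_
        have := Real.arccos_eq_pi.1 h0
        linarith [ht.1]
      constructor <;> linarith
    have he : eta (Real.arccos t / 2) = t := by
      rw [eta, mul_div_cancel₀ _ two_ne_zero, Real.cos_arccos ht.1.le ht.2.le]
    have hl : (lin c h).eval (eta (Real.arccos t / 2)) ≠ 0 := by
      rw [he, eval_lin_eq c ha]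
      exact mul_ne_zero (slope_ne_zero c ha) (sub_ne_zero.2 ht0)
    have h1 := (hQ _ hx hl).symm.trans (deformedState_eq ha hx hk hl n)
    rw [waveFun, waveFun, he] at h1
    rw [he] at hl
    have h2 := rpow_pos_of_pos (sub_pos.2 ht.2) (gBar c h / 2)
    have h3 := rpow_pos_of_pos (neg_lt_iff_pos_add'.1 ht.1) (hBar c h / 2)
    have h4 := mul_left_cancel₀ (mul_pos h2 h3).ne' h1
    exact (div_left_inj' (pow_ne_zero 2 hl)).1 h4
  · rintro rfl x hx hl
    exact deformedState_eq ha hx hk hl n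

/-- Up to a constant, log|W| is a log(1 - η) + b log(1 + η) + 3 log|η - η₀|. The exponents satisfy
4a = ḡ(ḡ - 1) - g(g - 1) and the analogue for h̄, so the first two terms shift the parameters and
the third gives the extra term. -/
theorem deformedPotential_eq {c : Case} {h x : ℝ} (ha : Admissible c h)
    (hd : hBar c h ∉ degenerateHBar c) (hx : x ∈ Ioo 0 (π / 2))
    (hl : (lin c h).eval (eta x) ≠ 0) : deformedPotential c h x = commonPotential c h x := by
  have hκ := (kappa_ne_zero_iff c ha).2 hd
  have hE := sub_etaZero_ne_zero c ha hl
  have hs := slope_ne_zero c ha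
  have ht := eta_mem hx
  set u : ℝ → ℝ := fun t => exponentMinus c h * Real.log (1 - t) +
    exponentPlus c h * Real.log (1 + t) + (Real.log (kappa c h * slope c h ^ 3) +
      3 * Real.log (t - etaZero c h)) with hu
  set u' : ℝ → ℝ := fun t => -exponentMinus c h / (1 - t) + exponentPlus c h / (1 + t) +
    3 / (t - etaZero c h) with hu'
  have hlog : (fun s => Real.log (seedWronskian c h s)) =ᶠ[𝓝 x] fun s => u (eta s) := by
    have hne : ∀ᶠ s in 𝓝 x, (lin c h).eval (eta s) ≠ 0 :=
      (((lin c h).continuous.continuousAt.comp (hasDerivAt_eta x).continuousAt)).eventually_ne hl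
    filter_upwards [Ioo_mem_nhds hx.1 hx.2, hne] with s hs' hls
    have h1 := eta_mem hs'
    have hEs := sub_etaZero_ne_zero c ha hls
    have e1 := rpow_pos_of_pos (sub_pos.2 h1.2) (exponentMinus c h)
    have e2 := rpow_pos_of_pos (neg_lt_iff_pos_add'.1 h1.1) (exponentPlus c h)
    have hc : kappa c h * slope c h ^ 3 ≠ 0 := mul_ne_zero hκ (pow_ne_zero 3 hs)
    rw [seedWronskian_eq ha hs', hu, eval_mul, eval_C, eval_pow, eval_lin_eq c ha, mul_pow,
      ← mul_assoc (kappa c h), Real.log_mul (mul_pos e1 e2).ne' (mul_ne_zero hc (pow_ne_zero 3 hEs)),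
      Real.log_mul e1.ne' e2.ne', Real.log_mul hc (pow_ne_zero 3 hEs),
      Real.log_rpow (sub_pos.2 h1.2), Real.log_rpow (neg_lt_iff_pos_add'.1 h1.1), Real.log_pow]
    norm_num
  have ev : ∀ᶠ t in 𝓝 (eta x), HasDerivAt u (u' t) t := by
    have hne : ∀ᶠ s in 𝓝 (eta x), s - etaZero c h ≠ 0 :=
      (continuousAt_id.sub continuousAt_const).eventually_ne hE
    filter_upwards [Ioo_mem_nhds ht.1 ht.2, hne] with t ht' hEt
    have d1 := (((hasDerivAt_id' t).const_sub 1).log (sub_pos.2 ht'.2).ne').const_mul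
      (exponentMinus c h)
    have d2 := (((hasDerivAt_id' t).const_add 1).log (neg_lt_iff_pos_add'.1 ht'.1).ne').const_mul
      (exponentPlus c h)
    have d3 := (((hasDerivAt_id' t).sub_const (etaZero c h)).log hEt).const_mul 3
    refine ((d1.fun_add d2).fun_add (d3.const_add _)).congr_deriv ?_
    simp only [hu']
    ring
  have p1 : 1 - eta x ≠ 0 := (sub_pos.2 ht.2).ne'
  have p2 : 1 + eta x ≠ 0 := (neg_lt_iff_pos_add'.1 ht.1).ne'
  have ev' : HasDerivAt u' (-exponentMinus c h / (1 - eta x) ^ 2 -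
      exponentPlus c h / (1 + eta x) ^ 2 - 3 / (eta x - etaZero c h) ^ 2) (eta x) := by
    have d1 := (hasDerivAt_const (eta x) (-exponentMinus c h)).fun_div
      ((hasDerivAt_id' (eta x)).const_sub 1) p1
    have d2 := (hasDerivAt_const (eta x) (exponentPlus c h)).fun_div
      ((hasDerivAt_id' (eta x)).const_add 1) p2
    have d3 := (hasDerivAt_const (eta x) (3 : ℝ)).fun_div
      ((hasDerivAt_id' (eta x)).sub_const (etaZero c h)) hE
    refine ((d1.fun_add d2).fun_add d3).congr_deriv ?_
    field_simp
    ring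
  rw [deformedPotential, hlog.iteratedDeriv_eq, iteratedDeriv_comp_eta ev ev', commonPotential_eq,
    extraTerm_eq c ha _ hE, potential, gBar_add_hBar]
  have f1 : Real.sin x ^ 2 = (1 - eta x) / 2 := by rw [one_sub_eta]; ring
  have f2 : Real.cos x ^ 2 = (1 + eta x) / 2 := by rw [one_add_eta]; ring
  have f3 : gBar c h * (gBar c h - 1) = curve c h * (curve c h - 1) + 4 * exponentMinus c h := by
    rw [exponentMinus, gBar]; ring
  have f4 : hBar c h * (hBar c h - 1) = h * (h - 1) + 4 * exponentPlus c h := by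
    rw [exponentPlus, hBar]; ring
  rw [f1, f2, mul_assoc 2, mul_assoc 2, f3, f4]
  simp only [hu']
  generalize exponentMinus c h = a
  generalize exponentPlus c h = b
  generalize etaZero c h = E at *
  generalize eta x = t at *
  generalize curve c h = g
  field_simp
  ring

/-! ### The explicit polynomials -/

/-- The factor between the explicit polynomials and `transformed`. -/
def Grp.explicitScale : Grp → ℝ
  | .I => -1 / 32 | .II => 1 / 32 | .III => -1 / 32 | .IV => 1 / 128

theorem Grp.explicitScale_ne_zero (G : Grp) : G.explicitScale ≠ 0 := by
  cases G <;> norm_num [Grp.explicitScale]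

theorem Grp.memberA_group (G : Grp) : G.memberA.group = G := by cases G <;> rfl

-- The factors of J and of J' are compared separately, after p is expressed by h.
set_option synthInstance.maxSize 100000 in
set_option synthInstance.maxHeartbeats 0 in
theorem explicitPoly_eq (G : Grp) (h : ℝ) (n : ℕ) :
    explicitPoly G h n = C G.explicitScale * transformed G.memberA h n := by
  refine Polynomial.funext fun t => ?_
  rw [eval_mul, eval_C, eval_transformed, Case.par, hBar_eq_add]
  cases G <;>
    simp only [explicitPoly, Grp.memberA, Case.group, Case.shiftH, param, Grp.sigma, baseJacobi,
      eval_add, eval_mul, Grp.explicitScale, numA, numB, mul_add, ← mul_assoc]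
  · refine congrArg₂ (· + ·) (congrArg (· * _) ?_) (congrArg (· * _) ?_) <;>
    · simp only [coeffJacI, coeffDerI, eval_add, eval_sub, eval_mul, eval_pow, eval_C, eval_X,
        eval_natCast, eval_ofNat, eval_neg, eval_one, numAIa, numBIa, eval_taylor, hor_cons,
        hor_nil]
      exact eq_of_test h (n : ℝ) t (by decide +kernel)
  · refine congrArg₂ (· + ·) (congrArg (· * _) ?_) (congrArg (· * _) ?_) <;>
    · simp only [coeffJacII, coeffDerII, eval_add, eval_sub, eval_mul, eval_pow, eval_C, eval_X,
        eval_natCast, eval_ofNat, eval_neg, eval_one, numAIIa, numBIIa, eval_taylor, hor_cons,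
        hor_nil]
      exact eq_of_test h (n : ℝ) t (by decide +kernel)
  · refine congrArg₂ (· + ·) (congrArg (· * _) ?_) (congrArg (· * _) ?_) <;>
    · simp only [coeffJacIII, coeffDerIII, eval_add, eval_sub, eval_mul, eval_pow, eval_C, eval_X,
        eval_natCast, eval_ofNat, eval_neg, eval_one, numAIIIa, numBIIIa, eval_taylor, hor_cons,
        hor_nil]
      exact eq_of_test h (n : ℝ) t (by decide +kernel)
  · refine congrArg₂ (· + ·) (congrArg (· * _) ?_) (congrArg (· * _) ?_) <;>
    · simp only [coeffJacIV, coeffDerIV, eval_add, eval_sub, eval_mul, eval_pow, eval_C, eval_X,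
        eval_natCast, eval_ofNat, eval_neg, eval_one, numAIVa, numBIVa, eval_taylor, hor_cons,
        hor_nil]
      exact eq_of_test h (n : ℝ) t (by decide +kernel)

theorem hBar_hOfMemberA (G : Grp) (b : ℝ) : hBar G.memberA (hOfMemberA G b) = b := by
  rw [hBar_eq_add]
  cases G <;> simp only [Grp.memberA, Case.shiftH, hOfMemberA] <;> ring

theorem hOfMemberA_hBar (G : Grp) (h : ℝ) : hOfMemberA G (hBar G.memberA h) = h := by
  rw [hBar_eq_add]
  cases G <;> simp only [Grp.memberA, Case.shiftH, hOfMemberA] <;> ring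

/-- With its companions this expresses that everything relevant depends on the group and on h̄ only,
so results pass from member (a) to member (b). -/
theorem admissible_congr {c c' : Case} {h h' : ℝ} (hc : c.group = c'.group)
    (hb : hBar c h = hBar c' h') : Admissible c h ↔ Admissible c' h' := by
  rw [admissible_iff, admissible_iff, hc, hb]

theorem statedRange_congr {c c' : Case} {h h' : ℝ} (hc : c.group = c'.group)
    (hb : hBar c h = hBar c' h') : StatedRange c h ↔ StatedRange c' h' := by
  rw [statedRange_iff, statedRange_iff, hc, hb]

theorem gBar_congr {c c' : Case} {h h' : ℝ} (hc : c.group = c'.group)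
    (hb : hBar c h = hBar c' h') (ha : Admissible c h) : gBar c h = gBar c' h' := by
  rw [gBar_eq_gBarOfHBar c ha, gBar_eq_gBarOfHBar c' ((admissible_congr hc hb).1 ha), hc, hb]

theorem etaZero_congr {c c' : Case} {h h' : ℝ} (hc : c.group = c'.group)
    (hb : hBar c h = hBar c' h') : etaZero c h = etaZero c' h' := by
  unfold etaZero; rw [hc, hb]

theorem normalEq_congr {c c' : Case} {h h' : ℝ} (hc : c.group = c'.group)
    (hb : hBar c h = hBar c' h') (ha : Admissible c h) (m : ℤ) :
    normalEq c h m = normalEq c' h' m := by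
  rw [normalEq, normalEq, tau, tau, spectral, spectral, gBar_congr hc hb ha, etaZero_congr hc hb,
    hb, hc]

set_option linter.unusedSimpArgs false in
theorem normalEq_additionalPoly (G : Grp) {h : ℝ} (ha : Admissible G.memberA h) {k : ℕ}
    (hk : G.IsMode (Int.negSucc k)) :
    (normalEq G.memberA h (Int.negSucc k)).Solves (additionalPoly G h k) := by
  have h1 := slope_ne_zero _ ha
  have h2 := etaZero_sub_one_ne_zero _ ha
  have h3 := etaZero_add_one_ne_zero _ ha
  have hg := gBar_eq_etaZero _ ha
  have hh := hBar_eq_etaZero _ ha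
  have hb := hBar_eq_add G.memberA h
  unfold normalEq tau spectral
  revert hk hg hh h1 h2 h3 hb
  generalize gBar G.memberA h = g
  generalize hBar G.memberA h = b
  generalize slope G.memberA h = s
  generalize etaZero G.memberA h = E
  cases G <;> intro hk h1 h2 h3 hg hh hb <;>
  simp only [Grp.sigma, Grp.eps, Grp.typeIII, Grp.memberA, Case.group, Case.shiftH,
    Grp.IsMode] at *
  on_goal 1 => obtain rfl : k = 1 := by omega
  on_goal 2 => obtain rfl : k = 2 := by omega
  on_goal 3 => obtain rfl : k = 1 := by omega
  on_goal 4 => obtain rfl | rfl : k = 1 ∨ k = 2 := by omega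
  all_goals
    rw [← sub_eq_iff_eq_add] at hb
    subst hb
    subst hg hh
    refine Polynomial.funext fun t => ?_
    simp only [additionalPoly, derivative_add, derivative_sub, derivative_mul, derivative_C,
      derivative_X, derivative_X_pow, derivative_one, derivative_zero, derivative_ofNat,
      derivative_neg, zero_mul, mul_one, zero_add,
      mul_zero, Nat.cast_ofNat, Nat.add_one_sub_one, pow_one, add_zero, eval_add, eval_sub,
      eval_mul, eval_pow, eval_C, eval_X, eval_one, eval_zero, eval_ofNat, Int.cast_negSucc,
      sub_zero, zero_sub, eval_neg, map_ofNat]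
    push_cast
    field_simp
    ring

theorem normalEq_memberAPoly (G : Grp) {h : ℝ} (ha : Admissible G.memberA h) {m : ℤ}
    (hm : G.IsMode m) : (normalEq G.memberA h m).Solves (memberAPoly G h m) := by
  cases m with
  | ofNat n =>
    rw [memberAPoly, explicitPoly_eq]
    exact (normalEq_transformed G.memberA ha n).C_mul _
  | negSucc k => exact normalEq_additionalPoly G ha hm

theorem normalEq_modePoly (c : Case) {h : ℝ} (ha : Admissible c h) {m : ℤ} (hm : m ∈ modes c) :
    (normalEq c h m).Solves (modePoly c h m) := by
  have hc := c.group.memberA_group.symm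
  have hb := (hBar_hOfMemberA c.group (hBar c h)).symm
  rw [normalEq_congr hc hb ha]
  exact normalEq_memberAPoly _ ((admissible_congr hc hb).1 ha) ((mem_modes_iff c m).1 hm)

/-- For n ≥ 0 the coefficients A, B are evaluated at η₀ = (p + σ)/(p - σ), and J does not vanish
there because η₀ lies outside [-1, 1]. In groups I to III the factor B vanishes at η₀; in group IV a
sign argument is needed. The additional modes have explicit nonzero values. -/
theorem memberAPoly_eval_etaZero_ne_zero (G : Grp) {h : ℝ} (hs : StatedRange G.memberA h) {m : ℤ}
    (hm : G.IsMode m) : (memberAPoly G h m).eval (etaZero G.memberA h) ≠ 0 := by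
  have ha := hs.admissible
  have hp := G.memberA.par_ne_zero ha
  have hps := G.memberA.par_sub_sigma_ne_zero ha
  have hE : etaZero G.memberA h = _ := etaZero_eq _ ha
  have hE1 := one_lt_etaZero_sq _ hs.regularRange
  have hr := (statedRange_iff _ _).1 hs
  have hb := hBar_eq_add G.memberA h
  cases m with
  | ofNat n =>
    rw [memberAPoly, explicitPoly_eq, eval_mul, eval_C, eval_transformed]
    refine mul_ne_zero G.explicitScale_ne_zero ?_
    obtain ⟨o1, o2⟩ := jacobi_outside n (α := curve G.memberA h - 1 / 2) (β := h - 1 / 2)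
      (by linarith [hs.curve_gt]) (by linarith [hs.h_gt])
    rw [← baseJacobi] at o1 o2
    have hJ : (baseJacobi G.memberA h n).eval (etaZero G.memberA h) ≠ 0 := by
      rcases one_lt_sq_iff_one_lt_abs _ |>.1 hE1 |> lt_abs.1 with h1 | h1
      · exact (o1 _ h1).1
      · exact (o2 _ (by linarith)).1
    rw [← Case.par] at hE
    revert hE o1 o2 hJ hp hps hE1 hr
    rw [show hBar G.memberA h = 1 / 2 + (G.memberA.par h - G.memberA.group.sigma / 3) / 4 from
      hBar_eq _ _]
    generalize etaZero G.memberA h = E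
    generalize G.memberA.par h = p
    generalize baseJacobi G.memberA h n = J
    rw [G.memberA_group]
    cases G <;> simp only [Grp.memberA, Grp.sigma, numA, numB, Grp.range] <;>
      intro hp hps hE hE1 hr o1 o2 hJ
    -- At η₀ the dependence on n disappears.
    · have eA : (numAIa p n).eval E = -1152 * p ^ 3 / (p - 3) := by
        rw [hE, numAIa, eval_taylor]; simp only [hor]; field_simp; ring
      have eB : (numBIa p n).eval E = 0 := by
        rw [hE, numBIa, eval_taylor]; simp only [hor]; field_simp; ring
      rw [eA, eB, zero_mul, add_zero]
      exact mul_ne_zero (div_ne_zero (mul_ne_zero (by norm_num) (pow_ne_zero 3 hp)) hps) hJ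
    · have eA : (numAIIa p n).eval E = 1152 * p ^ 3 / (p - 3) := by
        rw [hE, numAIIa, eval_taylor]; simp only [hor]; field_simp; ring
      have eB : (numBIIa p n).eval E = 0 := by
        rw [hE, numBIIa, eval_taylor]; simp only [hor]; field_simp; ring
      rw [eA, eB, zero_mul, add_zero]
      exact mul_ne_zero (div_ne_zero (mul_ne_zero (by norm_num) (pow_ne_zero 3 hp)) hps) hJ
    · rw [sub_neg_eq_add, ← sub_eq_add_neg] at *
      have eA : (numAIIIa p n).eval E = -3456 * p ^ 3 / (p + 3) := by
        rw [hE, numAIIIa, eval_taylor]; simp only [hor]; field_simp; ring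
      have eB : (numBIIIa p n).eval E = 0 := by
        rw [hE, numBIIIa, eval_taylor]; simp only [hor]; field_simp; ring
      rw [eA, eB, zero_mul, add_zero]
      exact mul_ne_zero (div_ne_zero (mul_ne_zero (by norm_num) (pow_ne_zero 3 hp)) hps) hJ
    · rw [sub_neg_eq_add, ← sub_eq_add_neg] at *
      have eA : (numAIVa p n).eval E = 82944 * p ^ 4 * (p + 1) / (p + 3) ^ 2 := by
        rw [hE, numAIVa, eval_taylor]; simp only [hor]; field_simp; ring
      have eB : (numBIVa p n).eval E = -165888 * p ^ 5 / (p + 3) ^ 3 := by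
        rw [hE, numBIVa, eval_taylor]; simp only [hor]; field_simp; ring
      -- The upper bound h̄ < 3/10 of group IV gives p < -1, and hence A(η₀) < 0.
      have hp1 : p + 1 < 0 := by linarith [hr.2.1]
      have hA0 : (numAIVa p n).eval E < 0 := by
        rw [eA]
        exact div_neg_of_neg_of_pos (mul_neg_of_pos_of_neg (by positivity) hp1) (by positivity)
      have hp5 : 0 < -165888 * p ^ 5 := by
        have h5 : p ^ 5 < 0 := Odd.pow_neg (by decide) (by linarith)
        linarith
      have hB0 : J.eval E * (derivative J).eval E * (numBIVa p n).eval E ≤ 0 := by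
        -- The sign of p + 3 decides the side of [-1, 1] on which η₀ lies, hence the sign of JJ'. It
        -- also decides the sign of B, and in both cases JJ'B ≤ 0.
        have h3 : E = 1 + -6 / (p + 3) := by rw [hE]; field_simp; ring
        rcases lt_or_gt_of_ne hps with h1 | h1
        · have h2 : 1 < E := by
            rw [h3]; linarith [div_pos_of_neg_of_neg (by norm_num : (-6 : ℝ) < 0) h1]
          have h4 : (numBIVa p n).eval E ≤ 0 := by
            rw [eB]
            exact div_nonpos_of_nonneg_of_nonpos hp5.le (Odd.pow_neg (by decide) h1).le
          exact mul_nonpos_of_nonneg_of_nonpos (o1 E h2).2 h4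
        · have h2 : E < -1 := by
            have h5 : E < 1 := by
              rw [h3]; linarith [div_neg_of_neg_of_pos (by norm_num : (-6 : ℝ) < 0) h1]
            nlinarith
          have h4 : 0 ≤ (numBIVa p n).eval E := by
            rw [eB]
            exact div_nonneg hp5.le (by positivity)
          exact mul_nonpos_of_nonpos_of_nonneg (o2 E h2).2 h4
      intro h0
      have h6 : 0 < J.eval E ^ 2 := by positivity
      -- J(AJ + BJ') is the sum of AJ² < 0 and a nonpositive term.
      nlinarith [mul_neg_of_neg_of_pos hA0 h6, congrArg (· * J.eval E) h0]
  | negSucc k =>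
    have hh : h = _ := (G.memberA.ofParam_param h).symm
    rw [memberAPoly, hE]
    rw [← Case.par] at hh ⊢
    revert hh hm hp hps
    clear hE hE1 hr hb ha hs
    generalize G.memberA.par h = p
    rw [G.memberA_group]
    cases G <;> intro hp hps hm hh <;>
    simp only [Grp.sigma, Grp.memberA, Case.group, Case.shiftH, Case.ofParam,
      Grp.IsMode] at *
    · obtain rfl : k = 1 := by omega
      have e : (additionalPoly .I h 1).eval ((p + 3) / (p - 3)) = -6 * p := by
        rw [hh]; simp [additionalPoly]; field_simp; ring
      rw [e]
      exact mul_ne_zero (by norm_num) hp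
    · obtain rfl : k = 2 := by omega
      simp [additionalPoly]
    · obtain rfl : k = 1 := by omega
      rw [sub_neg_eq_add] at hps
      have e : (additionalPoly .III h 1).eval ((p + -3) / (p - -3)) = -2 * p := by
        rw [hh]; simp only [sub_neg_eq_add]; simp [additionalPoly]; field_simp; ring
      rw [e]
      exact mul_ne_zero (by norm_num) hp
    · rw [sub_neg_eq_add] at hps
      obtain rfl | rfl : k = 1 ∨ k = 2 := by omega
      · have e : (additionalPoly .IV h 1).eval ((p + -3) / (p - -3)) = 18 * p ^ 2 := by
          rw [hh]; simp only [sub_neg_eq_add]; simp [additionalPoly]; field_simp; ring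
        rw [e]
        exact mul_ne_zero (by norm_num) (pow_ne_zero 2 hp)
      · have e : (additionalPoly .IV h 2).eval ((p + -3) / (p - -3)) = -6 * p / (p + 3) := by
          rw [hh]; simp only [sub_neg_eq_add]; simp [additionalPoly]; field_simp; ring
        rw [e]
        exact div_ne_zero (mul_ne_zero (by norm_num) hp) hps

theorem modePoly_eval_etaZero_ne_zero (c : Case) {h : ℝ} (hs : StatedRange c h) {m : ℤ}
    (hm : m ∈ modes c) : (modePoly c h m).eval (etaZero c h) ≠ 0 := by
  have hc := c.group.memberA_group.symm
  have hb := (hBar_hOfMemberA c.group (hBar c h)).symm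
  rw [etaZero_congr hc hb]
  exact memberAPoly_eval_etaZero_ne_zero _ ((statedRange_congr hc hb).1 hs)
    ((mem_modes_iff c m).1 hm)

/-! ### Norms -/

/-- Each difference of energies factors into two linear expressions, both positive in the stated
range. -/
theorem energy_sub_seedEnergy_pos {c : Case} {h : ℝ} (hs : StatedRange c h) (n : ℕ)
    {s : SeedType × ℕ} (hm : s ∈ seeds c) :
    0 < energy (curve c h) h n - seedEnergy (curve c h) h s := by
  have hr := (statedRange_iff c h).1 hs
  have hadd := Grp.sumBound_of_range _ hr
  rw [← gBar_eq_gBarOfHBar c hs.admissible, gBar_eq_add, hBar_eq_add] at hadd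
  have hg := hs.gBar_gt
  -- In group III the bound ḡ > 1/2 holds; the seed of type II and degree 2 in case IIIa needs it,
  -- as there g - 5/2 = ḡ - 1/2.
  have hg' : (match c.group with | .III => 1 / 2 | _ => -1 / 2) < gBar c h := by
    rw [gBar_eq_gBarOfHBar c hs.admissible] at hg ⊢
    revert hr hg
    cases c.group <;> simp only [Grp.range, gBarOfHBar] <;> intro hr hg
    · exact hg
    · exact hg
    · rw [lt_div_iff_of_neg (by linarith)]; linarith
    · exact hg
  rw [gBar_eq_add] at hg hg'
  rw [hBar_eq_add] at hr
  have hg0 := hs.curve_gt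
  have hh0 := hs.h_gt
  have hn : (0 : ℝ) ≤ n := Nat.cast_nonneg n
  have f1 : ∀ v : ℕ, energy (curve c h) h n - seedEnergy (curve c h) h (.I, v) =
      4 * ((n + curve c h + v + 1 / 2) * (n + h - v - 1 / 2)) := by
    intro v; rw [energy, seedEnergy]; push_cast; ring
  have f2 : ∀ v : ℕ, energy (curve c h) h n - seedEnergy (curve c h) h (.II, v) =
      4 * ((n + curve c h - v - 1 / 2) * (n + h + v + 1 / 2)) := by
    intro v; rw [energy, seedEnergy]; push_cast; ring
  have f3 : ∀ v : ℕ, energy (curve c h) h n - seedEnergy (curve c h) h (.III, v) =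
      4 * ((n + v + 1) * (n + curve c h + h - v - 1)) := by
    intro v; rw [energy, seedEnergy]; push_cast; ring
  revert hm hr hadd hg hg' hg0 f1 f2 f3
  generalize curve c h = g
  cases c <;> simp only [seeds, List.mem_cons, List.not_mem_nil, or_false, Case.group, Grp.range,
    Grp.SumBound, Case.shiftG, Case.shiftH] <;> intro hm hr hadd hg hg' hg0 f1 f2 f3 <;>
  rcases hm with rfl | rfl | rfl <;>
  simp only [f1, f2, f3, Nat.cast_one, Nat.cast_ofNat] <;>
  exact mul_pos (by norm_num) (mul_pos (by linarith) (by linarith))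

theorem energyProduct_pos {c : Case} {h : ℝ} (hs : StatedRange c h) (n : ℕ) :
    0 < energyProduct c h n := by
  refine List.prod_pos fun a ha => ?_
  obtain ⟨s, hm, rfl⟩ := List.mem_map.1 ha
  exact energy_sub_seedEnergy_pos hs n hm

theorem baseNorm_pos {c : Case} {h : ℝ} (hs : StatedRange c h) (n : ℕ) :
    0 < baseNorm (curve c h) h n := by
  have hg := hs.curve_gt
  have hh := hs.h_gt
  have hadd := hs.curve_add_pos
  have hn : (0 : ℝ) ≤ n := Nat.cast_nonneg n
  have h1 := Real.Gamma_pos_of_pos (by linarith : 0 < n + curve c h + 1 / 2)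
  have h2 := Real.Gamma_pos_of_pos (by linarith : 0 < n + h + 1 / 2)
  have h3 := Real.Gamma_pos_of_pos (by linarith : 0 < n + curve c h + h)
  have h4 : 0 < 2 * (n : ℝ) + curve c h + h := by linarith
  rw [baseNorm]
  positivity

theorem integral_C_mul_sq (c : Case) (h s : ℝ) (P : ℝ[X]) :
    ∫ t in (-1 : ℝ)..1, weight c h t * (C s * P).eval t * (C s * P).eval t =
      s ^ 2 * ∫ t in (-1 : ℝ)..1, weight c h t * P.eval t * P.eval t := by
  rw [← intervalIntegral.integral_const_mul]
  refine intervalIntegral.integral_congr fun t _ => ?_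
  simp only [eval_mul, eval_C]
  ring

/-- The constants of the norm identity and of the determinants match, so the norm of the polynomial
part contains no further power of p. -/
theorem scale_sq_mul (c : Case) {p : ℝ} (hp : p ≠ 0) :
    c.scale p ^ 2 * (c.normTheta p * p ^ (seeds c).length) = -c.normRho p ∧ c.normRho p ≠ 0 := by
  cases c <;> simp [Case.scale, Case.normTheta, Case.normRho, seeds, hp] <;> field_simp <;> norm_num

theorem integral_polyPart_sq {c : Case} {h : ℝ} (hs : StatedRange c h) (n : ℕ) :
    ∫ t in (-1 : ℝ)..1, weight c h t * (polyPart c h n).eval t * (polyPart c h n).eval t =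
      2 * energyProduct c h n * baseNorm (curve c h) h n := by
  have hp := c.par_ne_zero hs.admissible
  obtain ⟨e1, e2⟩ := scale_sq_mul c hp
  have key := integral_transformed_sq hs n
  rw [polyPart, integral_C_mul_sq]
  -- The factor 2 of the norm is all that is left of the powers of 2.
  have h2 : ((2 : ℝ) ^ (-(curve c h + h) / 2)) ^ 2 * 2 ^ (curve c h + h + 1) = 2 := by
    rw [← rpow_natCast, ← rpow_mul (by norm_num), ← rpow_add (by norm_num)]
    ring_nf
    exact rpow_one 2
  refine mul_left_cancel₀ e2 ?_
  generalize (∫ t in (-1 : ℝ)..1, weight c h t * (transformed c h n).eval t *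
    (transformed c h n).eval t) = I at *
  generalize (2 : ℝ) ^ (-(curve c h + h) / 2) = a at *
  generalize (2 : ℝ) ^ (curve c h + h + 1) = b at *
  linear_combination (a ^ 2 * c.scale (c.par h) ^ 2) * key -
    a ^ 2 * b * energyProduct c h n * baseNorm (curve c h) h n * e1 +
    c.normRho (c.par h) * energyProduct c h n * baseNorm (curve c h) h n * h2

theorem normalEq_polyPart (c : Case) {h : ℝ} (ha : Admissible c h) (n : ℕ) :
    (normalEq c h n).Solves (polyPart c h n) := (normalEq_transformed c ha n).C_mul _

theorem polynomialEq_solves {c : Case} {h : ℝ} (ha : Admissible c h) {m : ℤ} {P : ℝ[X]}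
    (hP : (normalEq c h m).Solves P) : (polynomialEq c h m).Solves P :=
  ((polynomialEq_scaled c ha m).solves_iff (mul_ne_zero
    (by cases c.group <;> norm_num [Grp.factor]) (slope_ne_zero c ha)) P).2 hP

/-- Its squared norm is a product of positive numbers. -/
theorem polyPart_ne_zero {c : Case} {h : ℝ} (hs : StatedRange c h) (n : ℕ) :
    polyPart c h n ≠ 0 := by
  intro h0
  have h1 := integral_polyPart_sq hs n
  have h2 := mul_pos (mul_pos two_pos (energyProduct_pos hs n)) (baseNorm_pos hs n)
  rw [← h1, h0] at h2
  simp at h2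

theorem modePoly_ne_zero {c : Case} {h : ℝ} (hs : StatedRange c h) {m : ℤ} (hm : m ∈ modes c) :
    modePoly c h m ≠ 0 := by
  intro h0
  exact modePoly_eval_etaZero_ne_zero c hs hm (by rw [h0, eval_zero])

theorem natCast_mem_modes (c : Case) (n : ℕ) : (n : ℤ) ∈ modes c := Or.inl (Int.natCast_nonneg n)

/-- For a member (b) no explicit comparison is needed: both polynomials are nonzero solutions of the
same equation. -/
theorem polyPart_eq_C_mul {c : Case} {h : ℝ} (hs : StatedRange c h) (n : ℕ) :
    ∃ s : ℝ, s ≠ 0 ∧ polyPart c h n = C s * modePoly c h n :=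
  exists_eq_C_mul hs.admissible (by linarith [hs.gBar_gt]) (normalEq_polyPart c hs.admissible n)
    (normalEq_modePoly c hs.admissible (natCast_mem_modes c n)) (polyPart_ne_zero hs n)
    (modePoly_ne_zero hs (natCast_mem_modes c n))

theorem integral_polyPart_mul {c : Case} {h : ℝ} (hs : StatedRange c h) (n k : ℕ) :
    ∫ t in (-1 : ℝ)..1, weight c h t * (polyPart c h n).eval t * (polyPart c h k).eval t =
      if n = k then 2 * energyProduct c h n * baseNorm (curve c h) h n else 0 := by
  split_ifs with hnk
  · rw [← hnk]; exact integral_polyPart_sq hs n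
  · exact integral_weight_mul_eq_zero hs (normalEq_polyPart c hs.admissible n)
      (normalEq_polyPart c hs.admissible k) (spectral_ne hs (natCast_mem_modes c n)
        (natCast_mem_modes c k) (by exact_mod_cast hnk))

theorem par_memberA (G : Grp) (h : ℝ) : G.memberA.par h =
    (match G with | .I => 4 * h - 9 | .II => 4 * h - 9 | .III => 4 * h - 3 | .IV => 4 * h - 7) := by
  rw [Case.par, hBar_eq_add]
  cases G <;> simp only [Grp.memberA, Case.group, Case.shiftH, param, Grp.sigma] <;> ring

theorem modePoly_memberA (G : Grp) (h : ℝ) (m : ℤ) :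
    modePoly G.memberA h m = memberAPoly G h m := by
  rw [modePoly, G.memberA_group, hOfMemberA_hBar]

theorem polyPart_memberA (G : Grp) {h : ℝ} (ha : Admissible G.memberA h) (n : ℕ) :
    polyPart G.memberA h n = C (normalisation G h) * modePoly G.memberA h n := by
  have hp := G.memberA.par_ne_zero ha
  have he := par_memberA G h
  rw [modePoly_memberA, show memberAPoly G h (n : ℤ) = explicitPoly G h n from rfl, explicitPoly_eq,
    polyPart, ← mul_assoc, ← C_mul]
  unfold normalisation
  congr 2
  rw [mul_assoc]
  congr 1
  generalize G.memberA.par h = p at *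
  cases G <;> simp only at he <;> simp only [Grp.memberA, Case.scale, Grp.explicitScale, ← he] <;>
    field_simp <;> norm_num

theorem integral_explicitPoly_sq (G : Grp) {h : ℝ} (hs : StatedRange G.memberA h) (n : ℕ) :
    ∫ t in (-1 : ℝ)..1, weight G.memberA h t * (memberAPoly G h n).eval t *
      (memberAPoly G h n).eval t = explicitNorm G h n := by
  have hp := G.memberA.par_ne_zero hs.admissible
  have he := par_memberA G h
  have hρ := (scale_sq_mul G.memberA hp).2
  have key := integral_transformed_sq hs n
  rw [show memberAPoly G h (n : ℤ) = explicitPoly G h n from rfl, explicitPoly_eq,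
    integral_C_mul_sq]
  unfold explicitNorm
  refine mul_left_cancel₀ hρ ?_
  generalize (∫ t in (-1 : ℝ)..1, weight G.memberA h t * (transformed G.memberA h n).eval t *
    (transformed G.memberA h n).eval t) = I at *
  have r1 : (2 : ℝ) ^ (curve G.memberA h + h - 1) = 2 ^ (curve G.memberA h + h + 1) / 4 := by
    rw [rpow_sub_one two_ne_zero, rpow_add_one two_ne_zero]; ring
  have r2 : (2 : ℝ) ^ (curve G.memberA h + h - 3) = 2 ^ (curve G.memberA h + h + 1) / 16 := by
    rw [rpow_sub two_pos, rpow_add_one two_ne_zero]; norm_num; ring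
  rw [r1, r2]
  generalize (2 : ℝ) ^ (curve G.memberA h + h + 1) = b at *
  generalize energyProduct G.memberA h n = e at *
  generalize baseNorm (curve G.memberA h) h n = N at *
  generalize G.memberA.par h = p at *
  cases G <;> simp only at he <;>
    simp only [Grp.memberA, Case.normTheta, Case.normRho, Grp.explicitScale, seeds, List.length_cons,
      List.length_nil, ← he] at key ⊢
  · linear_combination (1 / 32) ^ 2 * key
  · linear_combination (1 / 32) ^ 2 * key
  · linear_combination (1 / 32) ^ 2 * key
  · linear_combination (1 / 128) ^ 2 * key

/-! ### Energies and the relation between the members of a group -/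

theorem energy_neg_eq_seedEnergy (g h : ℝ) (v : ℕ) :
    energy g h (-((v : ℤ) + 1)) = seedEnergy g h (SeedType.III, v) := by
  rw [energy, seedEnergy]; push_cast; ring

theorem seedEnergy_eq_additionalEnergy (G : Grp) {h : ℝ} (ha : Admissible G.memberA h) (v : ℕ)
    (hv : (SeedType.III, v) ∈ seeds G.memberA) :
    seedEnergy (curve G.memberA h) h (SeedType.III, v) = additionalEnergy G h v := by
  have hp := G.memberA.par_ne_zero ha
  have he := par_memberA G h
  rw [he] at hp
  clear he ha
  cases G <;> simp [seeds, Grp.memberA] at hv hp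
  · subst hv
    simp only [seedEnergy, curve, additionalEnergy, Grp.memberA]
    field_simp; push_cast; ring
  · subst hv
    have hp' : -9 + 4 * h ≠ 0 := fun h0 => hp (by linarith)
    simp only [seedEnergy, curve, additionalEnergy, Grp.memberA]
    field_simp; push_cast; ring
  · subst hv
    have hp' : -3 + 4 * h ≠ 0 := fun h0 => hp (by linarith)
    simp only [seedEnergy, curve, additionalEnergy, Grp.memberA]
    field_simp; push_cast; ring
  · rcases hv with rfl | rfl <;> simp only [seedEnergy, curve, additionalEnergy, Grp.memberA] <;>
      field_simp <;> push_cast <;> ring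

/-- In this form the energies depend only on ḡ, h̄ and the group, hence are unchanged by the shift
of h. -/
theorem energy_eq (c : Case) (h : ℝ) (m : ℤ) : energy (curve c h) h m =
    4 * m * (m + (gBar c h + hBar c h + 2 * c.group.typeIII)) := by
  rw [gBar_add_hBar, energy]; ring

theorem Grp.memberB_group (G : Grp) : G.memberB.group = G := by cases G <;> rfl

theorem hBar_memberB (G : Grp) (h : ℝ) :
    hBar G.memberB h = hBar G.memberA (h + memberShift G) := by
  rw [hBar_eq_add, hBar_eq_add]
  cases G <;> simp only [Grp.memberA, Grp.memberB, Case.shiftH, memberShift] <;> ring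

theorem commonPotential_congr {c c' : Case} {h h' : ℝ} (hc : c.group = c'.group)
    (hb : hBar c h = hBar c' h') (ha : Admissible c h) (x : ℝ) :
    commonPotential c h x = commonPotential c' h' x := by
  unfold commonPotential lin
  rw [gBar_congr hc hb ha, hb, hc]

theorem gBarOfHBar_reflect_I {b : ℝ} (hb : b ≠ 1 / 4) :
    gBarOfHBar .I b = 1 - gBarOfHBar .II b := by
  have : 4 * b - 1 ≠ 0 := fun h0 => hb (by linarith)
  rw [gBarOfHBar, gBarOfHBar, eq_sub_iff_add_eq, ← add_div, div_eq_one_iff_eq this]; ring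

theorem gBarOfHBar_reflect_III {b : ℝ} (hb : b ≠ 3 / 4) :
    gBarOfHBar .III b = 1 - gBarOfHBar .IV b := by
  have : 4 * b - 3 ≠ 0 := fun h0 => hb (by linarith)
  rw [gBarOfHBar, gBarOfHBar, eq_sub_iff_add_eq, ← add_div, div_eq_one_iff_eq this]; ring

end JacobiConfluence

end

/-! ### The main theorem -/

open JacobiConfluence in
theorem mainTheorem1 :
    (∀ (c : Case) (h : ℝ), Admissible c h →
      -- shifted parameters and parameter ranges
      (gBar c h = gBarOfHBar c.group (hBar c h) ∧
        gBar c h + hBar c h + 2 * c.group.typeIII = curve c h + h ∧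
        ((∀ t ∈ Ioo (-1 : ℝ) 1, (lin c h).eval t ≠ 0) ↔ RegularRange c h) ∧
        (RegularRange c h ∧ -1 / 2 < gBar c h ∧ -1 / 2 < hBar c h ↔ StatedRange c h)) ∧
      -- the denominator polynomial is a constant times the cube of a linear factor
      (∃ κ : ℝ, (κ ≠ 0 ↔ hBar c h ∉ degenerateHBar c) ∧
        (lin c h ^ 3).eval 1 ≠ 0 ∧ (lin c h ^ 3).eval (-1) ≠ 0 ∧
        (lin c h).natDegree = 1 ∧ (lin c h).eval (etaZero c h) = 0 ∧
        ∀ x ∈ Ioo 0 (π / 2), seedWronskian c h x =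
          (1 - eta x) ^ exponentMinus c h * (1 + eta x) ^ exponentPlus c h *
            (C κ * lin c h ^ 3).eval (eta x)) ∧
      -- the deformed system and its polynomials
      (hBar c h ∉ degenerateHBar c →
        (∀ x ∈ Ioo 0 (π / 2), (lin c h).eval (eta x) ≠ 0 →
          deformedPotential c h x = commonPotential c h x) ∧
        ∃ P : ℕ → ℝ[X],
          (∀ n Q, IsPolynomialPart c h n Q ↔ Q = P n) ∧
          (∀ n : ℕ, SolvesRationalEq c h n (P n) ∧ (polynomialEq c h n).Solves (P n)) ∧
          (c = c.group.memberA →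
            ∀ n : ℕ, P n = C (normalisation c.group h) * modePoly c h n) ∧
          (StatedRange c h →
            (∀ n : ℕ, ∃ s : ℝ, s ≠ 0 ∧ P n = C s * modePoly c h n) ∧
            ∀ n k : ℕ,
              IntegrableOn (fun t => weight c h t * (P n).eval t * (P k).eval t)
                (Ioo (-1) 1) ∧
              ∫ t in (-1 : ℝ)..1, weight c h t * (P n).eval t * (P k).eval t =
                if n = k then 2 * energyProduct c h n * baseNorm (curve c h) h n else 0)) ∧
      -- all modes: eigenfunctions of the deformed Hamiltonian, Fuchsian equations
      (∀ m ∈ modes c,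
        (∀ x ∈ Ioo 0 (π / 2), (lin c h).eval (eta x) ≠ 0 →
          -iteratedDeriv 2 (waveFun c h (modePoly c h m)) x +
              commonPotential c h x * waveFun c h (modePoly c h m) x =
            energy (curve c h) h m * waveFun c h (modePoly c h m) x) ∧
        SolvesRationalEq c h m (modePoly c h m) ∧
        (polynomialEq c h m).Solves (modePoly c h m) ∧
        (RegularRange c h →
          (rationalEq c h m).IsFuchsian ∧ (polynomialEq c h m).IsFuchsian ∧
          (∀ z : ℂ, aeval z (rationalEq c h m).p₂ = 0 ↔
            z = 1 ∨ z = -1 ∨ z = (etaZero c h : ℂ)) ∧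
          (∀ z : ℂ, aeval z (polynomialEq c h m).p₂ = 0 ↔
            z = 1 ∨ z = -1 ∨ z = (etaZero c h : ℂ)) ∧
          (rationalEq c h m).IsApparent (etaZero c h : ℂ) (-2) 3 ∧
          (polynomialEq c h m).IsApparent (etaZero c h : ℂ) 0 5)) ∧
      -- energies of the additional modes
      (∀ v : ℕ, (SeedType.III, v) ∈ seeds c →
        energy (curve c h) h (-((v : ℤ) + 1)) = seedEnergy (curve c h) h (SeedType.III, v)) ∧
      -- orthogonality of all modes
      (StatedRange c h →
        (∀ m ∈ modes c, (modePoly c h m).eval (etaZero c h) ≠ 0) ∧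
        (∀ m ∈ modes c, ∀ k ∈ modes c,
          IntegrableOn (fun t => weight c h t * (modePoly c h m).eval t *
            (modePoly c h k).eval t) (Ioo (-1) 1) ∧
          (m ≠ k → ∫ t in (-1 : ℝ)..1,
            weight c h t * (modePoly c h m).eval t * (modePoly c h k).eval t = 0)) ∧
        (∀ m ∈ modes c, 0 < ∫ t in (-1 : ℝ)..1,
          weight c h t * (modePoly c h m).eval t * (modePoly c h m).eval t))) ∧
    -- explicit data of the four members (a)
    (∀ (G : Grp) (h : ℝ), Admissible G.memberA h →
      (∀ m : ℤ, modePoly G.memberA h m = memberAPoly G h m) ∧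
      (∀ m ∈ modes G.memberA, (explicitEq G h m).Solves (memberAPoly G h m)) ∧
      (∀ v : ℕ, (SeedType.III, v) ∈ seeds G.memberA →
        seedEnergy (curve G.memberA h) h (SeedType.III, v) = additionalEnergy G h v) ∧
      (StatedRange G.memberA h → ∀ n : ℕ,
        ∫ t in (-1 : ℝ)..1, weight G.memberA h t * (memberAPoly G h n).eval t *
          (memberAPoly G h n).eval t = explicitNorm G h n)) ∧
    -- the shift of `h` between the two members of a group
    (∀ (G : Grp) (h : ℝ),
      hBar G.memberB h = hBar G.memberA (h + memberShift G) ∧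
      (Admissible G.memberB h ↔ Admissible G.memberA (h + memberShift G)) ∧
      (StatedRange G.memberB h ↔ StatedRange G.memberA (h + memberShift G)) ∧
      (Admissible G.memberB h →
        gBar G.memberB h = gBar G.memberA (h + memberShift G) ∧
        (∀ m : ℤ, energy (curve G.memberB h) h m =
          energy (curve G.memberA (h + memberShift G)) (h + memberShift G) m) ∧
        (∀ x, commonPotential G.memberB h x =
          commonPotential G.memberA (h + memberShift G) x))) ∧
    -- the relation between the groups that share a potential
    (∀ b : ℝ, (b ≠ 1 / 4 → gBarOfHBar .I b = 1 - gBarOfHBar .II b) ∧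
      (b ≠ 3 / 4 → gBarOfHBar .III b = 1 - gBarOfHBar .IV b)) := by
  -- The witnesses are `kappa c h` for the constant κ and `polyPart c h` for the polynomials P_n.
  refine ⟨fun c h ha => ⟨⟨gBar_eq_gBarOfHBar c ha, gBar_add_hBar c h, regularRange_iff_forall c ha,
    regularRange_and_iff c ha⟩, ⟨kappa c h, kappa_ne_zero_iff c ha, ?_, ?_, natDegree_lin c ha,
      eval_lin_etaZero c ha, fun x hx => seedWronskian_eq ha hx⟩,
    fun hd => ⟨fun x hx hl => deformedPotential_eq ha hd hx hl, polyPart c h,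
      isPolynomialPart_iff ha hd, fun n => ⟨solvesRationalEq_of_normalEq ha
        (normalEq_polyPart c ha n), polynomialEq_solves ha (normalEq_polyPart c ha n)⟩,
      fun hc n => ?_, fun hs => ⟨polyPart_eq_C_mul hs, fun n k =>
        ⟨integrableOn_weight_mul hs _ _, integral_polyPart_mul hs n k⟩⟩⟩,
    fun m hm => ?_, fun v _ => energy_neg_eq_seedEnergy _ _ v, fun hs => ?_⟩,
    fun G h ha => ⟨modePoly_memberA G h, fun m hm => ?_, seedEnergy_eq_additionalEnergy G ha,
      integral_explicitPoly_sq G⟩, fun G h => ?_,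
    fun b => ⟨gBarOfHBar_reflect_I, gBarOfHBar_reflect_III⟩⟩
  · rw [eval_pow]
    exact pow_ne_zero 3 (eval_lin_one_ne_zero c)
  · rw [eval_pow]
    exact pow_ne_zero 3 (eval_lin_neg_one_ne_zero c ha)
  · have h1 := polyPart_memberA c.group (h := h) (by rwa [← hc]) n
    rwa [← hc] at h1
  · have hR := normalEq_modePoly c ha hm
    have hrat := solvesRationalEq_of_normalEq ha hR
    exact ⟨fun x hx hl => schrodinger_waveFun ha hrat hx hl, hrat, polynomialEq_solves ha hR,
      fun _ => ⟨rationalEq_isFuchsian c ha m, polynomialEq_isFuchsian c ha m,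
        aeval_rationalEq c ha m, aeval_polynomialEq c ha m, rationalEq_isApparent c ha m,
        polynomialEq_isApparent c ha m⟩⟩
  · exact ⟨fun m hm => modePoly_eval_etaZero_ne_zero c hs hm, fun m hm k hk =>
      ⟨integrableOn_weight_mul hs _ _, fun hmk => integral_weight_mul_eq_zero hs
        (normalEq_modePoly c ha hm) (normalEq_modePoly c ha hk) (spectral_ne hs hm hk hmk)⟩,
      fun m hm => integral_weight_mul_self_pos hs (modePoly_ne_zero hs hm)⟩
  -- The explicit equation is p times the slope of ℓ times `normalEq`, a nonzero factor at
  -- admissible h.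
  · refine ((explicitEq_scaled G ha m).solves_iff
      (mul_ne_zero (G.memberA.par_ne_zero ha) (slope_ne_zero _ ha)) _).2 ?_
    rw [mem_modes_iff, G.memberA_group] at hm
    exact normalEq_memberAPoly G ha hm
  · have hc : G.memberB.group = G.memberA.group := by rw [G.memberB_group, G.memberA_group]
    have hb := hBar_memberB G h
    refine ⟨hb, admissible_congr hc hb, statedRange_congr hc hb, fun ha =>
      ⟨gBar_congr hc hb ha, fun m => ?_, commonPotential_congr hc hb ha⟩⟩
    rw [energy_eq, energy_eq, gBar_congr hc hb ha, hb, hc]
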